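/- Let $s\in[0,1]$ and let $f\in C_b^\infty(0,1)$ (smooth with all derivatives bounded, extended continuously to $[0,1]$) be decreasing with $f(0)>0$ and $f(1)=0$. Let $\Phi(x)=\phi(|x|)$ on $\mathbb R^3$, where $\phi(r)=f(r)/r^s$ for $0<r\le 1$ and $\phi(r)=0$ otherwise, and for $\varepsilon\in(0,1)$ let $\Phi_\varepsilon=\varepsilon\Phi$. For $v_1\ne v_2\in\mathbb R^3$ and $\nu\in S^2_+=\{\nu\in S^2:\nu\cdot(v_1-v_2)\ge 0\}$ consider the motion, for $t\ge0$, of two particles with $$\dot X_1=V_1,\quad \dot V_1=-\nabla\Phi_\varepsilon(X_1-X_2),\quad \dot X_2=V_2,\quad \dot V_2=-\nabla\Phi_\varepsilon(X_2-X_1),\quad X_2(0)-X_1(0)=\nu,\quad V_i(0)=v_i,$$ with $X_1(t)\neq X_2(t)$ for all $t\ge 0$ and with the equations for $V_i$ understood in integrated form. For almost every $\nu\in S^2_+$ the outgoing velocities $v_{i,\varepsilon}'=\lim_{t\to\infty}V_i(t)$ exist and are unique. With $M(v)=(2\pi)^{-3/2}e^{-|v|^2/2}$ define the linearized Boltzmann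 operator $$\mathcal L_\varepsilon\psi(v_1)=\int_{\mathbb R^3}\int_{S^2_+}\big(\psi(v_{1,\varepsilon}')+\psi(v_{2,\varepsilon}')-\psi(v_1)-\psi(v_2)\big)M(v_2)\,(v_1-v_2)\cdot\nu\,d\nu\,dv_2$$ and the linearized Landau operator $$\mathcal K\psi(v_1)=\frac1{M(v_1)}\nabla_{v_1}\cdot\int_{\mathbb R^3}\frac{P^\perp_{v_1-v_2}}{|v_1-v_2|}\big(\nabla\psi(v_1)-\nabla\psi(v_2)\big)M(v_1)M(v_2)\,dv_2,$$ where $P^\perp_w$ is the orthogonal projection onto $w^\perp$. For $\psi\in C^3_b(\mathbb R^3)$ both are well defined: the integrals converge absolutely and the vector field under the divergence is differentiable. Let $\mathfrak d_\varepsilon=\varepsilon^2$ if $s<1$, $\mathfrak d_\varepsilon=\varepsilon^2|\log\varepsilon|$ if $s=1$, and $$c_\Phi=\begin{cases}\displaystyle\int_0^1\Big(\int_0^1\frac\rho u\,\phi'\Big(\frac\rho u\Big)\frac{du}{\sqrt{1-u^2}}\Big)^2\rho\,d\rho & \text{if } s<1,\\ f(0)^2 & \text{if } s=1.\end{cases}$$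 Then $c_\Phi>0$, and there is a constant $C$ depending only on $\Phi$ such that for all $\varepsilon\in(0,1)$ and all $\psi\in C^3_b(\mathbb R^3)$ $$\big\|\mathfrak d_\varepsilon^{-1}\mathcal L_\varepsilon\psi-2\pi c_\Phi\,\mathcal K\psi\big\|_{L^\infty(\mathbb R^3)}\le C\,|\log\varepsilon|^{-1}\,\|\psi\|_{C^3_b(\mathbb R^3)}.$$ If $s<1$, then moreover $$2\pi c_\Phi=\frac1{16\pi^2}\int_{\mathbb R^3}\delta(k\cdot e_1)\,|k|^2\,|\hat\Phi(k)|^2\,dk,\qquad \hat\Phi(k)=\int_{\mathbb R^3}e^{-ik\cdot x}\Phi(x)\,dx,$$ where $\int_{\mathbb R^3}\delta(k\cdot e_1)g(k)\,dk$ is the integral of $g$ over the plane $\{k\cdot e_1=0\}$. -/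

import Mathlib

open MeasureTheory Filter Topology
open scoped ContDiff

noncomputable section

namespace Grazing

/-- Velocity (and position) space `ℝ³` with the Euclidean norm. -/
abbrev E3 : Type := EuclideanSpace ℝ (Fin 3)

/-- The unit sphere `S²`. -/
abbrev S2 : Type := Metric.sphere (0 : E3) 1

/-- The surface measure of `S²` (total mass `4π`). -/
def sphereMeasure : Measure S2 := (volume : Measure E3).toSphere

/-! ### The interaction potential -/

/-- Profile `f` of the potential: `f ∈ C_b^∞(0,1)` (smooth, all derivatives bounded), extended
continuously to `[0,1]`, decreasing, `f(0) > 0` and `f(1) = 0`. -/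
structure IsProfile (f : ℝ → ℝ) : Prop where
  smooth : ContDiffOn ℝ ∞ f (Set.Ioo 0 1)
  bounded : ∀ n : ℕ, ∃ B : ℝ, ∀ r ∈ Set.Ioo (0 : ℝ) 1, |iteratedDeriv n f r| ≤ B
  continuousOn : ContinuousOn f (Set.Icc 0 1)
  antitone : AntitoneOn f (Set.Icc 0 1)
  pos_zero : 0 < f 0
  one_eq_zero : f 1 = 0

open Classical in
/-- `φ(r) = f(r) / r^s` for `0 < r ≤ 1`, and `0` otherwise. -/
def radialPotential (s : ℝ) (f : ℝ → ℝ) (r : ℝ) : ℝ :=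
  if 0 < r ∧ r ≤ 1 then f r / r ^ s else 0

/-- `Φ(x) = φ(|x|)`. -/
def potential (s : ℝ) (f : ℝ → ℝ) (x : E3) : ℝ := radialPotential s f ‖x‖

/-- The weak potential `Φ_ε = ε Φ`. -/
def weakPotential (s : ℝ) (f : ℝ → ℝ) (ε : ℝ) (x : E3) : ℝ := ε * potential s f x

/-! ### Two-particle scattering -/

/-- Two particles of unit mass interacting through `Φ`, for times `t ≥ 0`, started at unit distance
with `ν` pointing from particle 1 to particle 2, and with velocities `v₁, v₂`. The force may jump
at the edge `|x| = 1` of the range of `Φ`, so the equations for the velocities are meant in the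
sense of Carathéodory, i.e. in integrated form. -/
structure IsScatteringMotion (Φ : E3 → ℝ) (ν v₁ v₂ : E3) (X₁ X₂ V₁ V₂ : ℝ → E3) : Prop where
  init : X₂ 0 - X₁ 0 = ν
  no_contact : ∀ t, 0 ≤ t → X₁ t ≠ X₂ t
  position₁ : ∀ t, 0 ≤ t → HasDerivWithinAt X₁ (V₁ t) (Set.Ici 0) t
  position₂ : ∀ t, 0 ≤ t → HasDerivWithinAt X₂ (V₂ t) (Set.Ici 0) t
  force₁ : ∀ t, 0 ≤ t → IntervalIntegrable (fun τ => gradient Φ (X₁ τ - X₂ τ)) volume 0 t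
  force₂ : ∀ t, 0 ≤ t → IntervalIntegrable (fun τ => gradient Φ (X₂ τ - X₁ τ)) volume 0 t
  velocity₁ : ∀ t, 0 ≤ t → V₁ t = v₁ - ∫ τ in (0 : ℝ)..t, gradient Φ (X₁ τ - X₂ τ)
  velocity₂ : ∀ t, 0 ≤ t → V₂ t = v₂ - ∫ τ in (0 : ℝ)..t, gradient Φ (X₂ τ - X₁ τ)

/-- `p = (v₁', v₂')` are the limits, as `t → ∞`, of the velocities of the scattering motion. -/
def IsOutgoing (Φ : E3 → ℝ) (ν v₁ v₂ : E3) (p : E3 × E3) : Prop :=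
  ∃ X₁ X₂ V₁ V₂ : ℝ → E3, IsScatteringMotion Φ ν v₁ v₂ X₁ X₂ V₁ V₂ ∧
    Tendsto V₁ atTop (𝓝 p.1) ∧ Tendsto V₂ atTop (𝓝 p.2)

open Classical in
/-- The outgoing velocities `(v₁', v₂')`, where they exist (and `(v₁, v₂)` where they do not). -/
def outgoing (Φ : E3 → ℝ) (ν v₁ v₂ : E3) : E3 × E3 :=
  if h : ∃ p, IsOutgoing Φ ν v₁ v₂ p then h.choose else (v₁, v₂)

/-! ### The linearized Boltzmann operator -/

/-- The Maxwellian with unit temperature. -/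
def maxwellian (v : E3) : ℝ := Real.exp (-(‖v‖ ^ 2) / 2) / (2 * Real.pi) ^ ((3 : ℝ) / 2)

/-- The hemisphere `S²₊ = {ν ∈ S² : ν · (v₁ - v₂) ≥ 0}`. -/
def hemisphere (v₁ v₂ : E3) : Set S2 := {ν | 0 ≤ inner ℝ (ν : E3) (v₁ - v₂)}

/-- `(ψ(v₁') + ψ(v₂') - ψ(v₁) - ψ(v₂)) M(v₂) (v₁ - v₂) · ν`. -/
def boltzmannIntegrand (Φ : E3 → ℝ) (ψ : E3 → ℝ) (v₁ v₂ : E3) (ν : S2) : ℝ :=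
  (ψ (outgoing Φ ν v₁ v₂).1 + ψ (outgoing Φ ν v₁ v₂).2 - ψ v₁ - ψ v₂) *
    maxwellian v₂ * inner ℝ (v₁ - v₂) (ν : E3)

/-- The linearized Boltzmann operator of the potential `Φ`. -/
def boltzmannOp (Φ : E3 → ℝ) (ψ : E3 → ℝ) (v₁ : E3) : ℝ :=
  ∫ v₂ : E3, ∫ ν in hemisphere v₁ v₂, boltzmannIntegrand Φ ψ v₁ v₂ ν ∂sphereMeasure

/-! ### The linearized Landau operator -/

/-- The orthogonal projection of `x` to the complement of `w ≠ 0`. -/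
def perpProj (w x : E3) : E3 := x - (inner ℝ w x / ‖w‖ ^ 2) • w

def landauIntegrand (ψ : E3 → ℝ) (v₁ v₂ : E3) : E3 :=
  (maxwellian v₁ * maxwellian v₂ / ‖v₁ - v₂‖) •
    perpProj (v₁ - v₂) (gradient ψ v₁ - gradient ψ v₂)

def landauFlux (ψ : E3 → ℝ) (v₁ : E3) : E3 := ∫ v₂ : E3, landauIntegrand ψ v₁ v₂

/-- The divergence of a vector field on `ℝ³`. -/
def divergence (J : E3 → E3) (v : E3) : ℝ :=
  ∑ i : Fin 3, (fderiv ℝ J v (EuclideanSpace.single i 1)) i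

/-- The linearized Landau operator
`𝒦ψ(v₁) = M(v₁)⁻¹ ∇·(∫ P^⊥_{v₁-v₂} (∇ψ(v₁) - ∇ψ(v₂)) / |v₁-v₂| M(v₁) M(v₂) dv₂)`. -/
def landauOp (ψ : E3 → ℝ) (v₁ : E3) : ℝ :=
  (maxwellian v₁)⁻¹ * divergence (landauFlux ψ) v₁

/-! ### The space `C³_b(ℝ³)` -/

/-- `ψ ∈ C³_b(ℝ³)`: three times continuously differentiable, bounded with its derivatives. -/
def IsC3b (ψ : E3 → ℝ) : Prop :=
  ContDiff ℝ 3 ψ ∧ ∀ k : ℕ, k ≤ 3 → ∃ B : ℝ, ∀ v, ‖iteratedFDeriv ℝ k ψ v‖ ≤ B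

/-- The norm of `C³_b(ℝ³)`. -/
def c3bNorm (ψ : E3 → ℝ) : ℝ := ∑ k ∈ Finset.range 4, ⨆ v : E3, ‖iteratedFDeriv ℝ k ψ v‖

/-! ### The constants -/

open Classical in
/-- The time scale `𝔡_ε`: `ε²` for `s < 1`, and `ε² |log ε|` for `s = 1`. -/
def timeScale (s ε : ℝ) : ℝ := if s < 1 then ε ^ 2 else ε ^ 2 * |Real.log ε|

open Classical in
/-- The constant `c_Φ`. -/
def cPhi (s : ℝ) (f : ℝ → ℝ) : ℝ :=
  if s < 1 then
    ∫ ρ in (0 : ℝ)..1,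
      (∫ u in (0 : ℝ)..1, ρ / u * deriv (radialPotential s f) (ρ / u) / √(1 - u ^ 2)) ^ 2 * ρ
  else (f 0) ^ 2

/-- `Φ̂(k) = ∫ e^{-i k·x} Φ(x) dx`. -/
def fourierTransform (Φ : E3 → ℝ) (k : E3) : ℂ :=
  ∫ x : E3, Complex.exp (-(Complex.I * ((inner ℝ k x : ℝ) : ℂ))) * ((Φ x : ℝ) : ℂ)

/-- `∫_{ℝ³} δ(k · e₁) g(k) dk`, the integral of `g` over the plane orthogonal to `e₁`. -/
def deltaPlaneIntegral (g : E3 → ℝ) : ℝ := ∫ p : ℝ × ℝ, g !₂[0, p.1, p.2]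

end Grazing

end

noncomputable section

namespace Grazing

/-! ### Motion in a central repulsive field inside the unit ball -/

section CentralMotion

variable {E : Type*} [NormedAddCommGroup E] [InnerProductSpace ℝ E]

/-- A motion `V' = h(|X|) X` on the time interval `[0, T]` inside the closed unit ball, started at
the boundary with speed `c`, radial velocity `-σ` and angular momentum `L`. -/
structure IsCentralMotion (h : ℝ → ℝ) (X V : ℝ → E) (T c σ L : ℝ) : Prop where
  cont_h : Continuous h
  nonneg_h : ∀ r, 0 ≤ h r
  time_nonneg : 0 ≤ T
  contX : ContinuousOn X (Set.Icc 0 T)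
  contV : ContinuousOn V (Set.Icc 0 T)
  derivX : ∀ t ∈ Set.Ioo 0 T, HasDerivAt X (V t) t
  derivV : ∀ t ∈ Set.Ioo 0 T, HasDerivAt V (h ‖X t‖ • X t) t
  initX : ‖X 0‖ = 1
  initV : ‖V 0‖ = c
  initXV : inner ℝ (X 0) (V 0) = -σ
  speed_pos : 0 < c
  radial_pos : 0 < σ
  momentum_pos : 0 < L
  pythagoras : c ^ 2 = σ ^ 2 + L ^ 2
  mem_ball : ∀ t ∈ Set.Icc 0 T, ‖X t‖ ≤ 1

/-- A function that is continuous on `[0, T]` with zero derivative inside is constant. -/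
theorem eq_init_of_hasDerivAt_zero {F : Type*} [NormedAddCommGroup F] [NormedSpace ℝ F]
    {y : ℝ → F} {T t : ℝ} (hy : ContinuousOn y (Set.Icc 0 T))
    (hy' : ∀ t ∈ Set.Ioo 0 T, HasDerivAt y 0 t) (ht : t ∈ Set.Icc 0 T) : y t = y 0 := by
  rcases ht.1.eq_or_lt with h0 | h0
  · rw [← h0]
  have key : ∀ a ∈ Set.Ioo 0 t, y t = y a := by
    intro a ha
    have := constant_of_has_deriv_right_zero (f := y) (a := a) (b := t)
      (hy.mono (Set.Icc_subset_Icc ha.1.le ht.2))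
      (fun x hx => (hy' x ⟨ha.1.trans_le hx.1, hx.2.trans_le ht.2⟩).hasDerivWithinAt) t
      (Set.right_mem_Icc.2 ha.2.le)
    exact this
  have hlim : Tendsto y (𝓝[Set.Ioo 0 t] 0) (𝓝 (y 0)) :=
    (hy 0 ⟨le_rfl, ht.1.trans ht.2⟩).mono
      (Set.Ioo_subset_Icc_self.trans (Set.Icc_subset_Icc le_rfl ht.2))
  have hne : (𝓝[Set.Ioo 0 t] (0 : ℝ)).NeBot := by
    rw [nhdsWithin_Ioo_eq_nhdsGT h0]; infer_instance
  refine tendsto_nhds_unique ?_ hlim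
  refine tendsto_const_nhds.congr' ?_
  filter_upwards [self_mem_nhdsWithin] with a ha using key a ha

namespace IsCentralMotion

variable {h : ℝ → ℝ} {X V : ℝ → E} {T c σ L : ℝ}

theorem gram (H : IsCentralMotion h X V T c σ L) {t : ℝ} (ht : t ∈ Set.Icc 0 T) :
    ‖X t‖ ^ 2 * ‖V t‖ ^ 2 - inner ℝ (X t) (V t) ^ 2 = L ^ 2 := by
  have hX := H.contX
  have hV := H.contV
  have := eq_init_of_hasDerivAt_zero
    (y := fun t => inner ℝ (X t) (X t) * inner ℝ (V t) (V t) - inner ℝ (X t) (V t) ^ 2)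
    (T := T) (t := t) (by fun_prop) (fun τ hτ => ?_) ht
  · simp only [real_inner_self_eq_norm_sq] at this
    rw [this, H.initX, H.initV, H.initXV, H.pythagoras]; ring
  · have hx := H.derivX τ hτ
    have hv := H.derivV τ hτ
    refine (((hx.inner ℝ hx).mul (hv.inner ℝ hv)).sub ((hx.inner ℝ hv).pow 2)).congr_deriv ?_
    simp only [real_inner_smul_left, real_inner_smul_right, real_inner_comm (V τ) (X τ)]
    ring

theorem energy (H : IsCentralMotion h X V T c σ L) {t : ℝ} (ht : t ∈ Set.Icc 0 T) :
    ‖V t‖ ^ 2 = c ^ 2 - ∫ z in (‖X t‖ ^ 2)..1, h √z := by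
  have hX := H.contX
  have hV := H.contV
  have hh : Continuous fun z => h √z := H.cont_h.comp Real.continuous_sqrt
  have hF : ∀ y : ℝ, HasDerivAt (fun y => ∫ z in y..1, h √z) (-h √y) y := fun y =>
    intervalIntegral.integral_hasDerivAt_left (hh.intervalIntegrable _ _)
      (hh.stronglyMeasurableAtFilter _ _) hh.continuousAt
  have hFc : Continuous fun y => ∫ z in y..1, h √z :=
    continuous_iff_continuousAt.2 fun y => (hF y).continuousAt
  have := eq_init_of_hasDerivAt_zero
    (y := fun t => inner ℝ (V t) (V t) + ∫ z in (inner ℝ (X t) (X t))..1, h √z)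
    (T := T) (t := t) (by
      refine ContinuousOn.add (by fun_prop) (hFc.comp_continuousOn (by fun_prop)))
      (fun τ hτ => ?_) ht
  · simp only [real_inner_self_eq_norm_sq] at this
    rw [H.initX, H.initV] at this
    simp at this
    linarith
  · have hx := H.derivX τ hτ
    have hv := H.derivV τ hτ
    refine ((hv.inner ℝ hv).add ((hF _).comp τ (hx.inner ℝ hx))).congr_deriv ?_
    simp only [real_inner_smul_left, real_inner_smul_right, real_inner_comm (V τ) (X τ),
      real_inner_self_eq_norm_sq, Real.sqrt_sq (norm_nonneg _)]
    ring

theorem speed_le (H : IsCentralMotion h X V T c σ L) {t : ℝ} (ht : t ∈ Set.Icc 0 T) :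
    ‖V t‖ ≤ c := by
  have h1 := H.energy ht
  have h2 : 0 ≤ ∫ z in (‖X t‖ ^ 2)..1, h √z :=
    intervalIntegral.integral_nonneg (pow_le_one₀ (norm_nonneg _) (H.mem_ball t ht))
      fun z _ => H.nonneg_h _
  exact abs_le_of_sq_le_sq (by linarith) H.speed_pos.le |> (le_abs_self _).trans

theorem momentum_le (H : IsCentralMotion h X V T c σ L) {t : ℝ} (ht : t ∈ Set.Icc 0 T) :
    L ≤ ‖X t‖ * ‖V t‖ := by
  have h1 := H.gram ht
  refine abs_le_of_sq_le_sq ?_ (by positivity) |> (le_abs_self _).trans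
  nlinarith [sq_nonneg (inner ℝ (X t) (V t))]

theorem le_norm_position (H : IsCentralMotion h X V T c σ L) {t : ℝ} (ht : t ∈ Set.Icc 0 T) :
    L / c ≤ ‖X t‖ := by
  rw [div_le_iff₀ H.speed_pos]
  exact (H.momentum_le ht).trans (by gcongr; exact H.speed_le ht)

theorem le_speed (H : IsCentralMotion h X V T c σ L) {t : ℝ} (ht : t ∈ Set.Icc 0 T) :
    L ≤ ‖V t‖ :=
  (H.momentum_le ht).trans (mul_le_of_le_one_left (norm_nonneg _) (H.mem_ball t ht))

theorem hasDerivAt_inner (H : IsCentralMotion h X V T c σ L) {t : ℝ} (ht : t ∈ Set.Ioo 0 T) :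
    HasDerivAt (fun t => inner ℝ (X t) (V t)) (‖V t‖ ^ 2 + h ‖X t‖ * ‖X t‖ ^ 2) t := by
  refine ((H.derivX t ht).inner ℝ (H.derivV t ht)).congr_deriv ?_
  simp only [real_inner_smul_right, real_inner_self_eq_norm_sq]
  ring

theorem inner_ge (H : IsCentralMotion h X V T c σ L) {t : ℝ} (ht : t ∈ Set.Icc 0 T) :
    -σ + L ^ 2 * t ≤ inner ℝ (X t) (V t) := by
  have hX := H.contX
  have hV := H.contV
  have hd : ∀ τ ∈ Set.Ioo 0 T, HasDerivAt (fun t => inner ℝ (X t) (V t) - L ^ 2 * t)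
      (‖V τ‖ ^ 2 + h ‖X τ‖ * ‖X τ‖ ^ 2 - L ^ 2 * 1) τ := fun τ hτ =>
    (H.hasDerivAt_inner hτ).sub ((hasDerivAt_id τ).const_mul _)
  have hm := monotoneOn_of_deriv_nonneg (convex_Icc 0 T)
    (f := fun t => inner ℝ (X t) (V t) - L ^ 2 * t) (by fun_prop)
    (by rw [interior_Icc]; exact fun τ hτ => (hd τ hτ).differentiableAt.differentiableWithinAt)
    (by
      rw [interior_Icc]; intro τ hτ; rw [(hd τ hτ).deriv]
      have h1 := H.le_speed (Set.Ioo_subset_Icc_self hτ)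
      have h2 := H.nonneg_h ‖X τ‖
      have h3 : L ^ 2 ≤ ‖V τ‖ ^ 2 := by gcongr; exact H.momentum_pos.le
      nlinarith [mul_nonneg h2 (sq_nonneg ‖X τ‖)])
    (Set.left_mem_Icc.2 H.time_nonneg) ht ht.1
  simp only [H.initXV] at hm
  linarith

theorem norm_sq_ge (H : IsCentralMotion h X V T c σ L) {t : ℝ} (ht : t ∈ Set.Icc 0 T) :
    1 - 2 * σ * t + L ^ 2 * t ^ 2 ≤ ‖X t‖ ^ 2 := by
  have hX := H.contX
  have hd : ∀ τ ∈ Set.Ioo 0 T, HasDerivAt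
      (fun t => inner ℝ (X t) (X t) - (1 - 2 * σ * t + L ^ 2 * t ^ 2))
      (2 * (inner ℝ (X τ) (V τ) - (-σ + L ^ 2 * τ))) τ := fun τ hτ => by
    have hx := H.derivX τ hτ
    refine ((hx.inner ℝ hx).sub ((((hasDerivAt_id τ).const_mul (2 * σ)).const_sub 1).add
      (((hasDerivAt_id τ).pow 2).const_mul (L ^ 2)))).congr_deriv ?_
    simp [real_inner_comm (V τ) (X τ)]
    ring
  have hm := monotoneOn_of_deriv_nonneg (convex_Icc 0 T)
    (f := fun t => inner ℝ (X t) (X t) - (1 - 2 * σ * t + L ^ 2 * t ^ 2)) (by fun_prop)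
    (by rw [interior_Icc]; exact fun τ hτ => (hd τ hτ).differentiableAt.differentiableWithinAt)
    (by
      rw [interior_Icc]; intro τ hτ; rw [(hd τ hτ).deriv]
      have h1 := H.inner_ge (Set.Ioo_subset_Icc_self hτ)
      linarith)
    (Set.left_mem_Icc.2 H.time_nonneg) ht ht.1
  simp only [real_inner_self_eq_norm_sq, H.initX] at hm
  linarith

theorem time_le (H : IsCentralMotion h X V T c σ L) : T ≤ 2 * σ / L ^ 2 := by
  have hT := Set.right_mem_Icc.2 H.time_nonneg
  have h1 := H.norm_sq_ge hT
  have h2 : ‖X T‖ ^ 2 ≤ 1 := pow_le_one₀ (norm_nonneg _) (H.mem_ball T hT)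
  rw [le_div_iff₀ (pow_pos H.momentum_pos 2)]
  rcases H.time_nonneg.eq_or_lt with h0 | h0
  · rw [← h0]
    linarith [H.radial_pos]
  · nlinarith

theorem speed_pos_at (H : IsCentralMotion h X V T c σ L) {t : ℝ} (ht : t ∈ Set.Icc 0 T) :
    0 < ‖V t‖ := H.momentum_pos.trans_le (H.le_speed ht)

theorem norm_pos_at (H : IsCentralMotion h X V T c σ L) {t : ℝ} (ht : t ∈ Set.Icc 0 T) :
    0 < ‖X t‖ := (div_pos H.momentum_pos H.speed_pos).trans_le (H.le_norm_position ht)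

/-- The angular speed of the velocity vector. -/
theorem continuousOn_angularSpeed (H : IsCentralMotion h X V T c σ L) :
    ContinuousOn (fun t => h ‖X t‖ * L / ‖V t‖ ^ 2) (Set.Icc 0 T) := by
  have hX := H.contX
  have hV := H.contV
  have hh := H.cont_h
  refine ContinuousOn.div ?_ (by fun_prop) fun t ht => (pow_pos (H.speed_pos_at ht) 2).ne'
  exact (hh.comp_continuousOn hX.norm).mul continuousOn_const

theorem hasDerivAt_speed (H : IsCentralMotion h X V T c σ L) {t : ℝ} (ht : t ∈ Set.Ioo 0 T) :
    HasDerivAt (fun t => ‖V t‖) (h ‖X t‖ * inner ℝ (X t) (V t) / ‖V t‖) t := by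
  have hpos := H.speed_pos_at (Set.Ioo_subset_Icc_self ht)
  have h1 := ((H.derivV t ht).norm_sq).sqrt (by positivity)
  simp only [Real.sqrt_sq (norm_nonneg _)] at h1
  refine h1.congr_deriv ?_
  rw [real_inner_smul_right, real_inner_comm]
  field_simp

/-- The direction of the velocity rotates, in the plane of the motion, by the integral of the
angular speed. -/
theorem direction_eq (H : IsCentralMotion h X V T c σ L) {t : ℝ} (ht : t ∈ Set.Icc 0 T) :
    ‖V t‖⁻¹ • V t =
      Real.cos (∫ τ in (0 : ℝ)..t, h ‖X τ‖ * L / ‖V τ‖ ^ 2) • c⁻¹ • V 0 +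
      Real.sin (∫ τ in (0 : ℝ)..t, h ‖X τ‖ * L / ‖V τ‖ ^ 2) •
        (L * c)⁻¹ • (c ^ 2 • X 0 + σ • V 0) := by
  have hX := H.contX
  have hV := H.contV
  have hom_cont := H.continuousOn_angularSpeed
  set om : ℝ → ℝ := fun t => h ‖X t‖ * L / ‖V t‖ ^ 2 with hom
  have hL := H.momentum_pos
  have hVn : ∀ τ ∈ Set.Icc 0 T, ‖V τ‖ ≠ 0 := fun τ hτ => (H.speed_pos_at hτ).ne'
  set Ω : ℝ → ℝ := fun t => ∫ τ in (0 : ℝ)..t, om τ with hΩd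
  have hΩc : ContinuousOn Ω (Set.Icc 0 T) := by
    have := intervalIntegral.continuousOn_primitive_interval (μ := volume) (f := om) (a := 0) (b := T)
      (by rw [Set.uIcc_of_le H.time_nonneg]; exact hom_cont.integrableOn_Icc)
    rwa [Set.uIcc_of_le H.time_nonneg] at this
  have hΩ' : ∀ τ ∈ Set.Ioo 0 T, HasDerivAt Ω (om τ) τ := fun τ hτ => by
    refine intervalIntegral.integral_hasDerivAt_right ?_
      ((hom_cont.mono Set.Ioo_subset_Icc_self).stronglyMeasurableAtFilter isOpen_Ioo τ hτ)
      (hom_cont.continuousAt (Icc_mem_nhds hτ.1 hτ.2))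
    refine ContinuousOn.intervalIntegrable ?_
    rw [Set.uIcc_of_le hτ.1.le]
    exact hom_cont.mono (Set.Icc_subset_Icc le_rfl hτ.2.le)
  set U : ℝ → E := fun t => ‖V t‖⁻¹ • V t with hUd
  set N : ℝ → E := fun t => (L * ‖V t‖)⁻¹ •
    (‖V t‖ ^ 2 • X t - (inner ℝ (X t) (V t) : ℝ) • V t) with hNd
  have hUc : ContinuousOn U (Set.Icc 0 T) := (hV.norm.inv₀ hVn).smul hV
  have hNc : ContinuousOn N (Set.Icc 0 T) :=
    ((continuousOn_const.mul hV.norm).inv₀ fun τ hτ => mul_ne_zero hL.ne' (hVn τ hτ)).smul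
      (((hV.norm.pow 2).smul hX).sub ((hX.inner hV).smul hV))
  have hU' : ∀ τ ∈ Set.Ioo 0 T, HasDerivAt U (om τ • N τ) τ := fun τ hτ => by
    have hn := hVn τ (Set.Ioo_subset_Icc_self hτ)
    refine (((H.hasDerivAt_speed hτ).inv hn).smul (H.derivV τ hτ)).congr_deriv ?_
    simp only [hom, hNd, Pi.inv_apply]
    match_scalars <;> field_simp
  have hN' : ∀ τ ∈ Set.Ioo 0 T, HasDerivAt N (-om τ • U τ) τ := fun τ hτ => by
    have hn := hVn τ (Set.Ioo_subset_Icc_self hτ)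
    have hg := H.gram (Set.Ioo_subset_Icc_self hτ)
    have hs := H.hasDerivAt_speed hτ
    refine (((hs.const_mul L).inv (mul_ne_zero hL.ne' hn)).smul
      (((hs.pow 2).smul (H.derivX τ hτ)).sub
        ((H.hasDerivAt_inner hτ).smul (H.derivV τ hτ)))).congr_deriv ?_
    simp only [hom, hUd, Pi.inv_apply, Pi.pow_apply, Pi.sub_apply, Pi.smul_apply']
    match_scalars
    · field_simp
      rw [← hg]
      norm_num
      ring
    · field_simp
      rw [show 2 - 1 = 1 from rfl]
      ring
  have e1 := eq_init_of_hasDerivAt_zero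
    (y := fun τ => Real.cos (Ω τ) • U τ - Real.sin (Ω τ) • N τ) (T := T) (t := t)
    (((Real.continuous_cos.comp_continuousOn hΩc).smul hUc).sub ((Real.continuous_sin.comp_continuousOn hΩc).smul hNc)) (fun τ hτ => by
      refine (((hΩ' τ hτ).cos.smul (hU' τ hτ)).sub
        ((hΩ' τ hτ).sin.smul (hN' τ hτ))).congr_deriv ?_
      module) ht
  have e2 := eq_init_of_hasDerivAt_zero
    (y := fun τ => Real.sin (Ω τ) • U τ + Real.cos (Ω τ) • N τ) (T := T) (t := t)
    (((Real.continuous_sin.comp_continuousOn hΩc).smul hUc).add ((Real.continuous_cos.comp_continuousOn hΩc).smul hNc)) (fun τ hτ => by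
      refine (((hΩ' τ hτ).sin.smul (hU' τ hτ)).add
        ((hΩ' τ hτ).cos.smul (hN' τ hτ))).congr_deriv ?_
      module) ht
  have hΩ0 : Ω 0 = 0 := by simp [hΩd]
  simp only [hΩ0, Real.cos_zero, Real.sin_zero, one_smul, zero_smul, sub_zero, zero_add] at e1 e2
  have hU0 : U 0 = c⁻¹ • V 0 := by simp [hUd, H.initV]
  have hN0 : N 0 = (L * c)⁻¹ • (c ^ 2 • X 0 + σ • V 0) := by
    simp [hNd, H.initV, H.initXV]
  change U t = Real.cos (Ω t) • c⁻¹ • V 0 + Real.sin (Ω t) • _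
  rw [← hU0, ← hN0, ← e1, ← e2]
  have := Real.sin_sq_add_cos_sq (Ω t)
  calc U t = (Real.sin (Ω t) ^ 2 + Real.cos (Ω t) ^ 2) • U t := by rw [this, one_smul]
    _ = _ := by module

theorem hasDerivAt_arctan (H : IsCentralMotion h X V T c σ L) {t : ℝ} (ht : t ∈ Set.Ioo 0 T) :
    HasDerivAt (fun t => Real.arctan (inner ℝ (X t) (V t) / L))
      (L * (‖V t‖ ^ 2 + h ‖X t‖ * ‖X t‖ ^ 2) / (‖X t‖ ^ 2 * ‖V t‖ ^ 2)) t := by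
  have hL := H.momentum_pos
  have h1 := H.norm_pos_at (Set.Ioo_subset_Icc_self ht)
  have h2 := H.speed_pos_at (Set.Ioo_subset_Icc_self ht)
  refine ((H.hasDerivAt_inner ht).div_const L).arctan.congr_deriv ?_
  have hg := H.gram (Set.Ioo_subset_Icc_self ht)
  have h3 : 1 + (inner ℝ (X t) (V t) / L) ^ 2 = ‖X t‖ ^ 2 * ‖V t‖ ^ 2 / L ^ 2 := by
    rw [eq_div_iff (by positivity), add_mul, div_pow, div_mul_cancel₀ _ (by positivity)]
    linarith
  rw [h3]
  field_simp

theorem cos_arctan_eq (H : IsCentralMotion h X V T c σ L) {t : ℝ} (ht : t ∈ Set.Icc 0 T) :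
    Real.cos (Real.arctan (inner ℝ (X t) (V t) / L)) = L / (‖X t‖ * ‖V t‖) := by
  have hL := H.momentum_pos
  have hg := H.gram ht
  have h3 : 1 + (inner ℝ (X t) (V t) / L) ^ 2 = (‖X t‖ * ‖V t‖ / L) ^ 2 := by
    rw [div_pow, div_pow, eq_div_iff (by positivity), add_mul, div_mul_cancel₀ _ (by positivity)]
    linarith
  rw [Real.cos_arctan, h3, Real.sqrt_sq (by positivity), one_div_div]

/-- At the exit from the unit ball the speed is the initial one. -/
theorem exit_speed (H : IsCentralMotion h X V T c σ L) (hT : ‖X T‖ = 1) : ‖V T‖ = c := by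
  have := H.energy (Set.right_mem_Icc.2 H.time_nonneg)
  rw [hT] at this
  simp only [one_pow, intervalIntegral.integral_same, sub_zero] at this
  exact (sq_eq_sq₀ (norm_nonneg _) H.speed_pos.le).1 this

/-- At the exit from the unit ball the radial velocity is reversed. -/
theorem exit_inner (H : IsCentralMotion h X V T c σ L) (hT0 : 0 < T) (hT : ‖X T‖ = 1) :
    inner ℝ (X T) (V T) = σ := by
  have hm := Set.right_mem_Icc.2 H.time_nonneg
  have h1 := H.gram hm
  rw [hT, H.exit_speed hT, H.pythagoras] at h1
  have h2 := H.inner_ge hm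
  have h3 : inner ℝ (X T) (V T) ^ 2 = σ ^ 2 := by linarith
  rcases sq_eq_sq_iff_eq_or_eq_neg.1 h3 with h4 | h4
  · exact h4
  · have := mul_pos (pow_pos H.momentum_pos 2) hT0
    linarith

/-- The total rotation angle of the velocity, as an integral over the angle between the velocity
and the tangential direction. -/
theorem angle_eq (H : IsCentralMotion h X V T c σ L) (hT0 : 0 < T) (hT : ‖X T‖ = 1)
    {G : ℝ → ℝ} (hG : ∀ t ∈ Set.Ioo 0 T, G (Real.arctan (inner ℝ (X t) (V t) / L)) =
      h ‖X t‖ * ‖X t‖ ^ 2 / (‖V t‖ ^ 2 + h ‖X t‖ * ‖X t‖ ^ 2)) :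
    ∫ τ in (0 : ℝ)..T, h ‖X τ‖ * L / ‖V τ‖ ^ 2 =
      ∫ η in Set.Ioo (-Real.arctan (σ / L)) (Real.arctan (σ / L)), G η := by
  have hX := H.contX
  have hV := H.contV
  have hL := H.momentum_pos
  set η : ℝ → ℝ := fun t => Real.arctan (inner ℝ (X t) (V t) / L) with hη
  have hηc : ContinuousOn η (Set.Icc 0 T) :=
    Real.continuous_arctan.comp_continuousOn ((hX.inner hV).div_const L)
  have hpos : ∀ t ∈ Set.Ioo 0 T,
      0 < L * (‖V t‖ ^ 2 + h ‖X t‖ * ‖X t‖ ^ 2) / (‖X t‖ ^ 2 * ‖V t‖ ^ 2) := fun t ht => by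
    have h1 := H.norm_pos_at (Set.Ioo_subset_Icc_self ht)
    have h2 := H.speed_pos_at (Set.Ioo_subset_Icc_self ht)
    have h3 := H.nonneg_h ‖X t‖
    positivity
  have hmono : StrictMonoOn η (Set.Icc 0 T) := by
    refine strictMonoOn_of_deriv_pos (convex_Icc 0 T) hηc ?_
    rw [interior_Icc]
    exact fun t ht => by rw [(H.hasDerivAt_arctan ht).deriv]; exact hpos t ht
  have h0m := Set.left_mem_Icc.2 H.time_nonneg
  have hTm := Set.right_mem_Icc.2 H.time_nonneg
  have hη0 : η 0 = -Real.arctan (σ / L) := by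
    simp only [hη, H.initXV]; rw [neg_div, Real.arctan_neg]
  have hηT : η T = Real.arctan (σ / L) := by simp only [hη, H.exit_inner hT0 hT]
  have himg : η '' Set.Ioo 0 T = Set.Ioo (η 0) (η T) := by
    apply Set.Subset.antisymm
    · rintro _ ⟨t, ht, rfl⟩
      exact ⟨hmono h0m (Set.Ioo_subset_Icc_self ht) ht.1,
        hmono (Set.Ioo_subset_Icc_self ht) hTm ht.2⟩
    · exact intermediate_value_Ioo H.time_nonneg hηc
  rw [← hη0, ← hηT, ← himg, integral_image_eq_integral_abs_deriv_smul measurableSet_Ioo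
    (fun t ht => (H.hasDerivAt_arctan ht).hasDerivWithinAt)
    (hmono.injOn.mono Set.Ioo_subset_Icc_self), intervalIntegral.integral_of_le H.time_nonneg,
    integral_Ioc_eq_integral_Ioo]
  refine setIntegral_congr_fun measurableSet_Ioo fun t ht => ?_
  simp only [smul_eq_mul]
  rw [abs_of_pos (hpos t ht), hG t ht]
  have h1 := H.norm_pos_at (Set.Ioo_subset_Icc_self ht)
  have h2 := H.speed_pos_at (Set.Ioo_subset_Icc_self ht)
  have h3 := H.nonneg_h ‖X t‖
  have h4 : 0 < ‖V t‖ ^ 2 + h ‖X t‖ * ‖X t‖ ^ 2 := by positivity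
  field_simp

end IsCentralMotion
end CentralMotion

/-! ### Existence of motions in a central field -/

section Existence

variable {E : Type*} [NormedAddCommGroup E] [InnerProductSpace ℝ E]

/-- A Lipschitz function on `(a, 1)` with values in `[0, M]` extends to a Lipschitz function on `ℝ`
with values in `[0, M]` that vanishes on `[2, ∞)`. -/
theorem exists_lipschitz_cutoff {p : ℝ → ℝ} {a M : ℝ} {K : NNReal}
    (hp : LipschitzOnWith K p (Set.Ioo a 1)) (hM : 0 ≤ M)
    (hpM : ∀ r ∈ Set.Ioo a 1, p r ∈ Set.Icc 0 M) :
    ∃ (h : ℝ → ℝ) (K' : NNReal), LipschitzWith K' h ∧ (∀ r, h r ∈ Set.Icc 0 M) ∧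
      (∀ r ∈ Set.Ioo a 1, h r = p r) ∧ ∀ r, 2 ≤ r → h r = 0 := by
  classical
  set q : ℝ → ℝ := fun r => if r < 1 then p r else 0 with hq
  set S : Set ℝ := Set.Ioo a 1 ∪ Set.Ici 2 with hS
  have hlip : LipschitzOnWith (K + NNReal.mk M hM) q S := by
    have cross : ∀ x ∈ Set.Ioo a 1, ∀ y ∈ Set.Ici (2 : ℝ), |q x - q y| ≤ (K + M) * |x - y| := by
      intro x hx y hy
      have hy2 : (2 : ℝ) ≤ y := hy
      have h1 : ¬ y < 1 := by linarith
      simp only [hq, hx.2, if_true, h1, if_false, sub_zero]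
      rw [abs_of_nonneg (hpM x hx).1, abs_of_nonpos (by linarith [hx.2])]
      have h2 := (hpM x hx).2
      have h3 := K.coe_nonneg
      have h4 : 1 ≤ -(x - y) := by linarith [hx.2]
      nlinarith
    refine LipschitzOnWith.of_dist_le_mul fun x hx y hy => ?_
    simp only [Real.dist_eq, NNReal.coe_add, NNReal.coe_mk]
    rcases hx with hx | hx <;> rcases hy with hy | hy
    · simp only [hq, hx.2, hy.2, if_true]
      have := hp.dist_le_mul x hx y hy
      rw [Real.dist_eq, Real.dist_eq] at this
      nlinarith [abs_nonneg (x - y)]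
    · exact cross x hx y hy
    · rw [abs_sub_comm, abs_sub_comm x]; exact cross y hy x hx
    · have hx2 : (2 : ℝ) ≤ x := hx
      have hy2 : (2 : ℝ) ≤ y := hy
      have h1 : ¬ y < 1 := by linarith
      have h2 : ¬ x < 1 := by linarith
      simp only [hq, h1, h2, if_false, sub_zero, abs_zero]
      have h3 := K.coe_nonneg
      positivity
  obtain ⟨g, hg, hgq⟩ := hlip.extend_real
  refine ⟨fun r => max 0 (min M (g r)), _, (hg.const_min M).const_max 0, fun r =>
    ⟨le_max_left _ _, max_le hM (min_le_left _ _)⟩, fun r hr => ?_, fun r hr => ?_⟩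
  · have : g r = p r := by rw [← hgq (Or.inl hr)]; simp [hq, hr.2]
    simp only [this]
    rw [min_eq_right (hpM r hr).2, max_eq_right (hpM r hr).1]
  · have : g r = 0 := by
      rw [← hgq (Or.inr hr)]; have : ¬ r < 1 := by linarith
      simp [hq, this]
    simp only [this]
    rw [min_eq_right hM, max_self]

/-- Existence of solutions of `X'' = h(|X|) X` for a compactly supported Lipschitz `h`. -/
theorem exists_central_solution [CompleteSpace E] {h : ℝ → ℝ} {K : NNReal} {M : ℝ}
    (hK : LipschitzWith K h) (hM : ∀ r, h r ∈ Set.Icc 0 M) (h2 : ∀ r, 2 ≤ r → h r = 0)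
    {T : ℝ} (hT : 0 < T) (x₀ v₀ : E) :
    ∃ X V : ℝ → E, X 0 = x₀ ∧ V 0 = v₀ ∧
      (∀ t ∈ Set.Icc 0 T, HasDerivWithinAt X (V t) (Set.Icc 0 T) t) ∧
      ∀ t ∈ Set.Icc 0 T, HasDerivWithinAt V (h ‖X t‖ • X t) (Set.Icc 0 T) t := by
  have hM0 : 0 ≤ M := (hM 0).1.trans (hM 0).2
  set l : ℝ := (2 * T)⁻¹ with hl
  have hl0 : 0 < l := by positivity
  set F : E × E → E × E := fun z => (l • z.2, l⁻¹ • h ‖z.1‖ • z.1) with hF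
  set z₀ : E × E := (x₀, l⁻¹ • v₀) with hz
  set a : ℝ := ‖l⁻¹ • v₀‖ + 4 * T ^ 2 * M + 1 with ha
  have ha0 : 0 ≤ a := by positivity
  have hbd : ∀ z ∈ Metric.closedBall z₀ a, ‖F z‖ ≤ a / T := by
    intro z hz'
    rw [mem_closedBall_iff_norm, Prod.norm_def] at hz'
    have hp : ‖z.2‖ ≤ a + a := by
      have h1 : ‖z.2 - l⁻¹ • v₀‖ ≤ a := (le_max_right _ _).trans hz'
      have h3 : ‖z.2‖ ≤ ‖z.2 - l⁻¹ • v₀‖ + ‖l⁻¹ • v₀‖ := norm_le_norm_sub_add _ _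
      have h4 : ‖l⁻¹ • v₀‖ ≤ a := by
        rw [ha]; have : 0 ≤ 4 * T ^ 2 * M := by positivity
        linarith
      linarith
    have hx : ‖h ‖z.1‖ • z.1‖ ≤ 2 * M := by
      rw [norm_smul, Real.norm_eq_abs, abs_of_nonneg (hM _).1]
      rcases le_or_gt 2 ‖z.1‖ with h3 | h3
      · rw [h2 _ h3]; simpa using hM0
      · nlinarith [(hM ‖z.1‖).1, (hM ‖z.1‖).2, norm_nonneg z.1]
    rw [Prod.norm_def]
    refine max_le ?_ ?_
    · simp only [hF, norm_smul, Real.norm_eq_abs, abs_of_pos hl0]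
      calc l * ‖z.2‖ ≤ l * (a + a) := by gcongr
        _ = a / T := by rw [hl]; field_simp; ring
    · simp only [hF]
      rw [norm_smul, Real.norm_eq_abs, abs_of_pos (inv_pos.2 hl0), hl, inv_inv, le_div_iff₀ hT]
      have : 2 * T * ‖h ‖z.1‖ • z.1‖ * T ≤ 2 * T * (2 * M) * T := by gcongr
      rw [ha]
      nlinarith [norm_nonneg (l⁻¹ • v₀)]
  have hlip : LipschitzOnWith (Real.toNNReal (l + l⁻¹ * (M + K * (‖x₀‖ + a)))) F
      (Metric.closedBall z₀ a) := by
    have hc : 0 ≤ l⁻¹ * (M + K * (‖x₀‖ + a)) := by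
      have := K.coe_nonneg
      positivity
    refine LipschitzOnWith.of_dist_le_mul fun y hy z hz' => ?_
    rw [Real.coe_toNNReal _ (by positivity), dist_eq_norm, dist_eq_norm, Prod.norm_def]
    have n1 : ‖(y - z).1‖ ≤ ‖y - z‖ := norm_fst_le _
    have n2 : ‖(y - z).2‖ ≤ ‖y - z‖ := norm_snd_le _
    refine max_le ?_ ?_
    · have : (F y - F z).1 = l • (y - z).2 := by simp [hF, smul_sub]
      rw [this, norm_smul, Real.norm_eq_abs, abs_of_pos hl0]
      nlinarith [norm_nonneg (y - z)]
    · have : (F y - F z).2 = l⁻¹ • (h ‖y.1‖ • (y.1 - z.1) + (h ‖y.1‖ - h ‖z.1‖) • z.1) := by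
        simp only [hF, Prod.snd_sub]; module
      rw [this, norm_smul, Real.norm_eq_abs, abs_of_pos (inv_pos.2 hl0)]
      have hz1 : ‖z.1‖ ≤ ‖x₀‖ + a := by
        rw [mem_closedBall_iff_norm, Prod.norm_def] at hz'
        have h1 : ‖z.1 - x₀‖ ≤ a := (le_max_left _ _).trans hz'
        have h3 : ‖z.1‖ ≤ ‖z.1 - x₀‖ + ‖x₀‖ := norm_le_norm_sub_add _ _
        linarith
      have e1 : ‖h ‖y.1‖ • (y.1 - z.1)‖ ≤ M * ‖y - z‖ := by
        rw [norm_smul, Real.norm_eq_abs, abs_of_nonneg (hM _).1]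
        exact mul_le_mul (hM _).2 n1 (norm_nonneg _) hM0
      have e2 : ‖(h ‖y.1‖ - h ‖z.1‖) • z.1‖ ≤ K * (‖x₀‖ + a) * ‖y - z‖ := by
        rw [norm_smul]
        have h3 : ‖h ‖y.1‖ - h ‖z.1‖‖ ≤ K * ‖y - z‖ := by
          have := hK.dist_le_mul ‖y.1‖ ‖z.1‖
          rw [dist_eq_norm, Real.dist_eq] at this
          refine this.trans ?_
          gcongr
          exact (abs_norm_sub_norm_le _ _).trans n1
        calc _ ≤ (K * ‖y - z‖) * (‖x₀‖ + a) := by gcongr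
          _ = _ := by ring
      have e3 := (norm_add_le (h ‖y.1‖ • (y.1 - z.1)) ((h ‖y.1‖ - h ‖z.1‖) • z.1)).trans
        (add_le_add e1 e2)
      calc _ ≤ l⁻¹ * (M * ‖y - z‖ + K * (‖x₀‖ + a) * ‖y - z‖) := by gcongr
        _ ≤ _ := by nlinarith [norm_nonneg (y - z)]
  have hPL : IsPicardLindelof (fun _ => F) (tmin := 0) (tmax := T)
      ⟨0, Set.left_mem_Icc.2 hT.le⟩ z₀ (NNReal.mk a ha0) 0 (NNReal.mk (a / T) (by positivity)) _ :=
    IsPicardLindelof.of_time_independent hbd hlip (by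
      simp only [sub_zero, sub_self, NNReal.coe_mk, NNReal.coe_zero]
      rw [max_eq_left hT.le, div_mul_cancel₀ _ hT.ne'])
  obtain ⟨α, hα0, hα⟩ := hPL.exists_eq_forall_mem_Icc_hasDerivWithinAt₀
  refine ⟨fun t => (α t).1, fun t => l • (α t).2, ?_, ?_, fun t ht => ?_, fun t ht => ?_⟩
  · simp only at hα0; simp [hα0, hz]
  · simp only at hα0; simp [hα0, hz, smul_smul, hl0.ne']
  · exact (hasFDerivAt_fst.comp_hasDerivWithinAt t (hα t ht))
  · have := (hasFDerivAt_snd.comp_hasDerivWithinAt t (hα t ht)).const_smul l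
    refine this.congr_deriv ?_
    simp [hF, smul_smul, hl0.ne']

end Existence

/-! ### Radial repulsive potentials -/

/-- The quantitative properties of the radial potential `φ` that enter the scattering estimates. -/
structure IsRepulsive (φ : ℝ → ℝ) (s B : ℝ) : Prop where
  s_nonneg : 0 ≤ s
  s_le_one : s ≤ 1
  B_pos : 0 < B
  continuousOn : ContinuousOn φ (Set.Ioi 0)
  eq_zero : ∀ r, 1 ≤ r → φ r = 0
  differentiableAt : ∀ r ∈ Set.Ioo (0 : ℝ) 1, DifferentiableAt ℝ φ r
  differentiableAt_deriv : ∀ r ∈ Set.Ioo (0 : ℝ) 1, DifferentiableAt ℝ (deriv φ) r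
  nonneg : ∀ r, 0 < r → 0 ≤ φ r
  deriv_nonpos : ∀ r ∈ Set.Ioo (0 : ℝ) 1, deriv φ r ≤ 0
  le_rpow : ∀ r ∈ Set.Ioo (0 : ℝ) 1, φ r ≤ B * r ^ (-s)
  abs_deriv_le : ∀ r ∈ Set.Ioo (0 : ℝ) 1, |deriv φ r| ≤ B * r ^ (-s - 1)
  abs_deriv_deriv_le : ∀ r ∈ Set.Ioo (0 : ℝ) 1, |deriv (deriv φ) r| ≤ B * r ^ (-s - 2)

section Profile

variable {s : ℝ} {f : ℝ → ℝ}

theorem IsProfile.nonneg (hf : IsProfile f) {r : ℝ} (hr : r ∈ Set.Icc (0 : ℝ) 1) : 0 ≤ f r := by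
  rw [← hf.one_eq_zero]
  exact hf.antitone hr (Set.right_mem_Icc.2 zero_le_one) hr.2

theorem IsProfile.contDiffAt (hf : IsProfile f) {r : ℝ} (hr : r ∈ Set.Ioo (0 : ℝ) 1) :
    ContDiffAt ℝ ∞ f r := hf.smooth.contDiffAt (Ioo_mem_nhds hr.1 hr.2)

theorem IsProfile.hasDerivAt (hf : IsProfile f) {r : ℝ} (hr : r ∈ Set.Ioo (0 : ℝ) 1) :
    HasDerivAt f (deriv f r) r :=
  ((hf.contDiffAt hr).differentiableAt (by simp)).hasDerivAt

theorem IsProfile.hasDerivAt_deriv (hf : IsProfile f) {r : ℝ} (hr : r ∈ Set.Ioo (0 : ℝ) 1) :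
    HasDerivAt (deriv f) (deriv (deriv f) r) r := by
  have h : ContDiffOn ℝ 1 (deriv f) (Set.Ioo 0 1) :=
    hf.smooth.deriv_of_isOpen isOpen_Ioo (by norm_cast)
  exact ((h.contDiffAt (Ioo_mem_nhds hr.1 hr.2)).differentiableAt (by simp)).hasDerivAt

theorem IsProfile.deriv_nonpos (hf : IsProfile f) {r : ℝ} (hr : r ∈ Set.Ioo (0 : ℝ) 1) :
    deriv f r ≤ 0 := by
  have h1 := hf.hasDerivAt hr
  have h2 : Set.Icc (0 : ℝ) 1 ∈ 𝓝 r := Icc_mem_nhds hr.1 hr.2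
  rw [← derivWithin_of_mem_nhds h2]
  exact hf.antitone.derivWithin_nonpos

theorem radialPotential_eq {r : ℝ} (hr : r ∈ Set.Ioc (0 : ℝ) 1) :
    radialPotential s f r = f r * r ^ (-s) := by
  rw [radialPotential, if_pos ⟨hr.1, hr.2⟩, Real.rpow_neg hr.1.le, div_eq_mul_inv]

theorem radialPotential_eq_zero (hf : IsProfile f) {r : ℝ} (hr : 1 ≤ r) :
    radialPotential s f r = 0 := by
  rcases hr.eq_or_lt with h | h
  · rw [radialPotential_eq ⟨by linarith, h.ge⟩, ← h, hf.one_eq_zero, zero_mul]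
  · rw [radialPotential, if_neg (fun h' => by linarith [h'.2])]

theorem hasDerivAt_radialPotential (hf : IsProfile f) {r : ℝ} (hr : r ∈ Set.Ioo (0 : ℝ) 1) :
    HasDerivAt (radialPotential s f) (deriv f r * r ^ (-s) + f r * (-s * r ^ (-s - 1))) r := by
  refine ((hf.hasDerivAt hr).mul (Real.hasDerivAt_rpow_const (Or.inl hr.1.ne'))).congr_of_eventuallyEq
    ?_
  filter_upwards [Ioo_mem_nhds hr.1 hr.2] with x hx
  exact radialPotential_eq ⟨hx.1, hx.2.le⟩

theorem deriv_radialPotential (hf : IsProfile f) {r : ℝ} (hr : r ∈ Set.Ioo (0 : ℝ) 1) :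
    deriv (radialPotential s f) r = deriv f r * r ^ (-s) + f r * (-s * r ^ (-s - 1)) :=
  (hasDerivAt_radialPotential hf hr).deriv

theorem hasDerivAt_deriv_radialPotential (hf : IsProfile f) {r : ℝ} (hr : r ∈ Set.Ioo (0 : ℝ) 1) :
    HasDerivAt (deriv (radialPotential s f))
      (deriv (deriv f) r * r ^ (-s) + deriv f r * (-s * r ^ (-s - 1)) +
        (deriv f r * (-s * r ^ (-s - 1)) + f r * (-s * ((-s - 1) * r ^ (-s - 2))))) r := by
  have h1 : HasDerivAt (fun x : ℝ => x ^ (-s)) (-s * r ^ (-s - 1)) r :=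
    Real.hasDerivAt_rpow_const (Or.inl hr.1.ne')
  have h2 : HasDerivAt (fun x : ℝ => x ^ (-s - 1)) ((-s - 1) * r ^ (-s - 2)) r := by
    convert Real.hasDerivAt_rpow_const (p := -s - 1) (Or.inl hr.1.ne') using 2
    ring_nf
  refine (((hf.hasDerivAt_deriv hr).mul h1).add
    ((hf.hasDerivAt hr).mul (h2.const_mul (-s)))).congr_of_eventuallyEq ?_
  filter_upwards [Ioo_mem_nhds hr.1 hr.2] with x hx
  exact deriv_radialPotential hf hx

theorem continuousOn_radialPotential (hf : IsProfile f) :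
    ContinuousOn (radialPotential s f) (Set.Ioi 0) := by
  have h1 : ContinuousOn (radialPotential s f) (Set.Ioc 0 1) := by
    refine ContinuousOn.congr (f := fun r => f r * r ^ (-s)) ?_ fun r hr => radialPotential_eq hr
    exact (hf.continuousOn.mono Set.Ioc_subset_Icc_self).mul
      (ContinuousOn.rpow_const continuousOn_id fun r hr => Or.inl hr.1.ne')
  have h2 : ContinuousOn (radialPotential s f) (Set.Ici 1) :=
    continuousOn_const.congr fun r hr => radialPotential_eq_zero hf hr
  intro r hr
  have hr : 0 < r := hr
  have : Set.Ioi (0 : ℝ) = Set.Ioc 0 1 ∪ Set.Ici 1 := by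
    ext x
    simp only [Set.mem_Ioi, Set.mem_union, Set.mem_Ioc, Set.mem_Ici]
    constructor
    · intro h
      rcases le_or_gt x 1 with h' | h'
      · exact Or.inl ⟨h, h'⟩
      · exact Or.inr h'.le
    · rintro (h | h)
      · exact h.1
      · linarith
  rw [this]
  rcases lt_trichotomy r 1 with h | h | h
  · exact (h1.continuousAt (Ioc_mem_nhds hr h)).continuousWithinAt
  · exact ContinuousWithinAt.union (h1 r ⟨hr, h.le⟩) (h2 r h.ge)
  · exact (h2.continuousAt (Ici_mem_nhds h)).continuousWithinAt

theorem IsProfile.exists_bound (hf : IsProfile f) : ∃ B : ℝ, 0 < B ∧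
    ∀ r ∈ Set.Ioo (0 : ℝ) 1, |f r| ≤ B ∧ |deriv f r| ≤ B ∧ |deriv (deriv f) r| ≤ B := by
  obtain ⟨B0, h0⟩ := hf.bounded 0
  obtain ⟨B1, h1⟩ := hf.bounded 1
  obtain ⟨B2, h2⟩ := hf.bounded 2
  refine ⟨|B0| + |B1| + |B2| + 1, by positivity, fun r hr => ?_⟩
  have a0 := h0 r hr
  have a1 := h1 r hr
  have a2 := h2 r hr
  rw [iteratedDeriv_zero] at a0
  rw [iteratedDeriv_one] at a1
  rw [iteratedDeriv_succ, iteratedDeriv_one] at a2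
  have := le_abs_self B0
  have := le_abs_self B1
  have := le_abs_self B2
  have := abs_nonneg B0
  have := abs_nonneg B1
  have := abs_nonneg B2
  exact ⟨by linarith, by linarith, by linarith⟩

theorem IsProfile.exists_isRepulsive (hf : IsProfile f) (hs₀ : 0 ≤ s) (hs₁ : s ≤ 1) :
    ∃ B, IsRepulsive (radialPotential s f) s B := by
  obtain ⟨B, hB, hb⟩ := hf.exists_bound
  have key : ∀ r ∈ Set.Ioo (0 : ℝ) 1, 0 < r ^ (-s) ∧ r ^ (-s) ≤ r ^ (-s - 1) ∧
      r ^ (-s - 1) ≤ r ^ (-s - 2) := fun r hr =>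
    ⟨Real.rpow_pos_of_pos hr.1 _, Real.rpow_le_rpow_of_exponent_ge hr.1 hr.2.le (by linarith),
      Real.rpow_le_rpow_of_exponent_ge hr.1 hr.2.le (by linarith)⟩
  refine ⟨5 * B, hs₀, hs₁, by positivity, continuousOn_radialPotential hf,
    fun r hr => radialPotential_eq_zero hf hr,
    fun r hr => (hasDerivAt_radialPotential hf hr).differentiableAt,
    fun r hr => (hasDerivAt_deriv_radialPotential hf hr).differentiableAt,
    fun r hr => ?_, fun r hr => ?_, fun r hr => ?_, fun r hr => ?_, fun r hr => ?_⟩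
  · rcases le_or_gt r 1 with h | h
    · rw [radialPotential_eq ⟨hr, h⟩]
      exact mul_nonneg (hf.nonneg ⟨hr.le, h⟩) (Real.rpow_nonneg hr.le _)
    · rw [radialPotential_eq_zero hf h.le]
  · rw [deriv_radialPotential hf hr]
    have h1 := hf.deriv_nonpos hr
    have h2 := hf.nonneg (Set.Ioo_subset_Icc_self hr)
    obtain ⟨k1, k2, k3⟩ := key r hr
    have e1 : deriv f r * r ^ (-s) ≤ 0 := mul_nonpos_of_nonpos_of_nonneg h1 k1.le
    have e2 : 0 ≤ f r * (s * r ^ (-s - 1)) := by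
      have := k1.trans_le k2
      positivity
    linarith
  · obtain ⟨k1, k2, k3⟩ := key r hr
    rw [radialPotential_eq ⟨hr.1, hr.2.le⟩]
    have := (le_abs_self _).trans (hb r hr).1
    gcongr
    linarith
  · obtain ⟨k1, k2, k3⟩ := key r hr
    obtain ⟨b0, b1, b2⟩ := hb r hr
    rw [deriv_radialPotential hf hr]
    have k4 := k1.trans_le k2
    have e1 : |deriv f r * r ^ (-s)| ≤ B * r ^ (-s - 1) := by
      rw [abs_mul, abs_of_pos k1]; gcongr
    have e2 : |f r * (-s * r ^ (-s - 1))| ≤ B * (1 * r ^ (-s - 1)) := by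
      rw [abs_mul, abs_mul, abs_neg, abs_of_pos k4, abs_of_nonneg hs₀]; gcongr
    have := abs_add_le (deriv f r * r ^ (-s)) (f r * (-s * r ^ (-s - 1)))
    nlinarith
  · obtain ⟨k1, k2, k3⟩ := key r hr
    obtain ⟨b0, b1, b2⟩ := hb r hr
    rw [(hasDerivAt_deriv_radialPotential hf hr).deriv]
    have k4 := k1.trans_le k2
    have k5 := k4.trans_le k3
    have e1 : |deriv (deriv f) r * r ^ (-s)| ≤ B * r ^ (-s - 2) := by
      rw [abs_mul, abs_of_pos k1]; exact mul_le_mul b2 (k2.trans k3) k1.le hB.le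
    have e2 : |deriv f r * (-s * r ^ (-s - 1))| ≤ B * (1 * r ^ (-s - 2)) := by
      rw [abs_mul, abs_mul, abs_neg, abs_of_pos k4, abs_of_nonneg hs₀]; gcongr
    have e3 : |f r * (-s * ((-s - 1) * r ^ (-s - 2)))| ≤ B * (1 * (2 * r ^ (-s - 2))) := by
      rw [abs_mul, abs_mul, abs_mul, abs_neg, abs_of_pos k5, abs_of_nonneg hs₀]
      have : |-s - 1| ≤ 2 := by rw [abs_le]; constructor <;> linarith
      gcongr
    have a1 := abs_add_le (deriv (deriv f) r * r ^ (-s) + deriv f r * (-s * r ^ (-s - 1)))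
      (deriv f r * (-s * r ^ (-s - 1)) + f r * (-s * ((-s - 1) * r ^ (-s - 2))))
    have a2 := abs_add_le (deriv (deriv f) r * r ^ (-s)) (deriv f r * (-s * r ^ (-s - 1)))
    have a3 := abs_add_le (deriv f r * (-s * r ^ (-s - 1)))
      (f r * (-s * ((-s - 1) * r ^ (-s - 2))))
    linarith

/-- For the Coulomb singularity, `r φ'(r)` is `-f(0)/r` up to a bounded error. -/
theorem IsProfile.exists_coulomb_bound (hf : IsProfile f) : ∃ B : ℝ, 0 < B ∧
    ∀ r ∈ Set.Ioo (0 : ℝ) 1, |r * deriv (radialPotential 1 f) r + f 0 / r| ≤ B := by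
  obtain ⟨B, hB, hb⟩ := hf.exists_bound
  refine ⟨2 * B, by positivity, fun r hr => ?_⟩
  have h1 : |f r - f 0| ≤ B * r := by
    obtain ⟨x, hx, hx'⟩ := exists_deriv_eq_slope f hr.1
      (hf.continuousOn.mono (Set.Icc_subset_Icc le_rfl hr.2.le))
      (fun x hx => (hf.hasDerivAt ⟨hx.1, hx.2.trans hr.2⟩).differentiableAt.differentiableWithinAt)
    have h2 := (hb x ⟨hx.1, hx.2.trans hr.2⟩).2.1
    rw [hx', sub_zero, abs_div, abs_of_pos hr.1, div_le_iff₀ hr.1] at h2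
    exact h2
  rw [deriv_radialPotential hf hr]
  have e : r * (deriv f r * r ^ (-1 : ℝ) + f r * (-1 * r ^ (-1 - 1 : ℝ))) + f 0 / r =
      deriv f r - (f r - f 0) / r := by
    rw [Real.rpow_neg_one, show (-1 - 1 : ℝ) = ((-2 : ℤ) : ℝ) by norm_num, Real.rpow_intCast]
    have := hr.1.ne'
    rw [zpow_neg]
    field_simp
    ring
  rw [e]
  have h3 : |(f r - f 0) / r| ≤ B := by
    rw [abs_div, abs_of_pos hr.1, div_le_iff₀ hr.1]; exact h1
  have := abs_sub (deriv f r) ((f r - f 0) / r)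
  linarith [(hb r hr).2.1]

end Profile

/-! ### Gradients of radial functions -/

theorem hasGradientAt_radial {φ : ℝ → ℝ} {d : ℝ} {x : E3} (hx : x ≠ 0) (h : HasDerivAt φ d ‖x‖) :
    HasGradientAt (fun y : E3 => φ ‖y‖) ((d / ‖x‖) • x) x := by
  rw [hasGradientAt_iff_hasFDerivAt]
  have hn : 0 < ‖x‖ := norm_pos_iff.2 hx
  have h1 : HasFDerivAt (fun y : E3 => ‖y‖) (‖x‖⁻¹ • innerSL ℝ x) x := by
    have := ((hasStrictFDerivAt_norm_sq x).hasFDerivAt).sqrt (by positivity)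
    simp only [Real.sqrt_sq (norm_nonneg _)] at this
    refine this.congr_fderiv ?_
    ext y
    simp
    field_simp
  refine (h.comp_hasFDerivAt x h1).congr_fderiv ?_
  ext y
  simp [div_eq_mul_inv, mul_assoc]

theorem gradient_of_even {Φ : E3 → ℝ} (h : ∀ x, Φ (-x) = Φ x) (x : E3) :
    gradient Φ (-x) = -gradient Φ x := by
  unfold gradient
  have : fderiv ℝ Φ (-x) = -fderiv ℝ Φ x := by
    have h1 := (ContinuousLinearEquiv.neg ℝ (M := E3)).comp_right_fderiv (f := Φ) (x := x)
    have h2 : Φ ∘ (ContinuousLinearEquiv.neg ℝ (M := E3)) = Φ := funext fun y => by simp [h]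
    rw [h2] at h1
    rw [h1]
    ext y
    simp
  rw [this, map_neg]

variable {s : ℝ} {f : ℝ → ℝ} {ε : ℝ}

theorem weakPotential_neg (x : E3) : weakPotential s f ε (-x) = weakPotential s f ε x := by
  simp [weakPotential, potential]

theorem gradient_weakPotential (hf : IsProfile f) {x : E3} (hx : ‖x‖ ∈ Set.Ioo (0 : ℝ) 1) :
    gradient (weakPotential s f ε) x = (ε * deriv (radialPotential s f) ‖x‖ / ‖x‖) • x := by
  have h := (hasDerivAt_radialPotential (s := s) hf hx).differentiableAt.hasDerivAt
  exact (hasGradientAt_radial (norm_pos_iff.1 hx.1) (h.const_mul ε)).gradient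

theorem gradient_weakPotential_eq_zero (hf : IsProfile f) {x : E3} (hx : 1 < ‖x‖) :
    gradient (weakPotential s f ε) x = 0 := by
  have h : (fun y => weakPotential s f ε y) =ᶠ[𝓝 x] fun _ => 0 := by
    filter_upwards [continuous_norm.continuousAt.eventually (lt_mem_nhds hx)] with y hy
    rw [weakPotential, potential, radialPotential_eq_zero hf hy.le, mul_zero]
  have := (hasGradientAt_const x (0 : ℝ)).congr_of_eventuallyEq h
  exact this.gradient

/-! ### The deflection angle -/

/-- The distance `r` at which a particle with impact parameter `y` and unit speed, moving in the
potential `κ φ`, has purely tangential velocity, i.e. `r² (1 - 2 κ φ(r)) = y²`. -/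
def turningRadius (φ : ℝ → ℝ) (κ y : ℝ) : ℝ :=
  sInf {r | r ∈ Set.Ioc 0 1 ∧ y ^ 2 ≤ r ^ 2 * (1 - 2 * κ * φ r)}

/-- The rotation rate of the velocity with respect to the angle between the velocity and the
tangential direction. -/
def deflectionRate (φ : ℝ → ℝ) (κ r : ℝ) : ℝ :=
  κ * -(r * deriv φ r) / (1 - 2 * κ * φ r + κ * -(r * deriv φ r))

open Classical in
/-- The deflection angle for the impact parameter `ρ`, unit speed and the potential `κ φ`. -/
def deflection (φ : ℝ → ℝ) (κ ρ : ℝ) : ℝ :=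
  ∫ η in Set.Ioo (-(Real.pi / 2)) (Real.pi / 2),
    if ρ < Real.cos η then deflectionRate φ κ (turningRadius φ κ (ρ / Real.cos η)) else 0

section Turning

variable {φ : ℝ → ℝ} {s B κ : ℝ}

theorem IsRepulsive.antitoneOn (hφ : IsRepulsive φ s B) : AntitoneOn φ (Set.Ioc 0 1) := by
  refine antitoneOn_of_deriv_nonpos (convex_Ioc 0 1)
    (hφ.continuousOn.mono fun r hr => hr.1) ?_ ?_
  · rw [interior_Ioc]
    exact fun r hr => (hφ.differentiableAt r hr).differentiableWithinAt
  · rw [interior_Ioc]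
    exact hφ.deriv_nonpos

theorem IsRepulsive.radial_lt (hφ : IsRepulsive φ s B) (hκ : 0 ≤ κ) {r r' : ℝ}
    (hr : r ∈ Set.Ioc 0 1) (hr' : r' ∈ Set.Ioc 0 1) (h : r < r')
    (hpos : 0 < r ^ 2 * (1 - 2 * κ * φ r)) :
    r ^ 2 * (1 - 2 * κ * φ r) < r' ^ 2 * (1 - 2 * κ * φ r') := by
  have h1 := hφ.antitoneOn hr hr' h.le
  have h2 : 0 < 1 - 2 * κ * φ r := pos_of_mul_pos_right hpos (sq_nonneg r)
  have h3 : 1 - 2 * κ * φ r ≤ 1 - 2 * κ * φ r' := by nlinarith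
  have h4 : r ^ 2 < r' ^ 2 := by gcongr; exact hr.1.le
  nlinarith

theorem turningRadius_eq (hφ : IsRepulsive φ s B) (hκ : 0 ≤ κ) {r y : ℝ}
    (hr : r ∈ Set.Ioc 0 1) (hy : 0 < y) (h : r ^ 2 * (1 - 2 * κ * φ r) = y ^ 2) :
    turningRadius φ κ y = r := by
  have : IsLeast {r | r ∈ Set.Ioc 0 1 ∧ y ^ 2 ≤ r ^ 2 * (1 - 2 * κ * φ r)} r := by
    refine ⟨⟨hr, h.ge⟩, fun x hx => ?_⟩
    by_contra! hlt
    have := hφ.radial_lt hκ hx.1 hr hlt ((pow_pos hy 2).trans_le hx.2)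
    linarith [hx.2]
  exact this.csInf_eq

theorem exists_turningRadius (hφ : IsRepulsive φ s B) (hκ : 0 ≤ κ) {y : ℝ}
    (hy : y ∈ Set.Ioc 0 1) : turningRadius φ κ y ∈ Set.Icc y 1 ∧
      turningRadius φ κ y ^ 2 * (1 - 2 * κ * φ (turningRadius φ κ y)) = y ^ 2 := by
  have hc : ContinuousOn (fun r => r ^ 2 * (1 - 2 * κ * φ r)) (Set.Icc y 1) := by
    have := hφ.continuousOn.mono (fun r hr => hy.1.trans_le hr.1 : Set.Icc y 1 ⊆ Set.Ioi 0)
    fun_prop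
  have := intermediate_value_Icc hy.2 hc
  obtain ⟨r, hr, hr'⟩ := this (show y ^ 2 ∈ Set.Icc _ _ from ⟨by
    have := hφ.nonneg y hy.1
    have : 0 ≤ y ^ 2 * (2 * κ * φ y) := by positivity
    linarith, by
    rw [hφ.eq_zero 1 le_rfl]
    have := pow_le_one₀ (n := 2) hy.1.le hy.2
    linarith⟩)
  rw [turningRadius_eq hφ hκ ⟨hy.1.trans_le hr.1, hr.2⟩ hy.1 hr']
  exact ⟨hr, hr'⟩

theorem turningRadius_le_iff (hφ : IsRepulsive φ s B) (hκ : 0 ≤ κ) {y q : ℝ}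
    (hy : y ∈ Set.Ioc 0 1) (hq : q ∈ Set.Ioc 0 1) :
    turningRadius φ κ y ≤ q ↔ y ^ 2 ≤ q ^ 2 * (1 - 2 * κ * φ q) := by
  obtain ⟨h1, h2⟩ := exists_turningRadius hφ hκ hy
  have hm : turningRadius φ κ y ∈ Set.Ioc 0 1 := ⟨hy.1.trans_le h1.1, h1.2⟩
  constructor
  · intro h
    rcases h.eq_or_lt with h | h
    · rw [← h, h2]
    · rw [← h2]
      exact (hφ.radial_lt hκ hm hq h (by rw [h2]; exact pow_pos hy.1 2)).le
  · intro h
    by_contra! hlt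
    have := hφ.radial_lt hκ hq hm hlt ((pow_pos hy.1 2).trans_le h)
    linarith

end Turning

section FinalVelocity

variable {E : Type*} [NormedAddCommGroup E] [InnerProductSpace ℝ E]
  {φ : ℝ → ℝ} {s B : ℝ} {h : ℝ → ℝ} {X V : ℝ → E} {T c σ L l : ℝ}

/-- For the force `-l ∇φ(|X|)`, the field `h` integrates to the potential. -/
theorem integral_field_eq (hφ : IsRepulsive φ s B) (hh : Continuous h) {r : ℝ}
    (hr : r ∈ Set.Ioc 0 1) (hhφ : ∀ x ∈ Set.Ico r 1, h x = -(l * deriv φ x / x)) :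
    ∫ z in (r ^ 2)..1, h √z = 2 * l * φ r := by
  have hr2 : r ^ 2 ≤ 1 := pow_le_one₀ hr.1.le hr.2
  have hpos : ∀ z ∈ Set.Icc (r ^ 2) 1, 0 < √z := fun z hz =>
    Real.sqrt_pos.2 ((pow_pos hr.1 2).trans_le hz.1)
  have := intervalIntegral.integral_eq_sub_of_hasDerivAt_of_le
    (f := fun z => -(2 * l) * φ √z) (f' := fun z => h √z) hr2 ?_ ?_ ?_
  · rw [this]
    simp only [Real.sqrt_one, Real.sqrt_sq hr.1.le, hφ.eq_zero 1 le_rfl]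
    ring
  · exact continuousOn_const.mul (hφ.continuousOn.comp Real.continuous_sqrt.continuousOn hpos)
  · intro z hz
    have hz0 : 0 < z := (pow_pos hr.1 2).trans hz.1
    have h1 : √z < 1 := by rw [Real.sqrt_lt' one_pos]; simpa using hz.2
    have h2 : r ≤ √z := Real.le_sqrt_of_sq_le hz.1.le
    have hs := hpos z (Set.Ioo_subset_Icc_self hz)
    have h3 := ((hφ.differentiableAt √z ⟨hs, h1⟩).hasDerivAt.comp z
      (Real.hasDerivAt_sqrt hz0.ne')).const_mul (-(2 * l))
    refine h3.congr_deriv ?_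
    rw [hhφ _ ⟨h2, h1⟩]
    field_simp
  · exact (hh.comp Real.continuous_sqrt).intervalIntegrable _ _

/-- The velocity at the exit from the range of the potential. -/
theorem IsCentralMotion.final_velocity (H : IsCentralMotion h X V T c σ L)
    (hφ : IsRepulsive φ s B) (hl : 0 ≤ l) (hT0 : 0 < T) (hT : ‖X T‖ = 1)
    (hin : ∀ t ∈ Set.Ioo 0 T, ‖X t‖ < 1)
    (hhφ : ∀ x ∈ Set.Ico (L / c) 1, h x = -(l * deriv φ x / x)) :
    V T = Real.cos (deflection φ (l / c ^ 2) (L / c)) • V 0 +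
      Real.sin (deflection φ (l / c ^ 2) (L / c)) • L⁻¹ • (c ^ 2 • X 0 + σ • V 0) := by
  have hc := H.speed_pos
  have hL := H.momentum_pos
  have hLc : L / c ≤ 1 := by
    have := H.le_norm_position (Set.left_mem_Icc.2 H.time_nonneg)
    rwa [H.initX] at this
  have hLc0 : 0 < L / c := by positivity
  set κ := l / c ^ 2 with hκ
  have hκ0 : 0 ≤ κ := by positivity
  have hκl : l = κ * c ^ 2 := by rw [hκ]; field_simp
  have hspeed : ∀ t ∈ Set.Icc 0 T, ‖V t‖ ^ 2 = c ^ 2 * (1 - 2 * κ * φ ‖X t‖) := by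
    intro t ht
    rw [H.energy ht, integral_field_eq hφ H.cont_h ⟨H.norm_pos_at ht, H.mem_ball t ht⟩
      (fun x hx => hhφ x ⟨(H.le_norm_position ht).trans hx.1, hx.2⟩), hκl]
    ring
  have hangle : ∫ τ in (0 : ℝ)..T, h ‖X τ‖ * L / ‖V τ‖ ^ 2 = deflection φ κ (L / c) := by
    rw [H.angle_eq hT0 hT
      (G := fun η => deflectionRate φ κ (turningRadius φ κ (L / c / Real.cos η)))]
    · classical
      rw [deflection]
      have hcos : Real.cos (Real.arctan (σ / L)) = L / c := by
        have := H.cos_arctan_eq (Set.right_mem_Icc.2 H.time_nonneg)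
        rwa [H.exit_inner hT0 hT, hT, H.exit_speed hT, one_mul] at this
      have hσL : 0 < σ / L := div_pos H.radial_pos hL
      have ha0 : 0 < Real.arctan (σ / L) := Real.arctan_pos.2 hσL
      have ha1 := Real.arctan_lt_pi_div_two (σ / L)
      have hiff : ∀ η ∈ Set.Ioo (-(Real.pi / 2)) (Real.pi / 2),
          L / c < Real.cos η ↔ η ∈ Set.Ioo (-Real.arctan (σ / L)) (Real.arctan (σ / L)) := by
        intro η hη
        rw [← hcos, ← Real.cos_abs η, Set.mem_Ioo, ← abs_lt]
        exact Real.strictAntiOn_cos.lt_iff_gt ⟨ha0.le, by linarith [Real.pi_pos]⟩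
          ⟨abs_nonneg _, by have := abs_lt.2 ⟨hη.1, hη.2⟩; linarith [Real.pi_pos]⟩
      have hsub : Set.Ioo (-Real.arctan (σ / L)) (Real.arctan (σ / L)) ⊆
          Set.Ioo (-(Real.pi / 2)) (Real.pi / 2) :=
        Set.Ioo_subset_Ioo (by linarith) ha1.le
      symm
      rw [setIntegral_congr_fun (g := (Set.Ioo (-Real.arctan (σ / L))
        (Real.arctan (σ / L))).indicator
          fun η => deflectionRate φ κ (turningRadius φ κ (L / c / Real.cos η))) measurableSet_Ioo]
      · rw [setIntegral_indicator measurableSet_Ioo, Set.inter_eq_self_of_subset_right hsub]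
      · intro η hη
        simp only [Set.indicator_apply, hiff η hη]
    · intro t ht
      have ht' := Set.Ioo_subset_Icc_self ht
      have hx0 := H.norm_pos_at ht'
      have hv0 := H.speed_pos_at ht'
      have hr1 := hin t ht
      rw [H.cos_arctan_eq ht', turningRadius_eq hφ hκ0 (r := ‖X t‖) ⟨hx0, hr1.le⟩]
      · rw [deflectionRate, hspeed t ht', hhφ _ ⟨H.le_norm_position ht', hr1⟩, hκl]
        have e1 : -(κ * c ^ 2 * deriv φ ‖X t‖ / ‖X t‖) * ‖X t‖ ^ 2 =
            c ^ 2 * (κ * -(‖X t‖ * deriv φ ‖X t‖)) := by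
          field_simp
        rw [e1, ← mul_add, mul_div_mul_left _ _ (by positivity)]
      · positivity
      · have e2 : L / c / (L / (‖X t‖ * ‖V t‖)) = ‖X t‖ * ‖V t‖ / c := by field_simp
        rw [e2, div_pow, mul_pow, hspeed t ht']
        field_simp
  have h1 := H.direction_eq (Set.right_mem_Icc.2 H.time_nonneg)
  rw [hangle, H.exit_speed hT] at h1
  have h2 : V T = c • c⁻¹ • V T := by rw [smul_smul, mul_inv_cancel₀ hc.ne', one_smul]
  rw [h2, h1]
  match_scalars <;> field_simp

end FinalVelocity

/-! ### Two-particle scattering -/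

/-- The first exit time from the unit ball of a curve that enters it at time zero. -/
theorem exists_first_exit {E : Type*} [NormedAddCommGroup E] [InnerProductSpace ℝ E] {X : ℝ → E}
    {v : E} {t₁ : ℝ} (ht₁ : 0 < t₁) (hX : ContinuousOn X (Set.Icc 0 t₁)) (h0 : ‖X 0‖ = 1)
    (hd : HasDerivWithinAt X v (Set.Icc 0 t₁) 0) (hv : inner ℝ (X 0) v < 0)
    (hout : 1 ≤ ‖X t₁‖) :
    ∃ T ∈ Set.Ioc 0 t₁, ‖X T‖ = 1 ∧ ∀ t ∈ Set.Ioo 0 T, ‖X t‖ < 1 := by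
  have hd2 : HasDerivWithinAt (fun t => ‖X t‖ ^ 2) (2 * inner ℝ (X 0) v) (Set.Icc 0 t₁) 0 :=
    hd.norm_sq
  obtain ⟨δ, hδ0, hδ⟩ : ∃ δ ∈ Set.Ioo 0 t₁, ∀ t ∈ Set.Ioc 0 δ, ‖X t‖ < 1 := by
    have hs := (hasDerivWithinAt_iff_tendsto_slope.1 hd2).eventually
      (gt_mem_nhds (show 2 * inner ℝ (X 0) v < 0 by linarith))
    rw [Set.Icc_sdiff_left, nhdsWithin_Ioc_eq_nhdsGT ht₁] at hs
    obtain ⟨b, hb, hb'⟩ := (mem_nhdsGT_iff_exists_Ioo_subset' (u' := t₁) ht₁).1 hs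
    have hb0 : (0 : ℝ) < b := hb
    refine ⟨min (b / 2) (t₁ / 2), ⟨by positivity, (min_le_right _ _).trans_lt (by linarith)⟩,
      fun t ht => ?_⟩
    have h1 : t < b := (ht.2.trans (min_le_left _ _)).trans_lt (by linarith)
    have h2 := hb' ⟨ht.1, h1⟩
    simp only [Set.mem_ofPred_eq, slope_def_field, sub_zero, h0, one_pow] at h2
    rw [div_lt_iff₀ ht.1] at h2
    nlinarith [norm_nonneg (X t)]
  have hcomp : IsCompact (Set.Icc δ t₁ ∩ {t | 1 ≤ ‖X t‖}) := by
    have hc : ContinuousOn (fun t => ‖X t‖) (Set.Icc δ t₁) :=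
      (hX.mono (Set.Icc_subset_Icc hδ0.1.le le_rfl)).norm
    exact isCompact_Icc.of_isClosed_subset
      (hc.preimage_isClosed_of_isClosed isClosed_Icc isClosed_Ici) Set.inter_subset_left
  obtain ⟨T, hT, hTl⟩ := hcomp.exists_isLeast ⟨t₁, ⟨hδ0.2.le, le_rfl⟩, hout⟩
  have hin : ∀ t ∈ Set.Ioo 0 T, ‖X t‖ < 1 := by
    intro t ht
    rcases le_or_gt t δ with h | h
    · exact hδ t ⟨ht.1, h⟩
    · by_contra! hc
      exact absurd (hTl ⟨⟨h.le, ht.2.le.trans hT.1.2⟩, hc⟩) (not_le.2 ht.2)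
  have hT0 : 0 < T := hδ0.1.trans_le hT.1.1
  refine ⟨T, ⟨hT0, hT.1.2⟩, le_antisymm ?_ hT.2, hin⟩
  have hl : Tendsto (fun t => ‖X t‖) (𝓝[Set.Ioo 0 T] T) (𝓝 ‖X T‖) :=
    ((hX T ⟨hT0.le, hT.1.2⟩).norm).mono
      (Set.Ioo_subset_Icc_self.trans (Set.Icc_subset_Icc le_rfl hT.1.2))
  have : (𝓝[Set.Ioo 0 T] T).NeBot := by
    rw [nhdsWithin_Ioo_eq_nhdsLT hT0]; infer_instance
  refine le_of_tendsto hl ?_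
  filter_upwards [self_mem_nhdsWithin] with t ht using (hin t ht).le

theorem norm_perpProj_sq {w x : E3} (hw : w ≠ 0) :
    ‖perpProj w x‖ ^ 2 = ‖x‖ ^ 2 - inner ℝ w x ^ 2 / ‖w‖ ^ 2 := by
  have hn : ‖w‖ ≠ 0 := norm_ne_zero_iff.2 hw
  rw [perpProj, norm_sub_sq_real, real_inner_smul_right, norm_smul, mul_pow, Real.norm_eq_abs,
    sq_abs, real_inner_comm w x]
  field_simp
  ring

theorem inner_perpProj_left {w x : E3} (hw : w ≠ 0) : inner ℝ w (perpProj w x) = 0 := by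
  have hn : ‖w‖ ≠ 0 := norm_ne_zero_iff.2 hw
  rw [perpProj, inner_sub_right, real_inner_smul_right, real_inner_self_eq_norm_sq]
  field_simp
  ring

/-- The velocity transferred to the first particle. -/
def transfer (φ : ℝ → ℝ) (ε : ℝ) (w ν : E3) : E3 :=
  (1 / 2 : ℝ) • ((Real.cos (deflection φ (2 * ε / ‖w‖ ^ 2) ‖perpProj w ν‖) - 1) • w -
    (Real.sin (deflection φ (2 * ε / ‖w‖ ^ 2) ‖perpProj w ν‖) * (‖w‖ / ‖perpProj w ν‖)) •
      perpProj w ν)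

section Scattering

variable {s ε : ℝ} {f : ℝ → ℝ} {ν w : E3}

/-- The Lipschitz cut-off of the radial force field. -/
theorem IsRepulsive.exists_field {φ : ℝ → ℝ} {B l a : ℝ} (hφ : IsRepulsive φ s B) (hl : 0 ≤ l)
    (ha : 0 < a) (ha1 : a < 1) :
    ∃ (h : ℝ → ℝ) (K : NNReal) (M : ℝ), LipschitzWith K h ∧ (∀ r, h r ∈ Set.Icc 0 M) ∧
      (∀ r ∈ Set.Ioo a 1, h r = -(l * deriv φ r / r)) ∧ ∀ r, 2 ≤ r → h r = 0 := by
  have hB := hφ.B_pos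
  have hs := hφ.s_nonneg
  have hpow : ∀ p : ℝ, p ≤ 0 → ∀ r ∈ Set.Ioo a 1, r ^ p ≤ a ^ p := fun p hp r hr =>
    Real.rpow_le_rpow_of_nonpos ha hr.1.le hp
  have hd : ∀ r ∈ Set.Ioo a 1, HasDerivAt (fun r => -(l * deriv φ r / r))
      (-((l * deriv (deriv φ) r * r - l * deriv φ r * 1) / r ^ 2)) r := fun r hr => by
    have hr' : r ∈ Set.Ioo (0 : ℝ) 1 := ⟨ha.trans hr.1, hr.2⟩
    exact ((((hφ.differentiableAt_deriv r hr').hasDerivAt.const_mul l).div (hasDerivAt_id r)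
      hr'.1.ne').neg)
  set D : ℝ := (l * (B * a ^ (-s - 2)) + l * (B * a ^ (-s - 1))) / a ^ 2 with hD
  have hD0 : 0 ≤ D := by positivity
  have hlip : LipschitzOnWith (NNReal.mk D hD0) (fun r => -(l * deriv φ r / r)) (Set.Ioo a 1) := by
    refine (convex_Ioo a 1).lipschitzOnWith_of_nnnorm_hasDerivWithin_le
      (fun r hr => (hd r hr).hasDerivWithinAt) fun r hr => ?_
    rw [← NNReal.coe_le_coe, coe_nnnorm, NNReal.coe_mk, norm_neg, Real.norm_eq_abs, abs_div]
    have hr' : r ∈ Set.Ioo (0 : ℝ) 1 := ⟨ha.trans hr.1, hr.2⟩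
    have h1 := (hφ.abs_deriv_deriv_le r hr').trans
      (mul_le_mul_of_nonneg_left (hpow (-s - 2) (by linarith) r hr) hB.le)
    have h2 := (hφ.abs_deriv_le r hr').trans
      (mul_le_mul_of_nonneg_left (hpow (-s - 1) (by linarith) r hr) hB.le)
    have h3 : |l * deriv (deriv φ) r * r - l * deriv φ r * 1| ≤
        l * (B * a ^ (-s - 2)) + l * (B * a ^ (-s - 1)) := by
      refine (abs_sub _ _).trans ?_
      rw [abs_mul, abs_mul, abs_mul, abs_mul, abs_of_nonneg hl, abs_of_pos hr'.1, abs_one, mul_one]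
      refine add_le_add ?_ (by gcongr)
      calc l * |deriv (deriv φ) r| * r ≤ l * |deriv (deriv φ) r| * 1 := by
            gcongr; exact hr'.2.le
        _ ≤ _ := by rw [mul_one]; gcongr
    have h4 : a ^ 2 ≤ |r ^ 2| := by rw [abs_of_nonneg (sq_nonneg _)]; gcongr; exact hr.1.le
    rw [hD]
    gcongr
  set M : ℝ := l * (B * a ^ (-s - 1)) / a with hM
  obtain ⟨h, K, h1, h2, h3, h4⟩ := exists_lipschitz_cutoff (M := M) hlip (by positivity)
    (fun r hr => by
      have hr' : r ∈ Set.Ioo (0 : ℝ) 1 := ⟨ha.trans hr.1, hr.2⟩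
      have h5 := hφ.deriv_nonpos r hr'
      have h6 := (hφ.abs_deriv_le r hr').trans
        (mul_le_mul_of_nonneg_left (hpow (-s - 1) (by linarith) r hr) hB.le)
      rw [abs_of_nonpos h5] at h6
      have e : -(l * deriv φ r / r) = l * -deriv φ r / r := by ring
      rw [e]
      have h7 : 0 ≤ -deriv φ r := by linarith
      have := hr'.1
      refine ⟨by positivity, ?_⟩
      rw [hM]
      gcongr
      exact hr.1.le)
  exact ⟨h, K, M, h1, h2, h3, h4⟩

/-- Impact data: an incoming, non-central and non-grazing collision. -/
structure IsImpact (w ν : E3) : Prop where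
  norm_eq : ‖ν‖ = 1
  inner_pos : 0 < inner ℝ ν w
  perp_pos : 0 < ‖perpProj w ν‖

theorem IsImpact.ne_zero (H : IsImpact w ν) : w ≠ 0 := by
  rintro rfl
  have := H.inner_pos
  simp at this

theorem IsImpact.norm_pos (H : IsImpact w ν) : 0 < ‖w‖ := norm_pos_iff.2 H.ne_zero

theorem IsImpact.pythagoras (H : IsImpact w ν) :
    ‖w‖ ^ 2 = inner ℝ ν w ^ 2 + (‖perpProj w ν‖ * ‖w‖) ^ 2 := by
  have hn := H.norm_pos.ne'
  rw [mul_pow, norm_perpProj_sq H.ne_zero, H.norm_eq, real_inner_comm w ν]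
  field_simp
  ring

theorem IsImpact.perp_lt_one (H : IsImpact w ν) : ‖perpProj w ν‖ < 1 := by
  have h1 := norm_perpProj_sq (x := ν) H.ne_zero
  have h2 := H.inner_pos
  have h3 := H.norm_pos
  rw [H.norm_eq, real_inner_comm ν w] at h1
  have : 0 < inner ℝ ν w ^ 2 / ‖w‖ ^ 2 := by positivity
  nlinarith [norm_nonneg (perpProj w ν)]

/-- The outgoing relative velocity. -/
theorem IsImpact.out_eq (H : IsImpact w ν) (φ : ℝ → ℝ) :
    Real.cos (deflection φ (2 * ε / ‖w‖ ^ 2) (‖perpProj w ν‖ * ‖w‖ / ‖w‖)) • w +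
      Real.sin (deflection φ (2 * ε / ‖w‖ ^ 2) (‖perpProj w ν‖ * ‖w‖ / ‖w‖)) •
        (‖perpProj w ν‖ * ‖w‖)⁻¹ • (‖w‖ ^ 2 • (-ν) + (inner ℝ ν w : ℝ) • w) =
      w + (2 : ℝ) • transfer φ ε w ν := by
  have hn := H.norm_pos.ne'
  have hp := H.perp_pos.ne'
  rw [mul_div_cancel_right₀ _ hn, transfer, smul_smul]
  set θ := deflection φ (2 * ε / ‖w‖ ^ 2) ‖perpProj w ν‖
  set ρ := ‖perpProj w ν‖
  rw [perpProj, real_inner_comm ν w]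
  match_scalars
  · field_simp
    ring
  · field_simp

/-- A curve inside the unit ball that obeys the equations of motion is a central motion. -/
theorem IsImpact.isCentralMotion (H : IsImpact w ν) {h : ℝ → ℝ} (hh : Continuous h)
    (hh0 : ∀ r, 0 ≤ h r) {X V : ℝ → E3} {T : ℝ} (hT : 0 ≤ T) (hX0 : X 0 = -ν) (hV0 : V 0 = w)
    (hXc : ContinuousOn X (Set.Icc 0 T)) (hVc : ContinuousOn V (Set.Icc 0 T))
    (hX' : ∀ t ∈ Set.Ioo 0 T, HasDerivAt X (V t) t)
    (hV' : ∀ t ∈ Set.Ioo 0 T, HasDerivAt V (h ‖X t‖ • X t) t)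
    (hin : ∀ t ∈ Set.Icc 0 T, ‖X t‖ ≤ 1) :
    IsCentralMotion h X V T ‖w‖ (inner ℝ ν w) (‖perpProj w ν‖ * ‖w‖) where
  cont_h := hh
  nonneg_h := hh0
  time_nonneg := hT
  contX := hXc
  contV := hVc
  derivX := hX'
  derivV := hV'
  initX := by rw [hX0, norm_neg, H.norm_eq]
  initV := by rw [hV0]
  initXV := by rw [hX0, hV0, inner_neg_left]
  speed_pos := H.norm_pos
  radial_pos := H.inner_pos
  momentum_pos := mul_pos H.perp_pos H.norm_pos
  pythagoras := H.pythagoras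
  mem_ball := hin

end Scattering

section Scattering

variable {s ε : ℝ} {f : ℝ → ℝ} {ν w : E3}

/-- After some time, every relative motion has the explicit outgoing velocity. -/
theorem IsImpact.eventually_velocity_eq (H : IsImpact w ν) (hf : IsProfile f) (hs₀ : 0 ≤ s)
    (hs₁ : s ≤ 1) (hε : 0 < ε) {X V : ℝ → E3} (hX0 : X 0 = -ν)
    (hXne : ∀ t, 0 ≤ t → X t ≠ 0)
    (hX' : ∀ t, 0 ≤ t → HasDerivWithinAt X (V t) (Set.Ici 0) t)
    (hint : ∀ t, 0 ≤ t →
      IntervalIntegrable (fun τ => gradient (weakPotential s f ε) (X τ)) volume 0 t)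
    (hV : ∀ t, 0 ≤ t →
      V t = w - (2 : ℝ) • ∫ τ in (0 : ℝ)..t, gradient (weakPotential s f ε) (X τ)) :
    ∃ T, 0 < T ∧ ∀ t, T ≤ t → V t = w + (2 : ℝ) • transfer (radialPotential s f) ε w ν := by
  obtain ⟨B, hφ⟩ := hf.exists_isRepulsive hs₀ hs₁
  have hV0 : V 0 = w := by simpa using hV 0 le_rfl
  have hXc : ContinuousOn X (Set.Ici 0) := fun t ht => (hX' t ht).continuousWithinAt
  have hVc : ∀ t, 0 ≤ t → ContinuousOn V (Set.Icc 0 t) := by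
    intro t ht
    have h1 := intervalIntegral.continuousOn_primitive_interval (μ := volume)
      (f := fun τ => gradient (weakPotential s f ε) (X τ)) (a := 0) (b := t)
      (by rw [Set.uIcc_of_le ht, integrableOn_Icc_iff_integrableOn_Ioc]
          exact (intervalIntegrable_iff_integrableOn_Ioc_of_le ht).1 (hint t ht))
    rw [Set.uIcc_of_le ht] at h1
    exact (continuousOn_const.sub (h1.const_smul (2 : ℝ))).congr fun τ hτ => hV τ hτ.1
  have hXat : ∀ t, 0 < t → HasDerivAt X (V t) t := fun t ht =>
    (hX' t ht.le).hasDerivAt (Ici_mem_nhds ht)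
  set c := ‖w‖
  set L := ‖perpProj w ν‖ * ‖w‖ with hLdef
  set σ : ℝ := inner ℝ ν w
  have hL0 : 0 < L := mul_pos H.perp_pos H.norm_pos
  have hLc : L / c = ‖perpProj w ν‖ := mul_div_cancel_right₀ _ H.norm_pos.ne'
  have central : ∀ T, 0 < T → (∀ t ∈ Set.Ioo 0 T, ‖X t‖ < 1) →
      ∃ h : ℝ → ℝ, IsCentralMotion h X V T c σ L ∧
        ∀ x ∈ Set.Ico (L / c) 1, h x = -(2 * ε * deriv (radialPotential s f) x / x) := by
    intro T hT hin
    have hXcT : ContinuousOn X (Set.Icc 0 T) := hXc.mono fun t ht => ht.1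
    obtain ⟨t₀, ht₀, hmin⟩ := isCompact_Icc.exists_isMinOn ⟨0, Set.left_mem_Icc.2 hT.le⟩ hXcT.norm
    have hr0 : 0 < ‖X t₀‖ := norm_pos_iff.2 (hXne t₀ ht₀.1)
    have hr1 : ‖X t₀‖ ≤ 1 := by
      have := hmin (Set.left_mem_Icc.2 hT.le)
      simpa [hX0, H.norm_eq] using this
    set a := min ‖X t₀‖ ‖perpProj w ν‖ / 2 with ha
    have hp := H.perp_pos
    have ha0 : 0 < a := by positivity
    have ha1 : a < ‖X t₀‖ := by
      have := min_le_left ‖X t₀‖ ‖perpProj w ν‖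
      have : 0 < min ‖X t₀‖ ‖perpProj w ν‖ := by positivity
      linarith
    have ha2 : a < ‖perpProj w ν‖ := by
      have := min_le_right ‖X t₀‖ ‖perpProj w ν‖
      have : 0 < min ‖X t₀‖ ‖perpProj w ν‖ := by positivity
      linarith
    obtain ⟨h, K, M, hK, hM, hh, -⟩ := hφ.exists_field (l := 2 * ε) (by positivity) ha0
      (ha1.trans_le hr1)
    have hcont : ContinuousOn (fun τ => h ‖X τ‖ • X τ) (Set.Icc 0 T) :=
      (hK.continuous.comp_continuousOn hXcT.norm).smul hXcT
    have hforce : ∀ τ ∈ Set.Ioo 0 T, (2 : ℝ) • gradient (weakPotential s f ε) (X τ) =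
        -(h ‖X τ‖ • X τ) := by
      intro τ hτ
      have h1 : ‖X τ‖ ∈ Set.Ioo a 1 :=
        ⟨ha1.trans_le (hmin (Set.Ioo_subset_Icc_self hτ)), hin τ hτ⟩
      rw [gradient_weakPotential hf ⟨ha0.trans h1.1, h1.2⟩, hh _ h1, smul_smul, ← neg_smul]
      congr 1; ring
    have hVeq : ∀ t ∈ Set.Icc 0 T, V t = w + ∫ τ in (0 : ℝ)..t, h ‖X τ‖ • X τ := by
      intro t ht
      rw [hV t ht.1, ← intervalIntegral.integral_smul, sub_eq_add_neg,
        ← intervalIntegral.integral_neg]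
      congr 1
      rw [intervalIntegral.integral_of_le ht.1, intervalIntegral.integral_of_le ht.1,
        integral_Ioc_eq_integral_Ioo, integral_Ioc_eq_integral_Ioo]
      refine setIntegral_congr_fun measurableSet_Ioo fun τ hτ => ?_
      rw [hforce τ ⟨hτ.1, hτ.2.trans_le ht.2⟩, neg_neg]
    refine ⟨h, H.isCentralMotion hK.continuous (fun r => (hM r).1) hT.le hX0 hV0 hXcT
      (hVc T hT.le) (fun t ht => hXat t ht.1) (fun t ht => ?_) (fun t ht => ?_), fun x hx => ?_⟩
    · have h1 : HasDerivAt (fun t => w + ∫ τ in (0 : ℝ)..t, h ‖X τ‖ • X τ) (h ‖X t‖ • X t) t := by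
        refine HasDerivAt.const_add _ (intervalIntegral.integral_hasDerivAt_right ?_
          ((hcont.mono Set.Ioo_subset_Icc_self).stronglyMeasurableAtFilter isOpen_Ioo t ht)
          (hcont.continuousAt (Icc_mem_nhds ht.1 ht.2)))
        refine ContinuousOn.intervalIntegrable ?_
        rw [Set.uIcc_of_le ht.1.le]
        exact hcont.mono (Set.Icc_subset_Icc le_rfl ht.2.le)
      refine h1.congr_of_eventuallyEq ?_
      filter_upwards [Icc_mem_nhds ht.1 ht.2] with τ hτ using hVeq τ hτ
    · have hcl : closure (Set.Ioo 0 T) = Set.Icc 0 T := closure_Ioo hT.ne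
      rw [← hcl] at ht
      have hXn : ContinuousOn (fun t => ‖X t‖) (closure (Set.Ioo 0 T)) := by
        rw [hcl]; exact hXcT.norm
      exact closure_minimal (s := (fun t => ‖X t‖) '' Set.Ioo 0 T) (t := Set.Iic 1)
        (by rintro _ ⟨τ, hτ, rfl⟩; exact (hin τ hτ).le) isClosed_Iic
        (hXn.image_closure ⟨t, ht, rfl⟩)
    · rw [hLc] at hx
      exact hh x ⟨ha2.trans_le hx.1, hx.2⟩
  -- the motion leaves the ball
  have hexit : ∃ t₁, 0 < t₁ ∧ 1 ≤ ‖X t₁‖ := by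
    by_contra! hc
    have hpos : 0 < 2 * σ / L ^ 2 + 1 := by
      have := H.inner_pos
      positivity
    obtain ⟨h, hcm, -⟩ := central (2 * σ / L ^ 2 + 1) hpos (fun t ht => hc t ht.1)
    linarith [hcm.time_le]
  obtain ⟨t₁, ht₁, hout⟩ := hexit
  obtain ⟨T, hT, hXT, hin⟩ := exists_first_exit ht₁ (hXc.mono fun t ht => ht.1)
    (by rw [hX0, norm_neg, H.norm_eq]) ((hX' 0 le_rfl).mono fun t ht => ht.1)
    (by rw [hX0, hV0, inner_neg_left]; linarith [H.inner_pos]) hout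
  obtain ⟨h, hcm, hhφ⟩ := central T hT.1 hin
  have hVT := hcm.final_velocity hφ (by positivity) hT.1 hXT hin hhφ
  rw [hX0, hV0, H.out_eq] at hVT
  have hσT := hcm.exit_inner hT.1 hXT
  have hσ := H.inner_pos
  -- free motion as long as the particles are out of range
  have free : ∀ t, T ≤ t → (∀ τ ∈ Set.Ioo T t, 1 < ‖X τ‖) → V t = V T := by
    intro t ht hfree
    have h0 : ∫ τ in T..t, gradient (weakPotential s f ε) (X τ) = 0 := by
      rw [intervalIntegral.integral_of_le ht, integral_Ioc_eq_integral_Ioo]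
      exact setIntegral_eq_zero_of_forall_eq_zero fun τ hτ =>
        gradient_weakPotential_eq_zero hf (hfree τ hτ)
    have h1 := hint T hT.1.le
    have h2 := hint t (hT.1.le.trans ht)
    rw [hV t (hT.1.le.trans ht), hV T hT.1.le,
      ← intervalIntegral.integral_add_adjacent_intervals h1 (h1.symm.trans h2), h0, add_zero]
  have hline : ∀ t, T ≤ t → (∀ τ ∈ Set.Ioo T t, 1 < ‖X τ‖) → X t = X T + (t - T) • V T := by
    intro t ht hfree
    have h1 : ∀ τ ∈ Set.Icc T t, V τ = V T := fun τ hτ =>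
      free τ hτ.1 fun u hu => hfree u ⟨hu.1, hu.2.trans_le hτ.2⟩
    have h2 := intervalIntegral.integral_eq_sub_of_hasDerivAt_of_le (f := X) (f' := fun _ => V T) ht
      (hXc.mono fun τ hτ => hT.1.le.trans hτ.1)
      (fun τ hτ => by rw [← h1 τ (Set.Ioo_subset_Icc_self hτ)]; exact hXat τ (hT.1.trans hτ.1))
      (intervalIntegrable_const)
    rw [intervalIntegral.integral_const] at h2
    rw [h2]; abel
  have hlt : ∀ t, T < t → 1 < ‖X T + (t - T) • V T‖ := by
    intro t ht
    have h1 : ‖X T + (t - T) • V T‖ ^ 2 = 1 + 2 * ((t - T) * σ) + ‖(t - T) • V T‖ ^ 2 := by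
      rw [norm_add_sq_real, hXT, real_inner_smul_right, hσT]; ring
    have h2 : 0 < (t - T) * σ := mul_pos (by linarith) hσ
    by_contra! hc
    have : ‖X T + (t - T) • V T‖ ^ 2 ≤ 1 := pow_le_one₀ (norm_nonneg _) hc
    nlinarith [sq_nonneg ‖(t - T) • V T‖]
  -- the motion never returns
  have hout : ∀ t, T < t → 1 < ‖X t‖ := by
    by_contra! hc
    obtain ⟨t₂, ht₂, hc⟩ := hc
    obtain ⟨δ, hδ0, hδ⟩ : ∃ δ ∈ Set.Ioo T t₂, ∀ t ∈ Set.Ioc T δ, 1 < ‖X t‖ := by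
      have hd2 : HasDerivAt (fun t => ‖X t‖ ^ 2) (2 * inner ℝ (X T) (V T)) T :=
        (hXat T hT.1).norm_sq
      have hs := (hasDerivAt_iff_tendsto_slope.1 hd2).eventually
        (lt_mem_nhds (show 0 < 2 * inner ℝ (X T) (V T) by rw [hσT]; linarith))
      have hs' : ∀ᶠ t in 𝓝[>] T, 0 < slope (fun t => ‖X t‖ ^ 2) T t :=
        hs.filter_mono (nhdsWithin_mono _ fun t ht => ne_of_gt ht)
      obtain ⟨b, hb, hb'⟩ := (mem_nhdsGT_iff_exists_Ioo_subset' (u' := t₂) ht₂).1 hs'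
      have hb0 : T < b := hb
      refine ⟨min ((T + b) / 2) ((T + t₂) / 2), ⟨lt_min (by linarith) (by linarith),
        (min_le_right _ _).trans_lt (by linarith)⟩, fun t ht => ?_⟩
      have h1 : t < b := (ht.2.trans (min_le_left _ _)).trans_lt (by linarith)
      have h2 := hb' ⟨ht.1, h1⟩
      simp only [Set.mem_ofPred_eq, slope_def_field, hXT, one_pow] at h2
      have h3 : 0 < t - T := by linarith [ht.1]
      rw [lt_div_iff₀ h3] at h2
      nlinarith [norm_nonneg (X t)]
    have hcomp : IsCompact (Set.Icc δ t₂ ∩ {t | ‖X t‖ ≤ 1}) := by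
      have hc : ContinuousOn (fun t => ‖X t‖) (Set.Icc δ t₂) :=
        (hXc.mono fun t ht => hT.1.le.trans (hδ0.1.le.trans ht.1)).norm
      exact isCompact_Icc.of_isClosed_subset
        (hc.preimage_isClosed_of_isClosed isClosed_Icc isClosed_Iic) Set.inter_subset_left
    obtain ⟨T', hT', hTl⟩ := hcomp.exists_isLeast ⟨t₂, ⟨hδ0.2.le, le_rfl⟩, hc⟩
    have hTT' : T < T' := hδ0.1.trans_le hT'.1.1
    have hfree : ∀ τ ∈ Set.Ioo T T', 1 < ‖X τ‖ := by
      intro t ht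
      rcases le_or_gt t δ with h | h
      · exact hδ t ⟨ht.1, h⟩
      · by_contra! hc
        exact absurd (hTl ⟨⟨h.le, ht.2.le.trans hT'.1.2⟩, hc⟩) (not_le.2 ht.2)
    have := hlt T' hTT'
    rw [← hline T' hTT'.le hfree] at this
    exact absurd hT'.2 (not_le.2 this)
  exact ⟨T, hT.1, fun t ht => by rw [free t ht fun τ hτ => hout τ hτ.1, hVT]⟩

/-- Existence of a relative motion. -/
theorem IsImpact.exists_relative_motion (H : IsImpact w ν) (hf : IsProfile f) (hs₀ : 0 ≤ s)
    (hs₁ : s ≤ 1) (hε : 0 < ε) : ∃ X V : ℝ → E3, X 0 = -ν ∧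
    (∀ t, 0 ≤ t → X t ≠ 0) ∧ (∀ t, HasDerivAt X (V t) t) ∧
    (∀ t, 0 ≤ t →
      IntervalIntegrable (fun τ => gradient (weakPotential s f ε) (X τ)) volume 0 t) ∧
    ∀ t, 0 ≤ t →
      V t = w - (2 : ℝ) • ∫ τ in (0 : ℝ)..t, gradient (weakPotential s f ε) (X τ) := by
  obtain ⟨B, hφ⟩ := hf.exists_isRepulsive hs₀ hs₁
  have hp := H.perp_pos
  have hp1 := H.perp_lt_one
  set c := ‖w‖
  set L := ‖perpProj w ν‖ * ‖w‖ with hLdef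
  set σ : ℝ := inner ℝ ν w
  have hL0 : 0 < L := mul_pos H.perp_pos H.norm_pos
  have hLc : L / c = ‖perpProj w ν‖ := mul_div_cancel_right₀ _ H.norm_pos.ne'
  have hσ : 0 < σ := H.inner_pos
  obtain ⟨h, K, M, hK, hM, hh, hh2⟩ := hφ.exists_field (l := 2 * ε) (by positivity)
    (show 0 < ‖perpProj w ν‖ / 2 by positivity) (by linarith)
  set T₁ := 2 * σ / L ^ 2 + 1 with hT₁
  have hT₁0 : 0 < T₁ := by positivity
  obtain ⟨Y, U, hY0, hU0, hY', hU'⟩ := exists_central_solution hK hM hh2 hT₁0 (-ν) w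
  have hYc : ContinuousOn Y (Set.Icc 0 T₁) := fun t ht => (hY' t ht).continuousWithinAt
  have hUc : ContinuousOn U (Set.Icc 0 T₁) := fun t ht => (hU' t ht).continuousWithinAt
  have central : ∀ T ∈ Set.Ioc 0 T₁, (∀ t ∈ Set.Icc 0 T, ‖Y t‖ ≤ 1) →
      IsCentralMotion h Y U T c σ L := by
    intro T hT hin
    have hsub : Set.Icc 0 T ⊆ Set.Icc 0 T₁ := Set.Icc_subset_Icc le_rfl hT.2
    exact H.isCentralMotion hK.continuous (fun r => (hM r).1) hT.1.le hY0 hU0 (hYc.mono hsub)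
      (hUc.mono hsub) (fun t ht => (hY' t (hsub (Set.Ioo_subset_Icc_self ht))).hasDerivAt
        (Icc_mem_nhds ht.1 (ht.2.trans_le hT.2)))
      (fun t ht => (hU' t (hsub (Set.Ioo_subset_Icc_self ht))).hasDerivAt
        (Icc_mem_nhds ht.1 (ht.2.trans_le hT.2))) hin
  have hexit : ∃ t₁ ∈ Set.Ioc 0 T₁, 1 ≤ ‖Y t₁‖ := by
    by_contra! hc
    have := (central T₁ ⟨hT₁0, le_rfl⟩ fun t ht => by
      rcases ht.1.eq_or_lt with h0 | h0
      · rw [← h0, hY0, norm_neg, H.norm_eq]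
      · exact (hc t ⟨h0, ht.2⟩).le).time_le
    linarith
  obtain ⟨t₁, ht₁, hout⟩ := hexit
  have hsub₁ : Set.Icc 0 t₁ ⊆ Set.Icc 0 T₁ := Set.Icc_subset_Icc le_rfl ht₁.2
  obtain ⟨T, hT, hYT, hin⟩ := exists_first_exit ht₁.1 (hYc.mono hsub₁)
    (by rw [hY0, norm_neg, H.norm_eq]) ((hY' 0 (Set.left_mem_Icc.2 hT₁0.le)).mono hsub₁)
    (by rw [hY0, hU0, inner_neg_left]; linarith [H.inner_pos]) hout
  have hTT₁ : T ≤ T₁ := hT.2.trans ht₁.2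
  have hsub : Set.Icc 0 T ⊆ Set.Icc 0 T₁ := Set.Icc_subset_Icc le_rfl hTT₁
  have hcm := central T ⟨hT.1, hTT₁⟩ fun t ht => by
    rcases ht.1.eq_or_lt with h0 | h0
    · rw [← h0, hY0, norm_neg, H.norm_eq]
    · rcases ht.2.eq_or_lt with h1 | h1
      · rw [h1, hYT]
      · exact (hin t ⟨h0, h1⟩).le
  have hσT := hcm.exit_inner hT.1 hYT
  set V : ℝ → E3 := fun t => U (max 0 (min T t)) with hVdef
  have hVc : Continuous V := by
    refine (hUc.mono hsub).comp_continuous (by fun_prop) fun t => ?_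
    exact ⟨le_max_left _ _, max_le hT.1.le (min_le_left _ _)⟩
  have hVin : ∀ t ∈ Set.Icc 0 T, V t = U t := fun t ht => by
    simp only [hVdef, min_eq_right ht.2, max_eq_right ht.1]
  have hVout : ∀ t, T ≤ t → V t = U T := fun t ht => by
    simp only [hVdef, min_eq_left ht, max_eq_right hT.1.le]
  set X : ℝ → E3 := fun t => -ν + ∫ τ in (0 : ℝ)..t, V τ with hXdef
  have hX' : ∀ t, HasDerivAt X (V t) t := fun t =>
    ((hVc.integral_hasStrictDerivAt 0 t).hasDerivAt).const_add _
  have hXin : ∀ t ∈ Set.Icc 0 T, X t = Y t := by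
    intro t ht
    have := intervalIntegral.integral_eq_sub_of_hasDerivAt_of_le (f := Y) (f' := V) ht.1
      (hYc.mono (Set.Icc_subset_Icc le_rfl (ht.2.trans hTT₁)))
      (fun τ hτ => by
        have hτT : τ ∈ Set.Ioo 0 T := ⟨hτ.1, hτ.2.trans_le ht.2⟩
        rw [hVin τ (Set.Ioo_subset_Icc_self hτT)]
        exact hcm.derivX τ hτT) (hVc.intervalIntegrable _ _)
    simp only [hXdef, this, hY0]; abel
  have hXout : ∀ t, T ≤ t → X t = Y T + (t - T) • U T := by
    intro t ht
    have h1 := hXin T (Set.right_mem_Icc.2 hT.1.le)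
    simp only [hXdef] at h1 ⊢
    rw [← intervalIntegral.integral_add_adjacent_intervals (hVc.intervalIntegrable 0 T)
      (hVc.intervalIntegrable T t), ← add_assoc, h1]
    congr 1
    rw [intervalIntegral.integral_congr (g := fun _ => U T) fun τ hτ => ?_,
      intervalIntegral.integral_const]
    rw [Set.uIcc_of_le ht] at hτ
    exact hVout τ hτ.1
  have hlt : ∀ t, T < t → 1 < ‖X t‖ := by
    intro t ht
    rw [hXout t ht.le]
    have h1 : ‖Y T + (t - T) • U T‖ ^ 2 = 1 + 2 * ((t - T) * σ) + ‖(t - T) • U T‖ ^ 2 := by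
      rw [norm_add_sq_real, hYT, real_inner_smul_right, hσT]; ring
    have h2 : 0 < (t - T) * σ := mul_pos (by linarith) hσ
    by_contra! hc
    have : ‖Y T + (t - T) • U T‖ ^ 2 ≤ 1 := pow_le_one₀ (norm_nonneg _) hc
    nlinarith [sq_nonneg ‖(t - T) • U T‖]
  have hXc : Continuous X := continuous_iff_continuousAt.2 fun t => (hX' t).continuousAt
  set k : ℝ → E3 := (Set.Iio T).indicator fun τ => -(1 / 2 : ℝ) • h ‖X τ‖ • X τ with hk
  have hgrad : ∀ τ, 0 < τ → τ ≠ T → gradient (weakPotential s f ε) (X τ) = k τ := by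
    intro τ hτ hτT
    rcases lt_or_gt_of_ne hτT with h1 | h1
    · have hτ' : τ ∈ Set.Ioo 0 T := ⟨hτ, h1⟩
      have hτ'' := Set.Ioo_subset_Icc_self hτ'
      have hb : ‖X τ‖ ∈ Set.Ioo (‖perpProj w ν‖ / 2) 1 := by
        rw [hXin τ hτ'']
        refine ⟨?_, hin τ hτ'⟩
        have := hcm.le_norm_position hτ''
        rw [hLc] at this
        linarith
      rw [gradient_weakPotential hf ⟨by linarith [hb.1], hb.2⟩, hk,
        Set.indicator_of_mem (show τ ∈ Set.Iio T from h1), hh _ hb, smul_smul]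
      congr 1; ring
    · rw [gradient_weakPotential_eq_zero hf (hlt τ h1), hk,
        Set.indicator_of_notMem (by simpa using h1.le)]
  have hae : ∀ t, 0 ≤ t → (fun τ => gradient (weakPotential s f ε) (X τ))
      =ᵐ[volume.restrict (Set.uIoc 0 t)] k := by
    intro t ht
    rw [Set.uIoc_of_le ht]
    have h1 : ∀ᵐ τ : ℝ, τ ≠ T := by simp [ae_iff]
    filter_upwards [ae_restrict_mem measurableSet_Ioc, ae_restrict_of_ae h1] with τ hτ hτT
    exact hgrad τ hτ.1 hτT
  have hkint : ∀ a b, IntervalIntegrable k volume a b := by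
    intro a b
    have hc : Continuous fun τ => -(1 / 2 : ℝ) • h ‖X τ‖ • X τ := by
      have := hK.continuous
      fun_prop
    have := hc.intervalIntegrable (μ := volume) a b
    rw [intervalIntegrable_iff] at this ⊢
    exact this.indicator measurableSet_Iio
  have hVT : ∀ t ∈ Set.Icc 0 T, U t = w - (2 : ℝ) • ∫ τ in (0 : ℝ)..t, k τ := by
    intro t ht
    have := intervalIntegral.integral_eq_sub_of_hasDerivAt_of_le (f := U)
      (f' := fun τ => -(2 : ℝ) • k τ) ht.1
      (hUc.mono (Set.Icc_subset_Icc le_rfl (ht.2.trans hTT₁)))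
      (fun τ hτ => by
        have hτT : τ ∈ Set.Ioo 0 T := ⟨hτ.1, hτ.2.trans_le ht.2⟩
        refine (hcm.derivV τ hτT).congr_deriv ?_
        rw [hk, Set.indicator_of_mem (show τ ∈ Set.Iio T from hτT.2), smul_smul, smul_smul,
          hXin τ (Set.Ioo_subset_Icc_self hτT)]
        congr 1; ring) ((hkint 0 t).smul (-(2 : ℝ)))
    rw [intervalIntegral.integral_smul, hU0] at this
    rw [sub_eq_add_neg, ← neg_smul, this]; abel
  refine ⟨X, V, by simp [hXdef], fun t ht => ?_, hX', fun t ht => ?_, fun t ht => ?_⟩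
  · rcases le_or_gt t T with h1 | h1
    · rw [hXin t ⟨ht, h1⟩]
      exact norm_pos_iff.1 (hcm.norm_pos_at ⟨ht, h1⟩)
    · exact norm_pos_iff.1 (one_pos.trans (hlt t h1))
  · exact (hkint 0 t).congr_ae (hae t ht).symm
  · rw [intervalIntegral.integral_congr_ae_restrict (hae t ht)]
    rcases le_or_gt t T with h1 | h1
    · rw [hVin t ⟨ht, h1⟩, hVT t ⟨ht, h1⟩]
    · have h0 : ∫ τ in T..t, k τ = 0 := by
        rw [intervalIntegral.integral_of_le h1.le]
        exact setIntegral_eq_zero_of_forall_eq_zero fun τ hτ => by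
          rw [hk, Set.indicator_of_notMem (by simpa using hτ.1.le)]
      rw [hVout t h1.le, hVT T (Set.right_mem_Icc.2 hT.1.le),
        ← intervalIntegral.integral_add_adjacent_intervals (hkint 0 T) (hkint T t), h0, add_zero]

/-- The outgoing velocities of an impact exist, are unique and are given by the transfer. -/
theorem IsImpact.isOutgoing_iff {v₁ v₂ : E3} (H : IsImpact (v₁ - v₂) ν) (hf : IsProfile f)
    (hs₀ : 0 ≤ s) (hs₁ : s ≤ 1) (hε : 0 < ε) {p : E3 × E3} :
    IsOutgoing (weakPotential s f ε) ν v₁ v₂ p ↔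
      p = (v₁ + transfer (radialPotential s f) ε (v₁ - v₂) ν,
        v₂ - transfer (radialPotential s f) ε (v₁ - v₂) ν) := by
  set a := transfer (radialPotential s f) ε (v₁ - v₂) ν with ha
  have hodd : ∀ x : E3, gradient (weakPotential s f ε) (-x) = -gradient (weakPotential s f ε) x :=
    gradient_of_even fun x => weakPotential_neg x
  have key : ∀ X₁ X₂ V₁ V₂ : ℝ → E3,
      IsScatteringMotion (weakPotential s f ε) ν v₁ v₂ X₁ X₂ V₁ V₂ →
      Tendsto V₁ atTop (𝓝 (v₁ + a)) ∧ Tendsto V₂ atTop (𝓝 (v₂ - a)) := by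
    intro X₁ X₂ V₁ V₂ hm
    have hsum : ∀ t, 0 ≤ t → V₁ t + V₂ t = v₁ + v₂ := by
      intro t ht
      rw [hm.velocity₁ t ht, hm.velocity₂ t ht]
      have : ∀ τ, gradient (weakPotential s f ε) (X₂ τ - X₁ τ) =
          -gradient (weakPotential s f ε) (X₁ τ - X₂ τ) := fun τ => by
        rw [← hodd, neg_sub]
      simp only [this, intervalIntegral.integral_neg]
      abel
    obtain ⟨T, hT, hV⟩ := H.eventually_velocity_eq hf hs₀ hs₁ hε
      (X := fun t => X₁ t - X₂ t) (V := fun t => V₁ t - V₂ t)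
      (by rw [← neg_sub, hm.init])
      (fun t ht => sub_ne_zero.2 (hm.no_contact t ht))
      (fun t ht => (hm.position₁ t ht).sub (hm.position₂ t ht)) hm.force₁
      (fun t ht => by
        have h1 := hm.velocity₁ t ht
        have h2 := hsum t ht
        have h3 : V₂ t = v₁ + v₂ - V₁ t := by rw [← h2]; abel
        rw [h3, h1]
        module)
    have h1 : ∀ t, T ≤ t → V₁ t = v₁ + a := fun t ht => by
      have e1 := hV t ht
      have e2 := hsum t (hT.le.trans ht)
      have : (2 : ℝ) • V₁ t = (2 : ℝ) • (v₁ + a) := by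
        calc (2 : ℝ) • V₁ t = (V₁ t - V₂ t) + (V₁ t + V₂ t) := by module
          _ = _ := by rw [e1, e2]; module
      exact smul_right_injective E3 (two_ne_zero (α := ℝ)) this
    have h2 : ∀ t, T ≤ t → V₂ t = v₂ - a := fun t ht => by
      have e2 := hsum t (hT.le.trans ht)
      rw [h1 t ht] at e2
      rw [eq_sub_of_add_eq' e2]
      abel
    exact ⟨tendsto_const_nhds.congr' (by
        filter_upwards [eventually_ge_atTop T] with t ht using (h1 t ht).symm),
      tendsto_const_nhds.congr' (by
        filter_upwards [eventually_ge_atTop T] with t ht using (h2 t ht).symm)⟩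
  constructor
  · rintro ⟨X₁, X₂, V₁, V₂, hm, h1, h2⟩
    obtain ⟨k1, k2⟩ := key X₁ X₂ V₁ V₂ hm
    exact Prod.ext (tendsto_nhds_unique h1 k1) (tendsto_nhds_unique h2 k2)
  · rintro rfl
    obtain ⟨X, V, hX0, hne, hX', hint, hV⟩ := H.exists_relative_motion hf hs₀ hs₁ hε
    set X₁ : ℝ → E3 := fun t => t • ((1 / 2 : ℝ) • (v₁ + v₂)) + (1 / 2 : ℝ) • X t with hX₁
    set X₂ : ℝ → E3 := fun t => t • ((1 / 2 : ℝ) • (v₁ + v₂)) - (1 / 2 : ℝ) • X t with hX₂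
    have hd1 : ∀ t, X₁ t - X₂ t = X t := fun t => by simp only [hX₁, hX₂]; module
    have hd2 : ∀ t, X₂ t - X₁ t = -X t := fun t => by simp only [hX₁, hX₂]; module
    have hcm : ∀ t : ℝ, HasDerivAt (fun t : ℝ => t • ((1 / 2 : ℝ) • (v₁ + v₂)))
        ((1 / 2 : ℝ) • (v₁ + v₂)) t := fun t => by
      simpa using (hasDerivAt_id t).smul_const ((1 / 2 : ℝ) • (v₁ + v₂))
    have hm : IsScatteringMotion (weakPotential s f ε) ν v₁ v₂ X₁ X₂
        (fun t => (1 / 2 : ℝ) • (v₁ + v₂) + (1 / 2 : ℝ) • V t)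
        (fun t => (1 / 2 : ℝ) • (v₁ + v₂) - (1 / 2 : ℝ) • V t) := by
      refine ⟨?_, fun t ht h => ?_, fun t ht => ?_, fun t ht => ?_, fun t ht => ?_, fun t ht => ?_,
        fun t ht => ?_, fun t ht => ?_⟩
      · rw [hd2, hX0, neg_neg]
      · exact hne t ht (by rw [← hd1, h, sub_self])
      · exact ((hcm t).add ((hX' t).const_smul (1 / 2 : ℝ))).hasDerivWithinAt
      · exact ((hcm t).sub ((hX' t).const_smul (1 / 2 : ℝ))).hasDerivWithinAt
      · simp only [hd1]; exact hint t ht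
      · simp only [hd2, hodd]; exact (hint t ht).neg
      · simp only [hd1]; rw [hV t ht]; module
      · simp only [hd2, hodd, intervalIntegral.integral_neg]; rw [hV t ht]; module
    obtain ⟨k1, k2⟩ := key _ _ _ _ hm
    exact ⟨_, _, _, _, hm, k1, k2⟩

theorem IsImpact.outgoing_eq {v₁ v₂ : E3} (H : IsImpact (v₁ - v₂) ν) (hf : IsProfile f)
    (hs₀ : 0 ≤ s) (hs₁ : s ≤ 1) (hε : 0 < ε) :
    outgoing (weakPotential s f ε) ν v₁ v₂ =
      (v₁ + transfer (radialPotential s f) ε (v₁ - v₂) ν,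
        v₂ - transfer (radialPotential s f) ε (v₁ - v₂) ν) := by
  have h : ∃ p, IsOutgoing (weakPotential s f ε) ν v₁ v₂ p :=
    ⟨_, (H.isOutgoing_iff hf hs₀ hs₁ hε).2 rfl⟩
  rw [outgoing, dif_pos h]
  exact (H.isOutgoing_iff hf hs₀ hs₁ hε).1 h.choose_spec

end Scattering

/-! ### Integration over the sphere -/

/-- The Euclidean plane. -/
abbrev E2 : Type := EuclideanSpace ℝ (Fin 2)

/-- Splitting off the `i`-th coordinate of a vector in `ℝ³`. -/
def splitAt (i : Fin 3) : E3 ≃ᵐ ℝ × E2 :=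
  ((MeasurableEquiv.toLp 2 (Fin 3 → ℝ)).symm.trans
    (MeasurableEquiv.piFinSuccAbove (fun _ => ℝ) i)).trans
      ((MeasurableEquiv.refl ℝ).prodCongr (MeasurableEquiv.toLp 2 (Fin 2 → ℝ)))

theorem splitAt_apply (i : Fin 3) (x : E3) :
    splitAt i x = (x i, WithLp.toLp 2 fun j => x (i.succAbove j)) := rfl

theorem splitAt_symm_self (i : Fin 3) (p : ℝ × E2) : (splitAt i).symm p i = p.1 := by
  have := congrArg Prod.fst ((splitAt i).apply_symm_apply p)
  rwa [splitAt_apply] at this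

theorem splitAt_symm_succAbove (i : Fin 3) (p : ℝ × E2) (j : Fin 2) :
    (splitAt i).symm p (i.succAbove j) = p.2 j := by
  have := congrArg (fun q : ℝ × E2 => q.2 j) ((splitAt i).apply_symm_apply p)
  rwa [splitAt_apply] at this

theorem measurePreserving_splitAt (i : Fin 3) : MeasurePreserving (splitAt i) := by
  refine ((MeasurePreserving.id volume).prod
    (EuclideanSpace.volume_preserving_symm_measurableEquiv_toLp (Fin 2)).symm).comp
    ((volume_preserving_piFinSuccAbove (fun _ => ℝ) i).comp
      (EuclideanSpace.volume_preserving_symm_measurableEquiv_toLp (Fin 3)))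

theorem norm_sq_eq_splitAt (i : Fin 3) (x : E3) :
    ‖x‖ ^ 2 = (splitAt i x).1 ^ 2 + ‖(splitAt i x).2‖ ^ 2 := by
  rw [EuclideanSpace.norm_sq_eq, EuclideanSpace.norm_sq_eq, Fin.sum_univ_succAbove _ i]
  simp [splitAt_apply]

theorem norm_splitAt_symm (i : Fin 3) (p : ℝ × E2) :
    ‖(splitAt i).symm p‖ = √(p.1 ^ 2 + ‖p.2‖ ^ 2) := by
  have := norm_sq_eq_splitAt i ((splitAt i).symm p)
  rw [(splitAt i).apply_symm_apply] at this
  rw [← this, Real.sqrt_sq (norm_nonneg _)]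

/-- Integrals over the sphere as integrals over the unit ball. -/
theorem integral_sphereMeasure (F : E3 → ℝ) :
    ∫ ν : S2, F ν ∂sphereMeasure =
      3 * ∫ x : E3, (Metric.ball (0 : E3) 1).indicator (fun x => F (‖x‖⁻¹ • x)) x := by
  classical
  have hdim : Module.finrank ℝ E3 = 3 := by simp
  set G : E3 → ℝ := (Metric.ball (0 : E3) 1).indicator (fun x => F (‖x‖⁻¹ • x)) with hG
  have h1 : ∫ x, G x = ∫ x : ({(0)}ᶜ : Set E3), G x.1 ∂((volume : Measure E3).comap (↑)) := by
    rw [integral_subtype_comap (measurableSet_singleton _).compl fun x => G x,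
      restrict_compl_singleton]
  have h2 : ∫ x : ({(0)}ᶜ : Set E3), G x.1 ∂((volume : Measure E3).comap (↑)) =
      ∫ p : S2 × Set.Ioi (0 : ℝ), F p.1 * (Set.Iio (⟨1, Set.mem_Ioi.2 one_pos⟩ : Set.Ioi (0 : ℝ))).indicator
        (fun _ => (1 : ℝ)) p.2 ∂(volume : Measure E3).toSphere.prod (.volumeIoiPow 2) := by
    have := (volume : Measure E3).measurePreserving_homeomorphUnitSphereProd
    rw [hdim] at this
    rw [← this.integral_comp (Homeomorph.measurableEmbedding _)]
    refine integral_congr_ae (Eventually.of_forall fun x => ?_)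
    simp only [hG, Set.indicator_apply, mem_ball_zero_iff, Set.mem_Iio]
    have e1 : ((homeomorphUnitSphereProd E3 x).1 : E3) = ‖x.1‖⁻¹ • x.1 := by simp
    have e2 : ((homeomorphUnitSphereProd E3 x).2 < (⟨1, Set.mem_Ioi.2 one_pos⟩ : Set.Ioi (0 : ℝ))) ↔
        ‖x.1‖ < 1 := by rw [← Subtype.coe_lt_coe]; simp
    rw [e1, if_congr e2 rfl rfl]
    split_ifs <;> simp
  rw [h1, h2, integral_prod_mul (fun ν : S2 => F ν), 
    integral_indicator measurableSet_Iio, setIntegral_const, measureReal_def, Measure.volumeIoiPow_apply_Iio, sphereMeasure]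
  norm_num
  ring

/-- The surface measure of the sphere is invariant under linear isometries. -/
theorem integral_sphereMeasure_comp (R : E3 ≃ₗᵢ[ℝ] E3) (F : E3 → ℝ) :
    ∫ ν : S2, F (R ν) ∂sphereMeasure = ∫ ν : S2, F ν ∂sphereMeasure := by
  classical
  rw [integral_sphereMeasure F, integral_sphereMeasure fun x => F (R x)]
  congr 1
  rw [← R.measurePreserving.integral_comp R.toHomeomorph.measurableEmbedding
    ((Metric.ball (0 : E3) 1).indicator fun x => F (‖x‖⁻¹ • x))]
  refine integral_congr_ae (Eventually.of_forall fun x => ?_)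
  simp only [Set.indicator_apply, mem_ball_zero_iff, R.norm_map, map_smul]

theorem integral_zonal_aux (g : ℝ → ℝ) (hg : Continuous g) (hb : ∃ C, ∀ z, |g z| ≤ C) :
    ∫ ν : S2, g ((ν : E3) 0) ∂sphereMeasure = 2 * Real.pi * ∫ z in (-1 : ℝ)..1, g z := by
  classical
  obtain ⟨C, hC⟩ := hb
  have hC0 : 0 ≤ C := (abs_nonneg _).trans (hC 0)
  set k : ℝ → ℝ → ℝ := fun z n => if n < 1 then g (z / n) else 0 with hk
  have hkm : Measurable fun p : ℝ × ℝ => k p.1 p.2 :=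
    Measurable.ite (measurableSet_lt measurable_snd measurable_const)
      (hg.measurable.comp (measurable_fst.div measurable_snd)) measurable_const
  have hkb : ∀ z n, |k z n| ≤ C := fun z n => by
    simp only [hk]; split_ifs
    · exact hC _
    · simpa using hC0
  have hk0 : ∀ z n, 1 ≤ n → k z n = 0 := fun z n hn => by simp [hk, not_lt.2 hn]
  rw [integral_sphereMeasure fun x => g (x 0)]
  have e0 : ∀ x : E3, (Metric.ball (0 : E3) 1).indicator (fun x => g ((‖x‖⁻¹ • x) 0)) x =
      k (x 0) ‖x‖ := fun x => by
    simp [hk, Set.indicator_apply, div_eq_inv_mul]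
  simp only [e0]
  have i0 : Integrable fun x : E3 => k (x 0) ‖x‖ := by
    have hm : Measurable fun x : E3 => k (x 0) ‖x‖ :=
      hkm.comp ((by fun_prop : Measurable fun x : E3 => x 0).prodMk measurable_norm)
    have : IntegrableOn (fun x : E3 => k (x 0) ‖x‖) (Metric.ball 0 1) :=
      Measure.integrableOn_of_bounded (M := C) measure_ball_lt_top.ne hm.aestronglyMeasurable
        (Eventually.of_forall fun x => hkb _ _)
    rwa [integrableOn_iff_integrable_of_support_subset] at this
    intro x hx
    by_contra hn
    exact hx (hk0 _ _ (by simpa using hn))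
  have e1 : ∫ x : E3, k (x 0) ‖x‖ = ∫ p : ℝ × E2, k p.1 (√(p.1 ^ 2 + ‖p.2‖ ^ 2)) := by
    rw [← (measurePreserving_splitAt 0).symm.integral_comp
      (splitAt 0).symm.measurableEmbedding (fun x : E3 => k (x 0) ‖x‖)]
    simp only [norm_splitAt_symm, splitAt_symm_self]
  have i1 : Integrable fun p : ℝ × E2 => k p.1 (√(p.1 ^ 2 + ‖p.2‖ ^ 2)) := by
    have := (measurePreserving_splitAt 0).symm.integrable_comp_emb
      (splitAt 0).symm.measurableEmbedding (g := fun x : E3 => k (x 0) ‖x‖)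
    have := this.2 i0
    simpa only [Function.comp_def, norm_splitAt_symm, splitAt_symm_self] using this
  have hvol : (volume : Measure E2).real (Metric.ball 0 1) = Real.pi := by
    rw [measureReal_def, EuclideanSpace.volume_ball_fin_two]
    simp [Real.pi_pos.le]
  have e2 : ∀ z : ℝ, ∫ y : E2, k z (√(z ^ 2 + ‖y‖ ^ 2)) =
      2 * Real.pi * ∫ r in Set.Ioi (0 : ℝ), r * k z (√(z ^ 2 + r ^ 2)) := fun z => by
    rw [integral_fun_norm_addHaar (volume : Measure E2) (fun r => k z (√(z ^ 2 + r ^ 2))), hvol]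
    simp only [finrank_euclideanSpace, Fintype.card_fin, nsmul_eq_mul, smul_eq_mul]
    norm_num
    ring
  set K : ℝ × ℝ → ℝ := fun p => (Set.Ioi (0 : ℝ)).indicator
    (fun r => r * k p.1 (√(p.1 ^ 2 + r ^ 2))) p.2 with hK
  have i2 : Integrable K := by
    have hm : Measurable K := by
      have : K = fun p => if 0 < p.2 then p.2 * k p.1 (√(p.1 ^ 2 + p.2 ^ 2)) else 0 := by
        ext p; simp [hK, Set.indicator_apply]
      rw [this]
      refine Measurable.ite (measurableSet_lt measurable_const measurable_snd)
        (measurable_snd.mul (hkm.comp (measurable_fst.prodMk ?_))) measurable_const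
      fun_prop
    have : IntegrableOn K (Set.Icc (-1) 1 ×ˢ Set.Icc (-1) 1) := by
      refine Measure.integrableOn_of_bounded (M := C)
        ((isCompact_Icc.prod isCompact_Icc).measure_lt_top.ne) hm.aestronglyMeasurable ?_
      filter_upwards [ae_restrict_mem (measurableSet_Icc.prod measurableSet_Icc)] with p hp
      simp only [hK, Set.indicator_apply]
      split_ifs with h
      · rw [norm_mul, Real.norm_eq_abs, Real.norm_eq_abs, abs_of_pos h]
        have h1 := hp.2.2
        have h2 := hkb p.1 (√(p.1 ^ 2 + p.2 ^ 2))
        have h3 : (0 : ℝ) < p.2 := h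
        nlinarith [abs_nonneg (k p.1 (√(p.1 ^ 2 + p.2 ^ 2)))]
      · simpa using hC0
    rwa [integrableOn_iff_integrable_of_support_subset] at this
    intro p hp
    by_contra hn
    apply hp
    simp only [hK, Set.indicator_apply]
    split_ifs with h
    · rw [hk0, mul_zero]
      rw [Real.one_le_sqrt]
      by_contra! hlt
      refine hn ⟨abs_le.1 (abs_le_of_sq_le_sq (by nlinarith [sq_nonneg p.2]) zero_le_one),
        abs_le.1 (abs_le_of_sq_le_sq (by nlinarith [sq_nonneg p.1]) zero_le_one)⟩
    · rfl
  have e3 : ∫ p : ℝ × E2, k p.1 (√(p.1 ^ 2 + ‖p.2‖ ^ 2)) = 2 * Real.pi * ∫ p, K p := by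
    rw [Measure.volume_eq_prod, integral_prod _ i1, Measure.volume_eq_prod, integral_prod _ i2]
    simp only [e2, hK]
    rw [integral_const_mul]
    simp only [integral_indicator measurableSet_Ioi]
  have e4 : ∫ p, K p = (∫ r in Set.Ioi (0 : ℝ), (Set.Iio 1).indicator (fun r => r ^ 2) r) *
      ∫ α in Set.Ioo (-Real.pi) Real.pi,
        (Set.Ioi 0).indicator (fun α => Real.sin α * g (Real.cos α)) α := by
    rw [← integral_comp_polarCoord_symm, ← setIntegral_prod_mul]
    have : polarCoord.target = Set.Ioi (0 : ℝ) ×ˢ Set.Ioo (-Real.pi) Real.pi := rfl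
    rw [this]
    refine setIntegral_congr_fun (measurableSet_Ioi.prod measurableSet_Ioo) fun p hp => ?_
    have hp1 : 0 < p.1 := hp.1
    simp only [polarCoord_symm_apply, hK, smul_eq_mul]
    have hsq : √((p.1 * Real.cos p.2) ^ 2 + (p.1 * Real.sin p.2) ^ 2) = p.1 := by
      rw [show (p.1 * Real.cos p.2) ^ 2 + (p.1 * Real.sin p.2) ^ 2 = p.1 ^ 2 by
        nlinarith [Real.sin_sq_add_cos_sq p.2], Real.sqrt_sq hp1.le]
    simp only [Set.indicator_apply, Set.mem_Ioi, Set.mem_Iio, hsq]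
    have hsign : 0 < p.1 * Real.sin p.2 ↔ 0 < p.2 := by
      rw [mul_pos_iff_of_pos_left hp1]
      constructor
      · intro h
        by_contra! hc
        exact absurd (Real.sin_nonpos_of_nonpos_of_neg_pi_le hc hp.2.1.le) (not_le.2 h)
      · exact fun h => Real.sin_pos_of_pos_of_lt_pi h hp.2.2
    rw [if_congr hsign rfl rfl]
    split_ifs with h1 h2 h2
    · simp only [hk, if_pos h2]
      rw [mul_div_cancel_left₀ _ hp1.ne']
      ring
    · rw [hk0 _ _ (not_lt.1 h2)]; ring
    · ring
    · ring
  have e5 : ∫ r in Set.Ioi (0 : ℝ), (Set.Iio 1).indicator (fun r : ℝ => r ^ 2) r = 1 / 3 := by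
    rw [setIntegral_indicator measurableSet_Iio, Set.Ioi_inter_Iio, ← integral_Ioc_eq_integral_Ioo,
      ← intervalIntegral.integral_of_le zero_le_one, integral_pow]
    norm_num
  have e6 : ∫ α in Set.Ioo (-Real.pi) Real.pi,
      (Set.Ioi 0).indicator (fun α => Real.sin α * g (Real.cos α)) α = ∫ z in (-1 : ℝ)..1, g z := by
    have : Set.Ioo (-Real.pi) Real.pi ∩ Set.Ioi 0 = Set.Ioo 0 Real.pi := by
      ext x; simp only [Set.mem_inter_iff, Set.mem_Ioo, Set.mem_Ioi]
      constructor
      · exact fun h => ⟨h.2, h.1.2⟩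
      · exact fun h => ⟨⟨by linarith [Real.pi_pos, h.1], h.2⟩, h.1⟩
    rw [setIntegral_indicator measurableSet_Ioi, this, ← integral_Ioc_eq_integral_Ioo,
      ← intervalIntegral.integral_of_le Real.pi_pos.le]
    have h := intervalIntegral.integral_comp_mul_deriv (a := 0) (b := Real.pi) (f := Real.cos)
      (f' := fun x => -Real.sin x) (g := g) (fun x _ => Real.hasDerivAt_cos x)
      (by fun_prop) hg
    rw [Real.cos_zero, Real.cos_pi] at h
    rw [intervalIntegral.integral_symm 1 (-1), ← h, ← intervalIntegral.integral_neg]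
    refine intervalIntegral.integral_congr fun x _ => ?_
    simp only [Function.comp]
    ring
  rw [e1, e3, e4, e5, e6]
  ring

instance : IsFiniteMeasure sphereMeasure := by unfold sphereMeasure; infer_instance

/-- The projection of the surface measure of the sphere to an axis is uniform. -/
theorem map_inner_sphereMeasure {e : E3} (he : ‖e‖ = 1) :
    sphereMeasure.map (fun ν : S2 => inner ℝ (ν : E3) e) =
      ENNReal.ofReal (2 * Real.pi) • volume.restrict (Set.Ioc (-1) 1) := by
  have hm : Measurable fun ν : S2 => inner ℝ (ν : E3) e := by fun_prop
  have : IsFiniteMeasure (ENNReal.ofReal (2 * Real.pi) •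
      (volume : Measure ℝ).restrict (Set.Ioc (-1) 1)) := by
    refine ⟨?_⟩
    simp only [Measure.smul_apply, Measure.restrict_apply_univ, Real.volume_Ioc, smul_eq_mul]
    exact ENNReal.mul_lt_top ENNReal.ofReal_lt_top ENNReal.ofReal_lt_top
  refine ext_of_forall_integral_eq_of_IsFiniteMeasure fun g => ?_
  rw [integral_map hm.aemeasurable g.continuous.aestronglyMeasurable, integral_smul_measure,
    ENNReal.toReal_ofReal (by positivity), ← intervalIntegral.integral_of_le (by norm_num),
    smul_eq_mul, ← integral_zonal_aux g g.continuous ⟨‖g‖, fun z => g.norm_coe_le_norm z⟩]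
  set e₀ : E3 := EuclideanSpace.single 0 1
  have h0 : ‖e‖ = ‖e₀‖ := by simp [he, e₀]
  set R := Submodule.reflection (Submodule.span ℝ {e - e₀})ᗮ
  have hR : R e = e₀ := Submodule.reflection_sub h0
  rw [← integral_sphereMeasure_comp R fun x => g (x 0)]
  refine integral_congr_ae (Eventually.of_forall fun ν => ?_)
  have : inner ℝ (ν : E3) e = R ν 0 := by
    rw [← R.inner_map_map, hR]
    simp [e₀, EuclideanSpace.inner_single_right]
  simp only [this]

/-- Almost every `ν` in the hemisphere leads to an impact. -/
theorem ae_isImpact {v₁ v₂ : E3} (hv : v₁ ≠ v₂) :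
    ∀ᵐ ν ∂sphereMeasure, ν ∈ hemisphere v₁ v₂ → IsImpact (v₁ - v₂) ν := by
  set w := v₁ - v₂ with hw
  have hw0 : w ≠ 0 := sub_ne_zero.2 hv
  have hn : 0 < ‖w‖ := norm_pos_iff.2 hw0
  have he : ‖‖w‖⁻¹ • w‖ = 1 := by rw [norm_smul]; simp [hn.ne']
  have hz : ∀ᵐ z ∂(sphereMeasure.map (fun ν : S2 => inner ℝ (ν : E3) (‖w‖⁻¹ • w))),
      z ∉ ({0, 1, -1} : Set ℝ) := by
    rw [map_inner_sphereMeasure he]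
    refine Measure.ae_smul_measure (ae_restrict_of_ae ?_) _
    have : (volume : Measure ℝ) {0, 1, -1} = 0 := (Set.toFinite _).measure_zero _
    exact measure_eq_zero_iff_ae_notMem.1 this
  have := ae_of_ae_map (by fun_prop) hz
  filter_upwards [this] with ν hν hh
  have hν1 : ‖(ν : E3)‖ = 1 := by simp
  have hh' : 0 ≤ inner ℝ (ν : E3) w := hh
  simp only [Set.mem_insert_iff, Set.mem_singleton_iff, not_or, real_inner_smul_right] at hν
  refine ⟨hν1, lt_of_le_of_ne hh' fun h => hν.1 (by rw [← h, mul_zero]), ?_⟩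
  refine lt_of_le_of_ne (norm_nonneg _) fun h => ?_
  have h1 := norm_perpProj_sq (x := (ν : E3)) hw0
  rw [← h, hν1, real_inner_comm] at h1
  have h2 : (‖w‖⁻¹ * inner ℝ (ν : E3) w) ^ 2 = 1 := by
    rw [mul_pow, inv_pow, inv_mul_eq_div]; linarith
  rcases mul_self_eq_one_iff.1 ((sq _).symm.trans h2) with h3 | h3
  · exact hν.2.1 h3
  · exact hν.2.2 h3

theorem integral_hemisphere_eq (v₁ v₂ : E3) (F : E3 → ℝ) :
    ∫ ν in hemisphere v₁ v₂, F ν ∂sphereMeasure =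
      ∫ ν : S2, {x : E3 | 0 ≤ inner ℝ x (v₁ - v₂)}.indicator F ν ∂sphereMeasure := by
  have : MeasurableSet (hemisphere v₁ v₂) :=
    measurableSet_le measurable_const (by fun_prop)
  rw [← integral_indicator this]
  rfl

/-- Integration of functions of the impact parameter over the hemisphere. -/
theorem integral_hemisphere_impact {v₁ v₂ : E3} (hv : v₁ ≠ v₂) {G : ℝ → ℝ} (hG : Measurable G) :
    ∫ ν in hemisphere v₁ v₂, G ‖perpProj (v₁ - v₂) ν‖ * inner ℝ (v₁ - v₂) (ν : E3) ∂sphereMeasure =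
      2 * Real.pi * ‖v₁ - v₂‖ * ∫ ρ in Set.Ioo (0 : ℝ) 1, G ρ * ρ := by
  classical
  set w := v₁ - v₂ with hw
  have hw0 : w ≠ 0 := sub_ne_zero.2 hv
  have hn : 0 < ‖w‖ := norm_pos_iff.2 hw0
  have he : ‖‖w‖⁻¹ • w‖ = 1 := by rw [norm_smul]; simp [hn.ne']
  set h : ℝ → ℝ := (Set.Ioi 0).indicator fun z => G √(1 - z ^ 2) * (‖w‖ * z) with hh
  have hm : Measurable h := by
    refine Measurable.indicator ?_ measurableSet_Ioi
    exact (hG.comp (by fun_prop)).mul (by fun_prop)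
  rw [integral_hemisphere_eq v₁ v₂ fun x => G ‖perpProj w x‖ * inner ℝ w x]
  have e1 : ∀ ν : S2, {x : E3 | 0 ≤ inner ℝ x (v₁ - v₂)}.indicator
      (fun x => G ‖perpProj w x‖ * inner ℝ w x) (ν : E3) =
      h (inner ℝ (ν : E3) (‖w‖⁻¹ • w)) := fun ν => by
    have hν1 : ‖(ν : E3)‖ = 1 := by simp
    have h1 := norm_perpProj_sq (x := (ν : E3)) hw0
    simp only [hh, Set.indicator_apply, Set.mem_ofPred_eq, Set.mem_Ioi, ← hw, real_inner_smul_right]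
    rw [real_inner_comm (ν : E3) w]
    have e2 : √(1 - (‖w‖⁻¹ * inner ℝ (ν : E3) w) ^ 2) = ‖perpProj w ν‖ := by
      rw [← Real.sqrt_sq (norm_nonneg (perpProj w (ν : E3))), h1, hν1, real_inner_comm, mul_pow,
        inv_pow, inv_mul_eq_div, one_pow]
    rw [e2, mul_inv_cancel_left₀ hn.ne']
    rcases lt_trichotomy (inner ℝ (ν : E3) w) 0 with h3 | h3 | h3
    · have : ¬ (0 < ‖w‖⁻¹ * inner ℝ (ν : E3) w) := not_lt.2
        (mul_nonpos_of_nonneg_of_nonpos (inv_nonneg.2 hn.le) h3.le)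
      rw [if_neg (not_le.2 h3), if_neg this]
    · simp [h3]
    · rw [if_pos h3.le, if_pos (by positivity)]
  simp only [e1]
  rw [← integral_map (μ := sphereMeasure) (f := h) (by fun_prop) hm.aestronglyMeasurable,
    map_inner_sphereMeasure he, integral_smul_measure, ENNReal.toReal_ofReal (by positivity),
    smul_eq_mul, mul_assoc (2 * Real.pi)]
  congr 1
  have e3 : Set.Ioc (-1 : ℝ) 1 ∩ Set.Ioi 0 = Set.Ioc 0 1 := by
    ext x; simp only [Set.mem_inter_iff, Set.mem_Ioc, Set.mem_Ioi]
    constructor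
    · exact fun h => ⟨h.2, h.1.2⟩
    · exact fun h => ⟨⟨by linarith [h.1], h.2⟩, h.1⟩
  rw [hh, setIntegral_indicator measurableSet_Ioi, e3, integral_Ioc_eq_integral_Ioo,
    ← integral_const_mul]
  have himg : (fun z : ℝ => √(1 - z ^ 2)) '' Set.Ioo 0 1 = Set.Ioo 0 1 := by
    have hsub : ∀ z ∈ Set.Ioo (0 : ℝ) 1, √(1 - z ^ 2) ∈ Set.Ioo (0 : ℝ) 1 := fun z hz => by
      have : z ^ 2 < 1 := pow_lt_one₀ hz.1.le hz.2 two_ne_zero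
      have : 0 < z ^ 2 := pow_pos hz.1 2
      exact ⟨Real.sqrt_pos.2 (by linarith), by rw [Real.sqrt_lt' one_pos]; linarith⟩
    apply Set.Subset.antisymm
    · rintro _ ⟨z, hz, rfl⟩; exact hsub z hz
    · intro z hz
      refine ⟨√(1 - z ^ 2), hsub z hz, ?_⟩
      have : z ^ 2 < 1 := pow_lt_one₀ hz.1.le hz.2 two_ne_zero
      simp only
      rw [Real.sq_sqrt (by linarith), sub_sub_cancel, Real.sqrt_sq hz.1.le]
  have hpos : ∀ z ∈ Set.Ioo (0 : ℝ) 1, 0 < 1 - z ^ 2 := fun z hz => by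
    have : z ^ 2 < 1 := pow_lt_one₀ hz.1.le hz.2 two_ne_zero
    linarith
  have hcv := integral_image_eq_integral_abs_deriv_smul (s := Set.Ioo (0 : ℝ) 1)
    (f := fun z : ℝ => √(1 - z ^ 2)) (f' := fun z => -(2 * z) / (2 * √(1 - z ^ 2)))
    measurableSet_Ioo (fun z hz => by
      have h1 : HasDerivAt (fun z : ℝ => 1 - z ^ 2) (-(2 * z)) z := by
        simpa using ((hasDerivAt_id z).pow 2).const_sub 1
      exact (h1.sqrt (hpos z hz).ne').hasDerivWithinAt)
    (fun x hx y hy hxy => by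
      have h1 := congrArg (· ^ 2) hxy
      simp only [Real.sq_sqrt (hpos x hx).le, Real.sq_sqrt (hpos y hy).le] at h1
      exact (sq_eq_sq₀ hx.1.le hy.1.le).1 (by linarith))
    (fun ρ => ‖w‖ * (G ρ * ρ))
  rw [himg] at hcv
  rw [hcv]
  refine setIntegral_congr_fun measurableSet_Ioo fun z hz => ?_
  have h1 := Real.sqrt_pos.2 (hpos z hz)
  simp only [smul_eq_mul]
  rw [abs_div, abs_neg, abs_of_pos (by linarith [hz.1] : 0 < 2 * z),
    abs_of_pos (by positivity : 0 < 2 * √(1 - z ^ 2))]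
  field_simp

/-! ### Averaging over rotations about an axis -/

theorem perpProj_isometry {w : E3} (R : E3 ≃ₗᵢ[ℝ] E3) (hR : R w = w) (x : E3) :
    perpProj w (R x) = R (perpProj w x) := by
  have : inner ℝ w (R x) = inner ℝ w x := by
    conv_lhs => rw [← hR]
    rw [R.inner_map_map]
  rw [perpProj, perpProj, this, map_sub, map_smul, hR]

theorem integral_hemisphere_comp {v₁ v₂ : E3} (R : E3 ≃ₗᵢ[ℝ] E3) (hR : R (v₁ - v₂) = v₁ - v₂)
    (F : E3 → ℝ) :
    ∫ ν in hemisphere v₁ v₂, F (R ν) ∂sphereMeasure = ∫ ν in hemisphere v₁ v₂, F ν ∂sphereMeasure := by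
  classical
  rw [integral_hemisphere_eq v₁ v₂ F, integral_hemisphere_eq v₁ v₂ fun x => F (R x),
    ← integral_sphereMeasure_comp R ({x : E3 | 0 ≤ inner ℝ x (v₁ - v₂)}.indicator F)]
  refine integral_congr_ae (Eventually.of_forall fun ν => ?_)
  have : inner ℝ (R ν) (v₁ - v₂) = inner ℝ (ν : E3) (v₁ - v₂) := by
    conv_lhs => rw [← hR]
    rw [R.inner_map_map]
  simp only [Set.indicator_apply, Set.mem_ofPred_eq, this]

/-- Odd functions of the transversal direction average to zero. -/
theorem integral_hemisphere_linear {v₁ v₂ : E3} (hv : v₁ ≠ v₂) (m : ℝ → ℝ) (u : E3) :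
    ∫ ν in hemisphere v₁ v₂, m ‖perpProj (v₁ - v₂) ν‖ * inner ℝ u (perpProj (v₁ - v₂) ν) *
      inner ℝ (v₁ - v₂) (ν : E3) ∂sphereMeasure = 0 := by
  set w := v₁ - v₂ with hw
  have hw0 : w ≠ 0 := sub_ne_zero.2 hv
  set R := Submodule.reflection (Submodule.span ℝ {w})
  have hR : R w = w := Submodule.reflection_mem_subspace_eq_self (Submodule.mem_span_singleton_self w)
  have hperp : ∀ x : E3, R (perpProj w x) = -perpProj w x := fun x =>
    Submodule.reflection_mem_subspace_orthogonalComplement_eq_neg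
      (Submodule.mem_orthogonal_singleton_iff_inner_right.2 (inner_perpProj_left hw0))
  have h := integral_hemisphere_comp (v₁ := v₁) (v₂ := v₂) R hR fun x =>
    m ‖perpProj w x‖ * inner ℝ u (perpProj w x) * inner ℝ w x
  have e : ∀ x : E3, inner ℝ w (R x) = inner ℝ w x := fun x => by
    conv_lhs => rw [← hR]
    rw [R.inner_map_map]
  simp only [perpProj_isometry R hR, hperp, norm_neg, inner_neg_right, e, mul_neg, neg_mul,
    integral_neg] at h
  linarith

/-- Quadratic functions of the transversal direction average to half of the transversal trace. -/
theorem integral_hemisphere_quadratic {v₁ v₂ : E3} (hv : v₁ ≠ v₂) {m : ℝ → ℝ} (hm : Measurable m)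
    {C : ℝ} (hC : ∀ ρ, |m ρ * ρ ^ 2| ≤ C) (T : E3 →L[ℝ] E3) :
    ∫ ν in hemisphere v₁ v₂, m ‖perpProj (v₁ - v₂) ν‖ *
        inner ℝ (perpProj (v₁ - v₂) ν) (T (perpProj (v₁ - v₂) ν)) *
        inner ℝ (v₁ - v₂) (ν : E3) ∂sphereMeasure =
      (1 / 2) * ((∑ i : Fin 3, T (EuclideanSpace.single i 1) i) -
        inner ℝ (v₁ - v₂) (T (v₁ - v₂)) / ‖v₁ - v₂‖ ^ 2) *
      ∫ ν in hemisphere v₁ v₂, m ‖perpProj (v₁ - v₂) ν‖ * ‖perpProj (v₁ - v₂) ν‖ ^ 2 *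
        inner ℝ (v₁ - v₂) (ν : E3) ∂sphereMeasure := by
  set w := v₁ - v₂ with hw
  have hw0 : w ≠ 0 := sub_ne_zero.2 hv
  have hn : 0 < ‖w‖ := norm_pos_iff.2 hw0
  have he : ‖‖w‖⁻¹ • w‖ = 1 := by rw [norm_smul]; simp [hn.ne']
  obtain ⟨b, hb⟩ := Orthonormal.exists_orthonormalBasis_extension_of_card_eq (𝕜 := ℝ) (E := E3)
    (ι := Fin 3) (by simp) (v := fun _ => ‖w‖⁻¹ • w) (s := {0}) (by
      constructor
      · intro i; exact he
      · intro i j hij; exact absurd (Subsingleton.elim i j) hij)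
  have hb0 : b 0 = ‖w‖⁻¹ • w := hb 0 rfl
  have hwb : w = ‖w‖ • b 0 := by rw [hb0, smul_smul, mul_inv_cancel₀ hn.ne', one_smul]
  -- rotation by a right angle about the axis `w`
  set J : E3 ≃ₗᵢ[ℝ] E3 := (b.equiv b (Equiv.swap 1 2)).trans
    (Submodule.reflection (Submodule.span ℝ {b 1})ᗮ) with hJ
  have hbo : ∀ i j, i ≠ j → inner ℝ (b i) (b j) = 0 := fun i j hij => b.orthonormal.2 hij
  have hJ0 : J (b 0) = b 0 := by
    rw [hJ, LinearIsometryEquiv.trans_apply, OrthonormalBasis.equiv_apply_basis,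
      Equiv.swap_apply_of_ne_of_ne (by decide) (by decide)]
    exact Submodule.reflection_mem_subspace_eq_self
      (Submodule.mem_orthogonal_singleton_iff_inner_right.2 (hbo 1 0 (by decide)))
  have hJ1 : J (b 1) = b 2 := by
    rw [hJ, LinearIsometryEquiv.trans_apply, OrthonormalBasis.equiv_apply_basis,
      Equiv.swap_apply_left]
    exact Submodule.reflection_mem_subspace_eq_self
      (Submodule.mem_orthogonal_singleton_iff_inner_right.2 (hbo 1 2 (by decide)))
  have hJ2 : J (b 2) = -b 1 := by
    rw [hJ, LinearIsometryEquiv.trans_apply, OrthonormalBasis.equiv_apply_basis,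
      Equiv.swap_apply_right]
    exact Submodule.reflection_orthogonalComplement_singleton_eq_neg (b 1)
  have hJw : J w = w := by rw [hwb, map_smul, hJ0]
  set t : ℝ := inner ℝ (b 1) (T (b 1)) + inner ℝ (b 2) (T (b 2)) with ht
  have htr : t = (∑ i : Fin 3, T (EuclideanSpace.single i 1) i) - inner ℝ w (T w) / ‖w‖ ^ 2 := by
    have h1 := LinearMap.trace_eq_sum_inner (T : E3 →ₗ[ℝ] E3) b
    have h2 := LinearMap.trace_eq_sum_inner (T : E3 →ₗ[ℝ] E3) (EuclideanSpace.basisFun (Fin 3) ℝ)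
    have h3 : inner ℝ w (T w) / ‖w‖ ^ 2 = inner ℝ (b 0) (T (b 0)) := by
      rw [hb0, map_smul, real_inner_smul_left, real_inner_smul_right]
      field_simp
    rw [h3]
    have h4 : (∑ i : Fin 3, T (EuclideanSpace.single i 1) i) =
        ∑ i, inner ℝ (EuclideanSpace.basisFun (Fin 3) ℝ i)
          ((T : E3 →ₗ[ℝ] E3) (EuclideanSpace.basisFun (Fin 3) ℝ i)) := by
      refine Finset.sum_congr rfl fun i _ => ?_
      simp [EuclideanSpace.inner_single_left]
    rw [h4, ← h2, h1, Fin.sum_univ_three, ht]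
    simp only [ContinuousLinearMap.coe_coe]
    ring
  have hquad : ∀ x : E3, inner ℝ (perpProj w x) (T (perpProj w x)) +
      inner ℝ (J (perpProj w x)) (T (J (perpProj w x))) = t * ‖perpProj w x‖ ^ 2 := by
    intro x
    set y := perpProj w x with hy
    have hy0 : inner ℝ (b 0) y = 0 := by
      rw [hb0, real_inner_smul_left, inner_perpProj_left hw0, mul_zero]
    have hyb : y = (inner ℝ (b 1) y : ℝ) • b 1 + (inner ℝ (b 2) y : ℝ) • b 2 := by
      conv_lhs => rw [← b.sum_repr' y]
      rw [Fin.sum_univ_three, hy0, zero_smul, zero_add]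
    set p := inner ℝ (b 1) y
    set q := inner ℝ (b 2) y
    have hJy : J y = p • b 2 - q • b 1 := by
      rw [hyb, map_add, map_smul, map_smul, hJ1, hJ2, smul_neg, sub_eq_add_neg]
    have hny : ‖y‖ ^ 2 = p ^ 2 + q ^ 2 := by
      rw [← b.sum_sq_norm_inner_right y, Fin.sum_univ_three, hy0]
      simp [p, q]
    rw [hJy, hny, hyb]
    simp only [map_add, map_sub, map_smul, inner_add_left, inner_add_right, inner_sub_left,
      inner_sub_right, real_inner_smul_left, real_inner_smul_right, ht]
    ring
  set F : E3 → ℝ := fun x => m ‖perpProj w x‖ * inner ℝ (perpProj w x) (T (perpProj w x)) *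
    inner ℝ w x with hF
  have hPm : Measurable fun x : E3 => perpProj w x := by unfold perpProj; fun_prop
  have hFm : Measurable F := by
    refine ((hm.comp hPm.norm).mul ?_).mul (by fun_prop)
    exact hPm.inner (T.continuous.measurable.comp hPm)
  have hFb : ∀ ν : S2, ‖F ν‖ ≤ C * ‖T‖ * ‖w‖ := by
    intro ν
    have h1 : |inner ℝ w (ν : E3)| ≤ ‖w‖ := by
      simpa using abs_real_inner_le_norm w (ν : E3)
    have h2 : |inner ℝ (perpProj w ν) (T (perpProj w ν))| ≤ ‖T‖ * ‖perpProj w (ν : E3)‖ ^ 2 := by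
      refine (abs_real_inner_le_norm _ _).trans ?_
      have := T.le_opNorm (perpProj w ν)
      nlinarith [norm_nonneg (perpProj w (ν : E3))]
    have h3 := hC ‖perpProj w (ν : E3)‖
    have hC0 : 0 ≤ C := (abs_nonneg _).trans h3
    rw [abs_mul, abs_of_nonneg (sq_nonneg ‖perpProj w (ν : E3)‖)] at h3
    simp only [hF, norm_mul, Real.norm_eq_abs]
    have h4 : |m ‖perpProj w (ν : E3)‖| * |inner ℝ (perpProj w ν) (T (perpProj w ν))| ≤ C * ‖T‖ := by
      calc _ ≤ |m ‖perpProj w (ν : E3)‖| * (‖T‖ * ‖perpProj w (ν : E3)‖ ^ 2) := by gcongr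
        _ = (|m ‖perpProj w (ν : E3)‖| * ‖perpProj w (ν : E3)‖ ^ 2) * ‖T‖ := by ring
        _ ≤ _ := by gcongr
    gcongr
  have hcoe : Measurable fun ν : S2 => (ν : E3) := measurable_subtype_coe
  have hint : IntegrableOn (fun ν : S2 => F ν) (hemisphere v₁ v₂) sphereMeasure :=
    Measure.integrableOn_of_bounded (measure_ne_top _ _)
      (hFm.comp hcoe).aestronglyMeasurable (Eventually.of_forall hFb)
  have hFJ : ∀ x : E3, F (J x) = m ‖perpProj w x‖ *
      inner ℝ (J (perpProj w x)) (T (J (perpProj w x))) * inner ℝ w x := by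
    intro x
    have : inner ℝ w (J x) = inner ℝ w x := by
      conv_lhs => rw [← hJw]
      rw [J.inner_map_map]
    simp only [hF, perpProj_isometry J hJw, J.norm_map, this]
  have hintJ : IntegrableOn (fun ν : S2 => F (J ν)) (hemisphere v₁ v₂) sphereMeasure := by
    refine Measure.integrableOn_of_bounded (M := C * ‖T‖ * ‖w‖) (measure_ne_top _ _)
      ((hFm.comp J.continuous.measurable).comp hcoe).aestronglyMeasurable
      (Eventually.of_forall fun ν => ?_)
    exact hFb ⟨J ν, by simp⟩
  have h1 := integral_hemisphere_comp (v₁ := v₁) (v₂ := v₂) J hJw F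
  have h2 := integral_add hint hintJ
  rw [h1] at h2
  have h3 : ∫ ν in hemisphere v₁ v₂, (F ν + F (J ν)) ∂sphereMeasure =
      t * ∫ ν in hemisphere v₁ v₂, m ‖perpProj w ν‖ * ‖perpProj w (ν : E3)‖ ^ 2 *
        inner ℝ w (ν : E3) ∂sphereMeasure := by
    rw [← integral_const_mul]
    refine integral_congr_ae (Eventually.of_forall fun ν => ?_)
    simp only [hFJ]
    simp only [hF]
    have := hquad ν
    linear_combination (m ‖perpProj w (ν : E3)‖ * inner ℝ w (ν : E3)) * this
  rw [h3] at h2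
  rw [← htr]
  linarith

/-! ### Small deflections -/

open Classical in
/-- The first-order rotation rate `-r φ'(r)` along the straight line with impact parameter `ρ`,
as a function of the angle. -/
def bornRate (φ : ℝ → ℝ) (ρ η : ℝ) : ℝ :=
  if ρ < Real.cos η then -(ρ / Real.cos η * deriv φ (ρ / Real.cos η)) else 0

/-- Half of the deflection angle to first order in the strength of the potential. -/
def bornAngle (φ : ℝ → ℝ) (ρ : ℝ) : ℝ :=
  1 / 2 * ∫ η in Set.Ioo (-(Real.pi / 2)) (Real.pi / 2), bornRate φ ρ η

section Estimates

variable {φ : ℝ → ℝ} {s B κ : ℝ}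

theorem div_cos_mem {ρ η : ℝ} (hρ : 0 < ρ) (h : ρ < Real.cos η) :
    ρ / Real.cos η ∈ Set.Ioo (0 : ℝ) 1 ∧ ρ ≤ ρ / Real.cos η := by
  have hc : 0 < Real.cos η := hρ.trans h
  refine ⟨⟨by positivity, (div_lt_one hc).2 h⟩, ?_⟩
  rw [le_div_iff₀ hc]
  nlinarith [Real.cos_le_one η]

theorem IsRepulsive.born_nonneg (hφ : IsRepulsive φ s B) {r : ℝ} (hr : r ∈ Set.Ioo (0 : ℝ) 1) :
    0 ≤ -(r * deriv φ r) := by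
  have := mul_nonneg hr.1.le (neg_nonneg.2 (hφ.deriv_nonpos r hr))
  linarith

theorem IsRepulsive.born_le (hφ : IsRepulsive φ s B) {r : ℝ} (hr : r ∈ Set.Ioo (0 : ℝ) 1) :
    -(r * deriv φ r) ≤ B * r ^ (-s) := by
  have h1 := hφ.abs_deriv_le r hr
  have h2 := neg_le_abs (deriv φ r)
  have h3 : r ^ (-s) = r * r ^ (-s - 1) := by
    rw [Real.rpow_sub_one hr.1.ne', mul_div_cancel₀ _ hr.1.ne']
  rw [h3]
  nlinarith [hr.1]

theorem IsRepulsive.abs_born_sub_le (hφ : IsRepulsive φ s B) {y r : ℝ} (hy : 0 < y) (hyr : y ≤ r)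
    (hr : r < 1) :
    |-(r * deriv φ r) - -(y * deriv φ y)| ≤ 2 * B * y ^ (-s - 1) * (r - y) := by
  have hd : ∀ x ∈ Set.Icc y r, HasDerivWithinAt (fun x => -(x * deriv φ x))
      (-(1 * deriv φ x + x * deriv (deriv φ) x)) (Set.Icc y r) x := fun x hx =>
    (((hasDerivAt_id x).mul (hφ.differentiableAt_deriv x
      ⟨hy.trans_le hx.1, hx.2.trans_lt hr⟩).hasDerivAt).neg).hasDerivWithinAt
  have hb : ∀ x ∈ Set.Icc y r, ‖-(1 * deriv φ x + x * deriv (deriv φ) x)‖ ≤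
      2 * B * y ^ (-s - 1) := by
    intro x hx
    have hx0 : 0 < x := hy.trans_le hx.1
    have hx' : x ∈ Set.Ioo (0 : ℝ) 1 := ⟨hx0, hx.2.trans_lt hr⟩
    have h1 := hφ.abs_deriv_le x hx'
    have h2 := hφ.abs_deriv_deriv_le x hx'
    have h3 : x * x ^ (-s - 2) = x ^ (-s - 1) := by
      rw [show -s - 1 = -s - 2 + 1 by ring, Real.rpow_add_one hx0.ne']; ring
    have h4 : x ^ (-s - 1) ≤ y ^ (-s - 1) :=
      Real.rpow_le_rpow_of_nonpos hy hx.1 (by linarith [hφ.s_nonneg])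
    have hB := hφ.B_pos
    rw [norm_neg, Real.norm_eq_abs, one_mul]
    calc |deriv φ x + x * deriv (deriv φ) x| ≤ |deriv φ x| + |x * deriv (deriv φ) x| := abs_add_le _ _
      _ ≤ B * x ^ (-s - 1) + x * (B * x ^ (-s - 2)) := by
          rw [abs_mul, abs_of_pos hx0]; gcongr
      _ = 2 * B * x ^ (-s - 1) := by rw [← h3]; ring
      _ ≤ _ := by gcongr
  have := (convex_Icc y r).norm_image_sub_le_of_norm_hasDerivWithin_le hd hb
    (Set.left_mem_Icc.2 hyr) (Set.right_mem_Icc.2 hyr)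
  rwa [Real.norm_eq_abs, Real.norm_eq_abs, abs_of_nonneg (sub_nonneg.2 hyr)] at this

theorem IsRepulsive.turningRadius_lt_one (hφ : IsRepulsive φ s B) (hκ : 0 ≤ κ) {y : ℝ}
    (hy : y ∈ Set.Ioo (0 : ℝ) 1) : turningRadius φ κ y < 1 := by
  obtain ⟨h1, h2⟩ := exists_turningRadius hφ hκ (Set.Ioo_subset_Ioc_self hy)
  refine lt_of_le_of_ne h1.2 fun h => ?_
  rw [h, hφ.eq_zero 1 le_rfl] at h2
  nlinarith [hy.1, hy.2]

theorem IsRepulsive.deflectionRate_mem (hφ : IsRepulsive φ s B) (hκ : 0 ≤ κ) {y : ℝ}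
    (hy : y ∈ Set.Ioo (0 : ℝ) 1) :
    deflectionRate φ κ (turningRadius φ κ y) ∈ Set.Icc (0 : ℝ) 1 := by
  obtain ⟨h1, h2⟩ := exists_turningRadius hφ hκ (Set.Ioo_subset_Ioc_self hy)
  have h3 := hφ.turningRadius_lt_one hκ hy
  set R := turningRadius φ κ y
  have hR : 0 < R := hy.1.trans_le h1.1
  have h4 : 0 < 1 - 2 * κ * φ R := by
    refine pos_of_mul_pos_right (a := R ^ 2) ?_ (sq_nonneg R)
    rw [h2]; exact pow_pos hy.1 2
  have h5 : 0 ≤ κ * -(R * deriv φ R) := mul_nonneg hκ (hφ.born_nonneg ⟨hR, h3⟩)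
  rw [deflectionRate]
  exact ⟨div_nonneg h5 (by linarith), (div_le_one (by linarith)).2 (by linarith)⟩

theorem IsRepulsive.abs_deflectionRate_sub_le (hφ : IsRepulsive φ s B) (hκ : 0 ≤ κ) {y : ℝ}
    (hy : y ∈ Set.Ioo (0 : ℝ) 1) (hq : B * (κ * y ^ (-s)) ≤ 1 / 8) :
    |deflectionRate φ κ (turningRadius φ κ y) - κ * -(y * deriv φ y)| ≤
      8 * (B * (κ * y ^ (-s))) ^ 2 := by
  obtain ⟨h1, h2⟩ := exists_turningRadius hφ hκ (Set.Ioo_subset_Ioc_self hy)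
  have h3 := hφ.turningRadius_lt_one hκ hy
  set R := turningRadius φ κ y
  set q := B * (κ * y ^ (-s)) with hq_def
  have hy0 := hy.1
  have hR : 0 < R := hy0.trans_le h1.1
  have hB := hφ.B_pos
  have hys : 0 < y ^ (-s) := Real.rpow_pos_of_pos hy0 _
  have hq0 : 0 ≤ q := by positivity
  have hRs : R ^ (-s) ≤ y ^ (-s) := Real.rpow_le_rpow_of_nonpos hy0 h1.1 (by linarith [hφ.s_nonneg])
  have hp0 : 0 ≤ κ * φ R := mul_nonneg hκ (hφ.nonneg R hR)
  have hp : κ * φ R ≤ q := calc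
    κ * φ R ≤ κ * (B * R ^ (-s)) := by gcongr; exact hφ.le_rpow R ⟨hR, h3⟩
    _ ≤ κ * (B * y ^ (-s)) := by gcongr
    _ = q := by rw [hq_def]; ring
  have hg0 : 0 ≤ κ * -(R * deriv φ R) := mul_nonneg hκ (hφ.born_nonneg ⟨hR, h3⟩)
  have hg : κ * -(R * deriv φ R) ≤ q := calc
    κ * -(R * deriv φ R) ≤ κ * (B * R ^ (-s)) := by gcongr; exact hφ.born_le ⟨hR, h3⟩
    _ ≤ κ * (B * y ^ (-s)) := by gcongr
    _ = q := by rw [hq_def]; ring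
  have hRy : R - y ≤ 2 * y * q := by
    have e1 : (R - y) * (R + y) = R ^ 2 * (2 * (κ * φ R)) := by linarith
    have e2 : R ^ 2 * (3 / 4) ≤ y ^ 2 := by
      rw [← h2]
      exact mul_le_mul_of_nonneg_left (by linarith) (sq_nonneg R)
    have e3 : (R - y) * (2 * y) ≤ (R - y) * (R + y) :=
      mul_le_mul_of_nonneg_left (by linarith [h1.1]) (by linarith [h1.1])
    have e4 : R ^ 2 * (2 * (κ * φ R)) ≤ (4 / 3 * y ^ 2) * (2 * q) := by
      apply mul_le_mul <;> nlinarith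
    have e5 : (R - y) * (2 * y) ≤ (2 * y * q) * (2 * y) := by nlinarith [mul_nonneg (sq_nonneg y) hq0]
    exact le_of_mul_le_mul_right e5 (by linarith)
  have hgg : |κ * -(R * deriv φ R) - κ * -(y * deriv φ y)| ≤ 4 * q ^ 2 := by
    rw [← mul_sub, abs_mul, abs_of_nonneg hκ]
    calc κ * |-(R * deriv φ R) - -(y * deriv φ y)| ≤ κ * (2 * B * y ^ (-s - 1) * (R - y)) := by
          gcongr; exact hφ.abs_born_sub_le hy0 h1.1 h3
      _ ≤ κ * (2 * B * y ^ (-s - 1) * (2 * y * q)) := by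
          have := Real.rpow_pos_of_pos hy0 (-s - 1)
          gcongr
      _ = 4 * q ^ 2 := by
          rw [Real.rpow_sub_one hy0.ne', sq q]
          conv_rhs => rw [hq_def]
          field_simp
          ring
  have hD : |deflectionRate φ κ R - κ * -(R * deriv φ R)| ≤ 4 * q ^ 2 := by
    rw [deflectionRate]
    set G := κ * -(R * deriv φ R)
    have hDpos : 3 / 4 ≤ 1 - 2 * κ * φ R + G := by linarith
    have e : G / (1 - 2 * κ * φ R + G) - G = G * (2 * (κ * φ R) - G) / (1 - 2 * κ * φ R + G) := by
      field_simp
      ring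
    have e2 : |2 * (κ * φ R) - G| ≤ 3 * q := abs_le.2 ⟨by linarith, by linarith⟩
    rw [e, abs_div, abs_mul, abs_of_nonneg hg0, abs_of_pos (by linarith : 0 < 1 - 2 * κ * φ R + G),
      div_le_iff₀ (by linarith)]
    calc G * |2 * (κ * φ R) - G| ≤ q * (3 * q) := by gcongr
      _ = 4 * q ^ 2 * (3 / 4) := by ring
      _ ≤ _ := by gcongr
  calc _ ≤ |deflectionRate φ κ R - κ * -(R * deriv φ R)| +
      |κ * -(R * deriv φ R) - κ * -(y * deriv φ y)| := abs_sub_le _ _ _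
    _ ≤ 8 * q ^ 2 := by linarith

/-! ### Measurability -/

theorem IsRepulsive.exists_measurable_turningRadius (hφ : IsRepulsive φ s B) :
    ∃ R : ℝ × ℝ → ℝ, Measurable R ∧
      ∀ κ y, 0 ≤ κ → y ∈ Set.Ioc (0 : ℝ) 1 → R (κ, y) = turningRadius φ κ y := by
  classical
  set D : Set (ℝ × ℝ) := {p | 0 ≤ p.1 ∧ 0 < p.2 ∧ p.2 ≤ 1} with hD
  have hDm : MeasurableSet D := by
    refine (measurableSet_le measurable_const measurable_fst).inter
      ((measurableSet_lt measurable_const measurable_snd).inter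
        (measurableSet_le measurable_snd measurable_const))
  refine ⟨D.indicator fun p => turningRadius φ p.1 p.2, ?_, fun κ y hκ hy => ?_⟩
  · refine measurable_of_Iic fun q => ?_
    rcases lt_or_ge q 0 with hq | hq
    · convert MeasurableSet.empty
      ext p
      simp only [Set.mem_preimage, Set.mem_Iic, Set.mem_empty_iff_false, iff_false, not_le]
      refine hq.trans_le (Set.indicator_nonneg (fun p hp => ?_) p)
      exact hp.2.1.le.trans (exists_turningRadius hφ hp.1 hp.2).1.1
    · have hmain : D.indicator (fun p => turningRadius φ p.1 p.2) ⁻¹' Set.Iic q =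
          Dᶜ ∪ (D ∩ {p | 1 ≤ q ∨ p.2 ^ 2 ≤ q ^ 2 * (1 - 2 * p.1 * φ q)}) := by
        ext p
        simp only [Set.mem_preimage, Set.mem_Iic, Set.mem_union, Set.mem_compl_iff,
          Set.mem_inter_iff, Set.mem_ofPred_eq]
        by_cases hp : p ∈ D
        · rw [Set.indicator_of_mem hp]
          simp only [hp, not_true, false_or, true_and]
          have h1 := (exists_turningRadius hφ hp.1 hp.2).1
          rcases le_or_gt 1 q with hq1 | hq1
          · simp only [hq1, true_or, iff_true]
            exact h1.2.trans hq1
          · simp only [not_le.2 hq1, false_or]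
            rcases hq.eq_or_lt with hq0 | hq0
            · rw [← hq0]
              have := hp.2.1
              have h2 : ¬ (turningRadius φ p.1 p.2 ≤ 0) := by linarith [h1.1]
              have h3 : ¬ (p.2 ^ 2 ≤ 0 ^ 2 * (1 - 2 * p.1 * φ 0)) := by
                have := pow_pos this 2
                linarith
              exact iff_of_false h2 h3
            · exact turningRadius_le_iff hφ hp.1 hp.2 ⟨hq0, hq1.le⟩
        · rw [Set.indicator_of_notMem hp]
          simp [hp, hq]
      rw [hmain]
      refine hDm.compl.union (hDm.inter ?_)
      have h1 : MeasurableSet {p : ℝ × ℝ | p.2 ^ 2 ≤ q ^ 2 * (1 - 2 * p.1 * φ q)} :=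
        measurableSet_le (by fun_prop) (by fun_prop)
      exact (MeasurableSet.const (1 ≤ q)).union h1
  · exact Set.indicator_of_mem (show (κ, y) ∈ D from ⟨hκ, hy⟩) _

theorem IsRepulsive.exists_measurable_deflection (hφ : IsRepulsive φ s B) :
    ∃ Θ : ℝ × ℝ → ℝ, Measurable Θ ∧
      ∀ κ ρ, 0 ≤ κ → 0 < ρ → Θ (κ, ρ) = deflection φ κ ρ ∧
        AEStronglyMeasurable (fun η => if ρ < Real.cos η then
          deflectionRate φ κ (turningRadius φ κ (ρ / Real.cos η)) else 0)
          volume := by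
  classical
  obtain ⟨R, hR, hR'⟩ := hφ.exists_measurable_turningRadius
  set φ' : ℝ → ℝ := (Set.Ioi 0).piecewise φ 0 with hφ'
  have hφm : Measurable φ' := by
    exact ContinuousOn.measurable_piecewise hφ.continuousOn continuousOn_const measurableSet_Ioi
  have hdm := measurable_deriv φ
  set G : (ℝ × ℝ) × ℝ → ℝ := fun p =>
    if p.1.2 < Real.cos p.2 then
      p.1.1 * -(R (p.1.1, p.1.2 / Real.cos p.2) * deriv φ (R (p.1.1, p.1.2 / Real.cos p.2))) /
      (1 - 2 * p.1.1 * φ' (R (p.1.1, p.1.2 / Real.cos p.2)) +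
        p.1.1 * -(R (p.1.1, p.1.2 / Real.cos p.2) * deriv φ (R (p.1.1, p.1.2 / Real.cos p.2))))
    else 0 with hG
  have hRm : Measurable fun p : (ℝ × ℝ) × ℝ => R (p.1.1, p.1.2 / Real.cos p.2) :=
    hR.comp (by fun_prop)
  have h1 := hφm.comp hRm
  have h2 := hdm.comp hRm
  simp only [Function.comp_def] at h1 h2
  have hGm : Measurable G := by
    refine Measurable.ite (measurableSet_lt (by fun_prop) (by fun_prop)) ?_ measurable_const
    fun_prop
  have key : ∀ κ ρ, 0 ≤ κ → 0 < ρ → (fun η => if ρ < Real.cos η then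
          deflectionRate φ κ (turningRadius φ κ (ρ / Real.cos η)) else 0) =
          fun η => G ((κ, ρ), η) := by
    intro κ ρ hκ hρ
    ext η
    simp only [hG]
    split_ifs with h
    · obtain ⟨hm, -⟩ := div_cos_mem hρ h
      have hm' := Set.Ioo_subset_Ioc_self hm
      have := (exists_turningRadius hφ hκ hm').1.1
      rw [hR' κ _ hκ hm', deflectionRate, hφ', Set.piecewise_eq_of_mem _ _ _
        (show turningRadius φ κ (ρ / Real.cos η) ∈ Set.Ioi 0 from hm.1.trans_le this)]
    · rfl
  refine ⟨fun p => ∫ η in Set.Ioo (-(Real.pi / 2)) (Real.pi / 2), G (p, η), ?_, ?_⟩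
  · exact (hGm.stronglyMeasurable.integral_prod_right' (f := G)).measurable
  · intro κ ρ hκ hρ
    refine ⟨?_, ?_⟩
    · simp only [deflection]
      congr 1
      have := (key κ ρ hκ hρ).symm
      convert this
    · have h := (hGm.comp (measurable_prodMk_left (x := (κ, ρ)))).aestronglyMeasurable (μ := volume)
      rw [show G ∘ Prod.mk (κ, ρ) = _ from (key κ ρ hκ hρ).symm] at h
      convert h

theorem measurable_bornRate (φ : ℝ → ℝ) : Measurable fun p : ℝ × ℝ => bornRate φ p.1 p.2 := by
  classical
  have h : Measurable fun p : ℝ × ℝ => deriv φ (p.1 / Real.cos p.2) :=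
    (measurable_deriv φ).comp (by fun_prop)
  unfold bornRate
  refine Measurable.ite (measurableSet_lt (by fun_prop) (by fun_prop)) ?_ measurable_const
  fun_prop

theorem measurable_bornAngle (φ : ℝ → ℝ) : Measurable (bornAngle φ) :=
  ((measurable_bornRate φ).stronglyMeasurable.integral_prod_right').measurable.const_mul _

theorem IsRepulsive.bornRate_mem (hφ : IsRepulsive φ s B) {ρ : ℝ} (hρ : 0 < ρ) (η : ℝ) :
    bornRate φ ρ η ∈ Set.Icc 0 (B * ρ ^ (-s)) := by
  have hB := hφ.B_pos
  rw [bornRate]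
  split_ifs with h
  · obtain ⟨hm, hle⟩ := div_cos_mem hρ h
    refine ⟨hφ.born_nonneg hm, (hφ.born_le hm).trans ?_⟩
    have := Real.rpow_le_rpow_of_nonpos hρ hle (neg_nonpos.2 hφ.s_nonneg)
    gcongr
  · exact ⟨le_rfl, by positivity⟩

theorem IsRepulsive.integrableOn_bornRate (hφ : IsRepulsive φ s B) {ρ : ℝ} (hρ : 0 < ρ) :
    IntegrableOn (bornRate φ ρ) (Set.Ioo (-(Real.pi / 2)) (Real.pi / 2)) := by
  refine Measure.integrableOn_of_bounded (M := B * ρ ^ (-s)) (by simp)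
    ((measurable_bornRate φ).comp measurable_prodMk_left).aestronglyMeasurable
    (Eventually.of_forall fun η => ?_)
  have := hφ.bornRate_mem hρ η
  rw [Real.norm_eq_abs, abs_of_nonneg this.1]
  exact this.2

theorem abs_integral_angles_le {F : ℝ → ℝ} {C : ℝ} (h : ∀ η, |F η| ≤ C) :
    |∫ η in Set.Ioo (-(Real.pi / 2)) (Real.pi / 2), F η| ≤ C * Real.pi := by
  have h1 := norm_setIntegral_le_of_norm_le_const (μ := volume)
    (measure_Ioo_lt_top (a := -(Real.pi / 2)) (b := Real.pi / 2)) (f := F) (C := C) fun η _ => h η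
  rwa [Real.volume_real_Ioo_of_le (by linarith [Real.pi_pos]), sub_neg_eq_add, add_halves] at h1

theorem IsRepulsive.bornAngle_mem (hφ : IsRepulsive φ s B) {ρ : ℝ} (hρ : 0 < ρ) :
    bornAngle φ ρ ∈ Set.Icc 0 (2 * B * ρ ^ (-s)) := by
  have hB := hφ.B_pos
  have h0 := Real.rpow_pos_of_pos hρ (-s)
  rw [bornAngle]
  refine ⟨mul_nonneg (by norm_num) (setIntegral_nonneg measurableSet_Ioo
    fun η _ => (hφ.bornRate_mem hρ η).1), ?_⟩
  have : ∫ η in Set.Ioo (-(Real.pi / 2)) (Real.pi / 2), bornRate φ ρ η ≤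
      (B * ρ ^ (-s)) * Real.pi := by
    refine (le_abs_self _).trans ?_
    refine abs_integral_angles_le fun η => ?_
    have := hφ.bornRate_mem hρ η
    rw [abs_of_nonneg this.1]
    exact this.2
  nlinarith [Real.pi_lt_four, mul_pos hB h0]

theorem IsRepulsive.abs_deflection_sub_le (hφ : IsRepulsive φ s B) (hκ : 0 ≤ κ) {ρ : ℝ}
    (hρ : 0 < ρ) (hq : B * (κ * ρ ^ (-s)) ≤ 1 / 8) :
    |deflection φ κ ρ / 2 - κ * bornAngle φ ρ| ≤ 16 * (B * (κ * ρ ^ (-s))) ^ 2 := by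
  classical
  obtain ⟨Θ, -, hΘ⟩ := hφ.exists_measurable_deflection
  have hB := hφ.B_pos
  have h0 := Real.rpow_pos_of_pos hρ (-s)
  have hm := (hΘ κ ρ hκ hρ).2
  have hi : IntegrableOn (fun η => if ρ < Real.cos η then
          deflectionRate φ κ (turningRadius φ κ (ρ / Real.cos η)) else 0)
          (Set.Ioo (-(Real.pi / 2)) (Real.pi / 2)) := by
    refine Measure.integrableOn_of_bounded (M := 1) (by simp) hm
      (Eventually.of_forall fun η => ?_)
    split_ifs with h
    · have := hφ.deflectionRate_mem hκ (div_cos_mem hρ h).1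
      rw [Real.norm_eq_abs, abs_of_nonneg this.1]
      exact this.2
    · simp
  have h1 : deflection φ κ ρ / 2 - κ * bornAngle φ ρ =
      1 / 2 * ∫ η in Set.Ioo (-(Real.pi / 2)) (Real.pi / 2), ((if ρ < Real.cos η then
          deflectionRate φ κ (turningRadius φ κ (ρ / Real.cos η)) else 0) -
            κ * bornRate φ ρ η) := by
    rw [integral_sub hi ((hφ.integrableOn_bornRate hρ).const_mul κ), integral_const_mul, deflection,
      bornAngle]
    have e : ∀ x y z : ℝ, x / 2 - κ * (1 / 2 * z) = 1 / 2 * (x - κ * z) := by intros; ring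
    convert e _ 0 _
  have h2 : |∫ η in Set.Ioo (-(Real.pi / 2)) (Real.pi / 2), ((if ρ < Real.cos η then
          deflectionRate φ κ (turningRadius φ κ (ρ / Real.cos η)) else 0) -
            κ * bornRate φ ρ η)| ≤ 8 * (B * (κ * ρ ^ (-s))) ^ 2 * Real.pi := by
    refine abs_integral_angles_le fun η => ?_
    rw [bornRate]
    split_ifs with h
    · obtain ⟨hm, hle⟩ := div_cos_mem hρ h
      have h3 := Real.rpow_le_rpow_of_nonpos hρ hle (neg_nonpos.2 hφ.s_nonneg)
      have h4 := Real.rpow_pos_of_pos hm.1 (-s)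
      have h5 : B * (κ * (ρ / Real.cos η) ^ (-s)) ≤ B * (κ * ρ ^ (-s)) := by gcongr
      refine (hφ.abs_deflectionRate_sub_le hκ hm (h5.trans hq)).trans ?_
      gcongr
    · rw [mul_zero, sub_zero, abs_zero]; positivity
  rw [h1, abs_mul, abs_of_pos (by norm_num : (0 : ℝ) < 1 / 2)]
  nlinarith [Real.pi_lt_four, sq_nonneg (B * (κ * ρ ^ (-s)))]

theorem sq_sub_sin_sq_le {b : ℝ} (hb : 0 ≤ b) (hb1 : b ≤ 1) : |Real.sin b ^ 2 - b ^ 2| ≤ b ^ 3 := by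
  rcases hb.eq_or_lt with rfl | hb0
  · simp
  have h1 := Real.sin_le hb
  have h2 := Real.sin_gt_sub_cube hb0
  have h3 : 0 ≤ Real.sin b := Real.sin_nonneg_of_nonneg_of_le_pi hb (by linarith [Real.pi_gt_three])
  rw [abs_le]
  constructor
  · have : b ^ 2 - Real.sin b ^ 2 ≤ b ^ 3 / 6 * (2 * b) := by
      rw [sq_sub_sq, mul_comm]
      apply mul_le_mul <;> linarith
    nlinarith [pow_pos hb0 3]
  · nlinarith [pow_pos hb0 3]

/-- The deflection at second order, uniformly down to the strongly deflected particles. -/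
theorem IsRepulsive.exists_sin_bounds (hφ : IsRepulsive φ s B) :
    ∃ C : ℝ, 0 ≤ C ∧ ∀ κ ρ, 0 ≤ κ → 0 < ρ →
      |Real.sin (deflection φ κ ρ / 2) ^ 2 - (κ * bornAngle φ ρ) ^ 2| ≤
        C * (κ * ρ ^ (-s)) ^ 2 * min 1 (κ * ρ ^ (-s)) ∧
      |Real.sin (deflection φ κ ρ / 2)| ^ 3 ≤ C * (κ * ρ ^ (-s)) ^ 2 * min 1 (κ * ρ ^ (-s)) := by
  have hB := hφ.B_pos
  have hbig : ∃ C₁ : ℝ, 0 ≤ C₁ ∧ ∀ q : ℝ, 0 ≤ q → 1 / 8 < B * q →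
      1 + (2 * (B * q)) ^ 2 ≤ C₁ * q ^ 2 * min 1 q := by
    refine ⟨68 * B ^ 2 * (1 + 8 * B), by positivity, fun q hq h => ?_⟩
    have h1 : 1 ≤ (1 + 8 * B) * min 1 q := by
      rcases le_total 1 q with h' | h'
      · rw [min_eq_left h']; linarith
      · rw [min_eq_right h']; nlinarith
    have h2 : 1 ≤ 64 * (B * q) ^ 2 := by nlinarith
    calc 1 + (2 * (B * q)) ^ 2 ≤ 68 * B ^ 2 * q ^ 2 * 1 := by nlinarith
      _ ≤ 68 * B ^ 2 * q ^ 2 * ((1 + 8 * B) * min 1 q) := by gcongr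
      _ = _ := by ring
  have hsmall : ∃ C₂ : ℝ, 0 ≤ C₂ ∧ ∀ q : ℝ, 0 ≤ q → B * q ≤ 1 / 8 →
      200 * (B * q) ^ 3 ≤ C₂ * q ^ 2 * min 1 q := by
    refine ⟨200 * B ^ 3 * (1 + 1 / (8 * B)), by positivity, fun q hq h => ?_⟩
    have h1 : q ≤ (1 + 1 / (8 * B)) * min 1 q := by
      rcases le_total 1 q with h' | h'
      · rw [min_eq_left h']
        have : q ≤ 1 / (8 * B) := by
          rw [le_div_iff₀ (by positivity)]; linarith
        linarith
      · rw [min_eq_right h']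
        have : 0 ≤ 1 / (8 * B) := by positivity
        nlinarith
    calc 200 * (B * q) ^ 3 = 200 * B ^ 3 * q ^ 2 * q := by ring
      _ ≤ 200 * B ^ 3 * q ^ 2 * ((1 + 1 / (8 * B)) * min 1 q) := by gcongr
      _ = _ := by ring
  obtain ⟨C₁, hC₁, h₁⟩ := hbig
  obtain ⟨C₂, hC₂, h₂⟩ := hsmall
  refine ⟨C₁ + C₂, by positivity, fun κ ρ hκ hρ => ?_⟩
  have h0 := Real.rpow_pos_of_pos hρ (-s)
  set q := κ * ρ ^ (-s) with hq
  have hq0 : 0 ≤ q := by positivity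
  obtain ⟨hX0, hX1⟩ := hφ.bornAngle_mem hρ
  set b := κ * bornAngle φ ρ
  set a := deflection φ κ ρ / 2
  have hb0 : 0 ≤ b := mul_nonneg hκ hX0
  have hb1 : b ≤ 2 * (B * q) := by
    calc b ≤ κ * (2 * B * ρ ^ (-s)) := mul_le_mul_of_nonneg_left hX1 hκ
      _ = _ := by rw [hq]; ring
  have hmin : 0 ≤ min 1 q := le_min zero_le_one hq0
  have hm : 0 ≤ q ^ 2 * min 1 q := by positivity
  rcases lt_or_ge (1 / 8) (B * q) with hlt | hle
  · have h3 := h₁ q hq0 hlt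
    have h4 : C₁ * q ^ 2 * min 1 q ≤ (C₁ + C₂) * q ^ 2 * min 1 q := by
      have := mul_nonneg hC₂ hm
      linarith
    have hs := Real.sin_sq_le_one a
    have hs' := Real.abs_sin_le_one a
    constructor
    · have hbb : b ^ 2 ≤ (2 * (B * q)) ^ 2 := by gcongr
      rw [abs_le]
      constructor <;> nlinarith [sq_nonneg (Real.sin a), sq_nonneg b]
    · have : |Real.sin a| ^ 3 ≤ 1 := pow_le_one₀ (abs_nonneg _) hs'
      nlinarith [sq_nonneg (2 * (B * q))]
  · have h3 := h₂ q hq0 hle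
    have h4 : C₂ * q ^ 2 * min 1 q ≤ (C₁ + C₂) * q ^ 2 * min 1 q := by
      have := mul_nonneg hC₁ hm
      linarith
    have hd : |a - b| ≤ 16 * (B * q) ^ 2 := hφ.abs_deflection_sub_le hκ hρ hle
    have hBq : 0 ≤ B * q := by positivity
    have hd2 : 16 * (B * q) ^ 2 ≤ 2 * (B * q) := by nlinarith
    have ha : |a| ≤ 4 * (B * q) := by
      have := abs_sub_abs_le_abs_sub a b
      rw [abs_of_nonneg hb0] at this
      linarith
    have hsa : |Real.sin a| ≤ 4 * (B * q) := Real.abs_sin_le_abs.trans ha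
    constructor
    · have e1 : |Real.sin a ^ 2 - Real.sin b ^ 2| ≤ 16 * (B * q) ^ 2 * (6 * (B * q)) := by
        have e2 : |Real.sin a - Real.sin b| ≤ |a - b| := by
          have := Real.lipschitzWith_sin.dist_le_mul a b
          simpa [Real.dist_eq] using this
        have e3 : |Real.sin b| ≤ 2 * (B * q) := by
          refine Real.abs_sin_le_abs.trans ?_
          rwa [abs_of_nonneg hb0]
        rw [sq_sub_sq, abs_mul, mul_comm]
        have e4 := abs_add_le (Real.sin a) (Real.sin b)
        apply mul_le_mul <;> first | positivity | linarith
      have e5 := sq_sub_sin_sq_le hb0 (by linarith)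
      have e6 : b ^ 3 ≤ (2 * (B * q)) ^ 3 := by gcongr
      have e7 := abs_sub_le (Real.sin a ^ 2) (Real.sin b ^ 2) (b ^ 2)
      nlinarith [pow_nonneg hBq 3]
    · have : |Real.sin a| ^ 3 ≤ (4 * (B * q)) ^ 3 := by gcongr
      nlinarith [pow_nonneg hBq 3]

end Estimates

/-! ### Moments of the deflection -/

/-- `∫₀¹ |sin(θ/2)|ⁿ ρ dρ`, where `θ` is the deflection angle at the impact parameter `ρ`. -/
def deflectionMoment (φ : ℝ → ℝ) (κ : ℝ) (n : ℕ) : ℝ :=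
  ∫ ρ in Set.Ioo (0 : ℝ) 1, |Real.sin (deflection φ κ ρ / 2)| ^ n * ρ

section Moments

variable {φ : ℝ → ℝ} {s B κ : ℝ}

theorem IsRepulsive.deriv_eq_zero (hφ : IsRepulsive φ s B) {r : ℝ} (hr : 1 ≤ r) :
    deriv φ r = 0 := by
  by_cases h : DifferentiableAt ℝ φ r
  · have h1 := h.hasDerivAt.hasDerivWithinAt (s := Set.Ici r)
    have h2 : HasDerivWithinAt φ 0 (Set.Ici r) r :=
      (hasDerivWithinAt_const r (Set.Ici r) 0).congr
        (fun x hx => hφ.eq_zero x (hr.trans hx)) (hφ.eq_zero r hr)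
    exact (uniqueDiffWithinAt_Ici r).eq_deriv _ h1 h2
  · exact deriv_zero_of_not_differentiableAt h

theorem IsRepulsive.bornRate_eq (hφ : IsRepulsive φ s B) {ρ η : ℝ} (hη : 0 < Real.cos η) :
    bornRate φ ρ η = -(ρ / Real.cos η * deriv φ (ρ / Real.cos η)) := by
  rw [bornRate]
  split_ifs with h
  · rfl
  · rw [hφ.deriv_eq_zero ((one_le_div hη).2 (not_lt.1 h)), mul_zero, neg_zero]

theorem bornRate_abs (φ : ℝ → ℝ) (ρ η : ℝ) : bornRate φ ρ |η| = bornRate φ ρ η := by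
  rw [bornRate, bornRate, Real.cos_abs]

theorem bornAngle_eq_integral_half (φ : ℝ → ℝ) (ρ : ℝ) :
    bornAngle φ ρ = ∫ η in Set.Ioo 0 (Real.pi / 2), bornRate φ ρ η := by
  classical
  have h := integral_comp_abs (f := (Set.Iio (Real.pi / 2)).indicator (bornRate φ ρ))
  rw [setIntegral_indicator measurableSet_Iio, Set.Ioi_inter_Iio] at h
  rw [bornAngle, ← integral_indicator measurableSet_Ioo]
  have e : ∀ x, (Set.Iio (Real.pi / 2)).indicator (bornRate φ ρ) |x| =
      (Set.Ioo (-(Real.pi / 2)) (Real.pi / 2)).indicator (bornRate φ ρ) x := fun x => by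
    simp only [Set.indicator_apply, Set.mem_Iio, Set.mem_Ioo, abs_lt, bornRate_abs]
  simp only [e] at h
  rw [h]
  ring

theorem IsRepulsive.integral_eq_neg_bornAngle (hφ : IsRepulsive φ s B) (ρ : ℝ) :
    ∫ u in (0 : ℝ)..1, ρ / u * deriv φ (ρ / u) / √(1 - u ^ 2) = -bornAngle φ ρ := by
  have himg : Real.cos '' Set.Ioo 0 (Real.pi / 2) = Set.Ioo 0 1 := by
    apply Set.Subset.antisymm
    · rintro _ ⟨η, hη, rfl⟩
      refine ⟨Real.cos_pos_of_mem_Ioo ⟨by linarith [hη.1, Real.pi_pos], hη.2⟩, ?_⟩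
      rw [← Real.cos_zero]
      exact Real.cos_lt_cos_of_nonneg_of_le_pi_div_two le_rfl hη.2.le hη.1
    · intro u hu
      exact ⟨Real.arccos u, ⟨Real.arccos_pos.2 hu.2, Real.arccos_lt_pi_div_two.2 hu.1⟩,
        Real.cos_arccos (by linarith [hu.1]) hu.2.le⟩
  have hcv := integral_image_eq_integral_abs_deriv_smul (s := Set.Ioo 0 (Real.pi / 2))
    (f := Real.cos) (f' := fun η => -Real.sin η) measurableSet_Ioo
    (fun η _ => (Real.hasDerivAt_cos η).hasDerivWithinAt)
    (Real.injOn_cos.mono fun η (hη : η ∈ Set.Ioo 0 (Real.pi / 2)) => Set.mem_Icc.2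
      ⟨hη.1.le, by linarith [hη.2, Real.pi_pos]⟩)
    (fun u => ρ / u * deriv φ (ρ / u) / √(1 - u ^ 2))
  rw [himg] at hcv
  rw [intervalIntegral.integral_of_le zero_le_one, integral_Ioc_eq_integral_Ioo, hcv,
    bornAngle_eq_integral_half, ← integral_neg]
  refine setIntegral_congr_fun measurableSet_Ioo fun η hη => ?_
  have hs : 0 < Real.sin η := Real.sin_pos_of_pos_of_lt_pi hη.1 (by linarith [hη.2, Real.pi_pos])
  have hc : 0 < Real.cos η := Real.cos_pos_of_mem_Ioo ⟨by linarith [hη.1, Real.pi_pos], hη.2⟩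
  rw [hφ.bornRate_eq hc, ← Real.sin_sq, Real.sqrt_sq hs.le, abs_neg, abs_of_pos hs, smul_eq_mul, neg_neg,
    mul_div_cancel₀ _ hs.ne']

theorem IsRepulsive.integrableOn_bornAngle_sq (hφ : IsRepulsive φ s B) (hs : s < 1) :
    IntegrableOn (fun ρ => bornAngle φ ρ ^ 2 * ρ) (Set.Ioo 0 1) := by
  have hi : IntegrableOn (fun ρ : ℝ => (2 * B) ^ 2 * ρ ^ (1 - 2 * s)) (Set.Ioo 0 1) :=
    ((intervalIntegral.integrableOn_Ioo_rpow_iff zero_lt_one).2 (by linarith)).const_mul _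
  refine hi.mono' (((measurable_bornAngle φ).pow_const 2).mul measurable_id).aestronglyMeasurable
    ((ae_restrict_iff' measurableSet_Ioo).2 (Eventually.of_forall fun ρ hρ => ?_))
  obtain ⟨h0, h1⟩ := hφ.bornAngle_mem hρ.1
  have h2 : ρ ^ (1 - 2 * s) = (ρ ^ (-s)) ^ 2 * ρ := by
    rw [show 1 - 2 * s = -s + -s + 1 by ring, Real.rpow_add_one hρ.1.ne', Real.rpow_add hρ.1, sq]
  have hρ0 := hρ.1
  rw [Real.norm_eq_abs, abs_of_nonneg (by positivity), h2, ← mul_assoc, ← mul_pow]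
  gcongr

theorem IsRepulsive.exists_deriv_neg (hφ : IsRepulsive φ s B) (hpos : ∃ r ∈ Set.Ioo (0 : ℝ) 1, 0 < φ r) :
    ∃ r ∈ Set.Ioo (0 : ℝ) 1, deriv φ r < 0 := by
  obtain ⟨r, hr, h⟩ := hpos
  obtain ⟨x, hx, hx'⟩ := exists_deriv_eq_slope φ hr.2
    (hφ.continuousOn.mono fun x hx => hr.1.trans_le hx.1)
    (fun x hx => (hφ.differentiableAt x ⟨hr.1.trans hx.1, hx.2⟩).differentiableWithinAt)
  refine ⟨x, ⟨hr.1.trans hx.1, hx.2⟩, ?_⟩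
  rw [hx', hφ.eq_zero 1 le_rfl]
  exact div_neg_of_neg_of_pos (by linarith) (by linarith [hr.2])

theorem IsRepulsive.integral_bornAngle_sq_pos (hφ : IsRepulsive φ s B) (hs : s < 1)
    (hpos : ∃ r ∈ Set.Ioo (0 : ℝ) 1, 0 < φ r) :
    0 < ∫ ρ in Set.Ioo (0 : ℝ) 1, bornAngle φ ρ ^ 2 * ρ := by
  obtain ⟨r, hr, hr'⟩ := hφ.exists_deriv_neg hpos
  have hev : ∀ᶠ x in 𝓝 r, deriv φ x < 0 ∧ x ∈ Set.Ioo (0 : ℝ) 1 :=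
    ((hφ.differentiableAt_deriv r hr).continuousAt.eventually_lt continuousAt_const hr').and
      (Ioo_mem_nhds hr.1 hr.2)
  obtain ⟨a, b, hab, hsub⟩ := mem_nhds_iff_exists_Ioo_subset.1 hev
  have hposX : ∀ ρ ∈ Set.Ioo a b, 0 < bornAngle φ ρ := by
    intro ρ hρ
    have hρ' := (hsub hρ).2
    rw [bornAngle]
    refine mul_pos (by norm_num) ((setIntegral_pos_iff_support_of_nonneg_ae
      (Eventually.of_forall fun η => (hφ.bornRate_mem hρ'.1 η).1)
      (hφ.integrableOn_bornRate hρ'.1)).2 ?_)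
    have hlim : ∀ᶠ η in 𝓝 (0 : ℝ), ρ / Real.cos η ∈ Set.Ioo a b ∧ 0 < Real.cos η ∧
        η ∈ Set.Ioo (-(Real.pi / 2)) (Real.pi / 2) := by
      have hc : ContinuousAt (fun η => ρ / Real.cos η) 0 :=
        continuousAt_const.div Real.continuous_cos.continuousAt (by simp)
      refine (hc.eventually_mem ?_).and ((continuousAt_const.eventually_lt
        Real.continuous_cos.continuousAt (by simp)).and
          (Ioo_mem_nhds (by linarith [Real.pi_pos]) (by linarith [Real.pi_pos])))
      rw [Real.cos_zero, div_one]
      exact Ioo_mem_nhds hρ.1 hρ.2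
    refine lt_of_lt_of_le (Measure.measure_pos_of_mem_nhds volume hlim) (measure_mono ?_)
    intro η hη
    obtain ⟨h1, h2, h3⟩ := hη
    refine ⟨?_, h3⟩
    have h4 := hsub h1
    rw [Function.mem_support, hφ.bornRate_eq h2]
    exact (neg_pos.2 (mul_neg_of_pos_of_neg h4.2.1 h4.1)).ne'
  refine (setIntegral_pos_iff_support_of_nonneg_ae ?_ (hφ.integrableOn_bornAngle_sq hs)).2 ?_
  · exact (ae_restrict_iff' measurableSet_Ioo).2 (Eventually.of_forall fun ρ hρ =>
      mul_nonneg (sq_nonneg _) hρ.1.le)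
  · have : 0 < volume (Set.Ioo a b) := by
      rw [Real.volume_Ioo, ENNReal.ofReal_pos]
      linarith [hab.1, hab.2]
    refine this.trans_le (measure_mono fun ρ hρ => ?_)
    have h1 := (hsub hρ).2
    exact ⟨(mul_pos (pow_pos (hposX ρ hρ) 2) h1.1).ne', h1⟩

theorem IsRepulsive.integrableOn_moment (hφ : IsRepulsive φ s B) (hκ : 0 ≤ κ) (n : ℕ) :
    IntegrableOn (fun ρ => |Real.sin (deflection φ κ ρ / 2)| ^ n * ρ) (Set.Ioo 0 1) := by
  obtain ⟨Θ, hm, hΘ⟩ := hφ.exists_measurable_deflection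
  have hm' : Measurable fun ρ : ℝ => |Real.sin (Θ (κ, ρ) / 2)| ^ n * ρ := by
    have := hm.comp (measurable_prodMk_left (x := κ))
    simp only [Function.comp_def] at this
    fun_prop
  have h : IntegrableOn (fun ρ : ℝ => |Real.sin (Θ (κ, ρ) / 2)| ^ n * ρ) (Set.Ioo 0 1) := by
    refine Measure.integrableOn_of_bounded (M := 1) (by simp) hm'.aestronglyMeasurable
      ((ae_restrict_iff' measurableSet_Ioo).2 (Eventually.of_forall fun ρ hρ => ?_))
    have h1 : |Real.sin (Θ (κ, ρ) / 2)| ^ n ≤ 1 := pow_le_one₀ (abs_nonneg _) (Real.abs_sin_le_one _)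
    have h2 : 0 ≤ |Real.sin (Θ (κ, ρ) / 2)| ^ n := by positivity
    rw [Real.norm_eq_abs, abs_of_nonneg (mul_nonneg h2 hρ.1.le)]
    nlinarith [hρ.1, hρ.2]
  refine h.congr_fun (fun ρ hρ => ?_) measurableSet_Ioo
  simp only [(hΘ κ ρ hκ hρ.1).1]

theorem deflectionMoment_mem (φ : ℝ → ℝ) (κ : ℝ) (n : ℕ) :
    deflectionMoment φ κ n ∈ Set.Icc (0 : ℝ) 1 := by
  have hnn : 0 ≤ deflectionMoment φ κ n := setIntegral_nonneg measurableSet_Ioo fun ρ hρ =>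
    mul_nonneg (by positivity) hρ.1.le
  refine ⟨hnn, ?_⟩
  have h : ‖deflectionMoment φ κ n‖ ≤ 1 * volume.real (Set.Ioo (0 : ℝ) 1) := by
    refine norm_setIntegral_le_of_norm_le_const measure_Ioo_lt_top fun ρ hρ => ?_
    have h1 : |Real.sin (deflection φ κ ρ / 2)| ^ n ≤ 1 :=
      pow_le_one₀ (abs_nonneg _) (Real.abs_sin_le_one _)
    have h2 : 0 ≤ |Real.sin (deflection φ κ ρ / 2)| ^ n := by positivity
    rw [Real.norm_eq_abs, abs_of_nonneg (mul_nonneg h2 hρ.1.le)]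
    nlinarith [hρ.1, hρ.2]
  rw [Real.norm_eq_abs, abs_of_nonneg hnn] at h
  simpa using h

theorem min_one_le_rpow {q γ : ℝ} (hq : 0 ≤ q) (hγ0 : 0 ≤ γ) (hγ1 : γ ≤ 1) : min 1 q ≤ q ^ γ := by
  rcases le_total 1 q with h | h
  · rw [min_eq_left h]; exact Real.one_le_rpow h hγ0
  · rw [min_eq_right h]
    calc q = q ^ (1 : ℝ) := (Real.rpow_one q).symm
      _ ≤ q ^ γ := Real.rpow_le_rpow_of_exponent_ge' hq h hγ0 hγ1

theorem IsRepulsive.exists_moment_bound (hφ : IsRepulsive φ s B) (hs : s < 1) :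
    ∃ C : ℝ, 0 ≤ C ∧ ∀ κ, 0 ≤ κ →
      |deflectionMoment φ κ 2 - κ ^ 2 * ∫ ρ in Set.Ioo (0 : ℝ) 1, bornAngle φ ρ ^ 2 * ρ| ≤
        C * κ ^ 2 * κ ^ ((1 - s) / 2) ∧
      deflectionMoment φ κ 3 ≤ C * κ ^ 2 * κ ^ ((1 - s) / 2) := by
  obtain ⟨C, hC, hb⟩ := hφ.exists_sin_bounds
  set γ := (1 - s) / 2 with hγ
  have hs0 := hφ.s_nonneg
  have hi : IntegrableOn (fun ρ : ℝ => ρ ^ (1 - 2 * s - s * γ)) (Set.Ioo 0 1) :=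
    (intervalIntegral.integrableOn_Ioo_rpow_iff zero_lt_one).2 (by rw [hγ]; nlinarith)
  set I := ∫ ρ in Set.Ioo (0 : ℝ) 1, ρ ^ (1 - 2 * s - s * γ) with hI
  have hI0 : 0 ≤ I := setIntegral_nonneg measurableSet_Ioo fun ρ hρ => Real.rpow_nonneg hρ.1.le _
  refine ⟨C * I, by positivity, fun κ hκ => ?_⟩
  have hdom : ∀ ρ ∈ Set.Ioo (0 : ℝ) 1, C * (κ * ρ ^ (-s)) ^ 2 * min 1 (κ * ρ ^ (-s)) * ρ ≤
      C * κ ^ 2 * κ ^ γ * ρ ^ (1 - 2 * s - s * γ) := by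
    intro ρ hρ
    have hρ0 := hρ.1
    have h0 := Real.rpow_pos_of_pos hρ.1 (-s)
    have h1 := min_one_le_rpow (q := κ * ρ ^ (-s)) (γ := γ) (by positivity) (by linarith)
      (by linarith)
    have h2 : ρ ^ (1 - 2 * s - s * γ) = (ρ ^ (-s)) ^ 2 * (ρ ^ (-s)) ^ γ * ρ := by
      rw [show 1 - 2 * s - s * γ = -s + -s + -s * γ + 1 by ring, Real.rpow_add_one hρ.1.ne',
        Real.rpow_add hρ.1, Real.rpow_add hρ.1, Real.rpow_mul hρ.1.le, sq]
    calc C * (κ * ρ ^ (-s)) ^ 2 * min 1 (κ * ρ ^ (-s)) * ρ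
        ≤ C * (κ * ρ ^ (-s)) ^ 2 * (κ * ρ ^ (-s)) ^ γ * ρ := by gcongr
      _ = _ := by rw [h2, Real.mul_rpow hκ h0.le]; ring
  have hdi : IntegrableOn (fun ρ : ℝ => C * κ ^ 2 * κ ^ γ * ρ ^ (1 - 2 * s - s * γ))
      (Set.Ioo 0 1) := hi.const_mul _
  have hval : ∫ ρ in Set.Ioo (0 : ℝ) 1, C * κ ^ 2 * κ ^ γ * ρ ^ (1 - 2 * s - s * γ) =
      C * I * κ ^ 2 * κ ^ γ := by rw [integral_const_mul]; ring
  constructor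
  · rw [deflectionMoment, ← integral_const_mul,
      ← integral_sub (hφ.integrableOn_moment hκ 2) ((hφ.integrableOn_bornAngle_sq hs).const_mul _),
      ← hval, ← Real.norm_eq_abs]
    refine norm_integral_le_of_norm_le hdi ((ae_restrict_iff' measurableSet_Ioo).2
      (Eventually.of_forall fun ρ hρ => ?_))
    refine le_trans ?_ (hdom ρ hρ)
    have := (hb κ ρ hκ hρ.1).1
    rw [sq_abs, Real.norm_eq_abs, show Real.sin (deflection φ κ ρ / 2) ^ 2 * ρ -
      κ ^ 2 * (bornAngle φ ρ ^ 2 * ρ) = (Real.sin (deflection φ κ ρ / 2) ^ 2 -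
        (κ * bornAngle φ ρ) ^ 2) * ρ by ring, abs_mul, abs_of_pos hρ.1]
    exact mul_le_mul_of_nonneg_right this hρ.1.le
  · rw [deflectionMoment, ← hval]
    refine setIntegral_mono_on (hφ.integrableOn_moment hκ 3) hdi measurableSet_Ioo fun ρ hρ => ?_
    exact (mul_le_mul_of_nonneg_right (hb κ ρ hκ hρ.1).2 hρ.1.le).trans (hdom ρ hρ)

theorem IsRepulsive.abs_bornAngle_sub_le (hφ : IsRepulsive φ 1 B) {a A : ℝ} (ha : 0 ≤ a) (hA : 0 ≤ A)
    (h : ∀ r ∈ Set.Ioo (0 : ℝ) 1, |r * deriv φ r + a / r| ≤ A) {ρ : ℝ} (hρ : 0 < ρ) :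
    |bornAngle φ ρ - a / ρ| ≤ 2 * (a + A) := by
  have hcos : ∫ η in Set.Ioo (-(Real.pi / 2)) (Real.pi / 2), Real.cos η = 2 := by
    rw [← integral_Ioc_eq_integral_Ioo, ← intervalIntegral.integral_of_le
      (by linarith [Real.pi_pos]), integral_cos]
    simp; norm_num
  have hci : IntegrableOn Real.cos (Set.Ioo (-(Real.pi / 2)) (Real.pi / 2)) :=
    (Real.continuous_cos.integrableOn_Icc).mono_set Set.Ioo_subset_Icc_self
  have e : bornAngle φ ρ - a / ρ = 1 / 2 * ∫ η in Set.Ioo (-(Real.pi / 2)) (Real.pi / 2),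
      (bornRate φ ρ η - a / ρ * Real.cos η) := by
    rw [integral_sub (hφ.integrableOn_bornRate hρ) (hci.const_mul _), integral_const_mul, hcos,
      bornAngle]
    ring
  have hb : |∫ η in Set.Ioo (-(Real.pi / 2)) (Real.pi / 2),
      (bornRate φ ρ η - a / ρ * Real.cos η)| ≤ (a + A) * Real.pi := by
    have h1 := norm_setIntegral_le_of_norm_le_const (μ := volume)
      (measure_Ioo_lt_top (a := -(Real.pi / 2)) (b := Real.pi / 2))
      (f := fun η => bornRate φ ρ η - a / ρ * Real.cos η) (C := a + A) fun η hη => ?_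
    · rwa [Real.volume_real_Ioo_of_le (by linarith [Real.pi_pos]), sub_neg_eq_add, add_halves] at h1
    · have hc := Real.cos_pos_of_mem_Ioo hη
      rw [Real.norm_eq_abs, bornRate]
      split_ifs with hlt
      · have h2 := h _ (div_cos_mem hρ hlt).1
        rw [show a / (ρ / Real.cos η) = a / ρ * Real.cos η by field_simp] at h2
        rw [← abs_neg]
        refine le_trans (le_of_eq ?_) (h2.trans (by linarith))
        congr 1; ring
      · rw [zero_sub, abs_neg, abs_of_nonneg (by positivity)]
        have : a / ρ * Real.cos η ≤ a / ρ * ρ := by gcongr; exact not_lt.1 hlt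
        rw [div_mul_cancel₀ _ hρ.ne'] at this
        linarith
  rw [e, abs_mul, abs_of_pos (by norm_num : (0 : ℝ) < 1 / 2)]
  nlinarith [Real.pi_lt_four]

theorem IsRepulsive.exists_coulomb_moment_bound (hφ : IsRepulsive φ 1 B) {a A : ℝ} (ha : 0 ≤ a)
    (hA : 0 ≤ A) (h : ∀ r ∈ Set.Ioo (0 : ℝ) 1, |r * deriv φ r + a / r| ≤ A) :
    ∃ C : ℝ, 0 ≤ C ∧ ∀ κ, 0 < κ → κ ≤ 1 →
      |deflectionMoment φ κ 2 - a ^ 2 * κ ^ 2 * -Real.log κ| ≤ C * κ ^ 2 ∧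
      deflectionMoment φ κ 3 ≤ C * κ ^ 2 := by
  obtain ⟨C, hC, hb⟩ := hφ.exists_sin_bounds
  set D := 2 * (a + A) * (2 * a + 2 * (a + A)) with hD
  have hD0 : 0 ≤ D := by positivity
  refine ⟨1 + C + D, by positivity, fun κ hκ hκ1 => ?_⟩
  have hI : ∀ n, IntervalIntegrable (fun ρ => |Real.sin (deflection φ κ ρ / 2)| ^ n * ρ) volume 0 1 :=
    fun n => by
      rw [intervalIntegrable_iff_integrableOn_Ioo_of_le zero_le_one]
      exact hφ.integrableOn_moment hκ.le n
  have hsub : ∀ n, IntervalIntegrable (fun ρ => |Real.sin (deflection φ κ ρ / 2)| ^ n * ρ) volume 0 κ ∧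
      IntervalIntegrable (fun ρ => |Real.sin (deflection φ κ ρ / 2)| ^ n * ρ) volume κ 1 := fun n =>
    ⟨(hI n).mono_set (Set.uIcc_subset_uIcc_left (by rw [Set.uIcc_of_le zero_le_one]; exact ⟨hκ.le, hκ1⟩)),
     (hI n).mono_set (Set.uIcc_subset_uIcc_right (by rw [Set.uIcc_of_le zero_le_one]; exact ⟨hκ.le, hκ1⟩))⟩
  have hsplit : ∀ n, deflectionMoment φ κ n = (∫ ρ in (0 : ℝ)..κ, |Real.sin (deflection φ κ ρ / 2)| ^ n * ρ) +
      ∫ ρ in κ..1, |Real.sin (deflection φ κ ρ / 2)| ^ n * ρ := fun n => by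
    rw [intervalIntegral.integral_add_adjacent_intervals (hsub n).1 (hsub n).2, deflectionMoment,
      intervalIntegral.integral_of_le zero_le_one, integral_Ioc_eq_integral_Ioo]
  have hsmall : ∀ n, |∫ ρ in (0 : ℝ)..κ, |Real.sin (deflection φ κ ρ / 2)| ^ n * ρ| ≤ κ ^ 2 := fun n => by
    have := intervalIntegral.norm_integral_le_of_norm_le_const (a := 0) (b := κ) (C := κ)
      (f := fun ρ => |Real.sin (deflection φ κ ρ / 2)| ^ n * ρ) fun ρ hρ => ?_
    · rw [sub_zero, abs_of_pos hκ, ← sq] at this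
      exact this
    · rw [Set.uIoc_of_le hκ.le] at hρ
      have h1 : |Real.sin (deflection φ κ ρ / 2)| ^ n ≤ 1 :=
        pow_le_one₀ (abs_nonneg _) (Real.abs_sin_le_one _)
      have h2 : 0 ≤ |Real.sin (deflection φ κ ρ / 2)| ^ n := by positivity
      rw [Real.norm_eq_abs, abs_of_nonneg (mul_nonneg h2 hρ.1.le)]
      nlinarith [hρ.1, hρ.2]
  have hne : ∀ ρ ∈ Set.uIcc κ 1, ρ ≠ 0 := fun ρ hρ => by
    rw [Set.uIcc_of_le hκ1] at hρ
    exact (hκ.trans_le hρ.1).ne'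
  have hci : IntervalIntegrable (fun ρ : ℝ => C * κ ^ 3 * (ρ ^ 2)⁻¹) volume κ 1 := by
    apply ContinuousOn.intervalIntegrable
    exact continuousOn_const.mul ((continuous_pow 2).continuousOn.inv₀ fun ρ hρ => pow_ne_zero 2 (hne ρ hρ))
  have hcv : ∫ ρ in κ..1, C * κ ^ 3 * (ρ ^ 2)⁻¹ ≤ C * κ ^ 2 := by
    have hd : ∀ ρ ∈ Set.uIcc κ 1, HasDerivAt (fun ρ : ℝ => -(C * κ ^ 3 * ρ⁻¹)) (C * κ ^ 3 * (ρ ^ 2)⁻¹) ρ :=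
      fun ρ hρ => (((hasDerivAt_inv (hne ρ hρ)).const_mul (C * κ ^ 3)).neg).congr_deriv (by ring)
    rw [intervalIntegral.integral_eq_sub_of_hasDerivAt hd hci]
    have : C * κ ^ 3 * κ⁻¹ = C * κ ^ 2 := by field_simp
    have h2 : 0 ≤ C * κ ^ 3 := by positivity
    rw [this, inv_one]
    linarith
  have hpt : ∀ ρ ∈ Set.Icc κ 1, C * (κ * ρ ^ (-1 : ℝ)) ^ 2 * min 1 (κ * ρ ^ (-1 : ℝ)) * ρ ≤
      C * κ ^ 3 * (ρ ^ 2)⁻¹ := fun ρ hρ => by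
    have hρ0 : 0 < ρ := hκ.trans_le hρ.1
    rw [Real.rpow_neg_one]
    calc C * (κ * ρ⁻¹) ^ 2 * min 1 (κ * ρ⁻¹) * ρ ≤ C * (κ * ρ⁻¹) ^ 2 * (κ * ρ⁻¹) * ρ := by
          gcongr; exact min_le_right _ _
      _ = _ := by field_simp
  constructor
  · have hi1 : IntervalIntegrable (fun ρ : ℝ => a ^ 2 * κ ^ 2 * ρ⁻¹) volume κ 1 := by
      apply ContinuousOn.intervalIntegrable
      exact continuousOn_const.mul (continuousOn_id.inv₀ hne)
    have hlog : ∫ ρ in κ..1, a ^ 2 * κ ^ 2 * ρ⁻¹ = a ^ 2 * κ ^ 2 * -Real.log κ := by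
      rw [intervalIntegral.integral_const_mul, integral_inv_of_pos hκ one_pos, one_div, Real.log_inv]
    have hmain : |∫ ρ in κ..1, (|Real.sin (deflection φ κ ρ / 2)| ^ 2 * ρ - a ^ 2 * κ ^ 2 * ρ⁻¹)| ≤
        (C + D) * κ ^ 2 := by
      have h1 : ‖∫ ρ in κ..1, (|Real.sin (deflection φ κ ρ / 2)| ^ 2 * ρ - a ^ 2 * κ ^ 2 * ρ⁻¹)‖ ≤
          ∫ ρ in κ..1, (C * κ ^ 3 * (ρ ^ 2)⁻¹ + D * κ ^ 2) := by
        refine intervalIntegral.norm_integral_le_of_norm_le hκ1 (Eventually.of_forall fun ρ hρ => ?_)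
          (hci.add intervalIntegrable_const)
        have hρ0 : 0 < ρ := hκ.trans hρ.1
        have e1 := (hb κ ρ hκ.le hρ0).1
        have e2 := hpt ρ ⟨hρ.1.le, hρ.2⟩
        have e3 := hφ.abs_bornAngle_sub_le ha hA h hρ0
        have e4 : |bornAngle φ ρ + a / ρ| ≤ (2 * a + 2 * (a + A)) * ρ⁻¹ := by
          have : bornAngle φ ρ + a / ρ = (bornAngle φ ρ - a / ρ) + 2 * (a / ρ) := by ring
          rw [this]
          refine (abs_add_le _ _).trans ?_
          rw [abs_of_nonneg (by positivity : 0 ≤ 2 * (a / ρ)), add_mul, div_eq_mul_inv]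
          have h3 : 1 ≤ ρ⁻¹ := (one_le_inv₀ hρ0).2 hρ.2
          have h4 : 2 * (a + A) * 1 ≤ 2 * (a + A) * ρ⁻¹ := by gcongr
          rw [div_eq_mul_inv] at e3
          linarith
        rw [Real.norm_eq_abs, sq_abs]
        have e5 : Real.sin (deflection φ κ ρ / 2) ^ 2 * ρ - a ^ 2 * κ ^ 2 * ρ⁻¹ =
            (Real.sin (deflection φ κ ρ / 2) ^ 2 - (κ * bornAngle φ ρ) ^ 2) * ρ +
              κ ^ 2 * ((bornAngle φ ρ - a / ρ) * (bornAngle φ ρ + a / ρ)) * ρ := by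
          field_simp
          ring
        rw [e5]
        refine (abs_add_le _ _).trans (add_le_add ?_ ?_)
        · rw [abs_mul, abs_of_pos hρ0]
          exact (mul_le_mul_of_nonneg_right e1 hρ0.le).trans e2
        · rw [abs_mul, abs_mul, abs_mul, abs_of_pos hρ0, abs_of_nonneg (sq_nonneg κ)]
          calc κ ^ 2 * (|bornAngle φ ρ - a / ρ| * |bornAngle φ ρ + a / ρ|) * ρ
              ≤ κ ^ 2 * (2 * (a + A) * ((2 * a + 2 * (a + A)) * ρ⁻¹)) * ρ := by gcongr
            _ = D * κ ^ 2 := by rw [hD]; field_simp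
      rw [intervalIntegral.integral_add hci intervalIntegrable_const, intervalIntegral.integral_const,
        smul_eq_mul, Real.norm_eq_abs] at h1
      have : (1 - κ) * (D * κ ^ 2) ≤ D * κ ^ 2 := by
        have := mul_nonneg hκ.le (mul_nonneg hD0 (sq_nonneg κ))
        linarith
      linarith
    rw [intervalIntegral.integral_sub (hsub 2).2 hi1, hlog] at hmain
    rw [hsplit 2, add_sub_assoc]
    refine (abs_add_le _ _).trans ?_
    linarith [hsmall 2]
  · have h1 : ∫ ρ in κ..1, |Real.sin (deflection φ κ ρ / 2)| ^ 3 * ρ ≤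
        ∫ ρ in κ..1, C * κ ^ 3 * (ρ ^ 2)⁻¹ :=
      intervalIntegral.integral_mono_on hκ1 (hsub 3).2 hci fun ρ hρ =>
        (mul_le_mul_of_nonneg_right (hb κ ρ hκ.le (hκ.trans_le hρ.1)).2 (hκ.trans_le hρ.1).le).trans
          (hpt ρ hρ)
    rw [hsplit 3]
    have := (le_abs_self _).trans (hsmall 3)
    have : 0 ≤ D * κ ^ 2 := by positivity
    linarith

end Moments

section ProfileMoments

variable {s : ℝ} {f : ℝ → ℝ}

theorem IsProfile.exists_pos (hf : IsProfile f) : ∃ r ∈ Set.Ioo (0 : ℝ) 1, 0 < radialPotential s f r := by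
  have h1 : ∀ᶠ x in 𝓝[Set.Icc 0 1] (0 : ℝ), 0 < f x :=
    (hf.continuousOn 0 (by simp)).eventually_const_lt hf.pos_zero
  have h2 : ∀ᶠ x in 𝓝[Set.Ioo 0 1] (0 : ℝ), 0 < f x ∧ x ∈ Set.Ioo (0 : ℝ) 1 :=
    (h1.filter_mono (nhdsWithin_mono _ Set.Ioo_subset_Icc_self)).and self_mem_nhdsWithin
  have : (𝓝[Set.Ioo 0 1] (0 : ℝ)).NeBot := by
    rw [← mem_closure_iff_nhdsWithin_neBot, closure_Ioo (by norm_num)]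
    simp
  obtain ⟨r, hr, hr'⟩ := h2.exists
  refine ⟨r, hr', ?_⟩
  rw [radialPotential_eq ⟨hr'.1, hr'.2.le⟩]
  exact mul_pos hr (Real.rpow_pos_of_pos hr'.1 _)

theorem IsProfile.cPhi_eq (hf : IsProfile f) (hs₀ : 0 ≤ s) (hs : s < 1) :
    cPhi s f = ∫ ρ in Set.Ioo (0 : ℝ) 1, bornAngle (radialPotential s f) ρ ^ 2 * ρ := by
  obtain ⟨B, hφ⟩ := hf.exists_isRepulsive hs₀ hs.le
  rw [cPhi, if_pos hs, intervalIntegral.integral_of_le zero_le_one, integral_Ioc_eq_integral_Ioo]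
  simp only [hφ.integral_eq_neg_bornAngle, neg_sq]

theorem IsProfile.cPhi_pos (hf : IsProfile f) (hs₀ : 0 ≤ s) (hs₁ : s ≤ 1) : 0 < cPhi s f := by
  rcases hs₁.lt_or_eq with hs | hs
  · obtain ⟨B, hφ⟩ := hf.exists_isRepulsive hs₀ hs₁
    rw [hf.cPhi_eq hs₀ hs]
    exact hφ.integral_bornAngle_sq_pos hs hf.exists_pos
  · rw [cPhi, if_neg (by linarith)]
    exact pow_pos hf.pos_zero 2

theorem timeScale_pos (s : ℝ) {ε : ℝ} (h0 : 0 < ε) (h1 : ε < 1) : 0 < timeScale s ε := by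
  have := abs_pos.2 (Real.log_neg h0 h1).ne
  rw [timeScale]
  split_ifs <;> positivity

theorem rpow_mul_abs_log_le {ε γ : ℝ} (h0 : 0 < ε) (h1 : ε < 1) (hγ : 0 < γ) :
    ε ^ γ * |Real.log ε| ≤ γ⁻¹ := by
  have h2 := Real.log_neg h0 h1
  have h3 := Real.add_one_le_exp (-(γ * Real.log ε))
  have h4 : ε ^ γ * Real.exp (-(γ * Real.log ε)) = 1 := by
    rw [Real.rpow_def_of_pos h0, ← Real.exp_add]; simp [mul_comm]
  have h5 : 0 < ε ^ γ := Real.rpow_pos_of_pos h0 γ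
  rw [abs_of_neg h2, le_inv_comm₀ (mul_pos h5 (by linarith)) hγ, ← one_div,
    le_div_iff₀ (mul_pos h5 (by linarith))]
  nlinarith

/-- The moments of the deflection for the weak potential, in the scaling of the limit. -/
theorem IsProfile.exists_scaled_moment_bound (hf : IsProfile f) (hs₀ : 0 ≤ s) (hs₁ : s ≤ 1) :
    ∃ C : ℝ, 0 ≤ C ∧ ∀ ε c : ℝ, 0 < ε → ε < 1 → 0 < c →
      |(timeScale s ε)⁻¹ * deflectionMoment (radialPotential s f) (2 * ε / c ^ 2) 2 -
          4 * cPhi s f / c ^ 4| ≤ C * |Real.log ε|⁻¹ * ((1 + 1 / c + c) / c ^ 4) ∧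
      (timeScale s ε)⁻¹ * deflectionMoment (radialPotential s f) (2 * ε / c ^ 2) 3 ≤
          C * |Real.log ε|⁻¹ * ((1 + 1 / c) / c ^ 4) := by
  obtain ⟨B, hφ⟩ := hf.exists_isRepulsive hs₀ hs₁
  rcases hs₁.lt_or_eq with hs | hs
  · obtain ⟨C, hC, hb⟩ := hφ.exists_moment_bound hs
    set γ := (1 - s) / 2 with hγ
    have hγ0 : 0 < γ := by linarith
    refine ⟨4 * C * (2 * γ⁻¹), by positivity, fun ε c h0 h1 hc => ?_⟩
    obtain ⟨b1, b2⟩ := hb (2 * ε / c ^ 2) (by positivity)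
    rw [← hf.cPhi_eq hs₀ hs] at b1
    have hlog := abs_pos.2 (Real.log_neg h0 h1).ne
    have ht : timeScale s ε = ε ^ 2 := if_pos hs
    have key : C * (2 * ε / c ^ 2) ^ 2 * (2 * ε / c ^ 2) ^ γ ≤
        ε ^ 2 * (4 * C * (2 * γ⁻¹) * |Real.log ε|⁻¹ * ((1 + 1 / c) / c ^ 4)) := by
      have e1 : (2 * ε / c ^ 2) ^ γ = 2 ^ γ * ε ^ γ * (1 / c) ^ (2 * γ) := by
        rw [show 2 * ε / c ^ 2 = 2 * ε * (1 / c) ^ 2 by field_simp, Real.mul_rpow (by positivity)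
          (by positivity), Real.mul_rpow (by positivity) (by positivity), ← Real.rpow_natCast,
          ← Real.rpow_mul (by positivity)]
        norm_num
      have e2 : (2 : ℝ) ^ γ ≤ 2 := by
        calc (2 : ℝ) ^ γ ≤ 2 ^ (1 : ℝ) := Real.rpow_le_rpow_of_exponent_le (by norm_num) (by linarith)
          _ = 2 := Real.rpow_one 2
      have e3 : ε ^ γ ≤ γ⁻¹ * |Real.log ε|⁻¹ := by
        rw [← div_eq_mul_inv, le_div_iff₀ hlog]
        exact rpow_mul_abs_log_le h0 h1 hγ0
      have e4 : (1 / c) ^ (2 * γ) ≤ 1 + 1 / c := by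
        have hc' : 0 < 1 / c := by positivity
        rcases le_total (1 / c) 1 with h | h
        · exact (Real.rpow_le_one hc'.le h (by linarith)).trans (by linarith)
        · calc (1 / c) ^ (2 * γ) ≤ (1 / c) ^ (1 : ℝ) :=
                Real.rpow_le_rpow_of_exponent_le h (by linarith)
            _ ≤ 1 + 1 / c := by rw [Real.rpow_one]; linarith
      rw [e1]
      calc C * (2 * ε / c ^ 2) ^ 2 * (2 ^ γ * ε ^ γ * (1 / c) ^ (2 * γ))
          ≤ C * (2 * ε / c ^ 2) ^ 2 * (2 * (γ⁻¹ * |Real.log ε|⁻¹) * (1 + 1 / c)) := by gcongr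
        _ = _ := by field_simp; ring
    rw [ht]
    have hε2 : 0 < ε ^ 2 := by positivity
    constructor
    · have e : (ε ^ 2)⁻¹ * deflectionMoment (radialPotential s f) (2 * ε / c ^ 2) 2 -
          4 * cPhi s f / c ^ 4 = (deflectionMoment (radialPotential s f) (2 * ε / c ^ 2) 2 -
            (2 * ε / c ^ 2) ^ 2 * cPhi s f) / ε ^ 2 := by field_simp; ring
      rw [e, abs_div, abs_of_pos hε2, div_le_iff₀ hε2]
      refine (b1.trans key).trans ?_
      rw [mul_comm]
      have : 1 + 1 / c ≤ 1 + 1 / c + c := by linarith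
      gcongr
    · rw [inv_mul_le_iff₀ hε2]
      exact b2.trans key
  · subst hs
    obtain ⟨A, hA, hbA⟩ := hf.exists_coulomb_bound
    obtain ⟨C, hC, hb⟩ := hφ.exists_coulomb_moment_bound hf.pos_zero.le hA.le hbA
    have hcf : cPhi 1 f = f 0 ^ 2 := if_neg (lt_irrefl 1)
    set D := 4 * (1 + C + 3 * f 0 ^ 2) with hD
    have hf0 := hf.pos_zero
    refine ⟨D, by positivity, fun ε c h0 h1 hc => ?_⟩
    have hlogneg := Real.log_neg h0 h1
    have hlog := abs_pos.2 hlogneg.ne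
    have ht : timeScale 1 ε = ε ^ 2 * |Real.log ε| := if_neg (lt_irrefl 1)
    set κ := 2 * ε / c ^ 2 with hκ
    have hκ0 : 0 < κ := by positivity
    have hlogκ : Real.log κ = Real.log 2 + Real.log ε - 2 * Real.log c := by
      rw [hκ, Real.log_div (by positivity) (by positivity), Real.log_mul (by norm_num) h0.ne',
        Real.log_pow]
      norm_num
    have hl2 : 0 < Real.log 2 := Real.log_pos (by norm_num)
    have hl2' : Real.log 2 ≤ 1 := by linarith [Real.log_two_lt_d9]
    have hlc1 : Real.log c ≤ c := (Real.log_le_sub_one_of_pos hc).trans (by linarith)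
    have hlc2 : -Real.log c ≤ 1 / c := by
      rw [← Real.log_inv, ← one_div]
      exact (Real.log_le_sub_one_of_pos (by positivity)).trans (by linarith)
    have hcinv : 0 < 1 / c := by positivity
    have habs : |Real.log ε| = -Real.log ε := abs_of_neg hlogneg
    rw [habs] at ht hlog ⊢
    have m2 := deflectionMoment_mem (radialPotential 1 f) κ 2
    have m3 := deflectionMoment_mem (radialPotential 1 f) κ 3
    have key : |deflectionMoment (radialPotential 1 f) κ 2 - f 0 ^ 2 * κ ^ 2 * -Real.log ε| ≤
        κ ^ 2 * ((1 + C + 3 * f 0 ^ 2) * (1 + 1 / c + c)) ∧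
        deflectionMoment (radialPotential 1 f) κ 3 ≤ κ ^ 2 * ((1 + C) * (1 + 1 / c)) := by
      rcases le_total κ 1 with h | h
      · obtain ⟨b1, b2⟩ := hb κ hκ0 h
        constructor
        · have e1 : |f 0 ^ 2 * κ ^ 2 * -Real.log κ - f 0 ^ 2 * κ ^ 2 * -Real.log ε| ≤
              f 0 ^ 2 * κ ^ 2 * (3 * (1 + 1 / c + c)) := by
            rw [← mul_sub, abs_mul, abs_of_nonneg (by positivity : 0 ≤ f 0 ^ 2 * κ ^ 2)]
            refine mul_le_mul_of_nonneg_left ?_ (by positivity)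
            rw [hlogκ, abs_le]
            constructor <;> linarith
          refine (abs_sub_le _ _ _).trans ((add_le_add b1 e1).trans ?_)
          have : C * κ ^ 2 ≤ κ ^ 2 * ((1 + C) * (1 + 1 / c + c)) := by
            rw [mul_comm C]
            refine mul_le_mul_of_nonneg_left ?_ (by positivity)
            nlinarith
          linarith
        · refine b2.trans ?_
          rw [mul_comm C]
          refine mul_le_mul_of_nonneg_left ?_ (by positivity)
          nlinarith
      · have hk2 : 1 ≤ κ ^ 2 := one_le_pow₀ h
        have hlk : 0 ≤ Real.log κ := Real.log_nonneg h
        constructor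
        · have e1 : -Real.log ε ≤ 3 * (1 + 1 / c + c) := by linarith
          have e2 : f 0 ^ 2 * κ ^ 2 * -Real.log ε ≤ f 0 ^ 2 * κ ^ 2 * (3 * (1 + 1 / c + c)) := by
            gcongr
          have e3 : 1 ≤ κ ^ 2 * ((1 + C) * (1 + 1 / c + c)) :=
            one_le_mul_of_one_le_of_one_le hk2
              (one_le_mul_of_one_le_of_one_le (by linarith) (by linarith))
          have e4 : 0 ≤ f 0 ^ 2 * κ ^ 2 * -Real.log ε := by positivity
          have e5 : 0 ≤ f 0 ^ 2 * κ ^ 2 * (3 * (1 + 1 / c + c)) := by positivity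
          rw [abs_le]
          constructor <;> linarith [m2.1, m2.2]
        · exact m3.2.trans (one_le_mul_of_one_le_of_one_le hk2
              (one_le_mul_of_one_le_of_one_le (by linarith) (by linarith)))
    clear habs hlogκ hlogneg
    generalize -Real.log ε = ℓ at hlog ht key ⊢
    have hTpos : 0 < ε ^ 2 * ℓ := by positivity
    rw [ht, hcf]
    constructor
    · have e : (ε ^ 2 * ℓ)⁻¹ * deflectionMoment (radialPotential 1 f) κ 2 -
          4 * f 0 ^ 2 / c ^ 4 = (deflectionMoment (radialPotential 1 f) κ 2 -
            f 0 ^ 2 * κ ^ 2 * ℓ) / (ε ^ 2 * ℓ) := by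
        rw [hκ]; field_simp; ring
      rw [e, abs_div, abs_of_pos hTpos, div_le_iff₀ hTpos]
      refine key.1.trans (le_of_eq ?_)
      rw [hκ, hD]; field_simp; ring
    · rw [inv_mul_le_iff₀ hTpos]
      refine key.2.trans ?_
      have : κ ^ 2 * ((1 + C) * (1 + 1 / c)) ≤ κ ^ 2 * ((1 + C + 3 * f 0 ^ 2) * (1 + 1 / c)) := by
        have : 1 + C ≤ 1 + C + 3 * f 0 ^ 2 := by linarith [sq_nonneg (f 0)]
        gcongr
      refine this.trans (le_of_eq ?_)
      rw [hκ, hD]; field_simp; ring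

end ProfileMoments

/-! ### Test functions in `C³_b` -/

/-- The inverse of the Riesz isomorphism, in coordinates. -/
def rieszInv : (E3 →L[ℝ] ℝ) →L[ℝ] E3 :=
  ∑ i : Fin 3, (ContinuousLinearMap.apply ℝ ℝ (EuclideanSpace.single i (1 : ℝ) : E3)).smulRight
    (EuclideanSpace.single i (1 : ℝ) : E3)

theorem sum_single_smul (x : E3) : ∑ i : Fin 3, x i • (EuclideanSpace.single i (1 : ℝ) : E3) = x := by
  ext j
  fin_cases j <;> simp [Fin.sum_univ_three]

theorem rieszInv_apply (l : E3 →L[ℝ] ℝ) : rieszInv l = (InnerProductSpace.toDual ℝ E3).symm l := by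
  refine ext_inner_right ℝ fun y => ?_
  rw [InnerProductSpace.toDual_symm_apply]
  conv_rhs => rw [← sum_single_smul y, map_sum]
  simp only [rieszInv, _root_.sum_apply, ContinuousLinearMap.smulRight_apply,
    ContinuousLinearMap.apply_apply, sum_inner, real_inner_smul_left, map_smul, smul_eq_mul]
  refine Finset.sum_congr rfl fun i _ => ?_
  rw [EuclideanSpace.inner_single_left]
  simp [mul_comm]

theorem norm_rieszInv_apply (l : E3 →L[ℝ] ℝ) : ‖rieszInv l‖ = ‖l‖ := by
  rw [rieszInv_apply, LinearIsometryEquiv.norm_map]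

theorem gradient_eq_rieszInv (ψ : E3 → ℝ) : gradient ψ = fun v => rieszInv (fderiv ℝ ψ v) := by
  ext1 v; rw [rieszInv_apply]; rfl

/-- The second derivative as a linear map. -/
def hessian (ψ : E3 → ℝ) (v : E3) : E3 →L[ℝ] E3 := fderiv ℝ (gradient ψ) v

section C3b

variable {ψ : E3 → ℝ}

theorem IsC3b.norm_iteratedFDeriv_le (h : IsC3b ψ) {k : ℕ} (hk : k ≤ 3) (v : E3) :
    ‖iteratedFDeriv ℝ k ψ v‖ ≤ c3bNorm ψ := by
  obtain ⟨B, hB⟩ := h.2 k hk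
  refine (le_ciSup (f := fun v => ‖iteratedFDeriv ℝ k ψ v‖) ⟨B, ?_⟩ v).trans ?_
  · rintro _ ⟨x, rfl⟩; exact hB x
  · exact Finset.single_le_sum (f := fun k => ⨆ v : E3, ‖iteratedFDeriv ℝ k ψ v‖)
      (fun i _ => Real.iSup_nonneg fun v => norm_nonneg _) (Finset.mem_range.2 (by omega))

theorem IsC3b.c3bNorm_nonneg (h : IsC3b ψ) : 0 ≤ c3bNorm ψ :=
  (norm_nonneg _).trans (h.norm_iteratedFDeriv_le (Nat.zero_le 3) 0)

theorem IsC3b.abs_le (h : IsC3b ψ) (v : E3) : |ψ v| ≤ c3bNorm ψ := by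
  have := h.norm_iteratedFDeriv_le (Nat.zero_le 3) v
  rwa [norm_iteratedFDeriv_zero, Real.norm_eq_abs] at this

theorem IsC3b.differentiable (h : IsC3b ψ) : Differentiable ℝ ψ := h.1.differentiable (by simp)

theorem IsC3b.hasFDerivAt (h : IsC3b ψ) (v : E3) : HasFDerivAt ψ (innerSL ℝ (gradient ψ v)) v := by
  refine (h.differentiable v).hasFDerivAt.congr_fderiv ?_
  ext x
  rw [innerSL_apply_apply, gradient, InnerProductSpace.toDual_symm_apply]

theorem IsC3b.contDiff_fderiv (h : IsC3b ψ) : ContDiff ℝ 2 (fderiv ℝ ψ) :=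
  h.1.fderiv_right (by norm_num)

theorem IsC3b.contDiff_gradient (h : IsC3b ψ) : ContDiff ℝ 2 (gradient ψ) := by
  rw [gradient_eq_rieszInv]
  exact rieszInv.contDiff.comp h.contDiff_fderiv

theorem IsC3b.hasFDerivAt_gradient (h : IsC3b ψ) (v : E3) :
    HasFDerivAt (gradient ψ) (hessian ψ v) v :=
  (h.contDiff_gradient.differentiable (by simp) v).hasFDerivAt

theorem IsC3b.continuous_gradient (h : IsC3b ψ) : Continuous (gradient ψ) :=
  h.contDiff_gradient.continuous

theorem IsC3b.contDiff_hessian (h : IsC3b ψ) : ContDiff ℝ 1 (hessian ψ) :=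
  h.contDiff_gradient.fderiv_right (by norm_num)

theorem IsC3b.norm_gradient_le (h : IsC3b ψ) (v : E3) : ‖gradient ψ v‖ ≤ c3bNorm ψ := by
  have := h.norm_iteratedFDeriv_le (by norm_num : 1 ≤ 3) v
  rw [norm_iteratedFDeriv_one] at this
  rwa [gradient_eq_rieszInv, norm_rieszInv_apply]

theorem hessian_eq (h : IsC3b ψ) (v : E3) :
    hessian ψ v = rieszInv.comp (fderiv ℝ (fderiv ℝ ψ) v) := by
  rw [hessian, gradient_eq_rieszInv]
  exact (rieszInv.hasFDerivAt.comp v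
    (h.contDiff_fderiv.differentiable (by simp) v).hasFDerivAt).fderiv

theorem norm_rieszInv_comp_le (T : E3 →L[ℝ] E3 →L[ℝ] ℝ) : ‖rieszInv.comp T‖ ≤ ‖T‖ :=
  ContinuousLinearMap.opNorm_le_bound _ T.opNorm_nonneg fun x => by
    rw [ContinuousLinearMap.comp_apply, norm_rieszInv_apply]
    exact T.le_opNorm x

theorem IsC3b.norm_hessian_le (h : IsC3b ψ) (v : E3) : ‖hessian ψ v‖ ≤ c3bNorm ψ := by
  rw [hessian_eq h]
  refine (norm_rieszInv_comp_le _).trans ?_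
  have := h.norm_iteratedFDeriv_le (by norm_num : 2 ≤ 3) v
  rwa [← norm_iteratedFDeriv_fderiv, norm_iteratedFDeriv_one] at this

theorem IsC3b.gradient_sub_le (h : IsC3b ψ) (a b : E3) :
    ‖gradient ψ a - gradient ψ b‖ ≤ c3bNorm ψ * ‖a - b‖ :=
  convex_univ.norm_image_sub_le_of_norm_hasFDerivWithin_le (f' := hessian ψ)
    (fun x _ => (h.hasFDerivAt_gradient x).hasFDerivWithinAt) (fun x _ => h.norm_hessian_le x)
    (Set.mem_univ b) (Set.mem_univ a)

theorem IsC3b.hessian_sub_le (h : IsC3b ψ) (a b : E3) :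
    ‖hessian ψ a - hessian ψ b‖ ≤ c3bNorm ψ * ‖a - b‖ := by
  rw [hessian_eq h, hessian_eq h, ← ContinuousLinearMap.comp_sub]
  refine (norm_rieszInv_comp_le _).trans ?_
  have hd : ContDiff ℝ 1 (fderiv ℝ (fderiv ℝ ψ)) := h.contDiff_fderiv.fderiv_right (by norm_num)
  refine convex_univ.norm_image_sub_le_of_norm_fderiv_le (𝕜 := ℝ)
    (fun x _ => hd.differentiable (by simp) x) (fun x _ => ?_) (Set.mem_univ b) (Set.mem_univ a)
  have := h.norm_iteratedFDeriv_le (le_refl 3) x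
  rwa [← norm_iteratedFDeriv_fderiv, ← norm_iteratedFDeriv_fderiv, norm_iteratedFDeriv_one] at this

end C3b

/-! ### The Maxwellian -/

theorem maxwellian_pos (v : E3) : 0 < maxwellian v := by
  have := Real.pi_pos
  rw [maxwellian]; positivity

theorem hasFDerivAt_maxwellian (v : E3) :
    HasFDerivAt maxwellian (-maxwellian v • innerSL ℝ v) v := by
  have h1 : HasFDerivAt (fun v : E3 => -(‖v‖ ^ 2) / 2) (-innerSL ℝ v) v := by
    refine ((hasStrictFDerivAt_norm_sq v).hasFDerivAt.neg.mul_const (2⁻¹ : ℝ)).congr_fderiv ?_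
    ext x
    simp
  refine (h1.exp.mul_const (((2 * Real.pi) ^ ((3 : ℝ) / 2))⁻¹)).congr_fderiv ?_
  ext x
  simp only [maxwellian, _root_.smul_apply, _root_.neg_apply, smul_eq_mul,
    innerSL_apply_apply]
  ring

theorem continuous_maxwellian : Continuous maxwellian :=
  continuous_iff_continuousAt.2 fun v => (hasFDerivAt_maxwellian v).continuousAt

theorem exists_maxwellian_mul_pow_le (m : ℕ) :
    ∃ C : ℝ, 0 < C ∧ ∀ v, maxwellian v * (1 + ‖v‖) ^ m ≤ C := by
  have hZ : (0 : ℝ) < (2 * Real.pi) ^ ((3 : ℝ) / 2) := by have := Real.pi_pos; positivity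
  set Z := (2 * Real.pi) ^ ((3 : ℝ) / 2)
  refine ⟨m.factorial * Real.exp 2 / Z, by positivity, fun v => ?_⟩
  have h1 := Real.pow_div_factorial_le_exp (1 + ‖v‖) (by positivity) m
  rw [div_le_iff₀ (by positivity)] at h1
  have h2 : Real.exp (-(‖v‖ ^ 2) / 2) * Real.exp (1 + ‖v‖) ≤ Real.exp 2 := by
    rw [← Real.exp_add]
    apply Real.exp_le_exp.2
    nlinarith [sq_nonneg (‖v‖ - 1)]
  rw [maxwellian, div_mul_eq_mul_div]
  refine div_le_div_of_nonneg_right ?_ hZ.le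
  calc Real.exp (-(‖v‖ ^ 2) / 2) * (1 + ‖v‖) ^ m
      ≤ Real.exp (-(‖v‖ ^ 2) / 2) * (Real.exp (1 + ‖v‖) * m.factorial) := by gcongr
    _ = m.factorial * (Real.exp (-(‖v‖ ^ 2) / 2) * Real.exp (1 + ‖v‖)) := by ring
    _ ≤ _ := by gcongr

theorem integrableOn_inv_norm_sq :
    Integrable fun w : E3 => (Metric.ball (0 : E3) 1).indicator (fun w => (‖w‖ ^ 2)⁻¹) w := by
  classical
  have h := integrable_fun_norm_addHaar (volume : Measure E3)
    (f := (Set.Iio (1 : ℝ)).indicator fun r => (r ^ 2)⁻¹)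
  have e : (fun w : E3 => (Set.Iio (1 : ℝ)).indicator (fun r => (r ^ 2)⁻¹) ‖w‖) =
      fun w : E3 => (Metric.ball (0 : E3) 1).indicator (fun w => (‖w‖ ^ 2)⁻¹) w := by
    ext w
    simp only [Set.indicator_apply, Set.mem_Iio, Metric.mem_ball, dist_zero_right]
  rw [← e, h]
  have h3 : Module.finrank ℝ E3 - 1 = 2 := by simp
  rw [h3]
  have hI : IntegrableOn ((Set.Iio (1 : ℝ)).indicator fun _ => (1 : ℝ)) (Set.Ioi 0) := by
    rw [integrableOn_indicator_iff measurableSet_Iio, Set.inter_comm, Set.Ioi_inter_Iio]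
    exact integrableOn_const (by simp)
  refine hI.congr_fun (fun r hr => ?_) measurableSet_Ioi
  have hr : 0 < r := hr
  simp only [Set.indicator_apply, Set.mem_Iio, smul_eq_mul]
  split_ifs
  · field_simp
  · simp

theorem integrable_singular_weight :
    Integrable fun w : E3 => (1 + (‖w‖ ^ 2)⁻¹) * ((1 + ‖w‖) ^ 4)⁻¹ := by
  classical
  have h1 : Integrable fun w : E3 => ((1 + ‖w‖) ^ 4)⁻¹ := by
    have := integrable_one_add_norm (E := E3) (μ := volume) (r := 4) (by simp; norm_num)
    refine this.congr (Eventually.of_forall fun w => ?_)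
    have : (0 : ℝ) ≤ 1 + ‖w‖ := by positivity
    simp only
    rw [Real.rpow_neg this]
    norm_cast
  refine ((h1.const_mul 2).add integrableOn_inv_norm_sq).mono' (by fun_prop)
    (Eventually.of_forall fun w => ?_)
  rw [Real.norm_eq_abs, abs_of_nonneg (by positivity)]
  simp only [Pi.add_apply, Set.indicator_apply, Metric.mem_ball, dist_zero_right]
  have hp : ((1 + ‖w‖) ^ 4)⁻¹ ≤ 1 := inv_le_one_of_one_le₀ (one_le_pow₀ (by linarith [norm_nonneg w]))
  have hp0 : 0 ≤ ((1 + ‖w‖) ^ 4)⁻¹ := by positivity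
  have hq0 : 0 ≤ (‖w‖ ^ 2)⁻¹ := by positivity
  split_ifs with h
  · nlinarith
  · have : (‖w‖ ^ 2)⁻¹ ≤ 1 := inv_le_one_of_one_le₀ (one_le_pow₀ (not_lt.1 h))
    nlinarith

theorem one_add_norm_le_mul (a b : E3) : 1 + ‖a - b‖ ≤ (1 + ‖a‖) * (1 + ‖b‖) := by
  have := norm_sub_le a b
  nlinarith [norm_nonneg a, norm_nonneg b, mul_nonneg (norm_nonneg a) (norm_nonneg b)]

/-- Integrability against the Maxwellian, with a singularity weaker than `|v₁ - v₂|⁻²`. -/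
theorem integrable_of_maxwellian_bound {E : Type*} [NormedAddCommGroup E] {F : E3 → E} (v₁ : E3)
    (C : ℝ) (k : ℕ) (hm : AEStronglyMeasurable F)
    (hb : ∀ v₂, v₁ ≠ v₂ →
      ‖F v₂‖ ≤ C * (1 + (‖v₁ - v₂‖ ^ 2)⁻¹) * (1 + ‖v₂‖) ^ k * maxwellian v₂) : Integrable F := by
  obtain ⟨K, hK, hK'⟩ := exists_maxwellian_mul_pow_le (k + 4)
  have hi : Integrable fun v₂ : E3 => |C| * K * (1 + ‖v₁‖) ^ 4 *
      ((1 + (‖v₁ - v₂‖ ^ 2)⁻¹) * ((1 + ‖v₁ - v₂‖) ^ 4)⁻¹) :=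
    (integrable_singular_weight.comp_sub_left v₁).const_mul _
  refine hi.mono' hm ?_
  have hne : ∀ᵐ v₂ : E3, v₁ ≠ v₂ := by
    have : (volume : Measure E3) {v₁} = 0 := measure_singleton v₁
    filter_upwards [measure_eq_zero_iff_ae_notMem.1 this] with v hv h
    exact hv h.symm
  filter_upwards [hne] with v₂ hv
  refine (hb v₂ hv).trans ?_
  have h1 := hK' v₂
  have hw : 0 ≤ 1 + (‖v₁ - v₂‖ ^ 2)⁻¹ := by positivity
  have h2 : (1 + ‖v₂‖) ^ k * maxwellian v₂ ≤ K * (1 + ‖v₁‖) ^ 4 * ((1 + ‖v₁ - v₂‖) ^ 4)⁻¹ := by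
    rw [← div_eq_mul_inv, le_div_iff₀ (by positivity)]
    calc (1 + ‖v₂‖) ^ k * maxwellian v₂ * (1 + ‖v₁ - v₂‖) ^ 4
        ≤ (1 + ‖v₂‖) ^ k * maxwellian v₂ * ((1 + ‖v₁‖) * (1 + ‖v₂‖)) ^ 4 := by
          have := (maxwellian_pos v₂).le
          gcongr; exact one_add_norm_le_mul v₁ v₂
      _ = maxwellian v₂ * (1 + ‖v₂‖) ^ (k + 4) * (1 + ‖v₁‖) ^ 4 := by ring
      _ ≤ _ := by gcongr
  have hM := (maxwellian_pos v₂).le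
  calc C * (1 + (‖v₁ - v₂‖ ^ 2)⁻¹) * (1 + ‖v₂‖) ^ k * maxwellian v₂
      = C * ((1 + (‖v₁ - v₂‖ ^ 2)⁻¹) * ((1 + ‖v₂‖) ^ k * maxwellian v₂)) := by ring
    _ ≤ |C| * ((1 + (‖v₁ - v₂‖ ^ 2)⁻¹) * (K * (1 + ‖v₁‖) ^ 4 * ((1 + ‖v₁ - v₂‖) ^ 4)⁻¹)) := by
        gcongr
        exact le_abs_self C
    _ = _ := by ring

/-- Maxwellian averages of `|v₁ - v₂|⁻²` are bounded uniformly in `v₁`. -/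
theorem exists_maxwellian_weight_bound :
    ∃ J : ℝ, 0 ≤ J ∧ ∀ v₁ : E3, Integrable (fun v₂ => maxwellian v₂ * (1 + (‖v₁ - v₂‖ ^ 2)⁻¹)) ∧
      ∫ v₂, maxwellian v₂ * (1 + (‖v₁ - v₂‖ ^ 2)⁻¹) ≤ J := by
  classical
  obtain ⟨K, hK, hK'⟩ := exists_maxwellian_mul_pow_le 0
  have hcm := continuous_maxwellian
  have hMi : Integrable maxwellian :=
    integrable_of_maxwellian_bound 0 1 0 hcm.aestronglyMeasurable fun v _ => by
      have := (maxwellian_pos v).le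
      rw [Real.norm_eq_abs, abs_of_nonneg this, pow_zero, mul_one, one_mul]
      have : 0 ≤ (‖0 - v‖ ^ 2)⁻¹ := by positivity
      nlinarith
  set D : E3 → ℝ := (Metric.ball (0 : E3) 1).indicator (fun w => (‖w‖ ^ 2)⁻¹)
  have hD0 : ∀ w, 0 ≤ D w := fun w => Set.indicator_nonneg (fun _ _ => by positivity) w
  refine ⟨2 * (∫ v, maxwellian v) + K * ∫ w, D w, ?_, fun v₁ => ?_⟩
  · have h1 : 0 ≤ ∫ v, maxwellian v := integral_nonneg fun v => (maxwellian_pos v).le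
    have h2 : 0 ≤ ∫ w, D w := integral_nonneg hD0
    positivity
  have hDi : Integrable fun v₂ => D (v₁ - v₂) := integrableOn_inv_norm_sq.comp_sub_left v₁
  have hint : Integrable (fun v₂ => maxwellian v₂ * (1 + (‖v₁ - v₂‖ ^ 2)⁻¹)) := by
    refine integrable_of_maxwellian_bound v₁ 1 0 (by fun_prop) fun v _ => ?_
    have := (maxwellian_pos v).le
    rw [Real.norm_eq_abs, abs_of_nonneg (by positivity)]
    exact le_of_eq (by ring)
  refine ⟨hint, ?_⟩
  have e : ∫ w, D w = ∫ v₂, D (v₁ - v₂) := (integral_sub_left_eq_self D volume v₁).symm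
  rw [e, ← integral_const_mul, ← integral_const_mul,
    ← integral_add (hMi.const_mul 2) (hDi.const_mul K)]
  refine integral_mono hint ((hMi.const_mul 2).add (hDi.const_mul K)) fun v₂ => ?_
  have hM := (maxwellian_pos v₂).le
  have hMK := hK' v₂
  rw [pow_zero, mul_one] at hMK
  simp only [D, Set.indicator_apply, Metric.mem_ball, dist_zero_right]
  have hq0 : 0 ≤ (‖v₁ - v₂‖ ^ 2)⁻¹ := by positivity
  split_ifs with h
  · nlinarith
  · have : (‖v₁ - v₂‖ ^ 2)⁻¹ ≤ 1 := inv_le_one_of_one_le₀ (one_le_pow₀ (not_lt.1 h))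
    nlinarith

/-! ### The linearized Landau operator -/

/-- The trace of a linear map of `ℝ³`. -/
def trace3 : (E3 →L[ℝ] E3) →L[ℝ] ℝ :=
  ∑ i : Fin 3, (EuclideanSpace.proj i : E3 →L[ℝ] ℝ).comp
    (ContinuousLinearMap.apply ℝ E3 (EuclideanSpace.single i (1 : ℝ) : E3))

theorem trace3_apply (T : E3 →L[ℝ] E3) :
    trace3 T = ∑ i : Fin 3, (T (EuclideanSpace.single i 1)) i := by
  simp [trace3]

theorem abs_trace3_le (T : E3 →L[ℝ] E3) : |trace3 T| ≤ 3 * ‖T‖ := by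
  rw [trace3_apply]
  refine (Finset.abs_sum_le_sum_abs _ _).trans ?_
  have : ∀ i ∈ (Finset.univ : Finset (Fin 3)), |(T (EuclideanSpace.single i 1)) i| ≤ ‖T‖ := fun i _ => by
    rw [← Real.norm_eq_abs]
    refine (PiLp.norm_apply_le _ i).trans ((T.le_opNorm _).trans ?_)
    simp
  refine (Finset.sum_le_sum this).trans ?_
  simp

theorem trace3_smulRight (l : E3 →L[ℝ] ℝ) (x : E3) : trace3 (l.smulRight x) = l x := by
  conv_rhs => rw [← sum_single_smul x, map_sum]
  rw [trace3_apply]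
  refine Finset.sum_congr rfl fun i _ => ?_
  simp [mul_comm]

theorem trace3_id : trace3 (ContinuousLinearMap.id ℝ E3) = 3 := by
  rw [trace3_apply]; simp

/-- The trace of the part of `T` transversal to `w`. -/
def perpTrace (w : E3) (T : E3 →L[ℝ] E3) : ℝ := trace3 T - inner ℝ w (T w) / ‖w‖ ^ 2

theorem abs_inner_apply_div_le (w : E3) (T : E3 →L[ℝ] E3) : |inner ℝ w (T w) / ‖w‖ ^ 2| ≤ ‖T‖ := by
  rcases eq_or_ne w 0 with rfl | hw
  · simp
  have hn : 0 < ‖w‖ := norm_pos_iff.2 hw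
  rw [abs_div, abs_of_pos (pow_pos hn 2), div_le_iff₀ (pow_pos hn 2)]
  calc |inner ℝ w (T w)| ≤ ‖w‖ * ‖T w‖ := abs_real_inner_le_norm _ _
    _ ≤ ‖w‖ * (‖T‖ * ‖w‖) := by gcongr; exact T.le_opNorm w
    _ = _ := by ring

theorem abs_perpTrace_le (w : E3) (T : E3 →L[ℝ] E3) : |perpTrace w T| ≤ 4 * ‖T‖ := by
  have h1 := abs_trace3_le T
  have h2 := abs_inner_apply_div_le w T
  rw [perpTrace]
  refine (abs_sub _ _).trans ?_
  linarith

theorem perpTrace_add (w : E3) (S T : E3 →L[ℝ] E3) :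
    perpTrace w (S + T) = perpTrace w S + perpTrace w T := by
  simp only [perpTrace, map_add, _root_.add_apply, inner_add_right]; ring

theorem perpTrace_sub (w : E3) (S T : E3 →L[ℝ] E3) :
    perpTrace w (S - T) = perpTrace w S - perpTrace w T := by
  simp only [perpTrace, map_sub, _root_.sub_apply, inner_sub_right]; ring

/-- `|w|² x - (w · x) w`. -/
def crossField (w x : E3) : E3 := ‖w‖ ^ 2 • x - inner ℝ w x • w

theorem inner_crossField_self (w x : E3) : inner ℝ w (crossField w x) = 0 := by
  rw [crossField, inner_sub_right, real_inner_smul_right, real_inner_smul_right,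
    real_inner_self_eq_norm_sq]
  ring

theorem norm_crossField_le (w x : E3) : ‖crossField w x‖ ≤ 2 * ‖w‖ ^ 2 * ‖x‖ := by
  rw [crossField]
  refine (norm_sub_le _ _).trans ?_
  rw [norm_smul, norm_smul, Real.norm_eq_abs, Real.norm_eq_abs, abs_of_nonneg (sq_nonneg ‖w‖)]
  have := mul_le_mul_of_nonneg_right (abs_real_inner_le_norm w x) (norm_nonneg w)
  nlinarith

theorem perpProj_eq_crossField {w : E3} (hw : w ≠ 0) (x : E3) :
    perpProj w x = (‖w‖ ^ 2)⁻¹ • crossField w x := by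
  have hn : ‖w‖ ^ 2 ≠ 0 := pow_ne_zero 2 (norm_ne_zero_iff.2 hw)
  rw [perpProj, crossField, smul_sub, smul_smul, smul_smul, inv_mul_cancel₀ hn, one_smul,
    div_eq_inv_mul]

/-- The kernel `P^⊥_w / |w|` of the Landau operator. -/
def landauKernel (w : E3) : E3 →L[ℝ] E3 :=
  ‖w‖⁻¹ • ContinuousLinearMap.id ℝ E3 - (‖w‖ ^ 3)⁻¹ • (innerSL ℝ w).smulRight w

theorem landauKernel_apply {w : E3} (hw : w ≠ 0) (x : E3) :
    landauKernel w x = (‖w‖ ^ 3)⁻¹ • crossField w x := by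
  have hn : ‖w‖ ≠ 0 := norm_ne_zero_iff.2 hw
  simp only [landauKernel, crossField, _root_.sub_apply, _root_.smul_apply,
    ContinuousLinearMap.id_apply, ContinuousLinearMap.smulRight_apply, innerSL_apply_apply, smul_sub,
    smul_smul]
  congr 2
  field_simp

theorem norm_landauKernel_le (w : E3) : ‖landauKernel w‖ ≤ 2 * ‖w‖⁻¹ := by
  rcases eq_or_ne w 0 with rfl | hw
  · have : landauKernel 0 = 0 := by ext1 x; simp [landauKernel]
    simp [this]
  have hn : 0 < ‖w‖ := norm_pos_iff.2 hw
  refine ContinuousLinearMap.opNorm_le_bound _ (by positivity) fun x => ?_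
  rw [landauKernel_apply hw, norm_smul, norm_inv, norm_pow, norm_norm]
  calc (‖w‖ ^ 3)⁻¹ * ‖crossField w x‖ ≤ (‖w‖ ^ 3)⁻¹ * (2 * ‖w‖ ^ 2 * ‖x‖) := by
        gcongr; exact norm_crossField_le w x
    _ = _ := by field_simp

theorem trace3_landauKernel_comp (w : E3) (T : E3 →L[ℝ] E3) :
    trace3 ((landauKernel w).comp T) = ‖w‖⁻¹ * perpTrace w T := by
  have h1 : (landauKernel w).comp T = ‖w‖⁻¹ • T -
      (‖w‖ ^ 3)⁻¹ • ((innerSL ℝ w).comp T).smulRight w := by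
    ext1 x
    simp [landauKernel]
  rw [h1, map_sub, map_smul, map_smul, trace3_smulRight, ContinuousLinearMap.comp_apply,
    innerSL_apply_apply, perpTrace, smul_eq_mul, smul_eq_mul]
  rcases eq_or_ne w 0 with rfl | hw
  · simp
  have hn : ‖w‖ ≠ 0 := norm_ne_zero_iff.2 hw
  field_simp

theorem aestronglyMeasurable_landauKernel : AEStronglyMeasurable landauKernel := by
  have h1 : Measurable fun w : E3 => ‖w‖⁻¹ := by fun_prop
  have h2 : Measurable fun w : E3 => (‖w‖ ^ 3)⁻¹ := by fun_prop
  have h3 : Continuous fun w : E3 => (innerSL ℝ w).smulRight w := by fun_prop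
  exact (h1.aestronglyMeasurable.smul aestronglyMeasurable_const).sub
    (h2.aestronglyMeasurable.smul h3.aestronglyMeasurable)

section Landau

variable {ψ : E3 → ℝ}

/-- The density of the Landau flux, in the relative velocity, before applying the kernel. -/
def landauDensity (ψ : E3 → ℝ) (w v : E3) : E3 :=
  (maxwellian v * maxwellian (v - w)) • (gradient ψ v - gradient ψ (v - w))

/-- The derivative of `landauDensity`. -/
def landauDensityDeriv (ψ : E3 → ℝ) (w v : E3) : E3 →L[ℝ] E3 :=
  (maxwellian v * maxwellian (v - w)) • (hessian ψ v - hessian ψ (v - w)) -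
    ((maxwellian v * maxwellian (v - w)) • innerSL ℝ (v + (v - w))).smulRight
      (gradient ψ v - gradient ψ (v - w))

theorem landauIntegrand_eq {v₁ v₂ : E3} (hv : v₁ ≠ v₂) :
    landauIntegrand ψ v₁ v₂ =
      landauKernel (v₁ - v₂) (landauDensity ψ (v₁ - v₂) v₁) := by
  have hw : v₁ - v₂ ≠ 0 := sub_ne_zero.2 hv
  have hn : ‖v₁ - v₂‖ ≠ 0 := norm_ne_zero_iff.2 hw
  rw [landauDensity, map_smul, landauKernel_apply hw, landauIntegrand, perpProj_eq_crossField hw,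
    smul_smul, smul_smul, sub_sub_cancel]
  congr 1
  field_simp

theorem ae_ne_const (v₁ : E3) : ∀ᵐ v₂ : E3, v₁ ≠ v₂ := by
  have : (volume : Measure E3) {v₁} = 0 := measure_singleton v₁
  filter_upwards [measure_eq_zero_iff_ae_notMem.1 this] with v hv h
  exact hv h.symm

theorem landauFlux_eq (ψ : E3 → ℝ) :
    landauFlux ψ = fun v => ∫ w, landauKernel w (landauDensity ψ w v) := by
  ext1 v
  rw [landauFlux, ← integral_sub_left_eq_self (fun w => landauKernel w (landauDensity ψ w v)) volume v]
  refine integral_congr_ae ?_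
  filter_upwards [ae_ne_const v] with v₂ h
  exact landauIntegrand_eq h

theorem hasFDerivAt_landauDensity (h : IsC3b ψ) (w v : E3) :
    HasFDerivAt (landauDensity ψ w) (landauDensityDeriv ψ w v) v := by
  have hs : HasFDerivAt (fun v : E3 => v - w) (ContinuousLinearMap.id ℝ E3) v :=
    (hasFDerivAt_id v).sub_const w
  have h1 := (hasFDerivAt_maxwellian v).mul ((hasFDerivAt_maxwellian (v - w)).comp v hs)
  have h2 := (h.hasFDerivAt_gradient v).sub ((h.hasFDerivAt_gradient (v - w)).comp v hs)
  refine (h1.smul h2).congr_fderiv ?_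
  ext1 x
  simp only [landauDensityDeriv, _root_.add_apply, _root_.sub_apply, _root_.smul_apply,
    ContinuousLinearMap.smulRight_apply, innerSL_apply_apply, Function.comp_apply, smul_eq_mul,
    inner_add_left, ContinuousLinearMap.comp_id]
  rw [sub_eq_add_neg _ (_ • _), ← neg_smul]
  congr 2
  ring

theorem continuous_landauDensityDeriv (h : IsC3b ψ) (v : E3) :
    Continuous fun w => landauDensityDeriv ψ w v := by
  have h1 := continuous_maxwellian
  have h2 := h.contDiff_hessian.continuous
  have h3 := h.continuous_gradient
  unfold landauDensityDeriv
  fun_prop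

theorem continuous_landauDensity (h : IsC3b ψ) (v : E3) : Continuous fun w => landauDensity ψ w v := by
  have h1 := continuous_maxwellian
  have h3 := h.continuous_gradient
  unfold landauDensity
  fun_prop

theorem exists_landauDensity_bound (h : IsC3b ψ) :
    ∃ C : ℝ, 0 ≤ C ∧ ∀ v w : E3, ‖landauDensity ψ w v‖ ≤ C * (1 + ‖v‖) ^ 4 * ((1 + ‖w‖) ^ 4)⁻¹ ∧
      ‖landauDensityDeriv ψ w v‖ ≤ C * (1 + ‖v‖) ^ 4 * ((1 + ‖w‖) ^ 4)⁻¹ := by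
  obtain ⟨K₁, hK₁, hb₁⟩ := exists_maxwellian_mul_pow_le 1
  obtain ⟨K₂, hK₂, hb₂⟩ := exists_maxwellian_mul_pow_le 5
  have hN := h.c3bNorm_nonneg
  set N := c3bNorm ψ
  refine ⟨4 * N * (K₁ * K₂), by positivity, fun v w => ?_⟩
  have hM := maxwellian_pos v
  have hM' := maxwellian_pos (v - w)
  have hx : ‖gradient ψ v - gradient ψ (v - w)‖ ≤ 2 * N := by
    refine (norm_sub_le _ _).trans ?_
    linarith [h.norm_gradient_le v, h.norm_gradient_le (v - w)]
  have hT : ‖hessian ψ v - hessian ψ (v - w)‖ ≤ 2 * N := by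
    refine (norm_sub_le _ _).trans ?_
    linarith [h.norm_hessian_le v, h.norm_hessian_le (v - w)]
  have hkey : maxwellian v * maxwellian (v - w) * ((1 + ‖v‖) * (1 + ‖v - w‖)) ≤
      K₁ * K₂ * (1 + ‖v‖) ^ 4 * ((1 + ‖w‖) ^ 4)⁻¹ := by
    rw [← div_eq_mul_inv, le_div_iff₀ (by positivity)]
    have h1 : 1 + ‖w‖ ≤ (1 + ‖v‖) * (1 + ‖v - w‖) := by
      have := one_add_norm_le_mul v (v - w)
      rwa [sub_sub_cancel] at this
    have e1 := hb₁ v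
    have e2 := hb₂ (v - w)
    calc maxwellian v * maxwellian (v - w) * ((1 + ‖v‖) * (1 + ‖v - w‖)) * (1 + ‖w‖) ^ 4
        ≤ maxwellian v * maxwellian (v - w) * ((1 + ‖v‖) * (1 + ‖v - w‖)) *
          ((1 + ‖v‖) * (1 + ‖v - w‖)) ^ 4 := by gcongr
      _ = (maxwellian v * (1 + ‖v‖) ^ 1) * (maxwellian (v - w) * (1 + ‖v - w‖) ^ 5) *
          (1 + ‖v‖) ^ 4 := by ring
      _ ≤ K₁ * K₂ * (1 + ‖v‖) ^ 4 := by gcongr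
  have hone : (1 : ℝ) ≤ (1 + ‖v‖) * (1 + ‖v - w‖) :=
    one_le_mul_of_one_le_of_one_le (by linarith [norm_nonneg v]) (by linarith [norm_nonneg (v - w)])
  have habs : ‖maxwellian v * maxwellian (v - w)‖ = maxwellian v * maxwellian (v - w) := by
    rw [Real.norm_eq_abs, abs_of_pos (mul_pos hM hM')]
  constructor
  · rw [landauDensity, norm_smul, habs]
    calc maxwellian v * maxwellian (v - w) * ‖gradient ψ v - gradient ψ (v - w)‖
        ≤ maxwellian v * maxwellian (v - w) * ((2 * N) * ((1 + ‖v‖) * (1 + ‖v - w‖))) := by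
          gcongr
          exact hx.trans (le_mul_of_one_le_right (by positivity) hone)
      _ = 2 * N * (maxwellian v * maxwellian (v - w) * ((1 + ‖v‖) * (1 + ‖v - w‖))) := by ring
      _ ≤ 4 * N * (K₁ * K₂ * (1 + ‖v‖) ^ 4 * ((1 + ‖w‖) ^ 4)⁻¹) := by gcongr; norm_num
      _ = _ := by ring
  · rw [landauDensityDeriv]
    refine (norm_sub_le _ _).trans ?_
    rw [norm_smul, ContinuousLinearMap.norm_smulRight_apply, norm_smul, habs, innerSL_apply_norm]
    have hvv : ‖v + (v - w)‖ ≤ ‖v‖ + ‖v - w‖ := norm_add_le _ _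
    calc maxwellian v * maxwellian (v - w) * ‖hessian ψ v - hessian ψ (v - w)‖ +
          maxwellian v * maxwellian (v - w) * ‖v + (v - w)‖ * ‖gradient ψ v - gradient ψ (v - w)‖
        ≤ maxwellian v * maxwellian (v - w) * (2 * N) +
          maxwellian v * maxwellian (v - w) * (‖v‖ + ‖v - w‖) * (2 * N) := by gcongr
      _ = 2 * N * (maxwellian v * maxwellian (v - w) * (1 + ‖v‖ + ‖v - w‖)) := by ring
      _ ≤ 2 * N * (maxwellian v * maxwellian (v - w) * ((1 + ‖v‖) * (1 + ‖v - w‖))) := by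
          gcongr
          nlinarith [mul_nonneg (norm_nonneg v) (norm_nonneg (v - w))]
      _ ≤ 4 * N * (K₁ * K₂ * (1 + ‖v‖) ^ 4 * ((1 + ‖w‖) ^ 4)⁻¹) := by gcongr; norm_num
      _ = _ := by ring

theorem inv_norm_le (w : E3) : ‖w‖⁻¹ ≤ 1 + (‖w‖ ^ 2)⁻¹ := by
  rw [← inv_pow]
  nlinarith [sq_nonneg (‖w‖⁻¹ - 1), inv_nonneg.2 (norm_nonneg w)]

theorem hasFDerivAt_landauFlux (h : IsC3b ψ) (v : E3) :
    Integrable (fun w => (landauKernel w).comp (landauDensityDeriv ψ w v)) ∧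
    HasFDerivAt (landauFlux ψ) (∫ w, (landauKernel w).comp (landauDensityDeriv ψ w v)) v := by
  obtain ⟨C, hC, hb⟩ := exists_landauDensity_bound h
  set K := 2 * (C * (2 + ‖v‖) ^ 4) with hK
  have hbi : Integrable fun w : E3 => K * ((1 + (‖w‖ ^ 2)⁻¹) * ((1 + ‖w‖) ^ 4)⁻¹) :=
    integrable_singular_weight.const_mul _
  have hbound : ∀ w, ∀ x ∈ Metric.ball v 1,
      ‖(landauKernel w).comp (landauDensityDeriv ψ w x)‖ ≤
        K * ((1 + (‖w‖ ^ 2)⁻¹) * ((1 + ‖w‖) ^ 4)⁻¹) ∧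
      ‖landauKernel w (landauDensity ψ w x)‖ ≤
        K * ((1 + (‖w‖ ^ 2)⁻¹) * ((1 + ‖w‖) ^ 4)⁻¹) := by
    intro w x hx
    have hx' : 1 + ‖x‖ ≤ 2 + ‖v‖ := by
      have := norm_le_norm_add_norm_sub v x
      rw [Metric.mem_ball, dist_comm, dist_eq_norm] at hx
      linarith
    have e1 := norm_landauKernel_le w
    have e2 := inv_norm_le w
    have e3 : ∀ t : ℝ, t ≤ C * (1 + ‖x‖) ^ 4 * ((1 + ‖w‖) ^ 4)⁻¹ → 0 ≤ t →
        ‖landauKernel w‖ * t ≤ K * ((1 + (‖w‖ ^ 2)⁻¹) * ((1 + ‖w‖) ^ 4)⁻¹) := by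
      intro t ht ht0
      calc ‖landauKernel w‖ * t
          ≤ (2 * (1 + (‖w‖ ^ 2)⁻¹)) * (C * (2 + ‖v‖) ^ 4 * ((1 + ‖w‖) ^ 4)⁻¹) := by
            gcongr
            · linarith
            · refine ht.trans ?_; gcongr
        _ = _ := by rw [hK]; ring
    exact ⟨(ContinuousLinearMap.opNorm_comp_le _ _).trans (e3 _ (hb x w).2 (norm_nonneg _)),
      ((landauKernel w).le_opNorm _).trans (e3 _ (hb x w).1 (norm_nonneg _))⟩
  have hm' : AEStronglyMeasurable (fun w => (landauKernel w).comp (landauDensityDeriv ψ w v)) :=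
    (ContinuousLinearMap.compL ℝ E3 E3 E3).aestronglyMeasurable_comp₂
      aestronglyMeasurable_landauKernel (continuous_landauDensityDeriv h v).aestronglyMeasurable
  have hm : ∀ x, AEStronglyMeasurable fun w => landauKernel w (landauDensity ψ w x) := fun x =>
    (ContinuousLinearMap.id ℝ (E3 →L[ℝ] E3)).aestronglyMeasurable_comp₂
      aestronglyMeasurable_landauKernel (continuous_landauDensity h x).aestronglyMeasurable
  have hv : v ∈ Metric.ball v 1 := Metric.mem_ball_self one_pos
  refine ⟨hbi.mono' hm' (Eventually.of_forall fun w => (hbound w v hv).1), ?_⟩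
  rw [landauFlux_eq]
  exact hasFDerivAt_integral_of_dominated_of_fderiv_le (𝕜 := ℝ) (Metric.ball_mem_nhds v one_pos)
    (F := fun v w => landauKernel w (landauDensity ψ w v))
    (F' := fun v w => (landauKernel w).comp (landauDensityDeriv ψ w v))
    (Eventually.of_forall hm)
    (hbi.mono' (hm v) (Eventually.of_forall fun w => (hbound w v hv).2)) hm'
    (Eventually.of_forall fun w x hx => (hbound w x hx).1) hbi
    (Eventually.of_forall fun w x _ =>
      (landauKernel w).hasFDerivAt.comp x (hasFDerivAt_landauDensity h w x))

theorem integrable_landauIntegrand (h : IsC3b ψ) (v₁ : E3) : Integrable (landauIntegrand ψ v₁) := by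
  have hN := h.c3bNorm_nonneg
  have hm := continuous_maxwellian
  have hg := h.continuous_gradient
  refine integrable_of_maxwellian_bound v₁ (4 * c3bNorm ψ * maxwellian v₁) 0 ?_ fun v₂ hv => ?_
  · have : Measurable (landauIntegrand ψ v₁) := by
      have h1 := hm.measurable
      have h2 := hg.measurable
      unfold landauIntegrand perpProj
      fun_prop
    exact this.aestronglyMeasurable
  · have hM := maxwellian_pos v₁
    have hM' := maxwellian_pos v₂
    rw [landauIntegrand_eq hv, landauDensity, map_smul, norm_smul, sub_sub_cancel, Real.norm_eq_abs,
      abs_of_pos (mul_pos hM hM'), pow_zero, mul_one]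
    have hx : ‖gradient ψ v₁ - gradient ψ v₂‖ ≤ 2 * c3bNorm ψ := by
      refine (norm_sub_le _ _).trans ?_
      linarith [h.norm_gradient_le v₁, h.norm_gradient_le v₂]
    calc maxwellian v₁ * maxwellian v₂ * ‖landauKernel (v₁ - v₂) (gradient ψ v₁ - gradient ψ v₂)‖
        ≤ maxwellian v₁ * maxwellian v₂ * ((2 * (1 + (‖v₁ - v₂‖ ^ 2)⁻¹)) * (2 * c3bNorm ψ)) := by
          gcongr
          refine ((landauKernel _).le_opNorm _).trans ?_
          have e1 := norm_landauKernel_le (v₁ - v₂)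
          have e2 := inv_norm_le (v₁ - v₂)
          gcongr
          linarith
      _ = _ := by ring

/-- The Landau operator with the derivatives carried out. -/
theorem landauOp_eq_integral (h : IsC3b ψ) (v₁ : E3) :
    landauOp ψ v₁ = ∫ v₂, maxwellian v₂ *
      (‖v₁ - v₂‖⁻¹ * perpTrace (v₁ - v₂) (hessian ψ v₁ - hessian ψ v₂) -
        2 * ((‖v₁ - v₂‖ ^ 3)⁻¹ *
          inner ℝ v₂ (crossField (v₁ - v₂) (gradient ψ v₁ - gradient ψ v₂)))) := by
  obtain ⟨hi, hd⟩ := hasFDerivAt_landauFlux h v₁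
  have h1 : divergence (landauFlux ψ) v₁ = trace3 (fderiv ℝ (landauFlux ψ) v₁) := by
    rw [divergence, trace3_apply]
  rw [landauOp, h1, hd.fderiv, ← ContinuousLinearMap.integral_comp_comm _ hi, ← integral_const_mul,
    ← integral_sub_left_eq_self (fun w => (maxwellian v₁)⁻¹ *
      trace3 ((landauKernel w).comp (landauDensityDeriv ψ w v₁))) volume v₁]
  refine integral_congr_ae ?_
  filter_upwards [ae_ne_const v₁] with v₂ hv
  have hw : v₁ - v₂ ≠ 0 := sub_ne_zero.2 hv
  have hM := (maxwellian_pos v₁).ne'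
  set w := v₁ - v₂ with hw_def
  have hv2 : v₁ - w = v₂ := sub_sub_cancel _ _
  have e1 : (landauKernel w).comp (((maxwellian v₁ * maxwellian v₂) • innerSL ℝ (v₁ + v₂)).smulRight
      (gradient ψ v₁ - gradient ψ v₂)) =
      ((maxwellian v₁ * maxwellian v₂) • innerSL ℝ (v₁ + v₂)).smulRight
        (landauKernel w (gradient ψ v₁ - gradient ψ v₂)) := by
    ext1 x; simp
  have e2 : inner ℝ (v₁ + v₂) (crossField w (gradient ψ v₁ - gradient ψ v₂)) =
      2 * inner ℝ v₂ (crossField w (gradient ψ v₁ - gradient ψ v₂)) := by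
    have : v₁ + v₂ = w + (2 : ℝ) • v₂ := by rw [hw_def, two_smul]; abel
    rw [this, inner_add_left, inner_crossField_self, real_inner_smul_left, zero_add]
  rw [landauDensityDeriv, hv2, ContinuousLinearMap.comp_sub, map_sub, ContinuousLinearMap.comp_smul,
    map_smul, trace3_landauKernel_comp, e1, trace3_smulRight, _root_.smul_apply, innerSL_apply_apply,
    landauKernel_apply hw, real_inner_smul_right, e2, smul_eq_mul, smul_eq_mul]
  field_simp

end Landau

/-! ### Integration by parts in the Landau operator -/

theorem integral_mul_trace3 {f : E3 → ℝ} {f' : E3 → E3 →L[ℝ] ℝ} {Y : E3 → E3}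
    {Y' : E3 → E3 →L[ℝ] E3} (hf : ∀ x, HasFDerivAt f (f' x) x) (hY : ∀ x, HasFDerivAt Y (Y' x) x)
    (hf' : Continuous f') (hY' : Continuous Y') (h1 : Integrable fun x => ‖f' x‖ * ‖Y x‖)
    (h2 : Integrable fun x => ‖f x‖ * ‖Y' x‖) (h3 : Integrable fun x => ‖f x‖ * ‖Y x‖) :
    ∫ x, f x * trace3 (Y' x) = -∫ x, f' x (Y x) := by
  have hfc : Continuous f := continuous_iff_continuousAt.2 fun x => (hf x).continuousAt
  have hYc : Continuous Y := continuous_iff_continuousAt.2 fun x => (hY x).continuousAt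
  have hsingle : ∀ i : Fin 3, ‖(EuclideanSpace.single i (1 : ℝ) : E3)‖ = 1 := fun i => by simp
  have i1 : ∀ i : Fin 3, Integrable fun x => f' x (EuclideanSpace.single i 1) * Y x i := fun i => by
    refine h1.mono' (Continuous.aestronglyMeasurable (by fun_prop)) (Eventually.of_forall fun x => ?_)
    rw [norm_mul]
    gcongr
    · simpa [hsingle] using (f' x).le_opNorm (EuclideanSpace.single i 1)
    · exact PiLp.norm_apply_le _ i
  have i2 : ∀ i : Fin 3, Integrable fun x => f x * (Y' x (EuclideanSpace.single i 1)) i := fun i => by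
    refine h2.mono' (Continuous.aestronglyMeasurable (by fun_prop)) (Eventually.of_forall fun x => ?_)
    rw [norm_mul]
    gcongr
    refine (PiLp.norm_apply_le _ i).trans ?_
    simpa [hsingle] using (Y' x).le_opNorm (EuclideanSpace.single i 1)
  have i3 : ∀ i : Fin 3, Integrable fun x => f x * Y x i := fun i => by
    refine h3.mono' (Continuous.aestronglyMeasurable (by fun_prop)) (Eventually.of_forall fun x => ?_)
    rw [norm_mul]
    gcongr
    exact PiLp.norm_apply_le _ i
  have key : ∀ i : Fin 3, ∫ x, f x * (Y' x (EuclideanSpace.single i 1)) i =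
      -∫ x, f' x (EuclideanSpace.single i 1) * Y x i := fun i =>
    integral_bilinear_hasFDerivAt_right_eq_neg_left_of_integrable (B := ContinuousLinearMap.mul ℝ ℝ)
      (f := f) (f' := f') (g := fun x => Y x i)
      (g' := fun x => (EuclideanSpace.proj i : E3 →L[ℝ] ℝ).comp (Y' x))
      (v := EuclideanSpace.single i 1) (i1 i) (i2 i) (i3 i) (fun x _ => hf x)
      (fun x _ => (EuclideanSpace.proj i : E3 →L[ℝ] ℝ).hasFDerivAt.comp x (hY x))
  have e1 : ∀ x, f x * trace3 (Y' x) = ∑ i, f x * (Y' x (EuclideanSpace.single i 1)) i := fun x => by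
    rw [trace3_apply, Finset.mul_sum]
  have e2 : ∀ x, f' x (Y x) = ∑ i, f' x (EuclideanSpace.single i 1) * Y x i := fun x => by
    conv_lhs => rw [← sum_single_smul (Y x), map_sum]
    simp [mul_comm]
  simp only [e1, e2]
  rw [integral_finsetSum _ fun i _ => i2 i, integral_finsetSum _ fun i _ => i1 i,
    ← Finset.sum_neg_distrib]
  exact Finset.sum_congr rfl fun i _ => key i

section Parts

variable {ψ : E3 → ℝ}

/-- The derivative of `v ↦ |w|² x - (w · x) w` for `w = v₁ - v`, `x = ∇ψ(v₁) - ∇ψ(v)`. -/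
def crossFieldDeriv (ψ : E3 → ℝ) (v₁ v : E3) : E3 →L[ℝ] E3 :=
  -((2 : ℝ) • innerSL ℝ (v₁ - v)).smulRight (gradient ψ v₁ - gradient ψ v) -
    ‖v₁ - v‖ ^ 2 • hessian ψ v +
    (innerSL ℝ (gradient ψ v₁ - gradient ψ v) + (innerSL ℝ (v₁ - v)).comp (hessian ψ v)).smulRight
      (v₁ - v) +
    (inner ℝ (v₁ - v) (gradient ψ v₁ - gradient ψ v) : ℝ) • ContinuousLinearMap.id ℝ E3

theorem hasFDerivAt_crossField (h : IsC3b ψ) (v₁ v : E3) :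
    HasFDerivAt (fun v => crossField (v₁ - v) (gradient ψ v₁ - gradient ψ v))
      (crossFieldDeriv ψ v₁ v) v := by
  have hw : HasFDerivAt (fun v : E3 => v₁ - v) (-ContinuousLinearMap.id ℝ E3) v :=
    (hasFDerivAt_id v).const_sub v₁
  have hx : HasFDerivAt (fun v : E3 => gradient ψ v₁ - gradient ψ v) (-hessian ψ v) v :=
    (h.hasFDerivAt_gradient v).const_sub _
  refine ((hw.norm_sq.smul hx).sub ((hw.inner ℝ hx).smul hw)).congr_fderiv ?_
  ext1 u
  simp only [crossFieldDeriv, _root_.add_apply, _root_.sub_apply, _root_.smul_apply,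
    _root_.neg_apply, ContinuousLinearMap.comp_apply, ContinuousLinearMap.id_apply,
    ContinuousLinearMap.smulRight_apply, innerSL_apply_apply, smul_eq_mul,
    ContinuousLinearMap.prod_apply, fderivInnerCLM_apply, inner_neg_right, inner_neg_left,
    real_inner_comm u]
  module

theorem continuous_crossFieldDeriv (h : IsC3b ψ) (v₁ : E3) : Continuous (crossFieldDeriv ψ v₁) := by
  have h2 := h.contDiff_hessian.continuous
  have h3 := h.continuous_gradient
  unfold crossFieldDeriv
  fun_prop

theorem norm_sq_mul_perpTrace (w : E3) (T : E3 →L[ℝ] E3) :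
    ‖w‖ ^ 2 * perpTrace w T = ‖w‖ ^ 2 * trace3 T - inner ℝ w (T w) := by
  rcases eq_or_ne w 0 with rfl | hw
  · simp
  have hn : ‖w‖ ≠ 0 := norm_ne_zero_iff.2 hw
  rw [perpTrace]
  field_simp

theorem trace3_crossFieldDeriv (ψ : E3 → ℝ) (v₁ v : E3) :
    trace3 (crossFieldDeriv ψ v₁ v) = 2 * inner ℝ (v₁ - v) (gradient ψ v₁ - gradient ψ v) -
      ‖v₁ - v‖ ^ 2 * perpTrace (v₁ - v) (hessian ψ v) := by
  rw [crossFieldDeriv, map_add, map_add, map_sub, map_neg, map_smul, map_smul, trace3_smulRight,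
    trace3_smulRight, trace3_id, norm_sq_mul_perpTrace]
  simp only [_root_.smul_apply, _root_.add_apply, innerSL_apply_apply, smul_eq_mul,
    ContinuousLinearMap.comp_apply, real_inner_comm (v₁ - v) (gradient ψ v₁ - gradient ψ v)]
  ring

theorem IsC3b.norm_gradient_sub_le (h : IsC3b ψ) (a b : E3) :
    ‖gradient ψ a - gradient ψ b‖ ≤ 2 * c3bNorm ψ := by
  refine (norm_sub_le _ _).trans ?_
  linarith [h.norm_gradient_le a, h.norm_gradient_le b]

theorem norm_crossFieldDeriv_le (h : IsC3b ψ) (v₁ v : E3) {P : ℝ} (hP1 : 1 ≤ P)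
    (hP : ‖v₁ - v‖ ≤ P) : ‖crossFieldDeriv ψ v₁ v‖ ≤ 10 * c3bNorm ψ * P ^ 2 := by
  have hN := h.c3bNorm_nonneg
  have hx := h.norm_gradient_sub_le v₁ v
  have hT := h.norm_hessian_le v
  set N := c3bNorm ψ
  set w := v₁ - v
  set x := gradient ψ v₁ - gradient ψ v
  have hw := norm_nonneg w
  refine ContinuousLinearMap.opNorm_le_bound _ (by positivity) fun u => ?_
  have hu := norm_nonneg u
  have hTu : ‖hessian ψ v u‖ ≤ N * ‖u‖ := ((hessian ψ v).le_opNorm u).trans (by gcongr)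
  have e : crossFieldDeriv ψ v₁ v u = -(2 * inner ℝ w u) • x - ‖w‖ ^ 2 • hessian ψ v u +
      (inner ℝ x u + inner ℝ w (hessian ψ v u)) • w + (inner ℝ w x : ℝ) • u := by
    simp only [crossFieldDeriv, _root_.add_apply, _root_.sub_apply, _root_.neg_apply,
      _root_.smul_apply, ContinuousLinearMap.smulRight_apply, innerSL_apply_apply,
      ContinuousLinearMap.comp_apply, ContinuousLinearMap.id_apply, smul_eq_mul, neg_smul, w, x]
  rw [e]
  refine (norm_add₃_le).trans ?_
  have a1 : ‖-(2 * inner ℝ w u) • x - ‖w‖ ^ 2 • hessian ψ v u‖ ≤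
      2 * (P * ‖u‖) * (2 * N) + P ^ 2 * (N * ‖u‖) := by
    refine (norm_sub_le _ _).trans ?_
    rw [norm_smul, norm_smul, norm_neg, norm_mul, Real.norm_ofNat, norm_pow, norm_norm]
    have := abs_real_inner_le_norm w u
    rw [← Real.norm_eq_abs] at this
    gcongr
    exact this.trans (by gcongr)
  have a2 : ‖(inner ℝ x u + inner ℝ w (hessian ψ v u)) • w‖ ≤
      (2 * N * ‖u‖ + P * (N * ‖u‖)) * P := by
    rw [norm_smul]
    have h1 := abs_real_inner_le_norm x u
    have h2 := abs_real_inner_le_norm w (hessian ψ v u)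
    rw [← Real.norm_eq_abs] at h1 h2
    gcongr
    refine (norm_add_le _ _).trans (add_le_add (h1.trans ?_) (h2.trans ?_)) <;> gcongr
  have a3 : ‖(inner ℝ w x : ℝ) • u‖ ≤ P * (2 * N) * ‖u‖ := by
    rw [norm_smul]
    have h1 := abs_real_inner_le_norm w x
    rw [← Real.norm_eq_abs] at h1
    gcongr
    exact h1.trans (by gcongr)
  have hPP : P ≤ P ^ 2 := by nlinarith
  have hNu : 0 ≤ N * ‖u‖ := by positivity
  have : 8 * (N * ‖u‖) * P ≤ 8 * (N * ‖u‖) * P ^ 2 := by gcongr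
  linarith

/-- The regularised radial factor `(|v₁ - v|² + δ)^(-3/2)`. -/
def radialFactor (δ : ℝ) (v₁ v : E3) : ℝ := (‖v₁ - v‖ ^ 2 + δ) ^ (-(3 / 2) : ℝ)

theorem hasFDerivAt_radialFactor {δ : ℝ} (hδ : 0 < δ) (v₁ v : E3) :
    HasFDerivAt (radialFactor δ v₁)
      ((3 * (‖v₁ - v‖ ^ 2 + δ) ^ (-(5 / 2) : ℝ)) • innerSL ℝ (v₁ - v)) v := by
  have hw : HasFDerivAt (fun v : E3 => v₁ - v) (-ContinuousLinearMap.id ℝ E3) v :=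
    (hasFDerivAt_id v).const_sub v₁
  have hpos : 0 < ‖v₁ - v‖ ^ 2 + δ := by positivity
  have h1 := (Real.hasDerivAt_rpow_const (p := (-(3 / 2) : ℝ)) (Or.inl hpos.ne')).comp_hasFDerivAt v
    (hw.norm_sq.add_const δ)
  refine h1.congr_fderiv ?_
  ext1 u
  simp only [_root_.smul_apply, ContinuousLinearMap.comp_apply, _root_.neg_apply,
    ContinuousLinearMap.id_apply, innerSL_apply_apply, inner_neg_right, smul_eq_mul]
  rw [show (-(3 / 2) - 1 : ℝ) = -(5 / 2) by norm_num, two_smul]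
  ring

theorem exists_pow_bound_of_maxwellian (v₁ : E3) {F : E3 → ℝ} (hF : Continuous F) (C : ℝ) (k : ℕ)
    (hb : ∀ v, |F v| ≤ C * ((1 + ‖v₁‖) * (1 + ‖v‖)) ^ k * maxwellian v) (hC : 0 ≤ C) :
    Integrable F := by
  refine integrable_of_maxwellian_bound v₁ (C * (1 + ‖v₁‖) ^ k) k hF.aestronglyMeasurable
    fun v _ => ?_
  refine (hb v).trans ?_
  have hM := (maxwellian_pos v).le
  have : 0 ≤ (‖v₁ - v‖ ^ 2)⁻¹ := by positivity
  rw [mul_pow]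
  calc C * ((1 + ‖v₁‖) ^ k * (1 + ‖v‖) ^ k) * maxwellian v
      = C * (1 + ‖v₁‖) ^ k * 1 * (1 + ‖v‖) ^ k * maxwellian v := by ring
    _ ≤ _ := by gcongr; linarith

/-- The divergence of the Landau kernel against the Maxwellian, up to the radial factor. -/
def partsDensity (ψ : E3 → ℝ) (v₁ v : E3) : ℝ :=
  maxwellian v * (2 * inner ℝ (v₁ - v) (gradient ψ v₁ - gradient ψ v) -
    ‖v₁ - v‖ ^ 2 * perpTrace (v₁ - v) (hessian ψ v) -
    inner ℝ v (crossField (v₁ - v) (gradient ψ v₁ - gradient ψ v)))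

theorem integral_radialFactor_mul (h : IsC3b ψ) (v₁ : E3) {δ : ℝ} (hδ : 0 < δ) :
    ∫ v, radialFactor δ v₁ v * partsDensity ψ v₁ v = 0 := by
  have hN := h.c3bNorm_nonneg
  set N := c3bNorm ψ with hN_def
  have hMc := continuous_maxwellian
  have hgc := h.continuous_gradient
  have hbase : ∀ v : E3, δ ≤ ‖v₁ - v‖ ^ 2 + δ := fun v => by linarith [sq_nonneg ‖v₁ - v‖]
  have hpos : ∀ v : E3, 0 < ‖v₁ - v‖ ^ 2 + δ := fun v => hδ.trans_le (hbase v)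
  set a := δ ^ (-(3 / 2) : ℝ)
  set b := δ ^ (-(5 / 2) : ℝ)
  have ha : 0 < a := Real.rpow_pos_of_pos hδ _
  have hb : 0 < b := Real.rpow_pos_of_pos hδ _
  have hra : ∀ v, radialFactor δ v₁ v ≤ a := fun v =>
    Real.rpow_le_rpow_of_nonpos hδ (hbase v) (by norm_num)
  have hr0 : ∀ v, 0 ≤ radialFactor δ v₁ v := fun v => Real.rpow_nonneg (hpos v).le _
  have hrb : ∀ v : E3, (‖v₁ - v‖ ^ 2 + δ) ^ (-(5 / 2) : ℝ) ≤ b := fun v =>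
    Real.rpow_le_rpow_of_nonpos hδ (hbase v) (by norm_num)
  set f' : E3 → E3 →L[ℝ] ℝ := fun v => maxwellian v •
    ((3 * (‖v₁ - v‖ ^ 2 + δ) ^ (-(5 / 2) : ℝ)) • innerSL ℝ (v₁ - v)) +
      radialFactor δ v₁ v • (-maxwellian v • innerSL ℝ v) with hf'_def
  have hrc : Continuous (radialFactor δ v₁) :=
    continuous_iff_continuousAt.2 fun v => (hasFDerivAt_radialFactor hδ v₁ v).continuousAt
  have hf : ∀ v, HasFDerivAt (fun v => maxwellian v * radialFactor δ v₁ v) (f' v) v := fun v =>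
    (hasFDerivAt_maxwellian v).mul (hasFDerivAt_radialFactor hδ v₁ v)
  have hf'c : Continuous f' := by
    have hc : Continuous fun v : E3 => (‖v₁ - v‖ ^ 2 + δ) ^ (-(5 / 2) : ℝ) :=
      Continuous.rpow_const (by fun_prop) fun v => Or.inl (hpos v).ne'
    rw [hf'_def]
    fun_prop
  have hYc : Continuous fun v => crossField (v₁ - v) (gradient ψ v₁ - gradient ψ v) :=
    continuous_iff_continuousAt.2 fun v => (hasFDerivAt_crossField h v₁ v).continuousAt
  have hY'c := continuous_crossFieldDeriv h v₁
  have hP : ∀ v : E3, 1 ≤ (1 + ‖v₁‖) * (1 + ‖v‖) ∧ ‖v₁ - v‖ ≤ (1 + ‖v₁‖) * (1 + ‖v‖) ∧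
      ‖v‖ ≤ (1 + ‖v₁‖) * (1 + ‖v‖) := fun v => by
    have h1 := one_add_norm_le_mul v₁ v
    have := norm_nonneg (v₁ - v)
    refine ⟨by linarith, by linarith, ?_⟩
    nlinarith [norm_nonneg v₁, norm_nonneg v, mul_nonneg (norm_nonneg v₁) (norm_nonneg v)]
  have hYb : ∀ v, ‖crossField (v₁ - v) (gradient ψ v₁ - gradient ψ v)‖ ≤
      4 * N * ((1 + ‖v₁‖) * (1 + ‖v‖)) ^ 2 := fun v => by
    obtain ⟨h1, h2, h3⟩ := hP v
    refine (norm_crossField_le _ _).trans ?_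
    calc 2 * ‖v₁ - v‖ ^ 2 * ‖gradient ψ v₁ - gradient ψ v‖
        ≤ 2 * ((1 + ‖v₁‖) * (1 + ‖v‖)) ^ 2 * (2 * N) := by
          gcongr; exact h.norm_gradient_sub_le v₁ v
      _ = _ := by ring
  have hfb : ∀ v, ‖maxwellian v * radialFactor δ v₁ v‖ ≤ maxwellian v * a := fun v => by
    have := maxwellian_pos v
    rw [Real.norm_eq_abs, abs_of_nonneg (mul_nonneg this.le (hr0 v))]
    gcongr
    exact hra v
  have hf'b : ∀ v, ‖f' v‖ ≤ (3 * b + a) * ((1 + ‖v₁‖) * (1 + ‖v‖)) * maxwellian v := fun v => by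
    obtain ⟨h1, h2, h3⟩ := hP v
    have hM := maxwellian_pos v
    have h5 : 0 ≤ (‖v₁ - v‖ ^ 2 + δ) ^ (-(5 / 2) : ℝ) := Real.rpow_nonneg (hpos v).le _
    simp only [hf'_def]
    refine (norm_add_le _ _).trans ?_
    rw [norm_smul, norm_smul, norm_smul, norm_smul, innerSL_apply_norm, innerSL_apply_norm, norm_neg,
      Real.norm_of_nonneg hM.le, Real.norm_of_nonneg (hr0 v), norm_mul, Real.norm_ofNat,
      Real.norm_of_nonneg h5]
    calc maxwellian v * (3 * (‖v₁ - v‖ ^ 2 + δ) ^ (-(5 / 2) : ℝ) * ‖v₁ - v‖) +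
          radialFactor δ v₁ v * (maxwellian v * ‖v‖)
        ≤ maxwellian v * (3 * b * ((1 + ‖v₁‖) * (1 + ‖v‖))) +
          a * (maxwellian v * ((1 + ‖v₁‖) * (1 + ‖v‖))) := by
          gcongr
          · exact hrb v
          · exact hra v
      _ = _ := by ring
  have hparts := integral_mul_trace3 hf (hasFDerivAt_crossField h v₁) hf'c hY'c ?_ ?_ ?_
  · rw [← sub_eq_zero, sub_neg_eq_add] at hparts
    have e : ∀ v, f' v (crossField (v₁ - v) (gradient ψ v₁ - gradient ψ v)) =
        -(maxwellian v * radialFactor δ v₁ v *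
          inner ℝ v (crossField (v₁ - v) (gradient ψ v₁ - gradient ψ v))) := fun v => by
      simp only [hf'_def, _root_.add_apply, _root_.smul_apply, innerSL_apply_apply,
        inner_crossField_self, smul_eq_mul, mul_zero, zero_add]
      ring
    rw [← integral_add ?_ ?_] at hparts
    · rw [← hparts]
      refine integral_congr_ae (Eventually.of_forall fun v => ?_)
      simp only
      rw [e, trace3_crossFieldDeriv, partsDensity]
      ring
    · refine exists_pow_bound_of_maxwellian v₁ (Continuous.mul (by fun_prop) (by fun_prop))
        (a * (3 * (10 * N))) 2 (fun v => ?_) (by positivity)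
      obtain ⟨h1, h2, h3⟩ := hP v
      rw [abs_mul]
      calc |maxwellian v * radialFactor δ v₁ v| * |trace3 (crossFieldDeriv ψ v₁ v)|
          ≤ (maxwellian v * a) * (3 * (10 * N * ((1 + ‖v₁‖) * (1 + ‖v‖)) ^ 2)) := by
            have := (maxwellian_pos v).le
            gcongr
            · exact hfb v
            · refine (abs_trace3_le _).trans ?_
              gcongr
              exact norm_crossFieldDeriv_le h v₁ v h1 h2
        _ = _ := by ring
    · refine exists_pow_bound_of_maxwellian v₁ (by fun_prop) ((3 * b + a) * (4 * N)) 3 (fun v => ?_)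
        (by positivity)
      rw [← Real.norm_eq_abs]
      refine ((f' v).le_opNorm _).trans ?_
      calc ‖f' v‖ * ‖crossField (v₁ - v) (gradient ψ v₁ - gradient ψ v)‖
          ≤ ((3 * b + a) * ((1 + ‖v₁‖) * (1 + ‖v‖)) * maxwellian v) *
            (4 * N * ((1 + ‖v₁‖) * (1 + ‖v‖)) ^ 2) := by
            have := (maxwellian_pos v).le
            gcongr
            · exact hf'b v
            · exact hYb v
        _ = _ := by ring
  · refine exists_pow_bound_of_maxwellian v₁ (by fun_prop) ((3 * b + a) * (4 * N)) 3 (fun v => ?_)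
      (by positivity)
    rw [abs_of_nonneg (by positivity)]
    calc ‖f' v‖ * ‖crossField (v₁ - v) (gradient ψ v₁ - gradient ψ v)‖
        ≤ ((3 * b + a) * ((1 + ‖v₁‖) * (1 + ‖v‖)) * maxwellian v) *
          (4 * N * ((1 + ‖v₁‖) * (1 + ‖v‖)) ^ 2) := by
          have := (maxwellian_pos v).le
          gcongr
          · exact hf'b v
          · exact hYb v
      _ = _ := by ring
  · refine exists_pow_bound_of_maxwellian v₁ (by fun_prop) (a * (10 * N)) 2 (fun v => ?_)
      (by positivity)
    obtain ⟨h1, h2, h3⟩ := hP v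
    rw [abs_of_nonneg (by positivity)]
    calc ‖maxwellian v * radialFactor δ v₁ v‖ * ‖crossFieldDeriv ψ v₁ v‖
        ≤ (maxwellian v * a) * (10 * N * ((1 + ‖v₁‖) * (1 + ‖v‖)) ^ 2) := by
          have := (maxwellian_pos v).le
          gcongr
          · exact hfb v
          · exact norm_crossFieldDeriv_le h v₁ v h1 h2
      _ = _ := by ring
  · refine exists_pow_bound_of_maxwellian v₁ (by fun_prop) (a * (4 * N)) 2 (fun v => ?_)
      (by positivity)
    rw [abs_of_nonneg (by positivity)]
    calc ‖maxwellian v * radialFactor δ v₁ v‖ * ‖crossField (v₁ - v) (gradient ψ v₁ - gradient ψ v)‖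
        ≤ (maxwellian v * a) * (4 * N * ((1 + ‖v₁‖) * (1 + ‖v‖)) ^ 2) := by
          have := (maxwellian_pos v).le
          gcongr
          · exact hfb v
          · exact hYb v
      _ = _ := by ring

theorem abs_partsDensity_le (h : IsC3b ψ) (v₁ v : E3) :
    |partsDensity ψ v₁ v| ≤ 10 * c3bNorm ψ * ‖v₁ - v‖ ^ 2 * (1 + ‖v‖) * maxwellian v := by
  have hN := h.c3bNorm_nonneg
  have hM := maxwellian_pos v
  rw [partsDensity, abs_mul, abs_of_pos hM, mul_comm (maxwellian v)]
  refine mul_le_mul_of_nonneg_right ?_ hM.le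
  have h1 : |2 * inner ℝ (v₁ - v) (gradient ψ v₁ - gradient ψ v)| ≤
      2 * (‖v₁ - v‖ * (c3bNorm ψ * ‖v₁ - v‖)) := by
    rw [abs_mul, abs_two]
    gcongr
    refine (abs_real_inner_le_norm _ _).trans ?_
    gcongr
    exact h.gradient_sub_le v₁ v
  have h2 : |‖v₁ - v‖ ^ 2 * perpTrace (v₁ - v) (hessian ψ v)| ≤ ‖v₁ - v‖ ^ 2 * (4 * c3bNorm ψ) := by
    rw [abs_mul, abs_of_nonneg (sq_nonneg ‖v₁ - v‖)]
    gcongr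
    refine (abs_perpTrace_le _ _).trans ?_
    gcongr
    exact h.norm_hessian_le v
  have h3 : |inner ℝ v (crossField (v₁ - v) (gradient ψ v₁ - gradient ψ v))| ≤
      ‖v‖ * (2 * ‖v₁ - v‖ ^ 2 * (2 * c3bNorm ψ)) := by
    refine (abs_real_inner_le_norm _ _).trans ?_
    gcongr
    refine (norm_crossField_le _ _).trans ?_
    gcongr
    exact h.norm_gradient_sub_le v₁ v
  refine (abs_sub _ _).trans ((add_le_add_left ((abs_sub _ _).trans (add_le_add h1 h2)) _).trans ?_)
  have : 0 ≤ c3bNorm ψ * ‖v₁ - v‖ ^ 2 := by positivity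
  nlinarith [mul_nonneg this (norm_nonneg v)]

theorem measurable_partsDensity (h : IsC3b ψ) (v₁ : E3) : Measurable (partsDensity ψ v₁) := by
  have h1 := continuous_maxwellian.measurable
  have h2 := h.continuous_gradient.measurable
  have h3 := h.contDiff_hessian.continuous
  have h4 : Measurable fun v => hessian ψ v (v₁ - v) := by
    have : Continuous fun v => hessian ψ v (v₁ - v) := by fun_prop
    exact this.measurable
  have h5 : Measurable fun v => trace3 (hessian ψ v) := by
    have : Continuous fun v => trace3 (hessian ψ v) := by fun_prop
    exact this.measurable
  unfold partsDensity perpTrace crossField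
  fun_prop

theorem integrable_inv_cube_mul_partsDensity (h : IsC3b ψ) (v₁ : E3) :
    Integrable fun v => (‖v₁ - v‖ ^ 3)⁻¹ * partsDensity ψ v₁ v := by
  have hN := h.c3bNorm_nonneg
  refine integrable_of_maxwellian_bound v₁ (10 * c3bNorm ψ) 1 ?_ fun v hv => ?_
  · have := measurable_partsDensity h v₁
    have : Measurable fun v => (‖v₁ - v‖ ^ 3)⁻¹ * partsDensity ψ v₁ v := by fun_prop
    exact this.aestronglyMeasurable
  · have hM := maxwellian_pos v
    have hn : 0 < ‖v₁ - v‖ := norm_pos_iff.2 (sub_ne_zero.2 hv)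
    rw [norm_mul, norm_inv, norm_pow, norm_norm, Real.norm_eq_abs, pow_one]
    calc (‖v₁ - v‖ ^ 3)⁻¹ * |partsDensity ψ v₁ v|
        ≤ (‖v₁ - v‖ ^ 3)⁻¹ * (10 * c3bNorm ψ * ‖v₁ - v‖ ^ 2 * (1 + ‖v‖) * maxwellian v) := by
          gcongr; exact abs_partsDensity_le h v₁ v
      _ = 10 * c3bNorm ψ * ‖v₁ - v‖⁻¹ * (1 + ‖v‖) * maxwellian v := by field_simp
      _ ≤ _ := by gcongr; exact inv_norm_le _

theorem integral_inv_cube_mul_partsDensity (h : IsC3b ψ) (v₁ : E3) :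
    ∫ v, (‖v₁ - v‖ ^ 3)⁻¹ * partsDensity ψ v₁ v = 0 := by
  have hm := measurable_partsDensity h v₁
  have hδ : ∀ n : ℕ, (0 : ℝ) < 1 / (n + 1) := fun n => by positivity
  have hrpow : ∀ v : E3, v₁ ≠ v → (‖v₁ - v‖ ^ 3)⁻¹ = (‖v₁ - v‖ ^ 2) ^ (-(3 / 2) : ℝ) := fun v hv => by
    have hn : 0 < ‖v₁ - v‖ := norm_pos_iff.2 (sub_ne_zero.2 hv)
    rw [← Real.rpow_natCast ‖v₁ - v‖ 2, ← Real.rpow_mul hn.le, Nat.cast_two,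
      show (2 : ℝ) * -(3 / 2) = -(3 : ℕ) by norm_num, Real.rpow_neg hn.le, Real.rpow_natCast]
  have hlim : Tendsto (fun n : ℕ => ∫ v, radialFactor (1 / (n + 1)) v₁ v * partsDensity ψ v₁ v) atTop
      (𝓝 (∫ v, (‖v₁ - v‖ ^ 3)⁻¹ * partsDensity ψ v₁ v)) := by
    refine tendsto_integral_of_dominated_convergence
      (fun v => ‖(‖v₁ - v‖ ^ 3)⁻¹ * partsDensity ψ v₁ v‖) (fun n => ?_)
      (integrable_inv_cube_mul_partsDensity h v₁).norm (fun n => ?_) ?_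
    · have hrc : Continuous (radialFactor (1 / ((n : ℝ) + 1)) v₁) :=
        continuous_iff_continuousAt.2 fun v => (hasFDerivAt_radialFactor (hδ n) v₁ v).continuousAt
      exact (hrc.measurable.mul hm).aestronglyMeasurable
    · filter_upwards [ae_ne_const v₁] with v hv
      have hn : 0 < ‖v₁ - v‖ := norm_pos_iff.2 (sub_ne_zero.2 hv)
      have hd := hδ n
      rw [norm_mul, norm_mul, hrpow v hv, radialFactor,
        Real.norm_of_nonneg (Real.rpow_nonneg (by positivity) _),
        Real.norm_of_nonneg (Real.rpow_nonneg (by positivity) _)]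
      refine mul_le_mul_of_nonneg_right ?_ (norm_nonneg _)
      exact Real.rpow_le_rpow_of_nonpos (by positivity) (by linarith) (by norm_num)
    · filter_upwards [ae_ne_const v₁] with v hv
      have hn : 0 < ‖v₁ - v‖ := norm_pos_iff.2 (sub_ne_zero.2 hv)
      rw [hrpow v hv]
      refine Tendsto.mul_const _ ?_
      unfold radialFactor
      have h1 : Tendsto (fun n : ℕ => ‖v₁ - v‖ ^ 2 + 1 / ((n : ℝ) + 1)) atTop (𝓝 (‖v₁ - v‖ ^ 2)) := by
        simpa using (tendsto_one_div_add_atTop_nhds_zero_nat (𝕜 := ℝ)).const_add (‖v₁ - v‖ ^ 2)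
      exact h1.rpow_const (Or.inl (by positivity))
  simp only [integral_radialFactor_mul h v₁ (hδ _)] at hlim
  exact (tendsto_nhds_unique hlim tendsto_const_nhds)

/-- The local expression whose Maxwellian average, with the weight `|v₁ - v₂|⁻¹`, is the Landau
operator. -/
def landauSymbol (ψ : E3 → ℝ) (v₁ v₂ : E3) : ℝ :=
  perpTrace (v₁ - v₂) (hessian ψ v₁ + hessian ψ v₂) -
    4 * (inner ℝ (v₁ - v₂) (gradient ψ v₁ - gradient ψ v₂) / ‖v₁ - v₂‖ ^ 2)

theorem abs_landauSymbol_le (h : IsC3b ψ) (v₁ v₂ : E3) :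
    |landauSymbol ψ v₁ v₂| ≤ 12 * c3bNorm ψ := by
  have hN := h.c3bNorm_nonneg
  have h1 : |perpTrace (v₁ - v₂) (hessian ψ v₁ + hessian ψ v₂)| ≤ 8 * c3bNorm ψ := by
    refine (abs_perpTrace_le _ _).trans ?_
    have := norm_add_le (hessian ψ v₁) (hessian ψ v₂)
    linarith [h.norm_hessian_le v₁, h.norm_hessian_le v₂]
  have h2 : |inner ℝ (v₁ - v₂) (gradient ψ v₁ - gradient ψ v₂) / ‖v₁ - v₂‖ ^ 2| ≤ c3bNorm ψ := by
    rw [abs_div, abs_of_nonneg (sq_nonneg ‖v₁ - v₂‖)]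
    refine div_le_of_le_mul₀ (by positivity) hN ?_
    refine (abs_real_inner_le_norm _ _).trans ?_
    calc ‖v₁ - v₂‖ * ‖gradient ψ v₁ - gradient ψ v₂‖ ≤ ‖v₁ - v₂‖ * (c3bNorm ψ * ‖v₁ - v₂‖) := by
          gcongr; exact h.gradient_sub_le v₁ v₂
      _ = _ := by ring
  rw [landauSymbol]
  refine (abs_sub _ _).trans ?_
  rw [abs_mul, abs_of_pos (by norm_num : (0 : ℝ) < 4)]
  linarith

theorem measurable_landauSymbol (h : IsC3b ψ) (v₁ : E3) : Measurable (landauSymbol ψ v₁) := by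
  have h2 := h.continuous_gradient.measurable
  have h3 := h.contDiff_hessian.continuous
  have h4 : Measurable fun v => (hessian ψ v₁ + hessian ψ v) (v₁ - v) := by
    have : Continuous fun v => (hessian ψ v₁ + hessian ψ v) (v₁ - v) := by fun_prop
    exact this.measurable
  have h5 : Measurable fun v => trace3 (hessian ψ v₁ + hessian ψ v) := by
    have : Continuous fun v => trace3 (hessian ψ v₁ + hessian ψ v) := by fun_prop
    exact this.measurable
  unfold landauSymbol perpTrace
  fun_prop

theorem integrable_landauSymbol (h : IsC3b ψ) (v₁ : E3) :
    Integrable fun v₂ => maxwellian v₂ * (‖v₁ - v₂‖⁻¹ * landauSymbol ψ v₁ v₂) := by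
  have hN := h.c3bNorm_nonneg
  have hm := measurable_landauSymbol h v₁
  have hM := continuous_maxwellian.measurable
  refine integrable_of_maxwellian_bound v₁ (12 * c3bNorm ψ) 0
    (Measurable.aestronglyMeasurable (by fun_prop)) fun v _ => ?_
  have hMv := maxwellian_pos v
  rw [norm_mul, norm_mul, norm_inv, norm_norm, Real.norm_of_nonneg hMv.le, pow_zero, mul_one]
  calc maxwellian v * (‖v₁ - v‖⁻¹ * ‖landauSymbol ψ v₁ v‖)
      ≤ maxwellian v * ((1 + (‖v₁ - v‖ ^ 2)⁻¹) * (12 * c3bNorm ψ)) := by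
        gcongr
        · exact inv_norm_le _
        · exact abs_landauSymbol_le h v₁ v
    _ = _ := by ring

theorem landauOp_eq (h : IsC3b ψ) (v₁ : E3) :
    landauOp ψ v₁ = ∫ v₂, maxwellian v₂ * (‖v₁ - v₂‖⁻¹ * landauSymbol ψ v₁ v₂) := by
  have hi := integrable_landauSymbol h v₁
  have hp := (integrable_inv_cube_mul_partsDensity h v₁).const_mul 2
  have e : (∫ v₂, maxwellian v₂ * (‖v₁ - v₂‖⁻¹ * landauSymbol ψ v₁ v₂)) =
      ∫ v₂, (maxwellian v₂ * (‖v₁ - v₂‖⁻¹ * landauSymbol ψ v₁ v₂) +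
        2 * ((‖v₁ - v₂‖ ^ 3)⁻¹ * partsDensity ψ v₁ v₂)) := by
    rw [integral_add hi hp, integral_const_mul, integral_inv_cube_mul_partsDensity h, mul_zero, add_zero]
  rw [e, landauOp_eq_integral h]
  refine integral_congr_ae ?_
  filter_upwards [ae_ne_const v₁] with v₂ hv
  have hn : ‖v₁ - v₂‖ ≠ 0 := norm_ne_zero_iff.2 (sub_ne_zero.2 hv)
  simp only [landauSymbol, partsDensity, perpTrace_add, perpTrace_sub]
  field_simp
  ring

end Parts

/-! ### Expansion of the collision integral for small deflections -/

section Taylor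

variable {ψ : E3 → ℝ}

theorem IsC3b.gradient_taylor (h : IsC3b ψ) (v a : E3) :
    ‖gradient ψ (v + a) - gradient ψ v - hessian ψ v a‖ ≤ c3bNorm ψ * ‖a‖ ^ 2 := by
  have hN := h.c3bNorm_nonneg
  have hd : ∀ t ∈ Set.Icc (0 : ℝ) 1, HasDerivWithinAt (fun t : ℝ => gradient ψ (v + t • a) -
      t • hessian ψ v a) (hessian ψ (v + t • a) a - hessian ψ v a) (Set.Icc 0 1) t := fun t _ => by
    have h1 : HasDerivAt (fun t : ℝ => v + t • a) a t := by
      simpa using ((hasDerivAt_id t).smul_const a).const_add v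
    have h2 : HasDerivAt (fun t : ℝ => t • hessian ψ v a) (hessian ψ v a) t := by
      simpa using (hasDerivAt_id t).smul_const (hessian ψ v a)
    exact (((h.hasFDerivAt_gradient _).comp_hasDerivAt t h1).sub h2).hasDerivWithinAt
  have := norm_image_sub_le_of_norm_deriv_le_segment_01' hd (C := c3bNorm ψ * ‖a‖ ^ 2) fun t ht => by
    rw [← _root_.sub_apply]
    refine (ContinuousLinearMap.le_opNorm _ _).trans ?_
    have h3 := h.hessian_sub_le (v + t • a) v
    rw [add_sub_cancel_left, norm_smul, Real.norm_of_nonneg ht.1] at h3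
    have h4 : t * ‖a‖ ≤ ‖a‖ := mul_le_of_le_one_left (norm_nonneg a) ht.2.le
    calc ‖hessian ψ (v + t • a) - hessian ψ v‖ * ‖a‖ ≤ (c3bNorm ψ * ‖a‖) * ‖a‖ := by
          gcongr
          exact h3.trans (by gcongr)
      _ = _ := by ring
  simp only [one_smul, zero_smul, add_zero, sub_zero] at this
  rwa [sub_right_comm] at this

theorem IsC3b.taylor (h : IsC3b ψ) (v a : E3) :
    |ψ (v + a) - ψ v - inner ℝ (gradient ψ v) a - 1 / 2 * inner ℝ a (hessian ψ v a)| ≤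
      c3bNorm ψ * ‖a‖ ^ 3 := by
  have hN := h.c3bNorm_nonneg
  have hd : ∀ t ∈ Set.Icc (0 : ℝ) 1, HasDerivWithinAt (fun t : ℝ => ψ (v + t • a) -
      t * inner ℝ (gradient ψ v) a - 1 / 2 * t ^ 2 * inner ℝ a (hessian ψ v a))
      (inner ℝ (gradient ψ (v + t • a) - gradient ψ v - hessian ψ v (t • a)) a) (Set.Icc 0 1) t := by
    intro t _
    have h1 : HasDerivAt (fun t : ℝ => v + t • a) a t := by
      simpa using ((hasDerivAt_id t).smul_const a).const_add v
    have h2 := (h.hasFDerivAt (v + t • a)).comp_hasDerivAt t h1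
    have h3 := (hasDerivAt_id t).mul_const (inner ℝ (gradient ψ v) a : ℝ)
    have h4 := (((hasDerivAt_id t).pow 2).const_mul (1 / 2 : ℝ)).mul_const
      (inner ℝ a (hessian ψ v a) : ℝ)
    refine (((h2.sub h3).sub h4).congr_deriv ?_).hasDerivWithinAt
    rw [innerSL_apply_apply, inner_sub_left, inner_sub_left, map_smul, real_inner_smul_left,
      real_inner_comm a (hessian ψ v a)]
    simp
  have := norm_image_sub_le_of_norm_deriv_le_segment_01' hd (C := c3bNorm ψ * ‖a‖ ^ 3) fun t ht => by
    rw [Real.norm_eq_abs]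
    refine (abs_real_inner_le_norm _ _).trans ?_
    have h3 := h.gradient_taylor v (t • a)
    rw [norm_smul, Real.norm_of_nonneg ht.1] at h3
    have h4 : t * ‖a‖ ≤ ‖a‖ := mul_le_of_le_one_left (norm_nonneg a) ht.2.le
    have h5 : 0 ≤ t * ‖a‖ := mul_nonneg ht.1 (norm_nonneg a)
    calc ‖gradient ψ (v + t • a) - gradient ψ v - hessian ψ v (t • a)‖ * ‖a‖
        ≤ (c3bNorm ψ * ‖a‖ ^ 2) * ‖a‖ := by
          gcongr
          exact h3.trans (by gcongr)
      _ = _ := by ring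
  simp only [one_smul, zero_smul, add_zero, one_pow, mul_one, one_mul, zero_mul, sub_zero,
    ne_eq, OfNat.ofNat_ne_zero, not_false_eq_true, zero_pow, mul_zero, Real.norm_eq_abs] at this
  convert this using 2
  ring

/-- The velocity transfer for the deflection angle `θ`, the relative velocity `w` and the impact
vector `p`. -/
def transferOf (θ : ℝ) (w p : E3) : E3 :=
  (1 / 2 : ℝ) • ((Real.cos θ - 1) • w - (Real.sin θ * (‖w‖ / ‖p‖)) • p)

theorem transfer_eq (φ : ℝ → ℝ) (ε : ℝ) (w ν : E3) :
    transfer φ ε w ν = transferOf (deflection φ (2 * ε / ‖w‖ ^ 2) ‖perpProj w ν‖) w (perpProj w ν) :=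
  rfl

theorem transferOf_eq (θ : ℝ) (w p : E3) :
    transferOf θ w p = -(Real.sin (θ / 2) ^ 2 • w +
      (Real.sin (θ / 2) * Real.cos (θ / 2) * (‖w‖ / ‖p‖)) • p) := by
  have h1 : Real.cos θ = 1 - 2 * Real.sin (θ / 2) ^ 2 := by
    rw [Real.sin_sq, show θ = 2 * (θ / 2) by ring, Real.cos_two_mul]; ring_nf
  have h2 : Real.sin θ = 2 * Real.sin (θ / 2) * Real.cos (θ / 2) := by
    rw [← Real.sin_two_mul]; ring_nf
  rw [transferOf, h1, h2]
  module

theorem norm_transferOf {θ : ℝ} {w p : E3} (hp : p ≠ 0) (hwp : inner ℝ w p = 0) :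
    ‖transferOf θ w p‖ = ‖w‖ * |Real.sin (θ / 2)| := by
  have hp' : ‖p‖ ≠ 0 := norm_ne_zero_iff.2 hp
  have h : ‖transferOf θ w p‖ ^ 2 = (‖w‖ * |Real.sin (θ / 2)|) ^ 2 := by
    rw [transferOf_eq, norm_neg, @norm_add_sq_real, norm_smul, norm_smul, real_inner_smul_left,
      real_inner_smul_right, hwp, mul_pow, mul_pow, mul_pow, Real.norm_eq_abs, Real.norm_eq_abs,
      sq_abs, sq_abs, sq_abs, mul_pow, mul_pow, Real.cos_sq']
    field_simp
    ring
  exact (pow_left_inj₀ (norm_nonneg _) (by positivity) two_ne_zero).1 h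

theorem abs_inner_apply_le {T : E3 →L[ℝ] E3} {K : ℝ} (hT : ‖T‖ ≤ K) (x y : E3) :
    |inner ℝ x (T y)| ≤ K * (‖x‖ * ‖y‖) := by
  refine (abs_real_inner_le_norm _ _).trans ?_
  calc ‖x‖ * ‖T y‖ ≤ ‖x‖ * (K * ‖y‖) := by
        gcongr
        exact (T.le_opNorm y).trans (by gcongr)
    _ = _ := by ring

/-- The increment of `ψ` in a collision, to second order in the deflection. -/
theorem IsC3b.collision_expansion (h : IsC3b ψ) {v₁ v₂ p : E3} (θ : ℝ) (hp : p ≠ 0)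
    (hwp : inner ℝ (v₁ - v₂) p = 0) :
    |ψ (v₁ + transferOf θ (v₁ - v₂) p) + ψ (v₂ - transferOf θ (v₁ - v₂) p) - ψ v₁ - ψ v₂ -
      (-(Real.sin (θ / 2) ^ 2 * inner ℝ (v₁ - v₂) (gradient ψ v₁ - gradient ψ v₂)) -
        Real.sin (θ / 2) * Real.cos (θ / 2) * (‖v₁ - v₂‖ / ‖p‖) *
          inner ℝ (gradient ψ v₁ - gradient ψ v₂) p +
        1 / 2 * ‖v₁ - v₂‖ ^ 2 * (Real.sin (θ / 2) ^ 2 / ‖p‖ ^ 2 *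
          inner ℝ p ((hessian ψ v₁ + hessian ψ v₂) p)))| ≤
      c3bNorm ψ * (4 * ‖v₁ - v₂‖ ^ 2 + 2 * ‖v₁ - v₂‖ ^ 3) * |Real.sin (θ / 2)| ^ 3 := by
  have hN := h.c3bNorm_nonneg
  have hp' : 0 < ‖p‖ := norm_pos_iff.2 hp
  have hna := norm_transferOf (θ := θ) hp hwp
  have ha := transferOf_eq θ (v₁ - v₂) p
  set N := c3bNorm ψ
  set w := v₁ - v₂
  set a := transferOf θ w p
  set x := gradient ψ v₁ - gradient ψ v₂ with hx
  set T := hessian ψ v₁ + hessian ψ v₂ with hT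
  set s := Real.sin (θ / 2)
  set k := Real.cos (θ / 2)
  have hsk : s ^ 2 + k ^ 2 = 1 := Real.sin_sq_add_cos_sq _
  have hs1 : |s| ≤ 1 := Real.abs_sin_le_one _
  have hk1 : |k| ≤ 1 := Real.abs_cos_le_one _
  have hTn : ‖T‖ ≤ 2 * N := by
    refine (norm_add_le _ _).trans ?_
    linarith [h.norm_hessian_le v₁, h.norm_hessian_le v₂]
  have t1 := h.taylor v₁ a
  have t2 := h.taylor v₂ (-a)
  rw [← sub_eq_add_neg, norm_neg, map_neg, inner_neg_right, inner_neg_left, inner_neg_right,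
    neg_neg] at t2
  rw [hna] at t1 t2
  set c := ‖w‖ with hc
  have hc0 : 0 ≤ c := norm_nonneg w
  have hxa : inner ℝ x a = -(s ^ 2 * inner ℝ w x) - s * k * (c / ‖p‖) * inner ℝ x p := by
    rw [ha, inner_neg_right, inner_add_right, real_inner_smul_right, real_inner_smul_right,
      real_inner_comm w x]
    ring
  have hTa : inner ℝ a (T a) = s ^ 4 * inner ℝ w (T w) +
      s ^ 2 * (s * k * (c / ‖p‖)) * (inner ℝ w (T p) + inner ℝ p (T w)) +
      (s * k * (c / ‖p‖)) ^ 2 * inner ℝ p (T p) := by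
    rw [ha, map_neg, inner_neg_neg, map_add, map_smul, map_smul]
    simp only [inner_add_left, inner_add_right, real_inner_smul_left, real_inner_smul_right]
    ring
  have hsplit : inner ℝ a (T a) = inner ℝ a (hessian ψ v₁ a) + inner ℝ a (hessian ψ v₂ a) := by
    rw [hT, _root_.add_apply, inner_add_right]
  have hxs : inner ℝ x a = inner ℝ (gradient ψ v₁) a - inner ℝ (gradient ψ v₂) a := by
    rw [hx, inner_sub_left]
  have hs3 : 0 ≤ |s| ^ 3 := by positivity
  have hs4 : s ^ 4 ≤ |s| ^ 3 := by
    have : s ^ 4 = |s| ^ 3 * |s| := by rw [← pow_succ, Even.pow_abs (by decide)]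
    rw [this]
    exact mul_le_of_le_one_right hs3 hs1
  have hs40 : 0 ≤ s ^ 4 := by positivity
  have b1 : |1 / 2 * (s ^ 4 * inner ℝ w (T w))| ≤ N * c ^ 2 * |s| ^ 3 := by
    have e := abs_inner_apply_le hTn w w
    rw [abs_mul, abs_mul, abs_of_nonneg hs40, abs_of_pos (by norm_num : (0 : ℝ) < 1 / 2)]
    calc 1 / 2 * (s ^ 4 * |inner ℝ w (T w)|) ≤ 1 / 2 * (|s| ^ 3 * (2 * N * (c * c))) := by gcongr
      _ = _ := by ring
  have b2 : |1 / 2 * (s ^ 2 * (s * k * (c / ‖p‖)) * (inner ℝ w (T p) + inner ℝ p (T w)))| ≤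
      2 * N * c ^ 2 * |s| ^ 3 := by
    have e1 := abs_inner_apply_le hTn w p
    have e2 := abs_inner_apply_le hTn p w
    have e3 : |inner ℝ w (T p) + inner ℝ p (T w)| ≤ 4 * N * (c * ‖p‖) := by
      refine (abs_add_le _ _).trans ?_
      linarith
    have e4 : |s ^ 2 * (s * k * (c / ‖p‖))| ≤ |s| ^ 3 * (c / ‖p‖) := by
      rw [show s ^ 2 * (s * k * (c / ‖p‖)) = s ^ 3 * k * (c / ‖p‖) by ring, abs_mul, abs_mul, abs_pow,
        abs_of_nonneg (by positivity : 0 ≤ c / ‖p‖)]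
      gcongr
      exact mul_le_of_le_one_right hs3 hk1
    rw [abs_mul, abs_mul, abs_of_pos (by norm_num : (0 : ℝ) < 1 / 2)]
    calc 1 / 2 * (|s ^ 2 * (s * k * (c / ‖p‖))| * |inner ℝ w (T p) + inner ℝ p (T w)|)
        ≤ 1 / 2 * ((|s| ^ 3 * (c / ‖p‖)) * (4 * N * (c * ‖p‖))) := by gcongr
      _ = _ := by field_simp; ring
  have b3 : |1 / 2 * (s ^ 4 * (c / ‖p‖) ^ 2 * inner ℝ p (T p))| ≤ N * c ^ 2 * |s| ^ 3 := by
    have e := abs_inner_apply_le hTn p p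
    rw [abs_mul, abs_mul, abs_of_nonneg (by positivity : 0 ≤ s ^ 4 * (c / ‖p‖) ^ 2),
      abs_of_pos (by norm_num : (0 : ℝ) < 1 / 2)]
    calc 1 / 2 * (s ^ 4 * (c / ‖p‖) ^ 2 * |inner ℝ p (T p)|)
        ≤ 1 / 2 * (|s| ^ 3 * (c / ‖p‖) ^ 2 * (2 * N * (‖p‖ * ‖p‖))) := by gcongr
      _ = _ := by field_simp
  have hk2 : (s * k * (c / ‖p‖)) ^ 2 = s ^ 2 * (c / ‖p‖) ^ 2 - s ^ 4 * (c / ‖p‖) ^ 2 := by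
    rw [mul_pow, mul_pow, show k ^ 2 = 1 - s ^ 2 by linarith]; ring
  have e : ψ (v₁ + a) + ψ (v₂ - a) - ψ v₁ - ψ v₂ -
      (-(s ^ 2 * inner ℝ w x) - s * k * (c / ‖p‖) * inner ℝ x p +
        1 / 2 * c ^ 2 * (s ^ 2 / ‖p‖ ^ 2 * inner ℝ p (T p))) =
      (ψ (v₁ + a) - ψ v₁ - inner ℝ (gradient ψ v₁) a - 1 / 2 * inner ℝ a (hessian ψ v₁ a)) +
      (ψ (v₂ - a) - ψ v₂ - -inner ℝ (gradient ψ v₂) a - 1 / 2 * inner ℝ a (hessian ψ v₂ a)) +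
      1 / 2 * (s ^ 4 * inner ℝ w (T w)) +
      1 / 2 * (s ^ 2 * (s * k * (c / ‖p‖)) * (inner ℝ w (T p) + inner ℝ p (T w))) -
      1 / 2 * (s ^ 4 * (c / ‖p‖) ^ 2 * inner ℝ p (T p)) := by
    rw [hk2] at hTa
    have : 1 / 2 * c ^ 2 * (s ^ 2 / ‖p‖ ^ 2 * inner ℝ p (T p)) =
        1 / 2 * (s ^ 2 * (c / ‖p‖) ^ 2 * inner ℝ p (T p)) := by field_simp
    rw [this]
    linarith
  rw [e]
  refine (abs_sub _ _).trans ((add_le_add ((abs_add_le _ _).trans (add_le_add ((abs_add_le _ _).trans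
    (add_le_add ((abs_add_le _ _).trans (add_le_add t1 t2)) b1)) b2)) b3).trans (le_of_eq ?_))
  ring

end Taylor

section Collision

variable {ψ : E3 → ℝ}

theorem measurableSet_hemisphere (v₁ v₂ : E3) : MeasurableSet (hemisphere v₁ v₂) :=
  measurableSet_le measurable_const (by fun_prop)

theorem integrableOn_hemisphere {v₁ v₂ : E3} {F : S2 → ℝ} (hF : Measurable F) {C : ℝ}
    (hC : ∀ ν, |F ν| ≤ C) : IntegrableOn F (hemisphere v₁ v₂) sphereMeasure :=
  Measure.integrableOn_of_bounded (M := C) (measure_ne_top _ _) hF.aestronglyMeasurable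
    (Eventually.of_forall hC)

theorem abs_inner_sphere_le (w : E3) (ν : S2) : |inner ℝ w (ν : E3)| ≤ ‖w‖ := by
  have hν : ‖(ν : E3)‖ = 1 := by simp
  simpa [hν] using abs_real_inner_le_norm w (ν : E3)

/-- The second-order part of the collision integral. -/
theorem integral_hemisphere_expansion (h : IsC3b ψ) {v₁ v₂ : E3} (hv : v₁ ≠ v₂) {θ : ℝ → ℝ}
    (hθ : Measurable θ) {F : S2 → ℝ} (hF : Measurable F) {K : ℝ} (hK : ∀ ν, |F ν| ≤ K)
    (hFeq : ∀ᵐ ν ∂sphereMeasure, ν ∈ hemisphere v₁ v₂ → F ν =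
      ψ (v₁ + transferOf (θ ‖perpProj (v₁ - v₂) ν‖) (v₁ - v₂) (perpProj (v₁ - v₂) ν)) +
      ψ (v₂ - transferOf (θ ‖perpProj (v₁ - v₂) ν‖) (v₁ - v₂) (perpProj (v₁ - v₂) ν)) -
      ψ v₁ - ψ v₂) :
    |(∫ ν in hemisphere v₁ v₂, F ν * inner ℝ (v₁ - v₂) (ν : E3) ∂sphereMeasure) -
      Real.pi / 2 * ‖v₁ - v₂‖ ^ 3 * (∫ ρ in Set.Ioo (0 : ℝ) 1, |Real.sin (θ ρ / 2)| ^ 2 * ρ) *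
        landauSymbol ψ v₁ v₂| ≤
      c3bNorm ψ * (4 * ‖v₁ - v₂‖ ^ 2 + 2 * ‖v₁ - v₂‖ ^ 3) * (2 * Real.pi * ‖v₁ - v₂‖ *
        ∫ ρ in Set.Ioo (0 : ℝ) 1, |Real.sin (θ ρ / 2)| ^ 3 * ρ) := by
  have hN := h.c3bNorm_nonneg
  have hae := ae_isImpact hv
  have hw0 : v₁ - v₂ ≠ 0 := sub_ne_zero.2 hv
  set w := v₁ - v₂ with hw
  have hn : 0 < ‖w‖ := norm_pos_iff.2 hw0
  set N := c3bNorm ψ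
  set x := gradient ψ v₁ - gradient ψ v₂ with hx
  set T := hessian ψ v₁ + hessian ψ v₂ with hT
  set S := fun ρ => Real.sin (θ ρ / 2) with hS
  set k := fun ρ => Real.cos (θ ρ / 2) with hk
  have hSm : Measurable S := by fun_prop
  have hkm : Measurable k := by fun_prop
  have hS1 : ∀ ρ, |S ρ| ≤ 1 := fun ρ => Real.abs_sin_le_one _
  have hk1 : ∀ ρ, |k ρ| ≤ 1 := fun ρ => Real.abs_cos_le_one _
  have hpm : Measurable fun ν : S2 => perpProj w ν := by unfold perpProj; fun_prop
  have hPm : Measurable fun ν : S2 => ‖perpProj w ν‖ := hpm.norm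
  have hSPm : Measurable fun ν : S2 => S ‖perpProj w ν‖ := hSm.comp hPm
  have hkPm : Measurable fun ν : S2 => k ‖perpProj w ν‖ := hkm.comp hPm
  have hwm : Measurable fun ν : S2 => inner ℝ w (ν : E3) := by fun_prop
  have hS2 : ∀ ρ, S ρ ^ 2 ≤ 1 := fun ρ => by
    rw [← sq_abs]; exact pow_le_one₀ (abs_nonneg _) (hS1 ρ)
  have hiw := abs_inner_sphere_le w
  have hdiv : ∀ ν : S2, |S ‖perpProj w ν‖ ^ 2 / ‖perpProj w ν‖ ^ 2 *
      inner ℝ (perpProj w ν) (T (perpProj w ν))| ≤ ‖T‖ := fun ν => by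
    rcases (norm_nonneg (perpProj w (ν : E3))).eq_or_lt with h0 | h0
    · rw [← h0]; simp
    have e := abs_inner_apply_le (le_refl ‖T‖) (perpProj w ν) (perpProj w ν)
    rw [abs_mul, abs_of_nonneg (by positivity)]
    calc S ‖perpProj w ν‖ ^ 2 / ‖perpProj w ν‖ ^ 2 * |inner ℝ (perpProj w ν) (T (perpProj w ν))|
        ≤ 1 / ‖perpProj w ν‖ ^ 2 * (‖T‖ * (‖perpProj w ν‖ * ‖perpProj w ν‖)) := by
          gcongr; exact hS2 _
      _ = ‖T‖ := by field_simp
  have hlin : ∀ ν : S2, |S ‖perpProj w ν‖ * k ‖perpProj w ν‖ * (‖w‖ / ‖perpProj w ν‖) *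
      inner ℝ x (perpProj w ν)| ≤ ‖w‖ * ‖x‖ := fun ν => by
    rcases (norm_nonneg (perpProj w (ν : E3))).eq_or_lt with h0 | h0
    · rw [← h0]; simp; positivity
    have e := abs_real_inner_le_norm x (perpProj w ν)
    rw [abs_mul, abs_mul, abs_mul, abs_of_nonneg (by positivity : 0 ≤ ‖w‖ / ‖perpProj w ν‖)]
    calc |S ‖perpProj w ν‖| * |k ‖perpProj w ν‖| * (‖w‖ / ‖perpProj w ν‖) *
          |inner ℝ x (perpProj w ν)|
        ≤ 1 * 1 * (‖w‖ / ‖perpProj w ν‖) * (‖x‖ * ‖perpProj w ν‖) := by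
          gcongr
          · exact hS1 _
          · exact hk1 _
      _ = _ := by field_simp
  have hmulw : ∀ {G : S2 → ℝ} {C : ℝ}, (∀ ν, |G ν| ≤ C) → ∀ ν, |G ν * inner ℝ w (ν : E3)| ≤ C * ‖w‖ :=
    fun {G C} hG ν => by
      rw [abs_mul]
      exact mul_le_mul (hG ν) (hiw ν) (abs_nonneg _) ((abs_nonneg _).trans (hG ν))
  have i0 : IntegrableOn (fun ν : S2 => F ν * inner ℝ w (ν : E3)) (hemisphere v₁ v₂) sphereMeasure :=
    integrableOn_hemisphere (hF.mul hwm) (hmulw hK)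
  have i1 : IntegrableOn (fun ν : S2 => S ‖perpProj w ν‖ ^ 2 * inner ℝ w (ν : E3))
      (hemisphere v₁ v₂) sphereMeasure :=
    integrableOn_hemisphere ((hSPm.pow_const 2).mul hwm) (hmulw (C := 1) fun ν => by
      rw [abs_of_nonneg (sq_nonneg _)]; exact hS2 _)
  have i2 : IntegrableOn (fun ν : S2 => S ‖perpProj w ν‖ * k ‖perpProj w ν‖ *
      (‖w‖ / ‖perpProj w ν‖) * inner ℝ x (perpProj w ν) * inner ℝ w (ν : E3))
      (hemisphere v₁ v₂) sphereMeasure :=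
    integrableOn_hemisphere (by fun_prop) (hmulw hlin)
  have i3 : IntegrableOn (fun ν : S2 => S ‖perpProj w ν‖ ^ 2 / ‖perpProj w ν‖ ^ 2 *
      inner ℝ (perpProj w ν) (T (perpProj w ν)) * inner ℝ w (ν : E3))
      (hemisphere v₁ v₂) sphereMeasure := by
    have : Measurable fun ν : S2 => T (perpProj w ν) := T.continuous.measurable.comp hpm
    exact integrableOn_hemisphere (by fun_prop) (hmulw hdiv)
  have i4 : IntegrableOn (fun ν : S2 => N * (4 * ‖w‖ ^ 2 + 2 * ‖w‖ ^ 3) *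
      (|S ‖perpProj w ν‖| ^ 3 * inner ℝ w (ν : E3))) (hemisphere v₁ v₂) sphereMeasure := by
    refine Integrable.const_mul (integrableOn_hemisphere (C := 1 * ‖w‖) (by fun_prop)
      (hmulw (C := 1) fun ν => ?_)) _
    rw [abs_of_nonneg (by positivity)]
    exact pow_le_one₀ (abs_nonneg _) (hS1 _)
  have v1 : ∫ ν in hemisphere v₁ v₂, S ‖perpProj w ν‖ ^ 2 * inner ℝ w (ν : E3) ∂sphereMeasure =
      2 * Real.pi * ‖w‖ * ∫ ρ in Set.Ioo (0 : ℝ) 1, |Real.sin (θ ρ / 2)| ^ 2 * ρ := by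
    simp only [sq_abs]
    exact integral_hemisphere_impact hv (G := fun ρ => S ρ ^ 2) (hSm.pow_const 2)
  have v2 : ∫ ν in hemisphere v₁ v₂, S ‖perpProj w ν‖ * k ‖perpProj w ν‖ *
      (‖w‖ / ‖perpProj w ν‖) * inner ℝ x (perpProj w ν) * inner ℝ w (ν : E3) ∂sphereMeasure = 0 :=
    integral_hemisphere_linear hv (fun ρ => S ρ * k ρ * (‖w‖ / ρ)) x
  have v3 : ∫ ν in hemisphere v₁ v₂, S ‖perpProj w ν‖ ^ 2 / ‖perpProj w ν‖ ^ 2 *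
      inner ℝ (perpProj w ν) (T (perpProj w ν)) * inner ℝ w (ν : E3) ∂sphereMeasure =
      1 / 2 * perpTrace w T *
        (2 * Real.pi * ‖w‖ * ∫ ρ in Set.Ioo (0 : ℝ) 1, |Real.sin (θ ρ / 2)| ^ 2 * ρ) := by
    have hq := integral_hemisphere_quadratic hv (m := fun ρ => S ρ ^ 2 / ρ ^ 2) (by fun_prop) (C := 1)
      (fun ρ => by
        rcases eq_or_ne ρ 0 with h0 | h0
        · simp [h0]
        · rw [div_mul_cancel₀ _ (pow_ne_zero 2 h0), abs_of_nonneg (sq_nonneg _)]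
          exact hS2 ρ) T
    rw [← hw] at hq
    rw [hq, ← v1, perpTrace, trace3_apply]
    congr 1
    refine setIntegral_congr_ae (measurableSet_hemisphere v₁ v₂) ?_
    filter_upwards [hae] with ν hν hmem
    have := (hν hmem).perp_pos
    rw [div_mul_cancel₀ _ (pow_ne_zero 2 this.ne')]
  have v4 : ∫ ν in hemisphere v₁ v₂, N * (4 * ‖w‖ ^ 2 + 2 * ‖w‖ ^ 3) *
      (|S ‖perpProj w ν‖| ^ 3 * inner ℝ w (ν : E3)) ∂sphereMeasure =
      N * (4 * ‖w‖ ^ 2 + 2 * ‖w‖ ^ 3) * (2 * Real.pi * ‖w‖ *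
        ∫ ρ in Set.Ioo (0 : ℝ) 1, |Real.sin (θ ρ / 2)| ^ 3 * ρ) := by
    rw [integral_const_mul]
    congr 1
    exact integral_hemisphere_impact hv (G := fun ρ => |S ρ| ^ 3) (by fun_prop)
  have j1 : IntegrableOn (fun ν : S2 => -(inner ℝ w x) * (S ‖perpProj w ν‖ ^ 2 * inner ℝ w (ν : E3)))
      (hemisphere v₁ v₂) sphereMeasure := i1.const_mul _
  have j2 : IntegrableOn (fun ν : S2 => -(inner ℝ w x) * (S ‖perpProj w ν‖ ^ 2 * inner ℝ w (ν : E3)) -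
      S ‖perpProj w ν‖ * k ‖perpProj w ν‖ * (‖w‖ / ‖perpProj w ν‖) *
        inner ℝ x (perpProj w ν) * inner ℝ w (ν : E3)) (hemisphere v₁ v₂) sphereMeasure := j1.sub i2
  have j3 : IntegrableOn (fun ν : S2 => 1 / 2 * ‖w‖ ^ 2 * (S ‖perpProj w ν‖ ^ 2 / ‖perpProj w ν‖ ^ 2 *
        inner ℝ (perpProj w ν) (T (perpProj w ν)) * inner ℝ w (ν : E3)))
      (hemisphere v₁ v₂) sphereMeasure := i3.const_mul _
  have j4 : IntegrableOn (fun ν : S2 => -(inner ℝ w x) * (S ‖perpProj w ν‖ ^ 2 * inner ℝ w (ν : E3)) -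
      S ‖perpProj w ν‖ * k ‖perpProj w ν‖ * (‖w‖ / ‖perpProj w ν‖) *
        inner ℝ x (perpProj w ν) * inner ℝ w (ν : E3) +
      1 / 2 * ‖w‖ ^ 2 * (S ‖perpProj w ν‖ ^ 2 / ‖perpProj w ν‖ ^ 2 *
        inner ℝ (perpProj w ν) (T (perpProj w ν)) * inner ℝ w (ν : E3)))
      (hemisphere v₁ v₂) sphereMeasure := j2.add j3
  have hmain : Real.pi / 2 * ‖w‖ ^ 3 * (∫ ρ in Set.Ioo (0 : ℝ) 1, |Real.sin (θ ρ / 2)| ^ 2 * ρ) *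
      landauSymbol ψ v₁ v₂ = ∫ ν in hemisphere v₁ v₂,
        (-(inner ℝ w x) * (S ‖perpProj w ν‖ ^ 2 * inner ℝ w (ν : E3)) -
          S ‖perpProj w ν‖ * k ‖perpProj w ν‖ * (‖w‖ / ‖perpProj w ν‖) *
            inner ℝ x (perpProj w ν) * inner ℝ w (ν : E3) +
          1 / 2 * ‖w‖ ^ 2 * (S ‖perpProj w ν‖ ^ 2 / ‖perpProj w ν‖ ^ 2 *
            inner ℝ (perpProj w ν) (T (perpProj w ν)) * inner ℝ w (ν : E3))) ∂sphereMeasure := by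
    rw [integral_add j2 j3, integral_sub j1 i2,
      integral_const_mul, integral_const_mul, v1, v2, v3, landauSymbol, ← hw, ← hx, ← hT]
    field_simp
    ring
  rw [hmain, ← integral_sub i0 j4, ← Real.norm_eq_abs,
    ← v4]
  refine norm_integral_le_of_norm_le i4 ?_
  refine (ae_restrict_iff' (measurableSet_hemisphere v₁ v₂)).2 ?_
  filter_upwards [hae, hFeq] with ν hν hFν hmem
  have H := hν hmem
  have hp : perpProj w (ν : E3) ≠ 0 := norm_pos_iff.1 H.perp_pos
  have hexp := h.collision_expansion (θ ‖perpProj w ν‖) hp (inner_perpProj_left hw0)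
  rw [← hFν hmem] at hexp
  have hpos : 0 ≤ inner ℝ w (ν : E3) := by rw [real_inner_comm]; exact H.inner_pos.le
  rw [Real.norm_eq_abs]
  have := mul_le_mul_of_nonneg_right hexp hpos
  rw [← abs_of_nonneg hpos, ← abs_mul, abs_of_nonneg hpos] at this
  refine le_trans (le_of_eq ?_) (this.trans (le_of_eq ?_))
  · congr 1
    simp only [hS, hk]
    ring
  · ring

end Collision

section Boltzmann

variable {s ε : ℝ} {f : ℝ → ℝ} {ψ : E3 → ℝ}

/-- The change of `ψ` in a collision whose deflection angle is given by `Θ`. -/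
def collisionIncrement (Θ : ℝ × ℝ → ℝ) (ψ : E3 → ℝ) (ε : ℝ) (v₁ v₂ : E3) (ν : S2) : ℝ :=
  ψ (v₁ + transferOf (Θ (2 * ε / ‖v₁ - v₂‖ ^ 2, ‖perpProj (v₁ - v₂) ν‖)) (v₁ - v₂)
      (perpProj (v₁ - v₂) ν)) +
    ψ (v₂ - transferOf (Θ (2 * ε / ‖v₁ - v₂‖ ^ 2, ‖perpProj (v₁ - v₂) ν‖)) (v₁ - v₂)
      (perpProj (v₁ - v₂) ν)) - ψ v₁ - ψ v₂

theorem measurable_collisionIncrement {Θ : ℝ × ℝ → ℝ} (hΘ : Measurable Θ) (h : IsC3b ψ) (ε : ℝ)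
    (v₁ : E3) : Measurable fun p : E3 × S2 => collisionIncrement Θ ψ ε v₁ p.1 p.2 := by
  have hψ : Measurable ψ := h.differentiable.continuous.measurable
  have hw : Measurable fun p : E3 × S2 => v₁ - p.1 := by fun_prop
  have hν : Measurable fun p : E3 × S2 => (p.2 : E3) := by fun_prop
  have hp : Measurable fun p : E3 × S2 => perpProj (v₁ - p.1) p.2 := by
    unfold perpProj
    fun_prop
  have hθ : Measurable fun p : E3 × S2 =>
      Θ (2 * ε / ‖v₁ - p.1‖ ^ 2, ‖perpProj (v₁ - p.1) p.2‖) := hΘ.comp (by fun_prop)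
  unfold collisionIncrement transferOf
  fun_prop

theorem abs_collisionIncrement_le (Θ : ℝ × ℝ → ℝ) (h : IsC3b ψ) (ε : ℝ) (v₁ v₂ : E3) (ν : S2) :
    |collisionIncrement Θ ψ ε v₁ v₂ ν| ≤ 4 * c3bNorm ψ := by
  have hb := fun v => abs_le.1 (h.abs_le v)
  unfold collisionIncrement
  generalize transferOf _ _ _ = a
  have h1 := hb (v₁ + a)
  have h2 := hb (v₂ - a)
  have h3 := hb v₁
  have h4 := hb v₂
  rw [abs_le]
  constructor <;> linarith

theorem IsImpact.boltzmannIntegrand_eq {v₁ v₂ : E3} {ν : S2} (H : IsImpact (v₁ - v₂) ν)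
    (hf : IsProfile f) (hs₀ : 0 ≤ s) (hs₁ : s ≤ 1) (hε : 0 < ε) {Θ : ℝ × ℝ → ℝ}
    (hΘ : ∀ κ ρ, 0 ≤ κ → 0 < ρ → Θ (κ, ρ) = deflection (radialPotential s f) κ ρ) :
    boltzmannIntegrand (weakPotential s f ε) ψ v₁ v₂ ν =
      collisionIncrement Θ ψ ε v₁ v₂ ν * maxwellian v₂ * inner ℝ (v₁ - v₂) (ν : E3) := by
  rw [boltzmannIntegrand, H.outgoing_eq hf hs₀ hs₁ hε, transfer_eq, collisionIncrement,
    hΘ _ _ (by positivity) H.perp_pos]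

theorem IsProfile.exists_measurable_deflection (hf : IsProfile f) (hs₀ : 0 ≤ s) (hs₁ : s ≤ 1) :
    ∃ Θ : ℝ × ℝ → ℝ, Measurable Θ ∧
      ∀ κ ρ, 0 ≤ κ → 0 < ρ → Θ (κ, ρ) = deflection (radialPotential s f) κ ρ := by
  obtain ⟨B, hφ⟩ := hf.exists_isRepulsive hs₀ hs₁
  obtain ⟨Θ, hm, h⟩ := hφ.exists_measurable_deflection
  exact ⟨Θ, hm, fun κ ρ hκ hρ => (h κ ρ hκ hρ).1⟩

theorem measurableSet_prod_hemisphere (v₁ : E3) :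
    MeasurableSet {p : E3 × S2 | p.2 ∈ hemisphere v₁ p.1} := by
  have : Measurable fun p : E3 × S2 => (inner ℝ (p.2 : E3) (v₁ - p.1) : ℝ) := by fun_prop
  exact measurableSet_le measurable_const this

theorem ae_prod_isImpact (v₁ : E3) : ∀ᵐ p ∂((volume : Measure E3).prod sphereMeasure),
    p.2 ∈ hemisphere v₁ p.1 → IsImpact (v₁ - p.1) p.2 := by
  have hp : Measurable fun p : E3 × S2 => ‖perpProj (v₁ - p.1) p.2‖ := by
    unfold perpProj
    fun_prop
  have hI : MeasurableSet {p : E3 × S2 | IsImpact (v₁ - p.1) p.2} := by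
    have : {p : E3 × S2 | IsImpact (v₁ - p.1) p.2} =
        {p | 0 < inner ℝ (p.2 : E3) (v₁ - p.1)} ∩ {p | 0 < ‖perpProj (v₁ - p.1) p.2‖} := by
      ext p
      exact ⟨fun H => ⟨H.inner_pos, H.perp_pos⟩, fun H => ⟨by simp, H.1, H.2⟩⟩
    rw [this]
    exact (measurableSet_lt measurable_const (by fun_prop)).inter (measurableSet_lt measurable_const hp)
  refine (Measure.ae_prod_iff_ae_ae ((measurableSet_prod_hemisphere v₁).imp hI)).2 ?_
  filter_upwards [ae_ne_const v₁] with v₂ hv using ae_isImpact hv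

theorem IsC3b.integrableOn_boltzmannIntegrand (h : IsC3b ψ) (hf : IsProfile f) (hs₀ : 0 ≤ s)
    (hs₁ : s ≤ 1) (hε : 0 < ε) (v₁ : E3) :
    IntegrableOn (fun p : E3 × S2 => boltzmannIntegrand (weakPotential s f ε) ψ v₁ p.1 p.2)
      {p | p.2 ∈ hemisphere v₁ p.1} (volume.prod sphereMeasure) := by
  obtain ⟨Θ, hm, hΘ⟩ := hf.exists_measurable_deflection hs₀ hs₁
  have hN := h.c3bNorm_nonneg
  have hM := continuous_maxwellian.measurable
  have hc := measurable_collisionIncrement hm h ε v₁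
  have hi : Integrable fun v₂ => 4 * c3bNorm ψ * maxwellian v₂ * ‖v₁ - v₂‖ := by
    refine integrable_of_maxwellian_bound v₁ (4 * c3bNorm ψ * (1 + ‖v₁‖)) 1
      (Measurable.aestronglyMeasurable (by fun_prop)) fun v _ => ?_
    have hMv := (maxwellian_pos v).le
    have h1 : ‖v₁ - v‖ ≤ (1 + ‖v₁‖) * (1 + ‖v‖) := by
      have := norm_sub_le v₁ v
      have := mul_nonneg (norm_nonneg v₁) (norm_nonneg v)
      nlinarith [norm_nonneg v₁, norm_nonneg v]
    have h2 : 0 ≤ (‖v₁ - v‖ ^ 2)⁻¹ := by positivity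
    rw [Real.norm_of_nonneg (by positivity), pow_one]
    calc 4 * c3bNorm ψ * maxwellian v * ‖v₁ - v‖
        ≤ 4 * c3bNorm ψ * maxwellian v * ((1 + ‖v₁‖) * (1 + ‖v‖)) * 1 := by
          rw [mul_one]; gcongr
      _ ≤ 4 * c3bNorm ψ * maxwellian v * ((1 + ‖v₁‖) * (1 + ‖v‖)) * (1 + (‖v₁ - v‖ ^ 2)⁻¹) := by
          gcongr; linarith
      _ = _ := by ring
  have hG : Integrable (fun p : E3 × S2 => collisionIncrement Θ ψ ε v₁ p.1 p.2 * maxwellian p.1 *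
      inner ℝ (v₁ - p.1) (p.2 : E3)) (volume.prod sphereMeasure) := by
    refine (hi.comp_fst sphereMeasure).mono' (Measurable.aestronglyMeasurable (by fun_prop))
      (Eventually.of_forall fun p => ?_)
    have hMv := (maxwellian_pos p.1).le
    rw [norm_mul, norm_mul, Real.norm_of_nonneg hMv]
    gcongr
    · exact abs_collisionIncrement_le Θ h ε v₁ p.1 p.2
    · exact abs_inner_sphere_le _ _
  refine hG.integrableOn.congr_fun_ae ((ae_restrict_iff' (measurableSet_prod_hemisphere v₁)).2 ?_)
  filter_upwards [ae_prod_isImpact v₁] with p hp hmem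
  exact ((hp hmem).boltzmannIntegrand_eq hf hs₀ hs₁ hε hΘ).symm

theorem IsC3b.integrable_boltzmann (h : IsC3b ψ) (hf : IsProfile f) (hs₀ : 0 ≤ s)
    (hs₁ : s ≤ 1) (hε : 0 < ε) (v₁ : E3) :
    Integrable fun v₂ => ∫ ν in hemisphere v₁ v₂,
      boltzmannIntegrand (weakPotential s f ε) ψ v₁ v₂ ν ∂sphereMeasure := by
  have := ((integrable_indicator_iff (measurableSet_prod_hemisphere v₁)).2
    (h.integrableOn_boltzmannIntegrand hf hs₀ hs₁ hε v₁)).integral_prod_left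
  refine this.congr (Eventually.of_forall fun v₂ => ?_)
  dsimp only
  rw [← integral_indicator (measurableSet_hemisphere v₁ v₂)]
  rfl

theorem IsC3b.abs_boltzmann_sub_le (h : IsC3b ψ) (hf : IsProfile f) (hs₀ : 0 ≤ s)
    (hs₁ : s ≤ 1) (hε : 0 < ε) {v₁ v₂ : E3} (hv : v₁ ≠ v₂) :
    |(∫ ν in hemisphere v₁ v₂, boltzmannIntegrand (weakPotential s f ε) ψ v₁ v₂ ν ∂sphereMeasure) -
      maxwellian v₂ * (Real.pi / 2 * ‖v₁ - v₂‖ ^ 3 *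
        deflectionMoment (radialPotential s f) (2 * ε / ‖v₁ - v₂‖ ^ 2) 2 * landauSymbol ψ v₁ v₂)| ≤
      maxwellian v₂ * (c3bNorm ψ * (4 * ‖v₁ - v₂‖ ^ 2 + 2 * ‖v₁ - v₂‖ ^ 3) * (2 * Real.pi *
        ‖v₁ - v₂‖ * deflectionMoment (radialPotential s f) (2 * ε / ‖v₁ - v₂‖ ^ 2) 3)) := by
  obtain ⟨Θ, hm, hΘ⟩ := hf.exists_measurable_deflection hs₀ hs₁
  have hmom : ∀ n : ℕ, deflectionMoment (radialPotential s f) (2 * ε / ‖v₁ - v₂‖ ^ 2) n =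
      ∫ ρ in Set.Ioo (0 : ℝ) 1, |Real.sin (Θ (2 * ε / ‖v₁ - v₂‖ ^ 2, ρ) / 2)| ^ n * ρ := by
    intro n
    rw [deflectionMoment]
    refine setIntegral_congr_fun measurableSet_Ioo fun ρ hρ => ?_
    rw [hΘ _ _ (by positivity) hρ.1]
  have hθ : Measurable fun ρ => Θ (2 * ε / ‖v₁ - v₂‖ ^ 2, ρ) := hm.comp measurable_prodMk_left
  have hm2 : Measurable fun ν : S2 => (v₂, ν) := by fun_prop
  have hF : Measurable (collisionIncrement Θ ψ ε v₁ v₂) := by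
    simpa only [Function.comp_def] using (measurable_collisionIncrement hm h ε v₁).comp hm2
  have hexp := integral_hemisphere_expansion h hv hθ hF
    (abs_collisionIncrement_le Θ h ε v₁ v₂) (Eventually.of_forall fun ν _ => rfl)
  rw [← hmom, ← hmom] at hexp
  have e : (∫ ν in hemisphere v₁ v₂,
      boltzmannIntegrand (weakPotential s f ε) ψ v₁ v₂ ν ∂sphereMeasure) = maxwellian v₂ *
      ∫ ν in hemisphere v₁ v₂, collisionIncrement Θ ψ ε v₁ v₂ ν * inner ℝ (v₁ - v₂) (ν : E3)
        ∂sphereMeasure := by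
    rw [← integral_const_mul]
    refine setIntegral_congr_ae (measurableSet_hemisphere v₁ v₂) ?_
    filter_upwards [ae_isImpact hv] with ν hν hmem
    rw [(hν hmem).boltzmannIntegrand_eq hf hs₀ hs₁ hε hΘ]
    ring
  have hM := (maxwellian_pos v₂).le
  rw [e, ← mul_sub, abs_mul, abs_of_nonneg hM]
  exact mul_le_mul_of_nonneg_left hexp hM

theorem IsProfile.exists_grazing_bound (hf : IsProfile f) (hs₀ : 0 ≤ s) (hs₁ : s ≤ 1) :
    ∃ C : ℝ, ∀ ε : ℝ, 0 < ε → ε < 1 → ∀ ψ : E3 → ℝ, IsC3b ψ → ∀ v : E3,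
      |(timeScale s ε)⁻¹ * boltzmannOp (weakPotential s f ε) ψ v -
          2 * Real.pi * cPhi s f * landauOp ψ v| ≤ C * |Real.log ε|⁻¹ * c3bNorm ψ := by
  obtain ⟨C, hC, hb⟩ := hf.exists_scaled_moment_bound hs₀ hs₁
  obtain ⟨J, hJ, hw⟩ := exists_maxwellian_weight_bound
  refine ⟨32 * Real.pi * C * J, fun ε h0 h1 ψ h v => ?_⟩
  have hN := h.c3bNorm_nonneg
  have hd := timeScale_pos s h0 h1
  have hpi := Real.pi_pos
  set L := |Real.log ε|⁻¹ with hL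
  have hL0 : 0 ≤ L := by positivity
  obtain ⟨hwi, hwJ⟩ := hw v
  have hi := (h.integrable_boltzmann hf hs₀ hs₁ h0 v).const_mul (timeScale s ε)⁻¹
  have hk := (integrable_landauSymbol h v).const_mul (2 * Real.pi * cPhi s f)
  rw [landauOp_eq h, boltzmannOp, ← integral_const_mul, ← integral_const_mul, ← integral_sub hi hk,
    ← Real.norm_eq_abs]
  have hle : ∀ᵐ v₂ : E3, ‖(timeScale s ε)⁻¹ * (∫ ν in hemisphere v v₂,
      boltzmannIntegrand (weakPotential s f ε) ψ v v₂ ν ∂sphereMeasure) -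
      2 * Real.pi * cPhi s f * (maxwellian v₂ * (‖v - v₂‖⁻¹ * landauSymbol ψ v v₂))‖ ≤
      32 * Real.pi * C * L * c3bNorm ψ * (maxwellian v₂ * (1 + (‖v - v₂‖ ^ 2)⁻¹)) := by
    filter_upwards [ae_ne_const v] with v₂ hv
    have hM := (maxwellian_pos v₂).le
    have hA := h.abs_boltzmann_sub_le hf hs₀ hs₁ h0 hv
    have hS := abs_landauSymbol_le h v v₂
    have hc : 0 < ‖v - v₂‖ := norm_pos_iff.2 (sub_ne_zero.2 hv)
    obtain ⟨b2, b3⟩ := hb ε ‖v - v₂‖ h0 h1 hc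
    generalize (∫ ν in hemisphere v v₂, boltzmannIntegrand (weakPotential s f ε) ψ v v₂ ν
      ∂sphereMeasure) = I at hA ⊢
    generalize deflectionMoment (radialPotential s f) (2 * ε / ‖v - v₂‖ ^ 2) 2 = m₂ at *
    generalize deflectionMoment (radialPotential s f) (2 * ε / ‖v - v₂‖ ^ 2) 3 = m₃ at *
    generalize landauSymbol ψ v v₂ = S at *
    generalize maxwellian v₂ = M at *
    generalize ‖v - v₂‖ = c at *
    generalize timeScale s ε = d at *
    generalize cPhi s f = q at *
    generalize c3bNorm ψ = N at *
    have split : d⁻¹ * I - 2 * Real.pi * q * (M * (c⁻¹ * S)) =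
        d⁻¹ * (I - M * (Real.pi / 2 * c ^ 3 * m₂ * S)) +
          M * (Real.pi / 2 * c ^ 3) * S * (d⁻¹ * m₂ - 4 * q / c ^ 4) := by
      field_simp
      ring
    have t1 : |d⁻¹ * (I - M * (Real.pi / 2 * c ^ 3 * m₂ * S))| ≤
        M * N * (C * L) * (2 * Real.pi * (2 + 6 * c⁻¹ + 4 * c⁻¹ ^ 2)) := by
      rw [abs_mul, abs_of_pos (inv_pos.2 hd)]
      calc d⁻¹ * |I - M * (Real.pi / 2 * c ^ 3 * m₂ * S)|
          ≤ d⁻¹ * (M * (N * (4 * c ^ 2 + 2 * c ^ 3) * (2 * Real.pi * c * m₃))) := by gcongr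
        _ = M * N * (4 * c ^ 2 + 2 * c ^ 3) * (2 * Real.pi * c) * (d⁻¹ * m₃) := by ring
        _ ≤ M * N * (4 * c ^ 2 + 2 * c ^ 3) * (2 * Real.pi * c) * (C * L * ((1 + 1 / c) / c ^ 4)) := by
            gcongr
        _ = _ := by field_simp; ring
    have t2 : |M * (Real.pi / 2 * c ^ 3) * S * (d⁻¹ * m₂ - 4 * q / c ^ 4)| ≤
        M * N * (C * L) * (6 * Real.pi * (1 + c⁻¹ + c⁻¹ ^ 2)) := by
      rw [abs_mul, abs_mul, abs_of_nonneg (by positivity : 0 ≤ M * (Real.pi / 2 * c ^ 3))]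
      calc M * (Real.pi / 2 * c ^ 3) * |S| * |d⁻¹ * m₂ - 4 * q / c ^ 4|
          ≤ M * (Real.pi / 2 * c ^ 3) * (12 * N) * (C * L * ((1 + 1 / c + c) / c ^ 4)) := by gcongr
        _ = _ := by field_simp; ring
    have hu : c⁻¹ ≤ 1 / 2 * (1 + c⁻¹ ^ 2) := by nlinarith [sq_nonneg (c⁻¹ - 1)]
    have t3 : 2 * Real.pi * (2 + 6 * c⁻¹ + 4 * c⁻¹ ^ 2) + 6 * Real.pi * (1 + c⁻¹ + c⁻¹ ^ 2) ≤
        32 * Real.pi * (1 + (c ^ 2)⁻¹) := by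
      rw [← inv_pow]
      nlinarith [sq_nonneg c⁻¹]
    rw [split, Real.norm_eq_abs]
    calc _ ≤ _ := abs_add_le _ _
      _ ≤ M * N * (C * L) * (2 * Real.pi * (2 + 6 * c⁻¹ + 4 * c⁻¹ ^ 2) +
            6 * Real.pi * (1 + c⁻¹ + c⁻¹ ^ 2)) := by
          rw [mul_add]
          exact add_le_add t1 t2
      _ ≤ M * N * (C * L) * (32 * Real.pi * (1 + (c ^ 2)⁻¹)) := by gcongr
      _ = _ := by ring
  refine (norm_integral_le_of_norm_le (hwi.const_mul _) hle).trans ?_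
  rw [integral_const_mul]
  calc 32 * Real.pi * C * L * c3bNorm ψ * ∫ v₂, maxwellian v₂ * (1 + (‖v - v₂‖ ^ 2)⁻¹)
      ≤ 32 * Real.pi * C * L * c3bNorm ψ * J := by gcongr
    _ = _ := by ring

theorem ae_existsUnique_isOutgoing (hf : IsProfile f) (hs₀ : 0 ≤ s) (hs₁ : s ≤ 1) (hε : 0 < ε)
    {v₁ v₂ : E3} (hv : v₁ ≠ v₂) : ∀ᵐ ν ∂sphereMeasure, ν ∈ hemisphere v₁ v₂ →
      ∃! p, IsOutgoing (weakPotential s f ε) ν v₁ v₂ p := by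
  filter_upwards [ae_isImpact hv] with ν hν hmem
  have := fun p => (hν hmem).isOutgoing_iff hf hs₀ hs₁ hε (p := p)
  exact ⟨_, (this _).2 rfl, fun p hp => (this p).1 hp⟩

end Boltzmann

section Plancherel

open FourierTransform SchwartzMap

theorem fourier_ae_eq {g : E2 → ℂ} (h1 : Integrable g) (h2 : MemLp g 2) :
    ((𝓕 (h2.toLp g) : Lp ℂ 2 (volume : Measure E2)) : E2 → ℂ) =ᵐ[volume] 𝓕 g := by
  have hcont : Continuous (𝓕 g) :=
    VectorFourier.fourierIntegral_continuous Real.continuous_fourierChar continuous_inner h1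
  refine ae_eq_of_integral_contDiff_smul_eq
    ((Lp.memLp _).locallyIntegrable one_le_two) hcont.locallyIntegrable fun u hu hs => ?_
  have hs' : HasCompactSupport (Complex.ofRealCLM ∘ u) := hs.comp_left rfl
  have hu' : ContDiff ℝ ∞ (Complex.ofRealCLM ∘ u) := by fun_prop
  set U : 𝓢(E2, ℂ) := hs'.toSchwartzMap hu' with hU
  have hUapp : ∀ x, U x = (u x : ℂ) := fun x => rfl
  have key := congrArg (fun T : 𝓢'(E2, ℂ) => T U) (Lp.fourier_toTemperedDistribution_eq (h2.toLp g))
  simp only [TemperedDistribution.fourier_apply, Lp.toTemperedDistribution_apply] at key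
  have e1 : (∫ x, u x • ((𝓕 (h2.toLp g) : Lp ℂ 2 (volume : Measure E2)) : E2 → ℂ) x) =
      ∫ x, U x • ((𝓕 (h2.toLp g) : Lp ℂ 2 (volume : Measure E2)) : E2 → ℂ) x := by
    simp [hUapp]
  have e2 : (∫ x, (𝓕 U) x • (h2.toLp g : E2 → ℂ) x) = ∫ x, (𝓕 U) x • g x := by
    refine integral_congr_ae ?_
    filter_upwards [h2.coeFn_toLp] with x hx
    rw [hx]
  have e3 : (∫ x, U x • (𝓕 g) x) = ∫ x, (𝓕 U) x • g x := by
    simpa using! (VectorFourier.integral_fourierIntegral_smul_eq_flip (L := innerₗ E2)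
      Real.continuous_fourierChar continuous_inner U.integrable h1).symm
  rw [e1, ← key, e2, ← e3]
  simp [hUapp]

/-- Plancherel's theorem for functions in `L¹ ∩ L²`. -/
theorem integral_norm_fourier_sq {g : E2 → ℂ} (h1 : Integrable g) (h2 : MemLp g 2) :
    Integrable (fun ξ => ‖(𝓕 g) ξ‖ ^ 2) ∧ ∫ ξ, ‖(𝓕 g) ξ‖ ^ 2 = ∫ y, ‖g y‖ ^ 2 := by
  have hae := fourier_ae_eq h1 h2
  have hm : MemLp (𝓕 g) 2 := (memLp_congr_ae hae).1 (Lp.memLp _)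
  refine ⟨hm.integrable_norm_pow two_ne_zero, ?_⟩
  have n1 := Lp.norm_fourier_eq (h2.toLp g)
  have sq : ∀ F : Lp ℂ 2 (volume : Measure E2), ‖F‖ ^ 2 = ∫ x, ‖F x‖ ^ 2 := fun F => by
    rw [Lp.norm_def, toReal_eLpNorm (Lp.aestronglyMeasurable F),
      lpNorm_eq_integral_norm_rpow_toReal two_ne_zero ENNReal.ofNat_ne_top
        (Lp.aestronglyMeasurable F), ← Real.rpow_natCast, ← Real.rpow_mul
        (integral_nonneg fun x => by positivity)]
    simp
  have := congrArg (· ^ 2) n1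
  simp only [sq] at this
  rw [integral_congr_ae (g := fun ξ => ‖((𝓕 (h2.toLp g) : Lp ℂ 2 (volume : Measure E2)) : E2 → ℂ) ξ‖ ^ 2)
    (hae.mono fun ξ h => by simp only [h]), this]
  exact integral_congr_ae (h2.coeFn_toLp.mono fun ξ h => by simp only [h])

end Plancherel

section PlaneFourier

open FourierTransform

/-- The Fourier transform `∫ e^{-i k·y} g(y) dy` in the plane. -/
def planeFourier (g : E2 → ℝ) (k : E2) : ℂ :=
  ∫ y : E2, Complex.exp (-(Complex.I * ((inner ℝ k y : ℝ) : ℂ))) * ((g y : ℝ) : ℂ)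

theorem planeFourier_eq (g : E2 → ℝ) (k : E2) :
    planeFourier g k = 𝓕 (fun y => (g y : ℂ)) ((2 * Real.pi)⁻¹ • k) := by
  rw [Real.fourier_eq', planeFourier]
  refine integral_congr_ae (Eventually.of_forall fun y => ?_)
  have : -2 * Real.pi * inner ℝ y ((2 * Real.pi)⁻¹ • k) = -inner ℝ k y := by
    rw [real_inner_smul_right, real_inner_comm]
    have := Real.pi_pos
    field_simp
  simp only [this, smul_eq_mul]
  push_cast
  ring_nf

theorem integral_norm_planeFourier_sq {g : E2 → ℝ} (h1 : Integrable g) (h2 : MemLp g 2) :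
    Integrable (fun k => ‖planeFourier g k‖ ^ 2) ∧
      ∫ k, ‖planeFourier g k‖ ^ 2 = (2 * Real.pi) ^ 2 * ∫ y, g y ^ 2 := by
  obtain ⟨hi, he⟩ := integral_norm_fourier_sq (g := fun y => (g y : ℂ)) h1.ofReal h2.ofReal
  have hpi := Real.pi_pos
  simp only [planeFourier_eq]
  refine ⟨(integrable_comp_smul_iff volume _ (by positivity)).2 hi, ?_⟩
  rw [Measure.integral_comp_smul volume
    (fun ξ : E2 => ‖(𝓕 (fun y : E2 => (g y : ℂ)) : E2 → ℂ) ξ‖ ^ 2) (2 * Real.pi)⁻¹, he]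
  simp [abs_of_pos hpi]
  left
  field_simp

end PlaneFourier

section Radial

variable {φ : ℝ → ℝ} {s B : ℝ}

/-- The partial derivative `∂_j φ(|x|)`. -/
def radialPartial (φ : ℝ → ℝ) (j : Fin 3) (x : E3) : ℝ := deriv φ ‖x‖ / ‖x‖ * x j

theorem rpow_le_inv_sq {r a : ℝ} (hr : r ∈ Set.Ioo (0 : ℝ) 1) (ha : -2 ≤ a) : r ^ a ≤ (r ^ 2)⁻¹ := by
  have h := Real.rpow_le_rpow_of_exponent_ge hr.1 hr.2.le ha
  rwa [Real.rpow_neg hr.1.le, Real.rpow_two] at h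

theorem integrable_of_le_inv_sq {F : E3 → ℝ} (hm : AEStronglyMeasurable F) (C : ℝ)
    (hb : ∀ x, ‖x‖ ∈ Set.Ioo (0 : ℝ) 1 → |F x| ≤ C * (‖x‖ ^ 2)⁻¹) (h0 : ∀ x, 1 ≤ ‖x‖ → F x = 0) :
    Integrable F := by
  refine (integrable_singular_weight.const_mul (|C| * 16)).mono' hm ?_
  have hne : ∀ᵐ x : E3, x ≠ 0 := by simp [ae_iff]
  filter_upwards [hne] with x hx
  have hx0 : 0 < ‖x‖ := norm_pos_iff.2 hx
  rw [Real.norm_eq_abs]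
  rcases lt_or_ge ‖x‖ 1 with h | h
  · have h1 : (16 : ℝ)⁻¹ ≤ ((1 + ‖x‖) ^ 4)⁻¹ := by
      refine inv_anti₀ (by positivity) ?_
      calc (1 + ‖x‖) ^ 4 ≤ (1 + 1) ^ 4 := by gcongr
        _ = 16 := by norm_num
    have h2 : 0 ≤ (‖x‖ ^ 2)⁻¹ := by positivity
    calc |F x| ≤ |C| * (‖x‖ ^ 2)⁻¹ := (hb x ⟨hx0, h⟩).trans (by gcongr; exact le_abs_self C)
      _ = |C| * 16 * ((‖x‖ ^ 2)⁻¹ * 16⁻¹) := by ring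
      _ ≤ |C| * 16 * ((1 + (‖x‖ ^ 2)⁻¹) * ((1 + ‖x‖) ^ 4)⁻¹) := by
          gcongr
          linarith
  · rw [h0 x h, abs_zero]
    positivity

theorem IsRepulsive.integrable_radial (hφ : IsRepulsive φ s B) : Integrable fun x : E3 => φ ‖x‖ := by
  have hB := hφ.B_pos
  have hm : AEStronglyMeasurable (fun x : E3 => φ ‖x‖) := by
    have hc : ContinuousOn (fun x : E3 => φ ‖x‖) {0}ᶜ :=
      hφ.continuousOn.comp continuous_norm.continuousOn fun x hx => norm_pos_iff.2 hx
    have := hc.aestronglyMeasurable (μ := volume) (measurableSet_singleton 0).compl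
    rwa [restrict_compl_singleton] at this
  refine integrable_of_le_inv_sq hm B (fun x hx => ?_) fun x hx => hφ.eq_zero _ hx
  rw [abs_of_nonneg (hφ.nonneg _ hx.1)]
  refine (hφ.le_rpow _ hx).trans ?_
  gcongr
  exact rpow_le_inv_sq hx (by linarith [hφ.s_le_one])

theorem measurable_radialPartial (φ : ℝ → ℝ) (j : Fin 3) : Measurable (radialPartial φ j) := by
  have : Measurable fun x : E3 => deriv φ ‖x‖ := (measurable_deriv φ).comp measurable_norm
  unfold radialPartial
  fun_prop

theorem IsRepulsive.integrable_radialPartial (hφ : IsRepulsive φ s B) (j : Fin 3) :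
    Integrable (radialPartial φ j) := by
  have hB := hφ.B_pos
  refine integrable_of_le_inv_sq (measurable_radialPartial φ j).aestronglyMeasurable B
    (fun x hx => ?_) fun x hx => by rw [radialPartial, hφ.deriv_eq_zero hx]; simp
  have hx0 := hx.1
  have h1 : |x j| ≤ ‖x‖ := PiLp.norm_apply_le x j
  rw [radialPartial, abs_mul, abs_div, abs_norm]
  calc |deriv φ ‖x‖| / ‖x‖ * |x j| ≤ |deriv φ ‖x‖| / ‖x‖ * ‖x‖ := by gcongr
    _ = |deriv φ ‖x‖| := by field_simp
    _ ≤ B * ‖x‖ ^ (-s - 1) := hφ.abs_deriv_le _ hx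
    _ ≤ _ := by
      gcongr
      exact rpow_le_inv_sq hx (by linarith [hφ.s_le_one])

theorem IsRepulsive.hasDerivAt_of_ne_one (hφ : IsRepulsive φ s B) {r : ℝ} (hr : 0 < r) (h1 : r ≠ 1) :
    HasDerivAt φ (deriv φ r) r := by
  rcases h1.lt_or_gt with h | h
  · exact (hφ.differentiableAt r ⟨hr, h⟩).hasDerivAt
  · have : φ =ᶠ[𝓝 r] fun _ => 0 := by
      filter_upwards [lt_mem_nhds h] with y hy using hφ.eq_zero y hy.le
    exact (this.differentiableAt_iff.2 (differentiableAt_const 0)).hasDerivAt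

/-- The derivative of `e^{-i k·x} φ(|x|)` along a line that avoids the origin has integral zero. -/
theorem IsRepulsive.integral_line (hφ : IsRepulsive φ s B) {ρ : ℝ} (hρ : 0 < ρ) (a b : ℝ)
    (hi : Integrable fun t : ℝ => Complex.exp (-(Complex.I * ((a * t + b : ℝ) : ℂ))) *
      (((deriv φ √(t ^ 2 + ρ ^ 2) / √(t ^ 2 + ρ ^ 2) * t : ℝ) : ℂ) -
        Complex.I * a * (φ √(t ^ 2 + ρ ^ 2) : ℝ))) :
    ∫ t : ℝ, Complex.exp (-(Complex.I * ((a * t + b : ℝ) : ℂ))) *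
      (((deriv φ √(t ^ 2 + ρ ^ 2) / √(t ^ 2 + ρ ^ 2) * t : ℝ) : ℂ) -
        Complex.I * a * (φ √(t ^ 2 + ρ ^ 2) : ℝ)) = 0 := by
  have hpos : ∀ t : ℝ, 0 < t ^ 2 + ρ ^ 2 := fun t => by positivity
  have hr : ∀ t : ℝ, 0 < √(t ^ 2 + ρ ^ 2) := fun t => Real.sqrt_pos.2 (hpos t)
  have hout : ∀ t : ℝ, 1 ≤ |t| → 1 ≤ √(t ^ 2 + ρ ^ 2) := fun t ht => by
    rw [Real.one_le_sqrt, ← sq_abs]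
    nlinarith [sq_nonneg ρ]
  set u : ℝ → ℂ := fun t => Complex.exp (-(Complex.I * ((a * t + b : ℝ) : ℂ))) *
    (φ √(t ^ 2 + ρ ^ 2) : ℝ) with hu
  have hcφ : Continuous fun t : ℝ => φ √(t ^ 2 + ρ ^ 2) :=
    hφ.continuousOn.comp_continuous (by fun_prop) hr
  have hcu : Continuous u :=
    Continuous.mul (by fun_prop) (Complex.continuous_ofReal.comp hcφ)
  have hcount : {t : ℝ | √(t ^ 2 + ρ ^ 2) = 1}.Countable := by
    refine Set.Countable.mono (s₂ := {√(1 - ρ ^ 2), -√(1 - ρ ^ 2)}) (fun t ht => ?_)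
      (Set.toFinite _).countable
    have h1 : t ^ 2 + ρ ^ 2 = 1 := Real.sqrt_eq_one.1 ht
    have h2 : t ^ 2 = √(1 - ρ ^ 2) ^ 2 := by rw [Real.sq_sqrt] <;> nlinarith [sq_nonneg t]
    exact sq_eq_sq_iff_eq_or_eq_neg.1 h2
  rw [← setIntegral_eq_integral_of_forall_compl_eq_zero (s := Set.Ioc (-1 : ℝ) 1) fun t ht => ?_,
    ← intervalIntegral.integral_of_le (by norm_num),
    integral_eq_of_hasDerivAt_off_countable_of_le u _ (by norm_num) hcount hcu.continuousOn
      (fun t ht => ?_) hi.intervalIntegrable]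
  · simp only [hu]
    rw [hφ.eq_zero _ (hout 1 (by simp)), hφ.eq_zero _ (hout (-1) (by simp))]
    simp
  · have h1 : HasDerivAt (fun t : ℝ => √(t ^ 2 + ρ ^ 2)) (t / √(t ^ 2 + ρ ^ 2)) t := by
      have h0 := (((hasDerivAt_id t).pow 2).add_const (ρ ^ 2)).sqrt (hpos t).ne'
      refine h0.congr_deriv ?_
      have := hr t
      simp
      field_simp
    have h2 := ((hφ.hasDerivAt_of_ne_one (hr t) ht.2).comp t h1).ofReal_comp
    have h3 : HasDerivAt (fun t : ℝ => -(Complex.I * ((a * t + b : ℝ) : ℂ))) (-(Complex.I * a)) t := by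
      have := (((hasDerivAt_id t).const_mul a).add_const b).ofReal_comp
      refine (this.const_mul Complex.I).neg.congr_deriv ?_
      simp
    refine (h3.cexp.mul h2).congr_deriv ?_
    simp only [Function.comp]
    push_cast
    ring
  · have h1 : 1 ≤ |t| := by
      by_contra h
      exact ht ⟨(abs_lt.1 (not_le.1 h)).1, (abs_lt.1 (not_le.1 h)).2.le⟩
    rw [hφ.eq_zero _ (hout t h1), hφ.deriv_eq_zero (hout t h1)]
    simp

end Radial

section Slices

variable {φ : ℝ → ℝ} {s B : ℝ}

theorem inner_splitAt_symm (j : Fin 3) (k : E3) (p : ℝ × E2) :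
    inner ℝ k ((splitAt j).symm p) = k j * p.1 + inner ℝ (splitAt j k).2 p.2 := by
  simp only [PiLp.inner_apply, Fin.sum_univ_succAbove _ j, splitAt_symm_self,
    splitAt_symm_succAbove, splitAt_apply]
  simp
  ring

theorem ae_plane_ne_zero : ∀ᵐ y : E2, y ≠ 0 := by simp [ae_iff]

theorem norm_cexp_neg_I_mul (r : ℝ) : ‖Complex.exp (-(Complex.I * (r : ℂ)))‖ = 1 := by
  rw [show -(Complex.I * (r : ℂ)) = ((-r : ℝ) : ℂ) * Complex.I by push_cast; ring,
    Complex.norm_exp_ofReal_mul_I]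

theorem integrable_cexp_mul {F : E3 → ℝ} (hF : Integrable F) (k : E3) :
    Integrable fun x : E3 => Complex.exp (-(Complex.I * ((inner ℝ k x : ℝ) : ℂ))) * (F x : ℂ) := by
  refine Integrable.bdd_mul (c := 1) hF.ofReal (Continuous.aestronglyMeasurable (by fun_prop))
    (Eventually.of_forall fun x => (norm_cexp_neg_I_mul _).le)

theorem IsRepulsive.fourier_radialPartial (hφ : IsRepulsive φ s B) (j : Fin 3) (k : E3) :
    fourierTransform (radialPartial φ j) k =
      Complex.I * (k j : ℂ) * fourierTransform (fun x => φ ‖x‖) k := by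
  have i1 := integrable_cexp_mul (hφ.integrable_radialPartial j) k
  have i2 := (integrable_cexp_mul hφ.integrable_radial k).const_mul (Complex.I * (k j : ℂ))
  rw [fourierTransform, fourierTransform, ← sub_eq_zero, ← integral_const_mul, ← integral_sub i1 i2]
  set H : E3 → ℂ := fun x => Complex.exp (-(Complex.I * ((inner ℝ k x : ℝ) : ℂ))) *
    (radialPartial φ j x : ℂ) - Complex.I * (k j : ℂ) *
      (Complex.exp (-(Complex.I * ((inner ℝ k x : ℝ) : ℂ))) * (φ ‖x‖ : ℂ)) with hH
  have hHi : Integrable H := i1.sub i2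
  have hmp := (measurePreserving_splitAt j).symm
  have hHp : Integrable (fun p : ℝ × E2 => H ((splitAt j).symm p)) (volume.prod volume) :=
    (hmp.integrable_comp_emb (splitAt j).symm.measurableEmbedding).2 hHi
  rw [← hmp.integral_comp' H, Measure.volume_eq_prod, integral_prod_symm _ hHp]
  refine integral_eq_zero_of_ae ?_
  filter_upwards [hHp.prod_left_ae, ae_plane_ne_zero] with y hy hy0
  have e : (fun t : ℝ => H ((splitAt j).symm (t, y))) = fun t : ℝ =>
      Complex.exp (-(Complex.I * ((k j * t + inner ℝ (splitAt j k).2 y : ℝ) : ℂ))) *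
      (((deriv φ √(t ^ 2 + ‖y‖ ^ 2) / √(t ^ 2 + ‖y‖ ^ 2) * t : ℝ) : ℂ) -
        Complex.I * (k j : ℝ) * (φ √(t ^ 2 + ‖y‖ ^ 2) : ℝ)) := by
    funext t
    simp only [hH, radialPartial, inner_splitAt_symm, norm_splitAt_symm, splitAt_symm_self]
    ring
  rw [e] at hy ⊢
  exact hφ.integral_line (norm_pos_iff.2 hy0) _ _ hy

/-- The line integral of the force transversal to the line. -/
theorem IsRepulsive.integral_transversal (hφ : IsRepulsive φ s B) {ρ : ℝ} (hρ : 0 < ρ) :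
    ∫ t : ℝ, deriv φ √(t ^ 2 + ρ ^ 2) / √(t ^ 2 + ρ ^ 2) = -(2 * bornAngle φ ρ / ρ) := by
  have himg : (fun η => ρ * Real.tan η) '' Set.Ioo (-(Real.pi / 2)) (Real.pi / 2) = Set.univ := by
    rw [← Set.image_image (fun x => ρ * x) Real.tan, Real.image_tan_Ioo, Set.image_univ]
    exact (mul_left_surjective₀ hρ.ne').range_eq
  have hcos : ∀ η ∈ Set.Ioo (-(Real.pi / 2)) (Real.pi / 2), 0 < Real.cos η := fun η hη =>
    Real.cos_pos_of_mem_Ioo hη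
  rw [← setIntegral_univ, ← himg, integral_image_eq_integral_abs_deriv_smul measurableSet_Ioo
    (f' := fun η => ρ * (1 / Real.cos η ^ 2))
    (fun η hη => ((Real.hasDerivAt_tan (hcos η hη).ne').const_mul ρ).hasDerivWithinAt)
    (fun x hx y hy h => Real.injOn_tan hx hy (mul_left_cancel₀ hρ.ne' h)), bornAngle]
  rw [show -(2 * (1 / 2 * ∫ η in Set.Ioo (-(Real.pi / 2)) (Real.pi / 2), bornRate φ ρ η) / ρ) =
    -ρ⁻¹ * ∫ η in Set.Ioo (-(Real.pi / 2)) (Real.pi / 2), bornRate φ ρ η by ring,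
    ← integral_const_mul]
  refine setIntegral_congr_fun measurableSet_Ioo fun η hη => ?_
  have hc := hcos η hη
  have hsq : √((ρ * Real.tan η) ^ 2 + ρ ^ 2) = ρ / Real.cos η := by
    rw [Real.sqrt_eq_iff_mul_self_eq (by positivity) (by positivity), Real.tan_eq_sin_div_cos]
    field_simp
    linarith [Real.sin_sq_add_cos_sq η]
  simp only [hsq, hφ.bornRate_eq hc, smul_eq_mul]
  rw [abs_of_pos (by positivity)]
  field_simp

/-- The gradient of the X-ray transform of a radial potential. -/
def rayGradient (φ : ℝ → ℝ) (i : Fin 2) (y : E2) : ℝ := -(2 * bornAngle φ ‖y‖ / ‖y‖) * y i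

theorem IsRepulsive.integral_radialPartial_line (hφ : IsRepulsive φ s B) (i : Fin 2) {y : E2}
    (hy : y ≠ 0) : ∫ t : ℝ, radialPartial φ (Fin.succAbove 0 i) ((splitAt 0).symm (t, y)) =
      rayGradient φ i y := by
  simp only [radialPartial, norm_splitAt_symm, splitAt_symm_succAbove]
  rw [integral_mul_const, hφ.integral_transversal (norm_pos_iff.2 hy), rayGradient]

theorem IsRepulsive.planeFourier_rayGradient (hφ : IsRepulsive φ s B) (i : Fin 2) (k : E2) :
    Integrable (rayGradient φ i) ∧ planeFourier (rayGradient φ i) k = Complex.I * (k i : ℂ) *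
      fourierTransform (fun x => φ ‖x‖) ((splitAt 0).symm (0, k)) := by
  have hmp := (measurePreserving_splitAt 0).symm
  have hi := hφ.integrable_radialPartial (Fin.succAbove 0 i)
  have hip : Integrable (fun p : ℝ × E2 => radialPartial φ (Fin.succAbove 0 i) ((splitAt 0).symm p))
      (volume.prod volume) :=
    (hmp.integrable_comp_emb (splitAt 0).symm.measurableEmbedding).2 hi
  refine ⟨hip.integral_prod_right.congr (ae_plane_ne_zero.mono fun y hy =>
    hφ.integral_radialPartial_line i hy), ?_⟩
  have h1 := hφ.fourier_radialPartial (Fin.succAbove 0 i) ((splitAt 0).symm (0, k))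
  rw [splitAt_symm_succAbove] at h1
  rw [← h1, fourierTransform, planeFourier]
  have hc := integrable_cexp_mul hi ((splitAt 0).symm (0, k))
  set H : E3 → ℂ := fun x =>
    Complex.exp (-(Complex.I * ((inner ℝ ((splitAt 0).symm (0, k)) x : ℝ) : ℂ))) *
      (radialPartial φ (Fin.succAbove 0 i) x : ℂ) with hH
  have hHp : Integrable (fun p : ℝ × E2 => H ((splitAt 0).symm p)) (volume.prod volume) :=
    (hmp.integrable_comp_emb (splitAt 0).symm.measurableEmbedding).2 hc
  rw [← hmp.integral_comp' H, Measure.volume_eq_prod, integral_prod_symm _ hHp]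
  refine integral_congr_ae ?_
  filter_upwards [ae_plane_ne_zero] with y hy
  have e : ∀ t : ℝ, H ((splitAt 0).symm (t, y)) =
      Complex.exp (-(Complex.I * ((inner ℝ k y : ℝ) : ℂ))) *
        ((radialPartial φ (Fin.succAbove 0 i) ((splitAt 0).symm (t, y)) : ℝ) : ℂ) := fun t => by
    simp only [hH, inner_splitAt_symm, splitAt_symm_self, (splitAt 0).apply_symm_apply, zero_mul,
      zero_add]
  simp only [e]
  rw [integral_const_mul, integral_complex_ofReal, hφ.integral_radialPartial_line i hy]

theorem bornAngle_eq_zero (φ : ℝ → ℝ) {ρ : ℝ} (hρ : 1 ≤ ρ) : bornAngle φ ρ = 0 := by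
  have : ∀ η, bornRate φ ρ η = 0 := fun η => by
    rw [bornRate, if_neg (not_lt.2 ((Real.cos_le_one η).trans hρ))]
  simp [bornAngle, this]

theorem IsRepulsive.integral_plane_bornAngle (hφ : IsRepulsive φ s B) (hs : s < 1) :
    Integrable (fun y : E2 => bornAngle φ ‖y‖ ^ 2) ∧ ∫ y : E2, bornAngle φ ‖y‖ ^ 2 =
      2 * Real.pi * ∫ ρ in Set.Ioo (0 : ℝ) 1, bornAngle φ ρ ^ 2 * ρ := by
  have h0 : ∀ ρ ∈ Set.Ioi (0 : ℝ) \ Set.Ioo 0 1, bornAngle φ ρ ^ 2 * ρ = 0 := fun ρ hρ => by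
    have : 1 ≤ ρ := by
      by_contra h
      exact hρ.2 ⟨hρ.1, not_le.1 h⟩
    rw [bornAngle_eq_zero φ this]
    simp
  constructor
  · refine (integrable_fun_norm_addHaar volume (f := fun ρ => bornAngle φ ρ ^ 2)).2 ?_
    simp only [finrank_euclideanSpace_fin, Nat.add_one_sub_one, pow_one, smul_eq_mul]
    simp only [mul_comm (_ : ℝ) (bornAngle φ _ ^ 2)]
    exact (hφ.integrableOn_bornAngle_sq hs).of_forall_sdiff_eq_zero measurableSet_Ioi h0
  · rw [integral_fun_norm_addHaar volume fun ρ => bornAngle φ ρ ^ 2]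
    have hb : (volume : Measure E2).real (Metric.ball 0 1) = Real.pi := by
      simp [Measure.real, Real.pi_pos.le]
    rw [hb, setIntegral_eq_of_subset_of_forall_sdiff_eq_zero measurableSet_Ioi
      Set.Ioo_subset_Ioi_self fun ρ hρ => ?_]
    · simp only [finrank_euclideanSpace_fin, Nat.add_one_sub_one, pow_one, smul_eq_mul]
      simp only [mul_comm (_ : ℝ) (bornAngle φ _ ^ 2)]
      simp
      ring
    · have := h0 ρ hρ
      simp only [finrank_euclideanSpace_fin, Nat.add_one_sub_one, pow_one, smul_eq_mul]
      linarith

theorem sum_rayGradient_sq (φ : ℝ → ℝ) {y : E2} (hy : y ≠ 0) :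
    rayGradient φ 0 y ^ 2 + rayGradient φ 1 y ^ 2 = 4 * bornAngle φ ‖y‖ ^ 2 := by
  have hn : 0 < ‖y‖ := norm_pos_iff.2 hy
  have h := EuclideanSpace.norm_sq_eq y
  simp only [Fin.sum_univ_two, Real.norm_eq_abs, sq_abs] at h
  simp only [rayGradient, mul_pow, neg_sq]
  rw [← mul_add, ← h]
  field_simp
  ring

theorem IsRepulsive.memLp_rayGradient (hφ : IsRepulsive φ s B) (hs : s < 1) (i : Fin 2) :
    MemLp (rayGradient φ i) 2 := by
  have hm : Measurable (rayGradient φ i) := by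
    have := (measurable_bornAngle φ).comp (measurable_norm (α := E2))
    have h2 : Measurable fun y : E2 => bornAngle φ ‖y‖ := this
    unfold rayGradient
    fun_prop
  refine (memLp_two_iff_integrable_sq hm.aestronglyMeasurable).2 ?_
  refine ((hφ.integral_plane_bornAngle hs).1.const_mul 4).mono' (by fun_prop) ?_
  filter_upwards [ae_plane_ne_zero] with y hy
  rw [Real.norm_of_nonneg (sq_nonneg _), ← sum_rayGradient_sq φ hy]
  fin_cases i
  · exact le_add_of_nonneg_right (sq_nonneg _)
  · exact le_add_of_nonneg_left (sq_nonneg _)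

theorem deltaPlaneIntegral_eq (g : E3 → ℝ) :
    deltaPlaneIntegral g = ∫ k : E2, g ((splitAt 0).symm (0, k)) := by
  have hmp := (EuclideanSpace.volume_preserving_symm_measurableEquiv_toLp (Fin 2)).symm.comp
    (volume_preserving_finTwoArrow ℝ).symm
  have := hmp.integral_comp ((MeasurableEquiv.measurableEmbedding _).comp
    (MeasurableEquiv.measurableEmbedding _)) fun k : E2 => g ((splitAt 0).symm (0, k))
  rw [← this, deltaPlaneIntegral]
  refine integral_congr_ae (Eventually.of_forall fun p => ?_)
  dsimp only
  congr 1
  apply (splitAt 0).injective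
  rw [(splitAt 0).apply_symm_apply, splitAt_apply]
  refine Prod.ext rfl ?_
  ext j
  fin_cases j <;> rfl

theorem IsRepulsive.deltaPlaneIntegral_fourier (hφ : IsRepulsive φ s B) (hs : s < 1) :
    deltaPlaneIntegral (fun k => ‖k‖ ^ 2 * ‖fourierTransform (fun x => φ ‖x‖) k‖ ^ 2) =
      32 * Real.pi ^ 3 * ∫ ρ in Set.Ioo (0 : ℝ) 1, bornAngle φ ρ ^ 2 * ρ := by
  have hP := fun i => integral_norm_planeFourier_sq (hφ.planeFourier_rayGradient i 0).1
    (hφ.memLp_rayGradient hs i)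
  have hi := fun i => (hφ.memLp_rayGradient hs i).integrable_sq
  have e : ∀ k : E2, ‖(splitAt 0).symm (0, k)‖ ^ 2 *
      ‖fourierTransform (fun x => φ ‖x‖) ((splitAt 0).symm (0, k))‖ ^ 2 =
      ‖planeFourier (rayGradient φ 0) k‖ ^ 2 + ‖planeFourier (rayGradient φ 1) k‖ ^ 2 := fun k => by
    rw [(hφ.planeFourier_rayGradient 0 k).2, (hφ.planeFourier_rayGradient 1 k).2,
      norm_sq_eq_splitAt 0, (splitAt 0).apply_symm_apply, EuclideanSpace.norm_sq_eq]
    simp [mul_pow]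
    ring
  rw [deltaPlaneIntegral_eq]
  simp only [e]
  rw [integral_add (hP 0).1 (hP 1).1, (hP 0).2, (hP 1).2, ← mul_add, ← integral_add (hi 0) (hi 1),
    integral_congr_ae (g := fun y : E2 => 4 * bornAngle φ ‖y‖ ^ 2)
      (ae_plane_ne_zero.mono fun y hy => sum_rayGradient_sq φ hy), integral_const_mul,
    (hφ.integral_plane_bornAngle hs).2]
  ring

theorem IsProfile.cPhi_fourier {f : ℝ → ℝ} (hf : IsProfile f) (hs₀ : 0 ≤ s) (hs : s < 1) :
    2 * Real.pi * cPhi s f = 1 / (16 * Real.pi ^ 2) *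
      deltaPlaneIntegral (fun k => ‖k‖ ^ 2 * ‖fourierTransform (potential s f) k‖ ^ 2) := by
  obtain ⟨B, hφ⟩ := hf.exists_isRepulsive hs₀ hs.le
  have := hφ.deltaPlaneIntegral_fourier hs
  rw [← hf.cPhi_eq hs₀ hs] at this
  have hpi := Real.pi_pos
  unfold potential
  rw [this]
  field_simp
  ring

end Slices

end Grazing

end

theorem theorem1 (s : ℝ) (hs₀ : 0 ≤ s) (hs₁ : s ≤ 1) (f : ℝ → ℝ) (hf : Grazing.IsProfile f) :
    -- well-posedness of the scattering problem for almost every impact vector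
    (∀ ε : ℝ, 0 < ε → ε < 1 → ∀ v₁ v₂ : Grazing.E3, v₁ ≠ v₂ →
      ∀ᵐ ν ∂Grazing.sphereMeasure, ν ∈ Grazing.hemisphere v₁ v₂ →
        ∃! p, Grazing.IsOutgoing (Grazing.weakPotential s f ε) ν v₁ v₂ p) ∧
    -- well-definedness of the linearized Boltzmann operators
    (∀ ε : ℝ, 0 < ε → ε < 1 → ∀ ψ : Grazing.E3 → ℝ, Grazing.IsC3b ψ → ∀ v₁ : Grazing.E3,
      MeasureTheory.IntegrableOn
        (fun p : Grazing.E3 × Grazing.S2 =>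
          Grazing.boltzmannIntegrand (Grazing.weakPotential s f ε) ψ v₁ p.1 p.2)
        {p | p.2 ∈ Grazing.hemisphere v₁ p.1}
        (MeasureTheory.volume.prod Grazing.sphereMeasure)) ∧
    -- well-definedness of the linearized Landau operator
    (∀ ψ : Grazing.E3 → ℝ, Grazing.IsC3b ψ →
      (∀ v₁, MeasureTheory.Integrable (Grazing.landauIntegrand ψ v₁)) ∧
      Differentiable ℝ (Grazing.landauFlux ψ)) ∧
    -- the grazing collisions limit
    0 < Grazing.cPhi s f ∧
    (∃ C : ℝ, ∀ ε : ℝ, 0 < ε → ε < 1 → ∀ ψ : Grazing.E3 → ℝ, Grazing.IsC3b ψ → ∀ v : Grazing.E3,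
      |(Grazing.timeScale s ε)⁻¹ * Grazing.boltzmannOp (Grazing.weakPotential s f ε) ψ v
          - 2 * Real.pi * Grazing.cPhi s f * Grazing.landauOp ψ v|
        ≤ C * |Real.log ε|⁻¹ * Grazing.c3bNorm ψ) ∧
    -- the Fourier representation of the constant
    (s < 1 →
      2 * Real.pi * Grazing.cPhi s f =
        1 / (16 * Real.pi ^ 2) * Grazing.deltaPlaneIntegral
          (fun k => ‖k‖ ^ 2 * ‖Grazing.fourierTransform (Grazing.potential s f) k‖ ^ 2)) := by
  obtain ⟨C, hC⟩ := hf.exists_grazing_bound hs₀ hs₁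
  exact ⟨fun ε h0 _ v₁ v₂ hv => Grazing.ae_existsUnique_isOutgoing hf hs₀ hs₁ h0 hv,
    fun ε h0 _ ψ h v₁ => h.integrableOn_boltzmannIntegrand hf hs₀ hs₁ h0 v₁,
    fun ψ h => ⟨fun v₁ => Grazing.integrable_landauIntegrand h v₁,
      fun v => (Grazing.hasFDerivAt_landauFlux h v).2.differentiableAt⟩,
    hf.cPhi_pos hs₀ hs₁, ⟨C, hC⟩, fun hs => hf.cPhi_fourier hs₀ hs⟩
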